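/- Setting. Fix $\lambda>0$ (a length), $\kappa>2$, $\varepsilon>2$. Let $M=\mathbb R\times\mathbb R^3\ni x=(x^0,\vec x)$ be Minkowski space with product $x\cdot y=x^0y^0-\vec x\cdot\vec y$, time axis $t=(1,\vec 0)$ and $|x|^2=|x^0|^2+|\vec x|^2$. Let $U$ be a unitary, strongly continuous representation of the translations of $M$ on a complex Hilbert space $\mathcal H$ (scalar product linear in the second argument), $U(a)=e^{iP\cdot a}$, with the spectrum of the four-momentum $P$ contained in the closed forward cone $\{p: p^0\ge|\vec p|\}$; let $\Omega$ be a unit vector, invariant under $U$ and, up to scalars, the only invariant vector; $E_\Omega^\perp$ is the projection onto $\{\Omega\}^\perp$. Let $E_0$ be the spectral projection of $P$ for $\{p: p\cdot p=0,\ p^0\ge0\}$. Put $B(x)=U(x)BU(-x)$. Let $\mathcal F\subset\mathcal B(\mathcal H)$ be a ${}^*$-algebra of operators $B$ with $x\mapsto B(x)$ norm-smooth, such that for all $B_1,B_2\in\mathcal F$ and all multi-indices there is a constant $c$ with $\|[D^{\alpha}B_1,D^{\beta}B_2(a)]\|\le c\,D_\kappa(a)$ for all $a\in M$, where $D_\kappa(a)=1$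 if $a\cdot a\ge0$ and $D_\kappa(a)=\lambda^\kappa(\lambda+|\vec a|-|a^0|)^{-\kappa}$ otherwise. Test functions. Let $C_+=\{l: l\cdot l=0,\ l^0>0\}$ and $L_{ab}=l_a\partial/\partial l^b-l_b\partial/\partial l^a$. $\mathcal S^{n}_\varepsilon$ is the space of smooth functions $b(s,l)$ on $\mathbb R\times C_+$ with $b(\gamma s,\gamma l)=\gamma^{n}b(s,l)$ for $\gamma>0$ and, for all $k,m$ and all indices, $|L_{a_1b_1}\cdots L_{a_kb_k}\partial_s^m b(s,l)|\le \mathrm{const}_{k,m}\,(t\cdot l)^{n-m}(\lambda+|s|/t\cdot l)^{-(m+1+\varepsilon)}$. Throughout $f_j=\partial_s^3b_j$ with $b_j\in\mathcal S^{1}_\varepsilon$. Put $\tilde f(\omega,l)=\frac1{2\pi}\int e^{i\omega s}f(s,l)\,ds$ and $f_+(s,l)=\int_0^\infty\tilde f(\omega,l)e^{-i\omega s}\,d\omega$. For $r\in\mathbb R$ and real $g\in C_c^\infty$ set $$B[r,f]=\frac r{2\pi}\int B(st+rl)f(s,l)\,ds\,d\Omega_t(l),\qquad B[g,f]=\int g(r)B[r,f]\,dr,$$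 where $d\Omega_t$ is the angle measure on the sphere $\{l\in C_+: t\cdot l=1\}$. For $\eta\in(0,1]$ let $w=w(R)=\lambda(R/\lambda)^\eta$ and $g^\eta_R(r)=w^{-1}g(w^{-1}(r-R)+1)$, where $g$ is smooth with $\int g=1$ and $\operatorname{supp}g\subseteq[\tau_1,\tau_2]\subset(0,\infty)$; let $B^+_{R,\eta}[f]=B[g_R^\eta,f_+]$ and $B^+_R[f]=B^+_{R,1}[f]$. The window is $\langle R_1,R_2\rangle=[R+(\tau_1-1)w(R),\,R+(\tau_2-1)w(R)]$. The operator $\tilde f(1,P)$ is defined through the function $p\mapsto\tilde f(1,p)$ on $C_+$, extended by zero. Clustering assumption. For $B_1,\dots,B_4\in\mathcal F$ put $B_{ij}(z)=[B_i(z/2),B_j(-z/2)]$ and $K(y_1,y_2,y)=(\Omega,B_{12}(y_1)E_\Omega^\perp U(-y)B_{34}(y_2)\Omega)$. For all $B_1,\dots,B_4\in\mathcal F$ and every positive integer $N$ there are positive constants $c_1,c_2,c_3,\mathsf M,\nu$ such that for all sufficiently large $d$ $$|K(y_1,y_2,y)|\le c_2\frac{d^{\mathsf M}}{(|\vec y|-|y^0|)^{\nu}}+c_3d^{-N}\quad\text{whenever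 } |y_1|\le d,\ |y_2|\le d,\ |\vec y|\ge|y^0|+c_1d .$$ Statement. Under the clustering assumption the following holds. (1) For all $B_1,B_2\in\mathcal F$ there is $\eta_0\in(0,1]$ such that for all $\eta\in(0,\eta_0]$, all $b_1,b_2\in\mathcal S^1_\varepsilon$ and all $0<\tau_1\le\tau_2$ $$\lim_{R\to\infty}\ \sup_{r_1,r_2\in\langle R_1,R_2\rangle}\big\|E_\Omega^\perp\big[B_1[r_1,f_{1+}]^*,B_2[r_2,f_{2+}]\big]\Omega\big\|=0 ,$$ and for every $g$ as above $$\lim_{R\to\infty}B^+_{1,R,\eta}[f_1]^*B^+_{2,R,\eta}[f_2]\Omega=(2\pi)^2\big(\tilde f_1(1,P)B_1\Omega,\,E_0\tilde f_2(1,P)B_2\Omega\big)\,\Omega .$$ (2) For all $m,n\ge0$ and $B_1,\dots,B_m,B_1',\dots,B_n'\in\mathcal F$ there is $\eta_0\in(0,1]$ such that, whenever the supports of the functions $l\mapsto\sup_s|f_i(s,l)|$, $i=1,\dots,m$, on the sphere $t\cdot l=1$ are pairwise disjoint, and likewise those of $f'_1,\dots,f'_n$, one has for all $g$ as above and all $\eta\in(0,\eta_0]$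 $$\lim_{R\to\infty}\big(B^+_{1,R,\eta}[f_1]\cdots B^+_{m,R,\eta}[f_m]\Omega,\ B'^{+}_{1,R,\eta}[f'_1]\cdots B'^{+}_{n,R,\eta}[f'_n]\Omega\big)=\delta_{mn}\sum_{\sigma\in S_n}\prod_{i=1}^{n}(2\pi)^2\big(\tilde f_i(1,P)B_i\Omega,\,E_0\tilde f'_{\sigma(i)}(1,P)B'_{\sigma(i)}\Omega\big).$$ Moreover, if the asymptotic states $\Psi=\lim_{R\to\infty}B^+_{1,R}[f_1]\cdots B^+_{m,R}[f_m]\Omega$ and $\Psi'=\lim_{R\to\infty}B'^+_{1,R}[f'_1]\cdots B'^+_{n,R}[f'_n]\Omega$ exist, then $(\Psi,\Psi')$ equals the same right-hand side. -/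

import Mathlib

open scoped ContDiff Topology
open MeasureTheory Filter

namespace NullAsymptotics

noncomputable section

/-! ### Minkowski space and translations -/

/-- Euclidean three-space. -/
abbrev Space3 : Type := EuclideanSpace ℝ (Fin 3)

/-- Minkowski space in the basis with time axis `t`: `x = (x⁰, 𝐱)`. The momentum space is
identified with it. -/
abbrev Mink : Type := ℝ × Space3

/-- Minkowski product of signature `(+,-,-,-)`. -/
def mdot (x y : Mink) : ℝ := x.1 * y.1 - inner ℝ x.2 y.2

/-- The auxiliary Euclidean length `|x|`, `|x|² = |x⁰|² + |𝐱|²`. -/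
def euclLen (x : Mink) : ℝ := Real.sqrt (x.1 ^ 2 + ‖x.2‖ ^ 2)

/-- A unitary, strongly continuous representation of the translation group. -/
structure TranslationRep (H : Type*) [NormedAddCommGroup H] [InnerProductSpace ℂ H]
    [CompleteSpace H] where
  /-- The operator `U(a)`. -/
  U : Mink → H →L[ℂ] H
  map_zero : U 0 = 1
  map_add : ∀ a b, U (a + b) = U a * U b
  star_eq : ∀ a, star (U a) = U (-a)
  strongly_continuous : ∀ ψ, Continuous fun a => U a ψ

variable {H : Type*} [NormedAddCommGroup H] [InnerProductSpace ℂ H] [CompleteSpace H]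

namespace TranslationRep

variable (T : TranslationRep H)

open Classical in
/-- The spectral measure of the four-momentum in the vector `ψ`, i.e. `A ↦ (ψ, E(A) ψ)`: the
unique finite Borel measure `μ` on momentum space with
`(ψ, U(a) ψ) = ∫ exp (i p · a) dμ(p)` for all `a`. -/
def spectralMeasure (ψ : H) : Measure Mink :=
  if h : ∃ μ : Measure Mink, IsFiniteMeasure μ ∧
      ∀ a : Mink, ∫ p, Complex.exp (Complex.I * (mdot p a : ℝ)) ∂μ = inner ℂ ψ (T.U a ψ)
  then h.choose else 0

open Classical in
/-- The operator `F(P)` for a bounded Borel function `F` of the four-momentum: the unique bounded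
operator whose quadratic form is `(ψ, F(P) ψ) = ∫ F(p) d(ψ, E(p) ψ)`. -/
def functionOf (F : Mink → ℂ) : H →L[ℂ] H :=
  if h : ∃ A : H →L[ℂ] H, ∀ ψ, inner ℂ ψ (A ψ) = ∫ p, F p ∂(T.spectralMeasure ψ)
  then h.choose else 0

/-- The spectral projection `E(A)` of the four-momentum. -/
def spectralProjection (A : Set Mink) : H →L[ℂ] H :=
  T.functionOf (A.indicator fun _ => 1)

/-- The projection `E_μ = E({p | 0 ≤ p² ≤ μ², p⁰ ≥ 0})`. -/
def massProjection (μ : ℝ) : H →L[ℂ] H :=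
  T.spectralProjection {p | 0 ≤ mdot p p ∧ mdot p p ≤ μ ^ 2 ∧ 0 ≤ p.1}

/-- The field `B(x) = U(x) B U(-x)`. -/
def field (B : H →L[ℂ] H) (x : Mink) : H →L[ℂ] H := T.U x * B * T.U (-x)

end TranslationRep

/-! ### Decay of commutators -/

/-- The function `D_κ` (with length scale `lam`). -/
def decayFn (lam κ : ℝ) (a : Mink) : ℝ :=
  if 0 ≤ mdot a a then 1 else lam ^ κ / (lam + ‖a.2‖ - |a.1|) ^ κ

/-- The commutator `[B₁, B₂]` is of `κ`-type. -/
def IsKappaType (T : TranslationRep H) (lam κ : ℝ) (B₁ B₂ : H →L[ℂ] H) : Prop :=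
  ∃ c : ℝ, ∀ a : Mink, ‖⁅B₁, T.field B₂ a⁆‖ ≤ c * decayFn lam κ a

/-- The commutator `[B₁, B₂]` is of `κ^∞`-type: both operators are smooth in norm under
translations and all `[D^α B₁, D^β B₂]` are of `κ`-type. -/
def IsKappaInftyType (T : TranslationRep H) (lam κ : ℝ) (B₁ B₂ : H →L[ℂ] H) : Prop :=
  ContDiff ℝ ∞ (T.field B₁) ∧ ContDiff ℝ ∞ (T.field B₂) ∧
    ∀ (j k : ℕ) (u : Fin j → Mink) (v : Fin k → Mink),
      IsKappaType T lam κ (iteratedFDeriv ℝ j (T.field B₁) 0 u)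
        (iteratedFDeriv ℝ k (T.field B₂) 0 v)

/-- A quantum field theory in vacuum representation: translations with relativistic positivity of
energy, a vacuum vector unique up to a phase, and a *-algebra of smooth field operators whose
commutators are of `κ^∞`-type. -/
structure VacuumTheory (H : Type*) [NormedAddCommGroup H] [InnerProductSpace ℂ H]
    [CompleteSpace H] (lam κ : ℝ) extends TranslationRep H where
  spectrum_condition : ∀ ψ : H,
    toTranslationRep.spectralMeasure ψ {p | ¬ ‖p.2‖ ≤ p.1} = 0
  /-- The vacuum vector. -/
  Ω : H
  norm_vacuum : ‖Ω‖ = 1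
  vacuum_invariant : ∀ a, U a Ω = Ω
  vacuum_unique : ∀ ψ : H, (∀ a, U a ψ = ψ) → ∃ c : ℂ, ψ = c • Ω
  /-- The field algebra. -/
  𝓕 : NonUnitalStarSubalgebra ℂ (H →L[ℂ] H)
  commutators : ∀ B₁ ∈ 𝓕, ∀ B₂ ∈ 𝓕, IsKappaInftyType toTranslationRep lam κ B₁ B₂

/-! ### Test functions on the light cone

The future light cone `{l | l · l = 0, l⁰ > 0}` is parametrized by the nonzero spatial part of `l`,
with `l⁰ = ‖l‖`; its section `t · l = 1` is the unit sphere. -/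

/-- Covariant components `l_a` of the null vector with spatial part `l`. -/
def lowerNull (l : Space3) : Fin 4 → ℝ := Fin.cons ‖l‖ fun i => - l i

/-- Partial derivatives `∂/∂l^a` of the extension of `F` which is independent of `l⁰`. -/
def partialNull (F : Space3 → ℂ) (l : Space3) : Fin 4 → ℂ :=
  Fin.cons 0 fun i => fderiv ℝ F l (EuclideanSpace.single i 1)

/-- The intrinsic operators `L_ab = l_a ∂/∂l^b - l_b ∂/∂l^a` on the cone. (They are tangent to the
cone, so it does not matter how a function is extended off the cone.) -/
def coneOp (ab : Fin 4 × Fin 4) (F : Space3 → ℂ) (l : Space3) : ℂ :=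
  lowerNull l ab.1 * partialNull F l ab.2 - lowerNull l ab.2 * partialNull F l ab.1

/-- The space `𝒮^n_ε` of smooth functions `b(s,l)`, homogeneous of degree `n`, with
`|L … L ∂_s^m b(s,l)| ≤ const (t·l)^(n-m) / (lam + |s|/t·l)^(m+1+ε)`. -/
structure IsHomTestFn (lam ε : ℝ) (n : ℤ) (b : ℝ → Space3 → ℂ) : Prop where
  smooth : ContDiffOn ℝ ∞ (fun p : ℝ × Space3 => b p.1 p.2) {p | p.2 ≠ 0}
  homogeneous : ∀ γ : ℝ, 0 < γ → ∀ (s : ℝ) (l : Space3), l ≠ 0 →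
    b (γ * s) (γ • l) = (γ : ℂ) ^ n * b s l
  bound : ∀ (ops : List (Fin 4 × Fin 4)) (m : ℕ), ∃ C : ℝ, ∀ (s : ℝ) (l : Space3), l ≠ 0 →
    ‖ops.foldr coneOp (fun l' => iteratedDeriv m (fun s' => b s' l') s) l‖ ≤
      C * ‖l‖ ^ (n - (m : ℤ)) / (lam + |s| / ‖l‖) ^ ((m : ℝ) + 1 + ε)

/-- `f = ∂_s³ b`. -/
def thirdDeriv (b : ℝ → Space3 → ℂ) (s : ℝ) (l : Space3) : ℂ :=
  iteratedDeriv 3 (fun s' => b s' l) s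

/-- `f̃(u,l) = (2π)⁻¹ ∫ exp(ius) f(s,l) ds`. -/
def timeFourier (f : ℝ → Space3 → ℂ) (u : ℝ) (l : Space3) : ℂ :=
  (2 * Real.pi : ℂ)⁻¹ * ∫ s : ℝ, Complex.exp (Complex.I * u * s) * f s l

/-- `f₊(s,l) = ∫ θ(u) f̃(u,l) exp(-ius) du`. -/
def positivePart (f : ℝ → Space3 → ℂ) (s : ℝ) (l : Space3) : ℂ :=
  ∫ u in Set.Ioi (0 : ℝ), timeFourier f u l * Complex.exp (-(Complex.I * u * s))

open Classical in
/-- The function `p ↦ f̃(1,p)` on the cone of nonzero future null vectors, extended by zero. -/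
def tildeOne (f : ℝ → Space3 → ℂ) (p : Mink) : ℂ :=
  if p.2 ≠ 0 ∧ p.1 = ‖p.2‖ then timeFourier f 1 p.2 else 0

/-- The support of `l ↦ sup_s |f(s,l)|` on the sphere `t · l = 1`. -/
def angularSupport (f : ℝ → Space3 → ℂ) : Set (Metric.sphere (0 : Space3) 1) :=
  tsupport fun l => ⨆ s : ℝ, ‖f s l‖

/-! ### Smeared fields -/

/-- `B[r,f] = (r/2π) ∫ B(st + rl) f(s,l) ds dΩ_t(l)`; here `st + rl = (s + r, r𝐥)`. -/
def smearRadius (T : TranslationRep H) (B : H →L[ℂ] H) (r : ℝ) (f : ℝ → Space3 → ℂ) :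
    H →L[ℂ] H :=
  ((r / (2 * Real.pi) : ℝ) : ℂ) •
    ∫ x : ℝ × Metric.sphere (0 : Space3) 1,
      f x.1 x.2 • T.field B (x.1 + r, r • (x.2 : Space3))
      ∂((volume : Measure ℝ).prod (volume : Measure Space3).toSphere)

/-- `B[g,f] = ∫ g(r) B[r,f] dr`. -/
def smear (T : TranslationRep H) (B : H →L[ℂ] H) (g : ℝ → ℝ) (f : ℝ → Space3 → ℂ) :
    H →L[ℂ] H :=
  ∫ r : ℝ, (g r : ℂ) • smearRadius T B r f

/-- `w(R) = lam (R/lam)^η`. -/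
def width (lam η R : ℝ) : ℝ := lam * (R / lam) ^ η

/-- `g^η_R(r) = w⁻¹ g(w⁻¹(r - R) + 1)`. -/
def scaled (lam η : ℝ) (g : ℝ → ℝ) (R r : ℝ) : ℝ :=
  (width lam η R)⁻¹ * g ((width lam η R)⁻¹ * (r - R) + 1)

/-- The window `⟨R₁,R₂⟩ = ⟨R + (τ₁-1) w(R), R + (τ₂-1) w(R)⟩`. -/
def window (lam η τ₁ τ₂ R : ℝ) : Set ℝ :=
  Set.Icc (R + (τ₁ - 1) * width lam η R) (R + (τ₂ - 1) * width lam η R)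

/-- The smearing functions in the radius: smooth, real, of integral one, with support in
`⟨τ₁,τ₂⟩ ⊂ (0,∞)`. -/
structure IsRadialSmearing (g : ℝ → ℝ) : Prop where
  smooth : ContDiff ℝ ∞ g
  support : ∃ τ₁ τ₂ : ℝ, 0 < τ₁ ∧ tsupport g ⊆ Set.Icc τ₁ τ₂
  integral_eq_one : ∫ r, g r = 1

/-- The creation-type operator `B⁺_{R,η}[f] = B[g^η_R, f₊]`; for `η = 1` this is `B⁺_R[f]`. -/
def creation (T : TranslationRep H) (lam η : ℝ) (g : ℝ → ℝ) (B : H →L[ℂ] H)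
    (f : ℝ → Space3 → ℂ) (R : ℝ) : H →L[ℂ] H :=
  smear T B (scaled lam η g R) (positivePart f)

namespace VacuumTheory

variable {lam κ : ℝ} (T : VacuumTheory H lam κ)

/-- The projection `E_Ω^⊥` onto the orthogonal complement of the vacuum. -/
def vacuumPerp : H →L[ℂ] H := ((Submodule.span ℂ {T.Ω})ᗮ).starProjection

/-- `B₁₂(z) = [B₁(z/2), B₂(-z/2)]`. -/
def relComm (B₁ B₂ : H →L[ℂ] H) (z : Mink) : H →L[ℂ] H :=
  ⁅T.field B₁ ((1 / 2 : ℝ) • z), T.field B₂ (-((1 / 2 : ℝ) • z))⁆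

/-- `K(y₁,y₂,y) = (Ω, B₁₂(y₁) E_Ω^⊥ U(-y) B₃₄(y₂) Ω)`. -/
def clusterFn (B₁ B₂ B₃ B₄ : H →L[ℂ] H) (y₁ y₂ y : Mink) : ℂ :=
  inner ℂ T.Ω (T.relComm B₁ B₂ y₁ (T.vacuumPerp (T.U (-y) (T.relComm B₃ B₄ y₂ T.Ω))))

/-- The clustering assumption on commutators. -/
def Clustering : Prop :=
  ∀ B₁ ∈ T.𝓕, ∀ B₂ ∈ T.𝓕, ∀ B₃ ∈ T.𝓕, ∀ B₄ ∈ T.𝓕, ∀ N : ℕ, 0 < N →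
    ∃ c₁ > (0 : ℝ), ∃ c₂ > (0 : ℝ), ∃ c₃ > (0 : ℝ), ∃ M > (0 : ℝ), ∃ ν > (0 : ℝ),
    ∃ d₀ > (0 : ℝ), ∀ d ≥ d₀, ∀ y₁ y₂ y : Mink,
      euclLen y₁ ≤ d → euclLen y₂ ≤ d → |y.1| + c₁ * d ≤ ‖y.2‖ →
      ‖T.clusterFn B₁ B₂ B₃ B₄ y₁ y₂ y‖ ≤
        c₂ * d ^ M / (‖y.2‖ - |y.1|) ^ ν + c₃ * d ^ (-(N : ℝ))

/-- The number `(2π)² (f̃₁(1,P) B₁Ω, E₀ f̃₂(1,P) B₂Ω)`. -/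
def twoPoint (B₁ : H →L[ℂ] H) (f₁ : ℝ → Space3 → ℂ) (B₂ : H →L[ℂ] H) (f₂ : ℝ → Space3 → ℂ) :
    ℂ :=
  (2 * Real.pi : ℂ) ^ 2 *
    inner ℂ (T.functionOf (tildeOne f₁) (B₁ T.Ω))
      (T.massProjection 0 (T.functionOf (tildeOne f₂) (B₂ T.Ω)))

/-- The vector `B⁺_{1,R,η}[f₁] ⋯ B⁺_{n,R,η}[f_n] Ω`. -/
def productState {n : ℕ} (η : ℝ) (g : ℝ → ℝ) (B : Fin n → H →L[ℂ] H)
    (f : Fin n → ℝ → Space3 → ℂ) (R : ℝ) : H :=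
  (List.ofFn fun j => creation T.toTranslationRep lam η g (B j) (f j) R).prod T.Ω

/-- The bosonic Fock scalar product `∑_σ ∏_i (2π)² (f̃_i(1,P) B_iΩ, E₀ f̃'_{σ(i)}(1,P) B'_{σ(i)}Ω)`;
the sum over bijections is empty, so zero, when the particle numbers differ. -/
def fockProduct {m n : ℕ} (B : Fin m → H →L[ℂ] H) (f : Fin m → ℝ → Space3 → ℂ)
    (B' : Fin n → H →L[ℂ] H) (f' : Fin n → ℝ → Space3 → ℂ) : ℂ :=
  ∑ σ : Fin m ≃ Fin n, ∏ i, T.twoPoint (B i) (f i) (B' (σ i)) (f' (σ i))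

end VacuumTheory

end

end NullAsymptotics

open NullAsymptotics

namespace NullAsymptotics

noncomputable section

set_option linter.unusedSectionVars false

open scoped Real
open Real (Gamma abs_exp arccos cos cos_pi div_rpow exp_le_one_iff exp_pos exp_zero mul_rpow
  norm_eq_abs norm_of_nonneg one_le_rpow one_le_sqrt one_rpow pi_gt_three pi_ne_zero pi_pos
  rpow_add rpow_intCast rpow_le_rpow rpow_mul rpow_natCast rpow_neg rpow_nonneg rpow_one rpow_two
  sin sin_sq_add_cos_sq smoothTransition sq_sqrt sqrt sqrt_le_iff sqrt_sq)
open Complex (I I_ne_zero I_sq coe_smul conjCLE conj_I conj_ofReal continuous_conj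
  continuous_ofReal exp exp_add exp_conj inv_I norm_I norm_exp norm_exp_ofReal_mul_I norm_real
  ofRealCLM ofReal_add ofReal_cpow ofReal_exp ofReal_re ofReal_zero real_smul)
open Set (Icc Ici Iic Iio InjOn Ioc Ioi Ioo indicator_of_mem indicator_of_notMem mem_image)
open ContinuousLinearMap (adjoint_inner_left adjoint_inner_right comp_apply flip_apply inr
  integral_apply integral_comp_comm le_of_opNorm_le_of_le le_opNorm mul_apply' opNorm_le_bound
  star_eq_adjoint)
open Metric (ball)
open Summable (mul_left of_nat_of_neg of_nonneg_of_le)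
open Finset (mul_sum sum_congr sum_mul sum_nonneg)
open ENNReal (mul_top ofReal ofReal_le_ofReal ofReal_le_ofReal_iff ofReal_lt_top ofReal_mul
  ofReal_mul' ofReal_ne_top ofReal_one toReal_ofReal)
open Submodule (smul_mem)

/-- The unit sphere. -/
local notation "S²" => Metric.sphere (0 : Space3) 1

local notation "Frame" => OrthonormalBasis (Fin 3) ℝ Space3

local notation "Op" X:max => X →L[ℂ] X

local notation "TestFn" => ℝ → Space3 → ℂ

variable {H : Type*} [NormedAddCommGroup H] [InnerProductSpace ℂ H] [CompleteSpace H]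

theorem integral_congr_fun {X E : Type*} [MeasurableSpace X] [NormedAddCommGroup E]
    [NormedSpace ℝ E] {μ : Measure X} {f g : X → E} (h : ∀ x, f x = g x) :
    ∫ x, f x ∂μ = ∫ x, g x ∂μ := integral_congr_ae (.of_forall h)

instance (lam κ : ℝ) : CoeOut (VacuumTheory H lam κ) (TranslationRep H) := ⟨VacuumTheory.toTranslationRep⟩

section Bochner

variable {V : Type*} [NormedAddCommGroup V] [InnerProductSpace ℝ V] [FiniteDimensional ℝ V]
  [MeasurableSpace V] [BorelSpace V]
/-- A pointwise limit of characteristic functions which is continuous at the origin is a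
characteristic function. -/
theorem exists_charFun_eq_of_tendsto (μ : ℕ → Measure V) [∀ n, IsProbabilityMeasure (μ n)] (φ : V →
    ℂ) (hφ : ContinuousAt φ 0) (h : ∀ a, Tendsto (fun n => charFun (μ n) a) atTop (𝓝 (φ a))) : ∃ ν :
    Measure V, IsProbabilityMeasure ν ∧ ∀ a, charFun ν a = φ a := by
  have tight := isTightMeasureSet_of_tendsto_charFun hφ h
  let P : ℕ → ProbabilityMeasure V := fun n => ⟨μ n, inferInstance⟩
  have hc : IsCompact (closure (Set.range P)) := by
    apply isCompact_closure_of_isTightMeasureSet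
    convert tight using 1
    ext x
    constructor
    · rintro ⟨_, ⟨n, rfl⟩, rfl⟩
      exact ⟨n, rfl⟩
    · rintro ⟨n, rfl⟩
      exact ⟨P n, ⟨n, rfl⟩, rfl⟩
  obtain ⟨ν, -, k, hk, hν⟩ := hc.tendsto_subseq (x := P) (fun n => subset_closure ⟨n, rfl⟩)
  refine ⟨ν, inferInstance, fun a => ?_⟩
  have h1 := (ProbabilityMeasure.tendsto_iff_tendsto_charFun (μ := P ∘ k)).1 hν a
  have h2 := (h a).comp hk.tendsto_atTop
  exact tendsto_nhds_unique h1 h2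

theorem integrable_gaussian {c : ℝ} (hc : 0 < c) : Integrable fun x : V => rexp (-c * ‖x‖ ^ 2) := by
  have := (GaussianFourier.integrable_cexp_neg_mul_sq_norm_add (V := V) (b := (c : ℂ))
    (by simpa using hc) 0 0).norm
  simpa [norm_exp, ← Complex.ofReal_pow] using this

theorem integral_gaussian_mul_translate (c : ℝ) (z : V) : ∫ x : V, rexp (-c * ‖x‖ ^ 2) * rexp (-c *
    ‖x + z‖ ^ 2) = rexp (-(c / 2) * ‖z‖ ^ 2) * ∫ x : V, rexp (-(2 * c) * ‖x‖ ^ 2) := by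
  have h : ∀ x : V, rexp (-c * ‖x‖ ^ 2) * rexp (-c * ‖x + z‖ ^ 2) =
      rexp (-(c / 2) * ‖z‖ ^ 2) * rexp (-(2 * c) * ‖x + (1 / 2 : ℝ) • z‖ ^ 2) := by
    intro x
    rw [← Real.exp_add, ← Real.exp_add, norm_add_sq_real, norm_add_sq_real, inner_smul_right,
      norm_smul]
    congr 1
    norm_num
    ring
  simp_rw [h]
  rw [integral_const_mul, integral_add_right_eq_self (fun x : V => rexp (-(2 * c) * ‖x‖ ^ 2))]

/-- The damped Fourier transform of the orbit `u`. -/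
def dampedFourier (u : V → H) (c : ℝ) (p : V) : H :=
  ∫ x, (rexp (-c * ‖x‖ ^ 2) * exp (-(I * inner ℝ x p)) : ℂ) • u x

variable {u : V → H} {φ : V → ℂ}

theorem integrable_dampedFourier (hu : Continuous u) {C : ℝ} (hC : ∀ x, ‖u x‖ ≤ C) {c : ℝ} (hc : 0 <
    c) (p : V) : Integrable fun x => (rexp (-c * ‖x‖ ^ 2) * exp (-(I * inner ℝ x p)) : ℂ) • u x :=
    by
  refine ((integrable_gaussian (V := V) hc).mul_const C).mono'
    (by fun_prop : Continuous _).aestronglyMeasurable (.of_forall fun x => ?_)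
  rw [norm_smul, norm_mul, norm_real, norm_exp]
  simp only [norm_eq_abs, abs_exp]
  have : (-(I * (inner ℝ x p : ℝ))).re = 0 := by simp
  rw [this, exp_zero, mul_one]
  exact mul_le_mul_of_nonneg_left (hC x) (exp_pos _).le

theorem continuous_dampedFourier (hu : Continuous u) {C : ℝ} (hC : ∀ x, ‖u x‖ ≤ C) {c : ℝ} (hc : 0 <
    c) : Continuous (dampedFourier u c) := by
  refine continuous_of_dominated (F := fun p x =>
    (rexp (-c * ‖x‖ ^ 2) * exp (-(I * inner ℝ x p)) : ℂ) • u x)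
    (bound := fun x => rexp (-c * ‖x‖ ^ 2) * C) (fun p =>
    (by fun_prop : Continuous _).aestronglyMeasurable) (fun p => .of_forall fun x => ?_)
    ((integrable_gaussian (V := V) hc).mul_const C) (.of_forall fun x => by fun_prop)
  rw [norm_smul, norm_mul, norm_real, norm_exp]
  simp only [norm_eq_abs, abs_exp]
  have : (-(I * (inner ℝ x p : ℝ))).re = 0 := by simp
  rw [this, exp_zero, mul_one]
  exact mul_le_mul_of_nonneg_left (hC x) (exp_pos _).le

theorem norm_sq_dampedFourier (hu : Continuous u) {C : ℝ} (hC : ∀ x, ‖u x‖ ≤ C) (hφ : ∀ x y, inner ℂ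
    (u x) (u y) = φ (y - x)) {c : ℝ} (hc : 0 < c) (p : V) : ((‖dampedFourier u c p‖ ^ 2 : ℝ) : ℂ) =
    ∫ x : V, ∫ y : V, (rexp (-c * ‖x‖ ^ 2) * rexp (-c * ‖y‖ ^ 2) : ℂ) * exp (I * inner ℝ (x - y) p)
    * φ (y - x) := by
  have h1 : ((‖dampedFourier u c p‖ ^ 2 : ℝ) : ℂ) =
      inner ℂ (dampedFourier u c p) (dampedFourier u c p) := by
    rw [inner_self_eq_norm_sq_to_K]; simp
  rw [h1]
  have h2 : inner ℂ (dampedFourier u c p) (dampedFourier u c p) = ∫ x, (starRingEnd ℂ)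
      (inner ℂ (dampedFourier u c p)
      ((rexp (-c * ‖x‖ ^ 2) * exp (-(I * inner ℝ x p)) : ℂ) • u x)) := by
    rw [integral_conj, integral_inner (integrable_dampedFourier hu hC hc p), inner_conj_symm]
    rfl
  rw [h2]
  refine integral_congr_fun fun x => ?_
  rw [inner_conj_symm, inner_smul_left]
  rw [dampedFourier, ← integral_inner (integrable_dampedFourier hu hC hc p), ← integral_const_mul]
  refine integral_congr_fun fun y => ?_
  simp only [inner_smul_right, hφ, map_mul, ← exp_conj, map_neg, conj_ofReal,
    conj_I, inner_sub_left]
  push_cast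
  have h3 : -(-I * (inner ℝ x p : ℂ)) = I * (inner ℝ x p : ℂ) := by ring
  rw [mul_sub, Complex.exp_sub, div_eq_mul_inv, ← Complex.exp_neg, h3]
  ring

theorem integral_charFun_damped (hu : Continuous u) {C : ℝ} (hC : ∀ x, ‖u x‖ ≤ C) (hφ : ∀ x y, inner
    ℂ (u x) (u y) = φ (y - x)) (hφc : Continuous φ) {c : ℝ} (hc : 0 < c) : ∃ K : ℝ, 0 < K ∧ ∀ a : V,
    ∫ p : V, ((rexp (-c * ‖p‖ ^ 2) * ‖dampedFourier u c p‖ ^ 2 : ℝ) : ℂ) * exp (I * inner ℝ a p) = K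
    * ∫ z : V, (rexp (-(c / 2) * ‖z‖ ^ 2) * rexp (-(4 * c)⁻¹ * ‖a - z‖ ^ 2) : ℝ) * φ z := by
  set d : ℝ := (Module.finrank ℝ V : ℝ) with hd
  have hC0 : 0 ≤ C := (norm_nonneg _).trans (hC 0)
  have hφC : ∀ z, ‖φ z‖ ≤ C ^ 2 := by
    intro z
    have := hφ 0 z
    rw [sub_zero] at this
    rw [← this, sq]
    exact (norm_inner_le_norm _ _).trans (mul_le_mul (hC _) (hC _) (norm_nonneg _) hC0)
  have hg := integrable_gaussian (V := V) hc
  have hg2 : 0 < ∫ x : V, rexp (-(2 * c) * ‖x‖ ^ 2) :=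
    integral_exp_pos (integrable_gaussian (V := V) (by positivity))
  refine ⟨(π / c) ^ (d / 2) * ∫ x : V, rexp (-(2 * c) * ‖x‖ ^ 2), by positivity,
    fun a => ?_⟩
  -- Fubini in `(p, (x, y))`
  let F : V → V × V → ℂ := fun p w => (rexp (-c * ‖p‖ ^ 2) : ℂ) *
    exp (I * inner ℝ a p) * ((rexp (-c * ‖w.1‖ ^ 2) *
    rexp (-c * ‖w.2‖ ^ 2) : ℂ) * exp (I * inner ℝ (w.1 - w.2) p) * φ (w.2 - w.1))
  have hI : ∀ t : ℝ, ‖exp (I * t)‖ = 1 := fun t => by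
    rw [mul_comm]; exact norm_exp_ofReal_mul_I t
  have hFn : ∀ p w, ‖F p w‖ ≤ rexp (-c * ‖p‖ ^ 2) * (rexp (-c * ‖w.1‖ ^ 2) *
    rexp (-c * ‖w.2‖ ^ 2) * C ^ 2) := by
    intro p w
    simp only [F, norm_mul, hI, norm_real, norm_eq_abs, abs_exp, mul_one]
    gcongr
    exact hφC _
  have hFint : Integrable (Function.uncurry F) ((volume : Measure V).prod
      ((volume : Measure V).prod (volume : Measure V))) := by
    refine (hg.mul_prod ((hg.mul_prod hg).mul_const (C ^ 2))).mono'
      (by fun_prop : Continuous _).aestronglyMeasurable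
      (.of_forall fun w => hFn w.1 w.2)
  have hgg : ∀ p, Integrable (fun w : V × V => ((rexp (-c * ‖w.1‖ ^ 2) *
    rexp (-c * ‖w.2‖ ^ 2) : ℂ) * exp (I * inner ℝ (w.1 - w.2) p) * φ (w.2 - w.1)))
        ((volume : Measure V).prod (volume : Measure V)) := by
    intro p
    refine ((hg.mul_prod hg).mul_const (C ^ 2)).mono'
      (by fun_prop : Continuous _).aestronglyMeasurable (.of_forall fun w => ?_)
    simp only [norm_mul, hI, norm_real, norm_eq_abs, abs_exp, mul_one]
    gcongr
    exact hφC _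
  have e1 : ∀ p, ((rexp (-c * ‖p‖ ^ 2) * ‖dampedFourier u c p‖ ^ 2 : ℝ) : ℂ) *
        exp (I * inner ℝ a p) = ∫ w, F p w ∂((volume : Measure V).prod volume) := by
    intro p
    simp only [F]
    rw [integral_const_mul, integral_prod _ (hgg p), Complex.ofReal_mul,
      norm_sq_dampedFourier hu hC hφ hc p]
    ring
  simp_rw [e1]
  rw [integral_integral_swap hFint]
  -- the Gaussian integral over `p`
  have e2 : ∀ w : V × V, ∫ p, F p w = ((π / c) ^ (d / 2) : ℝ) *
      ((rexp (-c * ‖w.1‖ ^ 2) * rexp (-c * ‖w.2‖ ^ 2) *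
        rexp (-(4 * c)⁻¹ * ‖a + w.1 - w.2‖ ^ 2) : ℝ) * φ (w.2 - w.1)) := by
    intro w
    have := GaussianFourier.integral_cexp_neg_mul_sq_norm_add (V := V) (b := (c : ℂ))
      (by simpa using hc) I (a + w.1 - w.2)
    have e3 : ∀ p, F p w = exp (-c * ‖p‖ ^ 2 + I * inner ℝ (a + w.1 - w.2) p) *
        ((rexp (-c * ‖w.1‖ ^ 2) * rexp (-c * ‖w.2‖ ^ 2) : ℂ) * φ (w.2 - w.1)) := by
      intro p
      simp only [F]
      rw [exp_add, add_sub_assoc, inner_add_left, ofReal_add, mul_add, exp_add]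
      push_cast
      ring
    simp_rw [e3]
    rw [integral_mul_const, this]
    rw [ofReal_cpow (by positivity)]
    push_cast
    rw [I_sq, hd]
    have : (-1 * (‖a + w.1 - w.2‖ : ℂ) ^ 2 / (4 * c)) = -(4 * (c : ℂ))⁻¹ * ‖a + w.1 - w.2‖ ^ 2 := by
      ring
    rw [this]
    push_cast
    ring
  simp_rw [e2]
  rw [integral_const_mul]
  have hint2 : Integrable (fun w : V × V => (((rexp (-c * ‖w.1‖ ^ 2) * rexp (-c * ‖w.1 + w.2‖ ^ 2) *
        rexp (-(4 * c)⁻¹ * ‖a - w.2‖ ^ 2) : ℝ) : ℂ) * φ (w.2)))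
         ((volume : Measure V).prod (volume : Measure V)) := by
    have hgz : Integrable (fun z : V => rexp (-(4 * c)⁻¹ * ‖a - z‖ ^ 2)) :=
      (integrable_gaussian (V := V) (c := (4 * c)⁻¹) (by positivity)).comp_sub_left a
    refine ((hg.mul_prod hgz).mul_const (C ^ 2)).mono'
      (by fun_prop : Continuous _).aestronglyMeasurable (.of_forall fun w => ?_)
    simp only [norm_mul, norm_real, norm_eq_abs, abs_exp]
    have : rexp (-c * ‖w.1 + w.2‖ ^ 2) ≤ 1 := by
      rw [exp_le_one_iff]
      have := mul_nonneg hc.le (sq_nonneg ‖w.1 + w.2‖)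
      linarith
    calc _ ≤ rexp (-c * ‖w.1‖ ^ 2) * 1 *
        rexp (-(4 * c)⁻¹ * ‖a - w.2‖ ^ 2) * C ^ 2 := by
          gcongr
          exact hφC _
      _ = _ := by simp
  have hint3 : Integrable (fun w : V × V => (((rexp (-c * ‖w.1‖ ^ 2) * rexp (-c * ‖w.2‖ ^ 2) *
        rexp (-(4 * c)⁻¹ * ‖a + w.1 - w.2‖ ^ 2) : ℝ) : ℂ) * φ (w.2 - w.1)))
         ((volume : Measure V).prod (volume : Measure V)) := by
    refine ((hg.mul_prod hg).mul_const (C ^ 2)).mono'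
      (by fun_prop : Continuous _).aestronglyMeasurable (.of_forall fun w => ?_)
    simp only [norm_mul, norm_real, norm_eq_abs, abs_exp]
    have : rexp (-(4 * c)⁻¹ * ‖a + w.1 - w.2‖ ^ 2) ≤ 1 := by
      rw [exp_le_one_iff]
      have := mul_nonneg (inv_nonneg.2 (by positivity : 0 ≤ 4 * c)) (sq_nonneg ‖a + w.1 - w.2‖)
      linarith
    calc _ ≤ rexp (-c * ‖w.1‖ ^ 2) * rexp (-c * ‖w.2‖ ^ 2) * 1 * C ^ 2 := by
          gcongr
          exact hφC _
      _ = _ := by simp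
  rw [integral_prod _ hint3]
  simp only
  have e4 : ∀ x : V, ∫ y : V, (((rexp (-c * ‖x‖ ^ 2) * rexp (-c * ‖y‖ ^ 2) *
        rexp (-(4 * c)⁻¹ * ‖a + x - y‖ ^ 2) : ℝ) : ℂ) * φ (y - x)) =
        ∫ z : V, (((rexp (-c * ‖x‖ ^ 2) * rexp (-c * ‖x + z‖ ^ 2) *
        rexp (-(4 * c)⁻¹ * ‖a - z‖ ^ 2) : ℝ) : ℂ) * φ z) := by
    intro x
    rw [← integral_add_left_eq_self _ x]
    refine integral_congr_fun fun z => ?_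
    simp only [add_sub_cancel_left]
    rw [add_comm a x, add_sub_add_left_eq_sub]
  simp_rw [e4]
  rw [integral_integral_swap hint2]
  rw [Complex.ofReal_mul, mul_assoc]
  congr 1
  rw [← integral_const_mul]
  refine integral_congr_fun fun z => ?_
  have e5 := integral_gaussian_mul_translate c z
  calc _ = ∫ x : V, ((rexp (-c * ‖x‖ ^ 2) * rexp (-c * ‖x + z‖ ^ 2) : ℝ) : ℂ) *
        ((rexp (-(4 * c)⁻¹ * ‖a - z‖ ^ 2) : ℝ) * φ z) := by
        congr 1; ext x; push_cast; ring
    _ = _ := by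
      rw [integral_mul_const, integral_complex_ofReal, e5]
      push_cast
      ring

theorem integral_scaled_gaussian (φ : V → ℂ) {c : ℝ} (hc : 0 < c) (a : V) : ∫ z : V, (rexp (-(c / 2)
    * ‖z‖ ^ 2) * rexp (-(4 * c)⁻¹ * ‖a - z‖ ^ 2) : ℝ) * φ z = (sqrt (4 * c) ^ Module.finrank ℝ V :
    ℝ) * ∫ y : V, (rexp (-(c / 2) * ‖a + sqrt (4 * c) • y‖ ^ 2) * rexp (-‖y‖ ^ 2) : ℝ) * φ (a + sqrt
    (4 * c) • y) := by
  have hs : 0 < sqrt (4 * c) := Real.sqrt_pos.2 (by positivity)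
  have h1 := Measure.integral_comp_smul (μ := (volume : Measure V)) (fun y : V =>
    ((rexp (-(c / 2) * ‖a + y‖ ^ 2) *
        rexp (-(4 * c)⁻¹ * ‖y‖ ^ 2) : ℝ) : ℂ) * φ (a + y)) (sqrt (4 * c))
  have h2 : ∀ y : V, -(4 * c)⁻¹ * ‖sqrt (4 * c) • y‖ ^ 2 = -‖y‖ ^ 2 := by
    intro y
    rw [norm_smul, norm_of_nonneg hs.le, mul_pow, sq_sqrt (by positivity)]
    field_simp
  simp only [h2] at h1
  rw [h1, abs_of_nonneg (by positivity), ← integral_add_left_eq_self _ a]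
  rw [real_smul, ← mul_assoc, ← Complex.ofReal_mul, mul_inv_cancel₀ (by positivity),
    Complex.ofReal_one, one_mul]
  refine integral_congr_fun fun y => ?_
  simp

/-- **Bochner's theorem** for a function of the form `φ (y - x) = (u x, u y)`. -/
theorem exists_charFun_eq_of_inner (hu : Continuous u) (hC : ∀ x, ‖u x‖ ≤ 1) (hφ : ∀ x y, inner ℂ (u
    x) (u y) = φ (y - x)) (hφc : Continuous φ) (h0 : φ 0 = 1) : ∃ ν : Measure V,
    IsProbabilityMeasure ν ∧ ∀ a, charFun ν a = φ a := by
  let c : ℕ → ℝ := fun n => 1 / ((n : ℝ) + 1)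
  have hc : ∀ n, 0 < c n := fun n => Nat.one_div_pos_of_nat
  have hc1 : ∀ n, c n ≤ 1 := fun n => by
    simp only [c]; rw [div_le_one (by positivity)]; linarith [(Nat.cast_nonneg n : (0 : ℝ) ≤ n)]
  have hclim : Tendsto c atTop (𝓝 0) := tendsto_one_div_add_atTop_nhds_zero_nat
  have hφC : ∀ z, ‖φ z‖ ≤ 1 := by
    intro z
    have := hφ 0 z
    rw [sub_zero] at this
    rw [← this]
    exact (norm_inner_le_norm _ _).trans (mul_le_one₀ (hC _) (norm_nonneg _) (hC _))
  let G : ℝ := ∫ y : V, rexp (-‖y‖ ^ 2)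
  have hGi : Integrable fun y : V => rexp (-‖y‖ ^ 2) := by
    simpa using integrable_gaussian (V := V) one_pos
  have hG : 0 < G := integral_exp_pos hGi
  let L : ℕ → V → ℂ := fun n a => ∫ y : V, (rexp (-(c n / 2) * ‖a + sqrt (4 * c n) • y‖ ^ 2)
    * rexp (-‖y‖ ^ 2) : ℝ) * φ (a + sqrt (4 * c n) • y)
  have hL : ∀ a, Tendsto (fun n => L n a) atTop (𝓝 (φ a * G)) := by
    intro a
    have e : φ a * G = ∫ y : V, (rexp (-(0 / 2) * ‖a + sqrt (4 * 0) • y‖ ^ 2)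
    * rexp (-‖y‖ ^ 2) : ℝ) * φ (a + sqrt (4 * 0) • y) := by
      simp only [mul_zero, Real.sqrt_zero, zero_smul, add_zero, zero_div, neg_zero, zero_mul,
        exp_zero, one_mul]
      rw [integral_mul_const, mul_comm, integral_complex_ofReal]
    rw [e]
    refine tendsto_integral_of_dominated_convergence (fun y => rexp (-‖y‖ ^ 2))
      (fun n => (by fun_prop : Continuous _).aestronglyMeasurable) hGi (fun n =>
      .of_forall fun y => ?_) (.of_forall fun y => ?_)
    · simp only [norm_mul, norm_real, norm_eq_abs, abs_exp]
      have : rexp (-(c n / 2) * ‖a + sqrt (4 * c n) • y‖ ^ 2) ≤ 1 := by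
        rw [exp_le_one_iff]
        have := mul_nonneg (hc n).le (sq_nonneg ‖a + sqrt (4 * c n) • y‖)
        linarith
      calc _ ≤ 1 * rexp (-‖y‖ ^ 2) * 1 := by gcongr; exact hφC _
        _ = _ := by simp
    · have : Continuous fun t : ℝ => ((rexp (-(t / 2) * ‖a + sqrt (4 * t) • y‖ ^ 2)
        * rexp (-‖y‖ ^ 2) : ℝ) : ℂ) * φ (a + sqrt (4 * t) • y) := by fun_prop
      exact (this.tendsto 0).comp hclim
  let r : ℕ → V → ℝ := fun n p => rexp (-c n * ‖p‖ ^ 2) * ‖dampedFourier u (c n) p‖ ^ 2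
  have hr0 : ∀ n p, 0 ≤ r n p := fun n p => by positivity
  have hrc : ∀ n, Continuous (r n) := fun n => by
    have := continuous_dampedFourier hu hC (hc n)
    fun_prop
  have key : ∀ n, ∃ K : ℝ, 0 < K ∧ ∀ a : V,
      ∫ p : V, ((r n p : ℝ) : ℂ) * exp (I * inner ℝ a p) = K * L n a := by
    intro n
    obtain ⟨K, hK, h⟩ := integral_charFun_damped hu hC hφ hφc (hc n)
    refine ⟨K * sqrt (4 * c n) ^ Module.finrank ℝ V, ?_, fun a => ?_⟩
    · have := Real.sqrt_pos.2 (by linarith [hc n] : 0 < 4 * c n)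
      positivity
    · rw [h a, integral_scaled_gaussian φ (hc n) a, ← mul_assoc, ← Complex.ofReal_mul]
  choose K hK hKL using key
  have hri : ∀ n, Integrable (r n) := by
    intro n
    have hb : ∀ p, ‖dampedFourier u (c n) p‖ ≤ ∫ x : V, rexp (-c n * ‖x‖ ^ 2) := by
      intro p
      refine norm_integral_le_of_norm_le (integrable_gaussian (hc n)) (.of_forall fun x => ?_)
      rw [norm_smul, norm_mul, norm_real, norm_exp]
      simp only [norm_eq_abs, abs_exp]
      have : (-(I * (inner ℝ x p : ℝ))).re = 0 := by simp
      rw [this, exp_zero, mul_one]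
      exact mul_le_of_le_one_right (exp_pos _).le (hC x)
    refine ((integrable_gaussian (V := V) (hc n)).mul_const
      ((∫ x : V, rexp (-c n * ‖x‖ ^ 2)) ^ 2)).mono' (hrc n).aestronglyMeasurable
      (.of_forall fun p => ?_)
    rw [norm_of_nonneg (hr0 n p)]
    simp only [r]
    gcongr
    exact hb p
  have hZ : ∀ n, ((∫ p, r n p : ℝ) : ℂ) = K n * L n 0 := by
    intro n
    rw [← hKL n 0, ← integral_complex_ofReal]
    simp
  have hLne : ∀ᶠ n in atTop, L n 0 ≠ 0 := by
    refine (hL 0).eventually_ne ?_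
    rw [h0, one_mul]
    exact_mod_cast hG.ne'
  obtain ⟨N, hN⟩ := eventually_atTop.1 hLne
  have hZpos : ∀ n, 0 < ∫ p, r (n + N) p := by
    intro n
    refine lt_of_le_of_ne (integral_nonneg (hr0 _)) fun h => hN (n + N) (by omega) ?_
    have := hZ (n + N)
    rw [← h] at this
    simpa [(hK (n + N)).ne'] using this.symm
  let μ : ℕ → Measure V := fun n => volume.withDensity
    (fun p => ofReal ((∫ p, r (n + N) p)⁻¹ * r (n + N) p))
  have hμ : ∀ n, IsProbabilityMeasure (μ n) := by
    intro n
    constructor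
    simp only [μ]
    rw [withDensity_apply _ MeasurableSet.univ, Measure.restrict_univ,
      ← ofReal_integral_eq_lintegral_ofReal ((hri _).const_mul _) (.of_forall fun p =>
      mul_nonneg (inv_nonneg.2 (hZpos n).le) (hr0 _ p)), integral_const_mul,
      inv_mul_cancel₀ (hZpos n).ne', ofReal_one]
  have hch : ∀ n a, charFun (μ n) a = L (n + N) a / L (n + N) 0 := by
    intro n a
    rw [charFun_apply]
    simp only [μ]
    rw [integral_withDensity_eq_integral_toReal_smul (by
      have := (hrc (n + N)).measurable
      fun_prop) (.of_forall fun p => ofReal_lt_top)]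
    have e : ∀ p, (ofReal ((∫ p, r (n + N) p)⁻¹ * r (n + N) p)).toReal •
        exp ((inner ℝ p a : ℝ) * I) = ((∫ p, r (n + N) p : ℝ) : ℂ)⁻¹ *
        (((r (n + N) p : ℝ) : ℂ) * exp (I * inner ℝ a p)) := by
      intro p
      rw [toReal_ofReal (mul_nonneg (inv_nonneg.2 (hZpos n).le) (hr0 _ p)),
        real_smul, real_inner_comm, mul_comm _ I]
      push_cast
      ring
    simp_rw [e]
    rw [integral_const_mul, hKL, hZ]
    have : (K (n + N) : ℂ) ≠ 0 := by exact_mod_cast (hK _).ne'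
    have := hN (n + N) (by omega)
    field_simp
  refine exists_charFun_eq_of_tendsto μ φ hφc.continuousAt fun a => ?_
  simp_rw [hch]
  have h1 : Tendsto (fun n => L n a / L n 0) atTop (𝓝 (φ a * G / (φ 0 * G))) := by
    refine (hL a).div (hL 0) ?_
    rw [h0, one_mul]
    exact_mod_cast hG.ne'
  have hGc : (G : ℂ) ≠ 0 := by exact_mod_cast hG.ne'
  rw [h0, one_mul, mul_div_cancel_right₀ _ hGc] at h1
  exact h1.comp (tendsto_add_atTop_nat N)

end Bochner

section MinkowskiFourier

theorem mdot_add_right (p a b : Mink) : mdot p (a + b) = mdot p a + mdot p b := by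
  simp only [mdot, Prod.fst_add, Prod.snd_add, inner_add_right]; ring

theorem mdot_neg_right (p a : Mink) : mdot p (-a) = -mdot p a := by
  simp only [mdot, Prod.fst_neg, Prod.snd_neg, inner_neg_right]; ring

@[simp] theorem mdot_zero_right (p : Mink) : mdot p 0 = 0 := by simp [mdot]

theorem continuous_mdot : Continuous fun x : Mink × Mink => mdot x.1 x.2 := by
  unfold mdot; fun_prop

@[fun_prop] theorem Continuous.mdot {X : Type*} [TopologicalSpace X] {f g : X → Mink}
    (hf : Continuous f) (hg : Continuous g) : Continuous fun x => mdot (f x) (g x) :=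
  continuous_mdot.comp (hf.prodMk hg)

/-- The plane wave `exp (i p · a)`. -/
def planeWave (a p : Mink) : ℂ := exp (I * (mdot p a : ℝ))

theorem norm_planeWave (a p : Mink) : ‖planeWave a p‖ = 1 := by
  rw [planeWave, mul_comm]; exact norm_exp_ofReal_mul_I _

theorem planeWave_add (a b p : Mink) : planeWave (a + b) p = planeWave a p * planeWave b p := by
  simp only [planeWave, mdot_add_right, ofReal_add, mul_add, exp_add]

theorem conj_planeWave (a p : Mink) : (starRingEnd ℂ) (planeWave a p) = planeWave (-a) p := by
  simp [planeWave, ← exp_conj, mdot_neg_right]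

@[simp] theorem planeWave_zero (p : Mink) : planeWave 0 p = 1 := by simp [planeWave]

@[fun_prop] theorem Continuous.planeWave {X : Type*} [TopologicalSpace X] {f g : X → Mink}
    (hf : Continuous f) (hg : Continuous g) : Continuous fun x => planeWave (f x) (g x) := by
  unfold NullAsymptotics.planeWave; fun_prop

theorem continuous_planeWave (a : Mink) : Continuous (planeWave a) := by fun_prop

/-- Identification of momentum space with a Euclidean space which turns `mdot` into the
scalar product. -/
def euclMomentum (p : Mink) : WithLp 2 (ℝ × Space3) := WithLp.toLp 2 (p.1, -p.2)

/-- Inverse of `euclMomentum`. -/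
def momentumOfEucl (x : WithLp 2 (ℝ × Space3)) : Mink := (x.fst, -x.snd)

theorem continuous_euclMomentum : Continuous euclMomentum := by
  unfold euclMomentum; fun_prop

theorem continuous_momentumOfEucl : Continuous momentumOfEucl := by
  unfold momentumOfEucl; fun_prop

theorem momentumOfEucl_euclMomentum (p : Mink) : momentumOfEucl (euclMomentum p) = p := by
  simp [momentumOfEucl, euclMomentum]

theorem mdot_momentumOfEucl (x : WithLp 2 (ℝ × Space3)) (a : Mink) : mdot (momentumOfEucl x) a =
    inner ℝ x (WithLp.toLp 2 a) := by
  simp [mdot, momentumOfEucl, WithLp.prod_inner_apply, mul_comm]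

theorem inner_euclMomentum (p : Mink) (x : WithLp 2 (ℝ × Space3)) : inner ℝ (euclMomentum p) x =
    mdot p x.ofLp := by
  rw [← momentumOfEucl_euclMomentum p, mdot_momentumOfEucl, momentumOfEucl_euclMomentum]

theorem measure_ext_of_planeWave {μ ν : Measure Mink} [IsFiniteMeasure μ] [IsFiniteMeasure ν] (h : ∀
    a, ∫ p, planeWave a p ∂μ = ∫ p, planeWave a p ∂ν) : μ = ν := by
  have hm : Measurable euclMomentum := continuous_euclMomentum.measurable
  have key : μ.map euclMomentum = ν.map euclMomentum := by
    refine Measure.ext_of_charFun ?_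
    ext a
    have h' : ∀ ρ : Measure Mink, charFun (ρ.map euclMomentum) a = ∫ p, planeWave a.ofLp p ∂ρ := by
      intro ρ
      rw [charFun_apply, integral_map hm.aemeasurable
        (by fun_prop : Continuous _).aestronglyMeasurable]
      refine integral_congr_fun fun p => ?_
      simp only [planeWave, inner_euclMomentum, mul_comm]
    rw [h', h', h]
  have h2 : ∀ ρ : Measure Mink, (ρ.map euclMomentum).map momentumOfEucl = ρ := by
    intro ρ
    rw [Measure.map_map continuous_momentumOfEucl.measurable hm]
    convert Measure.map_id
    ext1 p
    exact momentumOfEucl_euclMomentum p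
  rw [← h2 μ, ← h2 ν, key]

end MinkowskiFourier

namespace TranslationRep

variable (T : TranslationRep H)

theorem inner_U_left (a : Mink) (ψ φ : H) : inner ℂ (T.U a ψ) φ = inner ℂ ψ (T.U (-a) φ) := by
  rw [← T.star_eq, star_eq_adjoint, adjoint_inner_right]

theorem U_add_apply (a b : Mink) (ψ : H) : T.U (a + b) ψ = T.U a (T.U b ψ) := by
  rw [T.map_add]; rfl

theorem U_zero_apply (ψ : H) : T.U 0 ψ = ψ := by rw [T.map_zero]; rfl

theorem U_neg_U (a : Mink) (ψ : H) : T.U (-a) (T.U a ψ) = ψ := by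
  rw [← U_add_apply, neg_add_cancel, U_zero_apply]

theorem norm_U (a : Mink) (ψ : H) : ‖T.U a ψ‖ = ‖ψ‖ := by
  have : inner ℂ (T.U a ψ) (T.U a ψ) = inner ℂ ψ ψ := by rw [inner_U_left, U_neg_U]
  rw [inner_self_eq_norm_sq_to_K, inner_self_eq_norm_sq_to_K] at this
  have h : ‖T.U a ψ‖ ^ 2 = ‖ψ‖ ^ 2 := by exact_mod_cast this
  exact (sq_eq_sq₀ (norm_nonneg _) (norm_nonneg _)).1 h

theorem norm_U_le (a : Mink) : ‖T.U a‖ ≤ 1 :=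
  opNorm_le_bound _ zero_le_one fun ψ => by rw [norm_U, one_mul]

theorem inner_U_U (a b : Mink) (ψ φ : H) : inner ℂ (T.U a ψ) (T.U b φ) = inner ℂ ψ (T.U (b - a) φ)
    := by
  rw [inner_U_left, ← U_add_apply, neg_add_eq_sub]

theorem exists_spectralMeasure (ψ : H) : ∃ μ : Measure Mink, IsFiniteMeasure μ ∧ ∀ a : Mink, ∫ p,
    exp (I * (mdot p a : ℝ)) ∂μ = inner ℂ ψ (T.U a ψ) := by
  by_cases hψ : ψ = 0
  · exact ⟨0, inferInstance, fun a => by simp [hψ]⟩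
  have hn : (‖ψ‖ : ℂ) ≠ 0 := by simpa using hψ
  let u : WithLp 2 (ℝ × Space3) → H := fun x => (‖ψ‖ : ℂ)⁻¹ • T.U x.ofLp ψ
  let φ : WithLp 2 (ℝ × Space3) → ℂ := fun x => (‖ψ‖ : ℂ)⁻¹ ^ 2 * inner ℂ ψ (T.U x.ofLp ψ)
  have hc := T.strongly_continuous ψ
  have hc' : Continuous fun x : WithLp 2 (ℝ × Space3) => T.U x.ofLp ψ := hc.comp (by fun_prop)
  obtain ⟨ν, hν, h⟩ := exists_charFun_eq_of_inner (u := u) (φ := φ) (by fun_prop) (fun x => by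
      simp only [u, norm_smul, norm_U, norm_inv, norm_real, norm_norm]
      rw [inv_mul_cancel₀ (norm_ne_zero_iff.2 hψ)])
    (fun x y => by
      simp only [u, φ, inner_smul_left, inner_smul_right, inner_U_U, map_inv₀, conj_ofReal,
        WithLp.ofLp_sub]
      ring) (by fun_prop)
    (by
      simp only [φ, WithLp.ofLp_zero, U_zero_apply, inner_self_eq_norm_sq_to_K]
      have : ((‖ψ‖ : ℝ) : ℂ) ^ 2 ≠ 0 := pow_ne_zero _ hn
      simp only [Complex.coe_algebraMap]
      field_simp)
  refine ⟨ofReal (‖ψ‖ ^ 2) • ν.map momentumOfEucl, Measure.smul_finite _ ofReal_ne_top, fun a => ?_⟩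
  rw [integral_smul_measure, integral_map continuous_momentumOfEucl.measurable.aemeasurable
    (by fun_prop : Continuous _).aestronglyMeasurable]
  have h1 := h (WithLp.toLp 2 a)
  rw [charFun_apply] at h1
  simp only [mdot_momentumOfEucl, mul_comm I]
  rw [h1, toReal_ofReal (by positivity), real_smul]
  simp only [φ]
  push_cast
  field_simp

theorem spectralMeasure_spec (ψ : H) : IsFiniteMeasure (T.spectralMeasure ψ) ∧ ∀ a : Mink, ∫ p,
    planeWave a p ∂(T.spectralMeasure ψ) = inner ℂ ψ (T.U a ψ) := by
  rw [spectralMeasure, dif_pos (T.exists_spectralMeasure ψ)]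
  exact (T.exists_spectralMeasure ψ).choose_spec

instance (ψ : H) : IsFiniteMeasure (T.spectralMeasure ψ) := (T.spectralMeasure_spec ψ).1

theorem integral_planeWave (ψ : H) (a : Mink) : ∫ p, planeWave a p ∂(T.spectralMeasure ψ) = inner ℂ
    ψ (T.U a ψ) :=
  (T.spectralMeasure_spec ψ).2 a

theorem spectralMeasure_univ (ψ : H) : (T.spectralMeasure ψ).real Set.univ = ‖ψ‖ ^ 2 := by
  have := T.integral_planeWave ψ 0
  simp only [planeWave_zero, integral_const, U_zero_apply, inner_self_eq_norm_sq_to_K] at this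
  apply Complex.ofReal_injective
  simpa using this

end TranslationRep

/-- Bounded Borel functions. -/
def IsBoundedBorel {X : Type*} [MeasurableSpace X] (F : X → ℂ) : Prop :=
  Measurable F ∧ ∃ C : ℝ, ∀ p, ‖F p‖ ≤ C

namespace IsBoundedBorel

variable {X : Type*} [MeasurableSpace X] {F G : X → ℂ}

theorem integrable (hF : IsBoundedBorel F) (μ : Measure X) [IsFiniteMeasure μ] : Integrable F μ :=
    by
  obtain ⟨hm, C, hC⟩ := hF
  exact Integrable.of_bound hm.aestronglyMeasurable C (.of_forall hC)

theorem mul (hF : IsBoundedBorel F) (hG : IsBoundedBorel G) : IsBoundedBorel fun p => F p * G p :=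
    by
  obtain ⟨hm, C, hC⟩ := hF
  obtain ⟨hm', C', hC'⟩ := hG
  exact ⟨hm.mul hm', C * C', fun p => by
    rw [norm_mul]
    exact mul_le_mul (hC p) (hC' p) (norm_nonneg _) ((norm_nonneg _).trans (hC p))⟩

theorem sub (hF : IsBoundedBorel F) (hG : IsBoundedBorel G) : IsBoundedBorel fun p => F p - G p :=
    by
  obtain ⟨hm, C, hC⟩ := hF
  obtain ⟨hm', C', hC'⟩ := hG
  exact ⟨hm.sub hm', C + C', fun p => (norm_sub_le _ _).trans (add_le_add (hC p) (hC' p))⟩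

theorem conj (hF : IsBoundedBorel F) : IsBoundedBorel fun p => (starRingEnd ℂ) (F p) := by
  obtain ⟨hm, C, hC⟩ := hF
  exact ⟨continuous_conj.measurable.comp hm, C, fun p => by simpa using hC p⟩

theorem const (c : ℂ) : IsBoundedBorel fun _ : X => c := ⟨measurable_const, ‖c‖, fun _ => le_rfl⟩

end IsBoundedBorel

theorem isBoundedBorel_planeWave (a : Mink) : IsBoundedBorel (planeWave a) :=
  ⟨(continuous_planeWave a).measurable, 1, fun p => (norm_planeWave a p).le⟩

theorem integral_mul_eq_zero_of_planeWave_real {μ : Measure Mink} {h : Mink → ℝ} (hi : Integrable h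
    μ) (h0 : ∀ a, ∫ p, planeWave a p * h p ∂μ = 0) {F : Mink → ℂ} (hF : IsBoundedBorel F) : ∫ p, F p
    * h p ∂μ = 0 := by
  let pos := μ.withDensity fun p => ofReal (h p)
  let neg := μ.withDensity fun p => ofReal (-h p)
  have f1 : IsFiniteMeasure pos := isFiniteMeasure_withDensity_ofReal hi.2
  have f2 : IsFiniteMeasure neg := isFiniteMeasure_withDensity_ofReal hi.neg.2
  have hneg : Integrable (fun p => -h p) μ := hi.neg
  have key : ∀ G : Mink → ℂ, IsBoundedBorel G →
      ∫ p, G p ∂pos - ∫ p, G p ∂neg = ∫ p, G p * h p ∂μ := by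
    intro G hG
    have e : ∀ k : Mink → ℝ, Integrable k μ → ∫ p, G p ∂(μ.withDensity fun p => ofReal (k p)) =
        ∫ p, (max (k p) 0) • G p ∂μ := by
      intro k hk
      rw [integral_withDensity_eq_integral_toReal_smul₀ hk.1.aemeasurable.ennreal_ofReal
        (.of_forall fun p => ofReal_lt_top)]
      simp only [ENNReal.toReal_ofReal']
    have hb : ∀ k : Mink → ℝ, Integrable k μ → Integrable (fun p => (max (k p) 0) • G p) μ := by
      intro k hk
      obtain ⟨hm, C, hC⟩ := hG
      have := hk.pos_part
      simp only [real_smul]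
      exact this.ofReal.mul_bdd hm.aestronglyMeasurable (.of_forall hC)
    rw [e h hi, e (fun p => -h p) hneg, ← integral_sub (hb h hi) (hb _ hneg)]
    refine integral_congr_fun fun p => ?_
    simp only [real_smul]
    rw [← sub_mul, ← Complex.ofReal_sub, mul_comm, max_zero_sub_eq_self]
  have : pos = neg := measure_ext_of_planeWave fun a => by
    rw [← sub_eq_zero, key _ (isBoundedBorel_planeWave a), h0]
  rw [← key F hF, this, sub_self]

theorem integral_mul_eq_zero_of_planeWave {μ : Measure Mink} {h : Mink → ℂ} (hi : Integrable h μ)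
    (h0 : ∀ a, ∫ p, planeWave a p * h p ∂μ = 0) {F : Mink → ℂ} (hF : IsBoundedBorel F) : ∫ p, F p *
    h p ∂μ = 0 := by
  have bd : ∀ {G k : Mink → ℂ}, IsBoundedBorel G → Integrable k μ →
      Integrable (fun p => G p * k p) μ := by
    rintro G k ⟨hm, C, hC⟩ hk
    exact hk.bdd_mul hm.aestronglyMeasurable (.of_forall hC)
  have hic : Integrable (fun p => (starRingEnd ℂ) (h p)) μ :=
    hi.mono (continuous_conj.comp_aestronglyMeasurable hi.1) (.of_forall fun p => by simp)
  have ire : Integrable (fun p => ((h p).re : ℂ)) μ := (hi.re : Integrable (fun p => (h p).re) μ).ofReal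
  have iim : Integrable (fun p => ((h p).im : ℂ)) μ := (hi.im : Integrable (fun p => (h p).im) μ).ofReal
  have h0c : ∀ a, ∫ p, planeWave a p * (starRingEnd ℂ) (h p) ∂μ = 0 := by
    intro a
    have := congrArg (starRingEnd ℂ) (h0 (-a))
    rw [← integral_conj] at this
    simpa [conj_planeWave] using this
  have hre : ∫ p, F p * (h p).re ∂μ = 0 := by
    refine integral_mul_eq_zero_of_planeWave_real hi.re (fun a => ?_) hF
    have e : ∀ p, planeWave a p * ((h p).re : ℂ) =
        (1 / 2) * (planeWave a p * h p + planeWave a p * (starRingEnd ℂ) (h p)) := by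
      intro p
      rw [Complex.re_eq_add_conj]; ring
    change ∫ p, planeWave a p * ((h p).re : ℂ) ∂μ = 0
    simp_rw [e]
    rw [integral_const_mul, integral_add (bd (isBoundedBorel_planeWave a) hi)
      (bd (isBoundedBorel_planeWave a) hic), h0, h0c]
    simp
  have him : ∫ p, F p * (h p).im ∂μ = 0 := by
    refine integral_mul_eq_zero_of_planeWave_real hi.im (fun a => ?_) hF
    have e : ∀ p, planeWave a p * ((h p).im : ℂ) =
        (1 / (2 * I)) * (planeWave a p * h p - planeWave a p * (starRingEnd ℂ) (h p)) := by
      intro p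
      rw [Complex.im_eq_sub_conj]; ring
    change ∫ p, planeWave a p * ((h p).im : ℂ) ∂μ = 0
    simp_rw [e]
    rw [integral_const_mul, integral_sub (bd (isBoundedBorel_planeWave a) hi)
      (bd (isBoundedBorel_planeWave a) hic), h0, h0c]
    simp
  have e : ∀ p, F p * h p = F p * (h p).re + I * (F p * (h p).im) := by
    intro p
    conv_lhs => rw [← Complex.re_add_im (h p)]
    ring
  simp_rw [e]
  rw [integral_add (bd hF ire) ((bd hF iim).const_mul _), integral_const_mul]
  change ∫ p, F p * ((h p).re : ℂ) ∂μ + I * ∫ p, F p * ((h p).im : ℂ) ∂μ = 0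
  rw [hre, him]; simp

/-- The polarization combination of quadratic forms. -/
def polarSum (φ ψ : H) : H →₀ ℂ :=
  Finsupp.single (φ + ψ) (1 / 4) - Finsupp.single (φ - ψ) (1 / 4) -
    Finsupp.single (φ + I • ψ) (I / 4) +
    Finsupp.single (φ - I • ψ) (I / 4)

theorem linearCombination_polarSum (Q : H → ℂ) (φ ψ : H) : Finsupp.linearCombination ℂ Q (polarSum φ
    ψ) = (Q (φ + ψ) - Q (φ - ψ) - I * Q (φ + I • ψ) + I * Q (φ - I • ψ)) / 4 := by
  simp only [polarSum, map_add, map_sub, Finsupp.linearCombination_single, smul_eq_mul]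
  ring

theorem linearCombination_polarSum_inner (A : Op H) (φ ψ : H) : Finsupp.linearCombination ℂ (fun v
    => inner ℂ v (A v)) (polarSum φ ψ) = inner ℂ φ (A ψ) := by
  rw [linearCombination_polarSum]
  simp only [map_add, map_sub, map_smul, inner_add_left, inner_add_right, inner_sub_left,
    inner_sub_right, inner_smul_left, inner_smul_right, conj_I]
  ring_nf
  simp only [I_sq]
  ring

theorem eq_of_quadratic {A B : Op H} (h : ∀ ψ, inner ℂ ψ (A ψ) = inner ℂ ψ (B ψ)) : A = B := by
  ext ψ
  refine ext_inner_left ℂ fun φ => ?_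
  rw [← linearCombination_polarSum_inner, ← linearCombination_polarSum_inner]
  simp_rw [h]

namespace TranslationRep

variable (T : TranslationRep H)

/-- The quadratic form `ψ ↦ ∫ F dμ_ψ` extended linearly to formal sums. -/
def formSum (F : Mink → ℂ) : (H →₀ ℂ) →ₗ[ℂ] ℂ :=
  Finsupp.linearCombination ℂ fun v => ∫ p, F p ∂(T.spectralMeasure v)

theorem formSum_planeWave (a : Mink) (x : H →₀ ℂ) : T.formSum (planeWave a) x =
    Finsupp.linearCombination ℂ (fun v => inner ℂ v (T.U a v)) x := by
  simp only [formSum, integral_planeWave]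

theorem formSum_planeWave_polarSum (a : Mink) (φ ψ : H) : T.formSum (planeWave a) (polarSum φ ψ) =
    inner ℂ φ (T.U a ψ) := by
  rw [formSum_planeWave, linearCombination_polarSum_inner]

theorem formSum_eq_of_planeWave {x : H →₀ ℂ} {ψ : H} {g : Mink → ℂ} (hg : IsBoundedBorel g) (h : ∀
    b, T.formSum (planeWave b) x = ∫ p, planeWave b p * g p ∂(T.spectralMeasure ψ)) {F : Mink → ℂ}
    (hF : IsBoundedBorel F) : T.formSum F x = ∫ p, F p * g p ∂(T.spectralMeasure ψ) := by
  let μ : Measure Mink := T.spectralMeasure ψ + ∑ v ∈ x.support, T.spectralMeasure v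
  have hfin : IsFiniteMeasure μ := by simp only [μ]; infer_instance
  have ac0 : T.spectralMeasure ψ ≪ μ := Measure.absolutelyContinuous_of_le (Measure.le_add_right le_rfl)
  have ac : ∀ v ∈ x.support, T.spectralMeasure v ≪ μ := fun v hv =>
    Measure.absolutelyContinuous_of_le (Measure.le_add_left
      (Finset.single_le_sum (f := fun v => T.spectralMeasure v) (fun _ _ => Measure.zero_le _) hv))
  let d : H → Mink → ℝ := fun v p => ((T.spectralMeasure v).rnDeriv μ p).toReal
  have hd : ∀ v, Integrable (d v) μ := fun v => Measure.integrable_toReal_rnDeriv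
  have dm : ∀ v, ∀ G : Mink → ℂ, IsBoundedBorel G → Integrable (fun p => G p * (d v p : ℂ)) μ := by
    rintro v G ⟨hm, C, hC⟩
    exact (hd v).ofReal.bdd_mul hm.aestronglyMeasurable (.of_forall hC)
  have hI : ∀ v, T.spectralMeasure v ≪ μ → ∀ G : Mink → ℂ,
      ∫ p, G p ∂(T.spectralMeasure v) = ∫ p, G p * (d v p : ℂ) ∂μ := by
    intro v hv G
    have i1 : (T.spectralMeasure v).HaveLebesgueDecomposition μ :=
      Measure.haveLebesgueDecomposition_of_sigmaFinite (T.spectralMeasure v) μ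
    rw [← integral_rnDeriv_smul hv]
    simp only [d, real_smul, mul_comm]
  let k : Mink → ℂ := fun p => ∑ v ∈ x.support, x v * (d v p : ℂ) - g p * (d ψ p : ℂ)
  have hk : Integrable k μ := (integrable_finsetSum _ fun v _ => (hd v).ofReal.const_mul _).sub
    (dm ψ g hg)
  have main : ∀ G : Mink → ℂ, IsBoundedBorel G → T.formSum G x -
      ∫ p, G p * g p ∂(T.spectralMeasure ψ) = ∫ p, G p * k p ∂μ := by
    intro G hG
    rw [hI ψ ac0, formSum, Finsupp.linearCombination_apply, Finsupp.sum]
    have : ∑ a ∈ x.support, x a • ∫ p, G p ∂(T.spectralMeasure a) =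
        ∫ p, ∑ a ∈ x.support, x a * (G p * (d a p : ℂ)) ∂μ := by
      rw [integral_finsetSum _ fun v _ => (dm v G hG).const_mul _]
      refine sum_congr rfl fun v hv => ?_
      rw [hI v (ac v hv), integral_const_mul, smul_eq_mul]
    rw [this, ← integral_sub (integrable_finsetSum _ fun v _ => (dm v G hG).const_mul _)
      (dm ψ _ (hG.mul hg))]
    refine integral_congr_fun fun p => ?_
    simp only [k, mul_sub, mul_sum]
    congr 1
    · exact sum_congr rfl fun v _ => by ring
    · ring
  rw [← sub_eq_zero, main F hF]
  exact integral_mul_eq_zero_of_planeWave hk (fun a => by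
    rw [← main _ (isBoundedBorel_planeWave a), h, sub_self]) hF

theorem formSum_eq_zero {x : H →₀ ℂ} (h : ∀ b, T.formSum (planeWave b) x = 0) {F : Mink → ℂ} (hF :
    IsBoundedBorel F) : T.formSum F x = 0 := by
  have := T.formSum_eq_of_planeWave (x := x) (ψ := 0) (IsBoundedBorel.const 0)
    (fun b => by rw [h]; simp) hF
  rw [this]; simp

theorem norm_formSum_polarSum_le {F : Mink → ℂ} {C : ℝ} (hC : ∀ p, ‖F p‖ ≤ C) (φ ψ : H) : ‖T.formSum
    F (polarSum φ ψ)‖ ≤ C * (‖φ‖ ^ 2 + ‖ψ‖ ^ 2) := by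
  have hQ : ∀ v : H, ‖∫ p, F p ∂(T.spectralMeasure v)‖ ≤ C * ‖v‖ ^ 2 := by
    intro v
    have := norm_integral_le_of_norm_le_const (μ := T.spectralMeasure v) (.of_forall hC)
    rwa [spectralMeasure_univ] at this
  rw [formSum, linearCombination_polarSum]
  have p1 := parallelogram_law_with_norm ℂ φ ψ
  have p2 := parallelogram_law_with_norm ℂ φ (I • ψ)
  rw [norm_smul, norm_I, one_mul] at p2
  rw [norm_div, Complex.norm_ofNat, div_le_iff₀ (by norm_num)]
  refine (norm_add_le _ _).trans ?_
  refine (add_le_add (norm_sub_le _ _) le_rfl).trans ?_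
  refine (add_le_add (add_le_add (norm_sub_le _ _) le_rfl) le_rfl).trans ?_
  simp only [norm_mul, norm_I, one_mul]
  have h1 := hQ (φ + ψ)
  have h2 := hQ (φ - ψ)
  have h3 := hQ (φ + I • ψ)
  have h4 := hQ (φ - I • ψ)
  have : C * ‖φ + ψ‖ ^ 2 + C * ‖φ - ψ‖ ^ 2 + C * ‖φ + I • ψ‖ ^ 2 +
      C * ‖φ - I • ψ‖ ^ 2 = C * (‖φ‖ ^ 2 + ‖ψ‖ ^ 2) * 4 := by
    linear_combination C * p1 + C * p2
  linarith

theorem exists_functionOf {F : Mink → ℂ} (hF : IsBoundedBorel F) : ∃ A : Op H, ∀ ψ, inner ℂ ψ (A ψ)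
    = ∫ p, F p ∂(T.spectralMeasure ψ) := by
  have lin : ∀ x y : H →₀ ℂ, (∀ b, Finsupp.linearCombination ℂ (fun v => inner ℂ v (T.U b v)) x =
      Finsupp.linearCombination ℂ (fun v => inner ℂ v (T.U b v)) y) →
      T.formSum F x = T.formSum F y := by
    intro x y h
    rw [← sub_eq_zero, ← map_sub]
    refine T.formSum_eq_zero (fun b => ?_) hF
    rw [formSum_planeWave, map_sub, h, sub_self]
  obtain ⟨hm, C, hC⟩ := id hF
  have hC0 : 0 ≤ C := (norm_nonneg _).trans (hC 0)
  let B : H →ₗ⋆[ℂ] H →ₗ[ℂ] ℂ := LinearMap.mk₂'ₛₗ (starRingEnd ℂ) (RingHom.id ℂ)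
    (fun φ ψ => T.formSum F (polarSum φ ψ))
    (fun φ φ' ψ => by
      rw [← _root_.map_add (T.formSum F)]; apply lin; intro b
      simp only [_root_.map_add, linearCombination_polarSum_inner, inner_add_left])
    (fun c φ ψ => by
      change _ = (starRingEnd ℂ c) • T.formSum F _
      rw [← map_smul (T.formSum F)]; apply lin; intro b
      simp only [map_smul, linearCombination_polarSum_inner, inner_smul_left, smul_eq_mul])
    (fun φ ψ ψ' => by
      rw [← _root_.map_add (T.formSum F)]; apply lin; intro b
      simp only [_root_.map_add, linearCombination_polarSum_inner, inner_add_right])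
    (fun c φ ψ => by
      rw [RingHom.id_apply, ← map_smul (T.formSum F)]; apply lin; intro b
      simp only [map_smul, linearCombination_polarSum_inner, inner_smul_right, smul_eq_mul])
  have hBe : ∀ φ ψ, B φ ψ = T.formSum F (polarSum φ ψ) := fun _ _ => rfl
  have hB : ∀ φ ψ, ‖B φ ψ‖ ≤ 2 * C * ‖φ‖ * ‖ψ‖ := by
    intro φ ψ
    by_cases h1 : φ = 0
    · simp [h1]
    by_cases h2 : ψ = 0
    · simp [h2]
    have n1 : 0 < ‖φ‖ := norm_pos_iff.2 h1
    have n2 : 0 < ‖ψ‖ := norm_pos_iff.2 h2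
    have := T.norm_formSum_polarSum_le hC ((‖φ‖⁻¹ : ℂ) • φ) ((‖ψ‖⁻¹ : ℂ) • ψ)
    rw [← hBe, map_smul, map_smulₛₗ] at this
    simp only [LinearMap.smul_apply, smul_eq_mul, norm_mul, norm_smul, norm_inv,
      norm_real, norm_norm, RCLike.norm_conj] at this
    rw [inv_mul_cancel₀ n1.ne', inv_mul_cancel₀ n2.ne'] at this
    calc ‖B φ ψ‖ = (‖ψ‖⁻¹ * (‖φ‖⁻¹ * ‖B φ ψ‖)) * (‖φ‖ * ‖ψ‖) := by field_simp
      _ ≤ (C * (1 ^ 2 + 1 ^ 2)) * (‖φ‖ * ‖ψ‖) := by gcongr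
      _ = _ := by ring
  let B' := LinearMap.mkContinuous₂ B (2 * C) hB
  refine ⟨star (InnerProductSpace.continuousLinearMapOfBilin (𝕜 := ℂ) B'), fun ψ => ?_⟩
  rw [star_eq_adjoint, adjoint_inner_right, InnerProductSpace.continuousLinearMapOfBilin_apply]
  change T.formSum F (polarSum ψ ψ) = _
  have := lin (polarSum ψ ψ) (Finsupp.single ψ 1) fun b => by
    rw [linearCombination_polarSum_inner]; simp
  rw [this]
  simp [formSum]

theorem inner_functionOf_self {F : Mink → ℂ} (hF : IsBoundedBorel F) (ψ : H) : inner ℂ ψ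
    (T.functionOf F ψ) = ∫ p, F p ∂(T.spectralMeasure ψ) := by
  rw [functionOf, dif_pos (T.exists_functionOf hF)]
  exact (T.exists_functionOf hF).choose_spec ψ

theorem functionOf_eq {F : Mink → ℂ} (hF : IsBoundedBorel F) {A : Op H} (h : ∀ ψ, inner ℂ ψ (A ψ) =
    ∫ p, F p ∂(T.spectralMeasure ψ)) : T.functionOf F = A :=
  eq_of_quadratic fun ψ => by rw [T.inner_functionOf_self hF, h]

theorem inner_functionOf {F : Mink → ℂ} (hF : IsBoundedBorel F) (φ ψ : H) : inner ℂ φ (T.functionOf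
    F ψ) = T.formSum F (polarSum φ ψ) := by
  rw [← linearCombination_polarSum_inner]
  simp_rw [T.inner_functionOf_self hF]
  rfl

theorem functionOf_sub {F G : Mink → ℂ} (hF : IsBoundedBorel F) (hG : IsBoundedBorel G) :
    T.functionOf (fun p => F p - G p) = T.functionOf F - T.functionOf G := by
  refine T.functionOf_eq (hF.sub hG) fun ψ => ?_
  rw [sub_apply, inner_sub_right, T.inner_functionOf_self hF,
    T.inner_functionOf_self hG, integral_sub (hF.integrable _) (hG.integrable _)]

theorem functionOf_const_mul (c : ℂ) {F : Mink → ℂ} (hF : IsBoundedBorel F) : T.functionOf (fun p =>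
    c * F p) = c • T.functionOf F := by
  refine T.functionOf_eq ((IsBoundedBorel.const c).mul hF) fun ψ => ?_
  rw [smul_apply, inner_smul_right, T.inner_functionOf_self hF, integral_const_mul]

theorem star_functionOf {F : Mink → ℂ} (hF : IsBoundedBorel F) : star (T.functionOf F) =
    T.functionOf fun p => (starRingEnd ℂ) (F p) := by
  symm
  refine T.functionOf_eq hF.conj fun ψ => ?_
  rw [star_eq_adjoint, adjoint_inner_right,
    ← inner_conj_symm, T.inner_functionOf_self hF, integral_conj]

theorem inner_U_functionOf {F : Mink → ℂ} (hF : IsBoundedBorel F) (a : Mink) (ψ : H) : inner ℂ ψ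
    (T.U a (T.functionOf F ψ)) = ∫ p, planeWave a p * F p ∂(T.spectralMeasure ψ) := by
  have h1 : inner ℂ ψ (T.U a (T.functionOf F ψ)) = inner ℂ (T.U (-a) ψ) (T.functionOf F ψ) := by
    rw [inner_U_left, neg_neg]
  rw [h1, T.inner_functionOf hF, T.formSum_eq_of_planeWave (ψ := ψ) (isBoundedBorel_planeWave a)
    (fun b => ?_) hF]
  · simp only [mul_comm]
  · rw [formSum_planeWave_polarSum, inner_U_left, neg_neg, ← U_add_apply, ← integral_planeWave]
    simp only [planeWave_add, mul_comm]

theorem functionOf_mul {F G : Mink → ℂ} (hF : IsBoundedBorel F) (hG : IsBoundedBorel G) :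
    T.functionOf (fun p => F p * G p) = T.functionOf F * T.functionOf G := by
  refine T.functionOf_eq (hF.mul hG) fun ψ => ?_
  change inner ℂ ψ (T.functionOf F (T.functionOf G ψ)) = _
  rw [T.inner_functionOf hF, T.formSum_eq_of_planeWave hG (fun b => ?_) hF]
  rw [formSum_planeWave_polarSum, T.inner_U_functionOf hG]

theorem norm_sq_functionOf {F : Mink → ℂ} (hF : IsBoundedBorel F) (ψ : H) : ‖T.functionOf F ψ‖ ^ 2 =
    ∫ p, ‖F p‖ ^ 2 ∂(T.spectralMeasure ψ) := by
  have : inner ℂ (T.functionOf F ψ) (T.functionOf F ψ) =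
      ∫ p, ((‖F p‖ ^ 2 : ℝ) : ℂ) ∂(T.spectralMeasure ψ) := by
    rw [← adjoint_inner_right, ← star_eq_adjoint, T.star_functionOf hF]
    change inner ℂ ψ ((T.functionOf _ * T.functionOf F) ψ) = _
    rw [← T.functionOf_mul hF.conj hF, T.inner_functionOf_self (hF.conj.mul hF)]
    simp only [mul_comm ((starRingEnd ℂ) _), Complex.mul_conj, Complex.normSq_eq_norm_sq]
  rw [integral_complex_ofReal, inner_self_eq_norm_sq_to_K] at this
  apply Complex.ofReal_injective
  simpa using this

theorem functionOf_integral_planeWave {Z : Type*} [MeasurableSpace Z] {ρ : Measure Z} [SFinite ρ] {k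
    : Z → ℂ} (hk : Integrable k ρ) (hkm : StronglyMeasurable k) {a : Z → Mink} (ha : Measurable a)
    (ψ : H) : IsBoundedBorel (fun p => ∫ z, k z * planeWave (a z) p ∂ρ) ∧ T.functionOf (fun p => ∫
    z, k z * planeWave (a z) p ∂ρ) ψ = ∫ z, k z • T.U (a z) ψ ∂ρ := by
  have hmeas : StronglyMeasurable fun w : Mink × Z => k w.2 * planeWave (a w.2) w.1 := by
    refine (hkm.comp_measurable measurable_snd).mul ?_
    have : Continuous fun w : Mink × Mink => planeWave w.1 w.2 := by fun_prop
    exact this.stronglyMeasurable.comp_measurable ((ha.comp measurable_snd).prodMk measurable_fst)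
  have hB : IsBoundedBorel (fun p => ∫ z, k z * planeWave (a z) p ∂ρ) := by
    refine ⟨hmeas.integral_prod_right.measurable, ∫ z, ‖k z‖ ∂ρ, fun p => ?_⟩
    refine norm_integral_le_of_norm_le hk.norm (.of_forall fun z => ?_)
    rw [norm_mul, norm_planeWave, mul_one]
  refine ⟨hB, ext_inner_left ℂ fun φ => ?_⟩
  have hUm : StronglyMeasurable fun z => T.U (a z) ψ :=
    (T.strongly_continuous ψ).stronglyMeasurable.comp_measurable ha
  have hint : Integrable (fun z => k z • T.U (a z) ψ) ρ := by
    refine (hk.norm.mul_const ‖ψ‖).mono' (hkm.smul hUm).aestronglyMeasurable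
      (.of_forall fun z => ?_)
    rw [norm_smul, norm_U]
  rw [T.inner_functionOf hB, ← integral_inner hint]
  simp only [inner_smul_right, ← formSum_planeWave_polarSum]
  have sw : ∀ v : H, ∫ p, ∫ z, k z * planeWave (a z) p ∂ρ ∂(T.spectralMeasure v) =
      ∫ z, k z * ∫ p, planeWave (a z) p ∂(T.spectralMeasure v) ∂ρ := by
    intro v
    rw [integral_integral_swap]
    · simp_rw [integral_const_mul]
    · have : Integrable (fun w : Mink × Z => k w.2) ((T.spectralMeasure v).prod ρ) :=
        hk.comp_snd _
      refine this.norm.mono' hmeas.aestronglyMeasurable (.of_forall fun w => ?_)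
      simp only [Function.uncurry, norm_mul, norm_planeWave, mul_one]; exact le_rfl
  have iv : ∀ v : H, Integrable (fun z => k z * ∫ p, planeWave (a z) p ∂(T.spectralMeasure v)) ρ := by
    intro v
    simp only [integral_planeWave]
    have hm : StronglyMeasurable fun z => inner ℂ v (T.U (a z) v) := by
      have : Continuous fun b => inner ℂ v (T.U b v) :=
        continuous_const.inner (T.strongly_continuous v)
      exact this.stronglyMeasurable.comp_measurable ha
    refine hk.mul_bdd (c := ‖v‖ * ‖v‖) hm.aestronglyMeasurable (.of_forall fun z => ?_)
    exact (norm_inner_le_norm _ _).trans (by rw [norm_U])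
  simp only [formSum, linearCombination_polarSum, sw]
  set Q : H → Z → ℂ := fun v z => ∫ p, planeWave (a z) p ∂(T.spectralMeasure v)
  have i0 := iv (φ + ψ)
  have i1 := iv (φ - ψ)
  have i2 := (iv (φ + I • ψ)).const_mul I
  have i3 := (iv (φ - I • ψ)).const_mul I
  have i01 : Integrable (fun z => k z * Q (φ + ψ) z - k z * Q (φ - ψ) z) ρ := i0.sub i1
  have i012 : Integrable (fun z => k z * Q (φ + ψ) z - k z * Q (φ - ψ) z -
    I * (k z * Q (φ + I • ψ) z)) ρ := i01.sub i2
  rw [← integral_const_mul, ← integral_const_mul, ← integral_sub i0 i1,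
    ← integral_sub i01 i2, ← integral_add i012 i3, ← integral_div]
  refine integral_congr_fun fun z => ?_
  simp only [Q]
  ring

end TranslationRep

/-- The surface measure of the unit sphere. -/
abbrev sphereMeasure : Measure S² := (volume : Measure Space3).toSphere

section PolarCoordinates

variable (b : Frame)

/-- The vector with given coordinates in an orthonormal basis. -/
def combination (x y z : ℝ) : Space3 := x • b 0 + y • b 1 + z • b 2

theorem combination_eq (x y z : ℝ) : combination b x y z = b.repr.symm (WithLp.toLp 2 ![x, y, z]) :=
    by
  rw [← OrthonormalBasis.sum_repr_symm]
  simp [Fin.sum_univ_three, combination]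

theorem norm_sq_combination (x y z : ℝ) : ‖combination b x y z‖ ^ 2 = x ^ 2 + y ^ 2 + z ^ 2 := by
  rw [combination_eq, LinearIsometryEquiv.norm_map, EuclideanSpace.norm_sq_eq]
  simp [Fin.sum_univ_three]

theorem smul_combination (r x y z : ℝ) : r • combination b x y z = combination b (r * x) (r * y) (r
    * z) := by
  simp only [combination, smul_add, smul_smul]

@[fun_prop] theorem Continuous.combination {X : Type*} [TopologicalSpace X] {f g h : X → ℝ}
    (hf : Continuous f) (hg : Continuous g) (hh : Continuous h) :
    Continuous fun x => combination b (f x) (g x) (h x) := by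
  unfold NullAsymptotics.combination; fun_prop

theorem lintegral_combination {F : Space3 → ENNReal} (hF : Measurable F) : ∫⁻ v, F v = ∫⁻ z : ℝ, ∫⁻
    p : ℝ × ℝ, F (combination b p.1 p.2 z) := by
  have h1 := (b.measurePreserving_repr_symm.comp (PiLp.volume_preserving_toLp (Fin 3)))
  have h2 := (volume_preserving_piFinSuccAbove (fun _ : Fin 3 => ℝ) 2).symm
  have h3 := ((MeasurePreserving.id (volume : Measure ℝ)).prod
    (volume_preserving_finTwoArrow ℝ).symm)
  have h := (h1.comp h2).comp h3
  rw [← h.lintegral_comp hF]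
  change ∫⁻ w : ℝ × ℝ × ℝ, _ ∂((volume : Measure ℝ).prod volume) = _
  have hc : ∀ w : ℝ × ℝ × ℝ, (((⇑b.repr.symm ∘ WithLp.toLp 2) ∘
      ⇑(MeasurableEquiv.piFinSuccAbove (fun _ : Fin 3 => ℝ) 2).symm) ∘
      (Prod.map id ⇑(MeasurableEquiv.finTwoArrow (α := ℝ)).symm)) w =
      combination b w.2.1 w.2.2 w.1 := by
    intro w
    rw [combination_eq]
    simp only [Function.comp_apply]
    congr 2
    ext i
    fin_cases i <;> rfl
  simp only [hc]
  rw [lintegral_prod]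
  exact (hF.comp (by fun_prop : Continuous fun w : ℝ × ℝ × ℝ =>
    combination b w.2.1 w.2.2 w.1).measurable).aemeasurable

theorem norm_spherePoint_aux (θ φ : ℝ) : ‖combination b (sin θ * cos φ) (sin θ * sin φ) (cos θ)‖ = 1
    := by
  rw [← sq_eq_sq₀ (norm_nonneg _) zero_le_one, norm_sq_combination]
  nlinarith [sin_sq_add_cos_sq θ, sin_sq_add_cos_sq φ]

/-- The point of the unit sphere with polar angle `θ` and azimuth `φ`. -/
def spherePoint (θ φ : ℝ) : S² :=
  ⟨combination b (sin θ * cos φ) (sin θ * sin φ) (cos θ), by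
    simpa using norm_spherePoint_aux b θ φ⟩

@[fun_prop] theorem Continuous.spherePoint {X : Type*} [TopologicalSpace X] {f g : X → ℝ}
    (hf : Continuous f) (hg : Continuous g) : Continuous fun x => spherePoint b (f x) (g x) := by
  unfold NullAsymptotics.spherePoint; fun_prop

theorem lintegral_polar {F : Space3 → ENNReal} (hF : Measurable F) : ∫⁻ v, F v = ∫⁻ φ in Ioo (-π) π,
    ∫⁻ θ in Ioo 0 π, ∫⁻ r in Ioi (0 : ℝ), ofReal (r ^ 2 * sin θ) * F (r • (spherePoint b θ φ :
    Space3)) := by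
  rw [lintegral_combination b hF]
  have hFc : ∀ {X : Type} [MeasurableSpace X] [TopologicalSpace X] [BorelSpace X] {k : X → Space3},
      Continuous k → Measurable fun x => F (k x) := fun hk => hF.comp hk.measurable
  have e1 : ∀ z : ℝ, ∫⁻ p : ℝ × ℝ, F (combination b p.1 p.2 z) =
      ∫⁻ φ in Ioo (-π) π, ∫⁻ ρ in Ioi (0 : ℝ), ofReal ρ *
      F (combination b (ρ * cos φ) (ρ * sin φ) z) := by
    intro z
    rw [← lintegral_comp_polarCoord_symm, polarCoord_target]
    simp only [polarCoord_symm_apply, smul_eq_mul]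
    rw [Measure.volume_eq_prod, setLIntegral_prod_symm]
    exact ((by fun_prop : Measurable fun p : ℝ × ℝ => ofReal p.1).mul
      (hFc (by fun_prop))).aemeasurable
  simp_rw [e1]
  rw [lintegral_lintegral_swap]
  swap
  · refine Measurable.aemeasurable ?_
    refine Measurable.lintegral_prod_right' (f := fun w : (ℝ × ℝ) × ℝ => ofReal w.2 *
      F (combination b (w.2 * cos w.1.2) (w.2 * sin w.1.2) w.1.1)) ?_
    exact ((by fun_prop : Measurable fun p : (ℝ × ℝ) × ℝ => ofReal p.2).mul (hFc (by fun_prop)))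
  refine lintegral_congr fun φ => ?_
  -- polar coordinates in the half plane `(z, ρ)`
  let G : ℝ × ℝ → ENNReal := fun w => (Ioi (0 : ℝ)).indicator 1 w.2 * (ofReal w.2 *
    F (combination b (w.2 * cos φ) (w.2 * sin φ) w.1))
  have hG : Measurable G := by
    refine Measurable.mul ?_ ((by fun_prop : Measurable fun p : ℝ × ℝ => ofReal p.2).mul
      (hFc (by fun_prop)))
    exact (measurable_one.indicator measurableSet_Ioi).comp measurable_snd
  have e2 : ∫⁻ z : ℝ, ∫⁻ ρ in Ioi (0 : ℝ), ofReal ρ *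
      F (combination b (ρ * cos φ) (ρ * sin φ) z) = ∫⁻ w, G w := by
    rw [Measure.volume_eq_prod, lintegral_prod _ hG.aemeasurable]
    refine lintegral_congr fun z => ?_
    rw [← lintegral_indicator measurableSet_Ioi]
    refine lintegral_congr fun ρ => ?_
    by_cases h : ρ ∈ Ioi (0 : ℝ) <;> simp [G, h]
  rw [e2, ← lintegral_comp_polarCoord_symm, polarCoord_target]
  simp only [polarCoord_symm_apply, smul_eq_mul]
  rw [Measure.volume_eq_prod, setLIntegral_prod_symm]
  swap
  · exact ((by fun_prop : Measurable fun p : ℝ × ℝ => ofReal p.1).mul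
      (hG.comp (by fun_prop))).aemeasurable
  have sub : Ioo 0 π ⊆ Ioo (-π) π :=
    Set.Ioo_subset_Ioo_left (by linarith [pi_pos])
  rw [← Set.inter_eq_left.2 sub, ← setLIntegral_indicator measurableSet_Ioo]
  refine setLIntegral_congr_fun measurableSet_Ioo fun θ hθ => ?_
  by_cases h : θ ∈ Ioo 0 π
  · simp only [indicator_of_mem h]
    refine setLIntegral_congr_fun measurableSet_Ioi fun r hr => ?_
    have hr : 0 < r := hr
    have hs : 0 < sin θ := Real.sin_pos_of_mem_Ioo h
    have : r * sin θ ∈ Ioi (0 : ℝ) := mul_pos hr hs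
    simp only [G, indicator_of_mem this, Pi.one_apply, one_mul]
    rw [← mul_assoc, ← ofReal_mul hr.le]
    simp only [spherePoint, smul_combination]
    congr 2
    · ring
    · ring_nf
  · simp only [indicator_of_notMem h]
    rw [setLIntegral_congr_fun (g := fun _ => 0) measurableSet_Ioi fun r hr => ?_, lintegral_zero]
    have hr : 0 < r := hr
    have hs : sin θ ≤ 0 := by
      refine Real.sin_nonpos_of_nonpos_of_neg_pi_le ?_ hθ.1.le
      by_contra hc
      exact h ⟨not_le.1 hc, hθ.2⟩
    have : r * sin θ ∉ Ioi (0 : ℝ) := fun hc =>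
      absurd (mul_nonpos_of_nonneg_of_nonpos hr.le hs) (not_le.2 hc)
    simp [G, indicator_of_notMem this]

/-- The polar angle measure `sin θ dθ dφ`. -/
def angleMeasure : Measure (ℝ × ℝ) :=
  ((volume.restrict (Ioo 0 π)).withDensity fun θ => ofReal (sin θ)).prod
    (volume.restrict (Ioo (-π) π))

open scoped Pointwise in
theorem sphereMeasure_eq_map : sphereMeasure = angleMeasure.map fun w => spherePoint b w.1 w.2 := by
  have hSm : Measurable fun w : ℝ × ℝ => spherePoint b w.1 w.2 :=
    (by fun_prop : Continuous _).measurable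
  refine Measure.ext fun s hs => ?_
  rw [sphereMeasure, Measure.toSphere_apply' _ hs, Measure.map_apply hSm hs]
  set A : Set Space3 := Ioo (0 : ℝ) 1 • (Subtype.val '' s) with hA
  have hAm : MeasurableSet A := by
    have hK : MeasurableEmbedding (Subtype.val ∘ (homeomorphUnitSphereProd Space3).symm) :=
      (MeasurableEmbedding.subtype_coe (measurableSet_singleton _).compl).comp
        (Homeomorph.measurableEmbedding _)
    have : A = (Subtype.val ∘ (homeomorphUnitSphereProd Space3).symm) ''
        (s ×ˢ Iio ⟨1, Set.mem_Ioi.2 one_pos⟩) := by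
      ext v
      simp only [hA, Set.mem_smul, mem_image, Function.comp_apply, Set.mem_prod, Set.mem_Iio]
      constructor
      · rintro ⟨r, hr, _, ⟨l, hl, rfl⟩, rfl⟩
        exact ⟨(l, ⟨r, hr.1⟩), ⟨hl, hr.2⟩, by simp⟩
      · rintro ⟨⟨l, r⟩, ⟨hl, hr⟩, rfl⟩
        exact ⟨r, ⟨r.2, hr⟩, l, ⟨l, hl, rfl⟩, by simp⟩
    rw [this]
    exact hK.measurableSet_image.2 (hs.prod measurableSet_Iio)
  have hAmem : ∀ (r : ℝ) (l : S²), 0 < r → (r • (l : Space3) ∈ A ↔ r < 1 ∧ l ∈ s) := by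
    intro r l hr
    constructor
    · rintro ⟨r', hr', _, ⟨l', hl', rfl⟩, h⟩
      have h' : r' • (l' : Space3) = r • (l : Space3) := h
      have hn := congrArg norm h'
      rw [norm_smul, norm_smul, norm_eq_of_mem_sphere, norm_eq_of_mem_sphere, mul_one, mul_one,
        norm_of_nonneg hr.le, norm_of_nonneg hr'.1.le] at hn
      subst hn
      have : l' = l := Subtype.ext (smul_right_injective _ hr.ne' h')
      subst this
      exact ⟨hr'.2, hl'⟩
    · rintro ⟨h1, h2⟩
      exact ⟨r, ⟨hr, h1⟩, l, ⟨l, h2, rfl⟩, rfl⟩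
  have hv : (volume : Measure Space3) A = ∫⁻ v, A.indicator 1 v := by
    rw [lintegral_indicator_one hAm]
  rw [hv, lintegral_polar b (measurable_one.indicator hAm), angleMeasure,
    Measure.prod_apply_symm (hSm hs)]
  rw [← lintegral_const_mul' _ _ (ENNReal.natCast_ne_top _)]
  refine lintegral_congr fun φ => ?_
  have hm : MeasurableSet ((fun x => (x, φ)) ⁻¹' ((fun w : ℝ × ℝ => spherePoint b w.1 w.2) ⁻¹' s)) :=
    (hSm.comp (by fun_prop : Measurable fun x : ℝ => (x, φ))) hs
  rw [withDensity_apply _ hm, ← lintegral_const_mul' _ _ (ENNReal.natCast_ne_top _),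
    ← lintegral_indicator hm]
  refine setLIntegral_congr_fun measurableSet_Ioo fun θ hθ => ?_
  have hs0 : 0 ≤ sin θ := (Real.sin_pos_of_mem_Ioo hθ).le
  by_cases h : spherePoint b θ φ ∈ s
  · have e : ∫⁻ r in Ioi (0 : ℝ), ofReal (r ^ 2 * sin θ) *
        A.indicator 1 (r • (spherePoint b θ φ : Space3)) =
        ∫⁻ r in Ioo (0 : ℝ) 1, ofReal (r ^ 2 * sin θ) := by
      have : Ioo (0 : ℝ) 1 = Iio 1 ∩ Ioi 0 := by ext; simp [and_comm]
      rw [this, ← setLIntegral_indicator measurableSet_Iio]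
      refine setLIntegral_congr_fun measurableSet_Ioi fun r hr => ?_
      have hi := hAmem r (spherePoint b θ φ) hr
      by_cases h1 : r < 1
      · simp [Set.indicator, hi, h1, h]
      · simp [Set.indicator, hi, h1]
    have hint : ∫⁻ r in Ioo (0 : ℝ) 1, ofReal (r ^ 2 * sin θ) = ofReal (sin θ / 3) := by
      rw [← ofReal_integral_eq_lintegral_ofReal]
      · rw [← integral_Ioc_eq_integral_Ioo, ← intervalIntegral.integral_of_le zero_le_one,
          intervalIntegral.integral_mul_const, integral_pow]
        congr 1; norm_num; ring
      · exact (by fun_prop : Continuous fun r : ℝ => r ^ 2 * sin θ).integrableOn_Ioc.mono_set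
          Set.Ioo_subset_Ioc_self
      · exact .of_forall fun r => by positivity
    rw [e, hint]
    have hmem : θ ∈ (fun x => (x, φ)) ⁻¹' ((fun w : ℝ × ℝ => spherePoint b w.1 w.2) ⁻¹' s) := h
    rw [indicator_of_mem hmem]
    simp only [finrank_euclideanSpace, Fintype.card_fin]
    rw [← ENNReal.ofReal_natCast, ← ofReal_mul (by positivity)]
    congr 1
    push_cast
    ring
  · have e : ∫⁻ r in Ioi (0 : ℝ), ofReal (r ^ 2 * sin θ) *
        A.indicator 1 (r • (spherePoint b θ φ : Space3)) = 0 := by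
      rw [setLIntegral_congr_fun (g := fun _ => 0) measurableSet_Ioi fun r hr => ?_, lintegral_zero]
      have hi := hAmem r (spherePoint b θ φ) hr
      simp [Set.indicator, hi, h]
    have hmem : θ ∉ (fun x => (x, φ)) ⁻¹' ((fun w : ℝ × ℝ => spherePoint b w.1 w.2) ⁻¹' s) := h
    rw [e, indicator_of_notMem hmem, mul_zero]

end PolarCoordinates

theorem exists_orthonormalBasis_third {n : Space3} (hn : ‖n‖ = 1) : ∃ b : Frame, b 2 = n := by
  have : Orthonormal ℝ (({2} : Set (Fin 3)).domRestrict fun _ => n) := by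
    refine ⟨fun i => hn, fun i j hij => absurd (Subtype.ext (i.2.trans j.2.symm)) hij⟩
  obtain ⟨b, hb⟩ := this.exists_orthonormalBasis_extension_of_card_eq (by simp)
  exact ⟨b, hb 2 rfl⟩

theorem lintegral_sphere (b : Frame) {F : S² → ENNReal} (hF : Measurable F) : ∫⁻ l, F l
    ∂sphereMeasure = ∫⁻ φ in Ioo (-π) π, ∫⁻ θ in Ioo 0 π, ofReal (sin θ) * F (spherePoint b θ φ) :=
    by
  have hSm : Measurable fun w : ℝ × ℝ => spherePoint b w.1 w.2 :=
    (by fun_prop : Continuous _).measurable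
  rw [sphereMeasure_eq_map b, lintegral_map hF hSm, angleMeasure, lintegral_prod_symm]
  · refine lintegral_congr fun φ => ?_
    rw [lintegral_withDensity_eq_lintegral_mul₀]
    · rfl
    · fun_prop
    · exact ((hF.comp hSm).comp (by fun_prop : Measurable fun x : ℝ => (x, φ))).aemeasurable
  · exact (hF.comp hSm).aemeasurable

theorem norm_sub_spherePoint (b : Frame) (θ φ : ℝ) : ‖b 2 - (spherePoint b θ φ : Space3)‖ ^ 2 = (2 *
    sin (θ / 2)) ^ 2 := by
  have : b 2 - (spherePoint b θ φ : Space3) = combination b (-(sin θ * cos φ))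
      (-(sin θ * sin φ)) (1 - cos θ) := by
    simp only [spherePoint, combination, neg_smul, sub_smul, one_smul]
    abel
  rw [this, norm_sq_combination]
  have h1 : cos θ = 1 - 2 * sin (θ / 2) ^ 2 := by
    have := Real.cos_two_mul (θ / 2)
    have h2 := sin_sq_add_cos_sq (θ / 2)
    rw [mul_div_cancel₀ θ (two_ne_zero)] at this
    linarith
  have h2 : sin θ ^ 2 = 1 - cos θ ^ 2 := by
    have := sin_sq_add_cos_sq θ; linarith
  have h3 := sin_sq_add_cos_sq φ
  calc _ = sin θ ^ 2 * (sin φ ^ 2 + cos φ ^ 2) + (1 - cos θ) ^ 2 := by ring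
    _ = _ := by rw [h3, h2, h1]; ring

theorem lintegral_sphere_norm_sub (l : S²) {G : ℝ → ENNReal} (hG : Measurable G) : ∫⁻ l' : S², G ‖(l
    : Space3) - l'‖ ∂sphereMeasure = ofReal (2 * π) * ∫⁻ t in Ioo (0 : ℝ) 2, ofReal t * G t := by
  obtain ⟨b, hb⟩ := exists_orthonormalBasis_third (norm_eq_of_mem_sphere l)
  have hGm : Measurable fun l' : S² => G ‖(l : Space3) - l'‖ :=
    hG.comp (by fun_prop : Continuous _).measurable
  have hpi := pi_pos
  rw [lintegral_sphere b hGm]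
  have hn : ∀ θ ∈ Ioo 0 π, ∀ φ, ‖(l : Space3) - spherePoint b θ φ‖ = 2 * sin (θ / 2) := by
    intro θ hθ φ
    rw [← sq_eq_sq₀ (norm_nonneg _), ← hb, norm_sub_spherePoint]
    have := Real.sin_nonneg_of_nonneg_of_le_pi (x := θ / 2) (by linarith [hθ.1]) (by linarith [hθ.2])
    linarith
  have himg : (fun θ => 2 * sin (θ / 2)) '' Ioo 0 π = Ioo 0 2 := by
    ext t
    simp only [mem_image, Set.mem_Ioo]
    constructor
    · rintro ⟨θ, ⟨h0, h1⟩, rfl⟩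
      refine ⟨by have := Real.sin_pos_of_pos_of_lt_pi (x := θ / 2) (by linarith) (by linarith);
                 linarith, ?_⟩
      have := Real.sin_lt_sin_of_lt_of_le_pi_div_two (x := θ / 2) (y := π / 2) (by linarith)
        le_rfl (by linarith)
      rw [Real.sin_pi_div_two] at this
      linarith
    · rintro ⟨h0, h1⟩
      refine ⟨2 * Real.arcsin (t / 2), ⟨?_, ?_⟩, ?_⟩
      · have := Real.arcsin_pos.2 (by linarith : 0 < t / 2)
        linarith
      · have := Real.arcsin_lt_pi_div_two.2 (by linarith : t / 2 < 1)
        linarith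
      · rw [mul_div_cancel_left₀ _ two_ne_zero, Real.sin_arcsin (by linarith) (by linarith)]
        ring
  have hinj : InjOn (fun θ => 2 * sin (θ / 2)) (Ioo 0 π) := by
    intro x hx y hy h
    have h' : sin (x / 2) = sin (y / 2) := by
      have : 2 * sin (x / 2) = 2 * sin (y / 2) := h
      linarith
    have := Real.injOn_sin (x₁ := x / 2) ⟨by linarith [hx.1], by linarith [hx.2]⟩
      (x₂ := y / 2) ⟨by linarith [hy.1], by linarith [hy.2]⟩ h'
    linarith
  have e : ∀ φ : ℝ, ∫⁻ θ in Ioo 0 π, ofReal (sin θ) *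
      G ‖(l : Space3) - spherePoint b θ φ‖ = ∫⁻ t in Ioo (0 : ℝ) 2, ofReal t * G t := by
    intro φ
    rw [← himg, lintegral_image_eq_lintegral_abs_deriv_mul (f' := fun θ => cos (θ / 2))
      measurableSet_Ioo (fun x hx => ?_) hinj]
    · refine setLIntegral_congr_fun measurableSet_Ioo fun θ hθ => ?_
      have hc : 0 ≤ cos (θ / 2) :=
        Real.cos_nonneg_of_mem_Icc ⟨by linarith [hθ.1], by linarith [hθ.2]⟩
      simp only [hn θ hθ]
      rw [← mul_assoc, abs_of_nonneg hc, ← ofReal_mul hc]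
      congr 2
      have := Real.sin_two_mul (θ / 2)
      rw [mul_div_cancel₀ θ (two_ne_zero)] at this
      linarith
    · have := ((Real.hasDerivAt_sin (x / 2)).comp x ((hasDerivAt_id x).div_const 2)).const_mul 2
      exact (this.congr_deriv (by ring)).hasDerivWithinAt
  simp_rw [e]
  rw [lintegral_const, Measure.restrict_apply MeasurableSet.univ, Set.univ_inter, Real.volume_Ioo,
    mul_comm, sub_neg_eq_add, two_mul]

/-- Integral over the sphere of a decaying function of the chordal distance, with the region of
chordal distance less than `d / r` omitted. -/
theorem lintegral_sphere_decay (l : S²) {lam q d r : ℝ} (hl : 0 < lam) (hq : 2 < q) (hd : 0 ≤ d) (hr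
    : 0 < r) : ∫⁻ l' : S², (if d ≤ r * ‖(l : Space3) - l'‖ then ofReal ((lam + r * ‖(l : Space3) -
    l'‖) ^ (-q)) else 0) ∂sphereMeasure ≤ ofReal (2 * π * ((lam + d) ^ (2 - q) / ((q - 2) * r ^ 2)))
    := by
  rw [lintegral_sphere_norm_sub l (G := fun t => if d ≤ r * t then
      ofReal ((lam + r * t) ^ (-q)) else 0) (Measurable.ite
      (measurableSet_le (by fun_prop) (by fun_prop)) (by fun_prop) (by fun_prop)),
      ofReal_mul (p := 2 * π) (by positivity)]
  refine mul_le_mul' le_rfl ?_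
  have hder : ∀ t ∈ Ici (d / r), HasDerivAt (fun t => -((lam + r * t) ^ (2 - q) / ((q - 2) * r ^ 2)))
      ((lam + r * t) ^ (1 - q) / r) t := by
    intro t ht
    have ht0 : 0 ≤ t := (div_nonneg hd hr.le).trans ht
    have hpos : 0 < lam + r * t := by positivity
    have h1 : HasDerivAt (fun t => lam + r * t) r t := by
      simpa using ((hasDerivAt_id t).const_mul r).const_add lam
    have := ((h1.rpow_const (p := 2 - q) (Or.inl hpos.ne')).div_const ((q - 2) * r ^ 2)).neg
    refine this.congr_deriv ?_
    rw [show (2 : ℝ) - q - 1 = 1 - q by ring]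
    have : q - 2 ≠ 0 := by linarith
    field_simp
    ring
  have hlim : Tendsto (fun t => -((lam + r * t) ^ (2 - q) / ((q - 2) * r ^ 2))) atTop (𝓝 0) := by
    have h1 : Tendsto (fun t => lam + r * t) atTop atTop :=
      tendsto_atTop_add_const_left _ _ (tendsto_id.const_mul_atTop hr)
    have h2 := (tendsto_rpow_neg_atTop (by linarith : 0 < q - 2)).comp h1
    have := (h2.div_const ((q - 2) * r ^ 2)).neg
    simpa [Function.comp_def] using this
  have hnn : ∀ t ∈ Ioi (d / r), 0 ≤ (lam + r * t) ^ (1 - q) / r := by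
    intro t ht
    have ht0 : 0 ≤ t := (div_nonneg hd hr.le).trans (le_of_lt ht)
    positivity
  have hInt := integrableOn_Ioi_deriv_of_nonneg' hder hnn hlim
  have hval := integral_Ioi_of_hasDerivAt_of_nonneg' hder hnn hlim
  have hval' : ∫ t in Ioi (d / r), (lam + r * t) ^ (1 - q) / r =
      (lam + d) ^ (2 - q) / ((q - 2) * r ^ 2) := by
    rw [hval, mul_div_cancel₀ _ hr.ne']; ring
  rw [← hval', ofReal_integral_eq_lintegral_ofReal hInt
    ((ae_restrict_iff' measurableSet_Ioi).2 (.of_forall hnn)),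
    ← Measure.restrict_congr_set Ioi_ae_eq_Ici.symm]
  rw [← lintegral_indicator measurableSet_Ioo, ← lintegral_indicator measurableSet_Ici]
  refine lintegral_mono fun t => ?_
  by_cases h : t ∈ Ioo (0 : ℝ) 2
  · rw [indicator_of_mem h]
    by_cases h' : d ≤ r * t
    · have hmem : t ∈ Ici (d / r) := by
        rw [Set.mem_Ici, div_le_iff₀ hr]; linarith
      rw [indicator_of_mem hmem, if_pos h', ← ofReal_mul h.1.le]
      refine ofReal_le_ofReal ?_
      have hpos : 0 < lam + r * t := by have := mul_pos hr h.1; linarith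
      rw [le_div_iff₀ hr, show (1 : ℝ) - q = 1 + -q by ring, rpow_add hpos, rpow_one]
      have : 0 ≤ (lam + r * t) ^ (-q) := by positivity
      nlinarith
    · simp [h']
  · rw [indicator_of_notMem h]; exact zero_le

theorem sphereMeasure_cap_le (l : S²) {δ : ℝ} (hδ : 0 ≤ δ) : sphereMeasure {l' : S² | ‖(l : Space3)
    - l'‖ ≤ δ} ≤ ofReal (2 * π * δ ^ 2) := by
  have hm : MeasurableSet {l' : S² | ‖(l : Space3) - l'‖ ≤ δ} :=
    (isClosed_le (by fun_prop) (by fun_prop)).measurableSet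
  rw [← lintegral_indicator_one hm]
  have := lintegral_sphere_norm_sub l (G := (Iic δ).indicator 1)
    (measurable_one.indicator measurableSet_Iic)
  refine (le_of_eq ?_).trans (this.trans_le ?_)
  · rfl
  rw [ofReal_mul (p := 2 * π) (by positivity)]
  refine mul_le_mul' le_rfl ?_
  rw [← lintegral_indicator measurableSet_Ioo]
  calc _ ≤ ∫⁻ t in Ioc 0 δ, ofReal δ := by
        rw [← lintegral_indicator measurableSet_Ioc]
        refine lintegral_mono fun t => ?_
        by_cases h : t ∈ Ioo (0 : ℝ) 2
        · by_cases h' : t ≤ δ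
          · rw [indicator_of_mem h, indicator_of_mem (show t ∈ Ioc 0 δ from ⟨h.1, h'⟩),
              indicator_of_mem (show t ∈ Iic δ from h')]
            simpa using ofReal_le_ofReal h'
          · rw [indicator_of_mem h, indicator_of_notMem (show t ∉ Iic δ from h')]
            simp
        · rw [indicator_of_notMem h]; exact zero_le
    _ = ofReal (δ ^ 2) := by
        rw [lintegral_const, Measure.restrict_apply MeasurableSet.univ, Set.univ_inter,
          Real.volume_Ioc, ← ofReal_mul hδ]
        congr 1; ring

theorem integral_sphere (b : Frame) {F : S² → ℂ} (hF : Continuous F) : ∫ l, F l ∂sphereMeasure = ∫ φ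
    in Ioo (-π) π, ∫ θ in Ioo 0 π, (sin θ : ℂ) * F (spherePoint b θ φ) := by
  have hSm : Measurable fun w : ℝ × ℝ => spherePoint b w.1 w.2 :=
    (by fun_prop : Continuous _).measurable
  have hfin : IsFiniteMeasure ((volume.restrict (Ioo 0 π)).withDensity
      fun θ => ofReal (sin θ)) := by
    refine isFiniteMeasure_withDensity_ofReal ?_
    exact ((by fun_prop : Continuous fun θ : ℝ => sin θ).integrableOn_Ioc.mono_set
      Set.Ioo_subset_Ioc_self).2
  obtain ⟨C, hC⟩ : ∃ C, ∀ l, ‖F l‖ ≤ C := by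
    obtain ⟨C, hC⟩ := isCompact_univ.exists_bound_of_continuousOn hF.continuousOn
    exact ⟨C, fun l => hC l trivial⟩
  have hc : Continuous fun w : ℝ × ℝ => F (spherePoint b w.1 w.2) := by fun_prop
  rw [sphereMeasure_eq_map b, integral_map hSm.aemeasurable hF.aestronglyMeasurable, angleMeasure,
    integral_prod_symm]
  · refine integral_congr_fun fun φ => ?_
    rw [integral_withDensity_eq_integral_toReal_smul
      (by fun_prop : Measurable fun θ : ℝ => ofReal (sin θ))
      (.of_forall fun _ => ofReal_lt_top)]
    refine setIntegral_congr_fun measurableSet_Ioo fun θ hθ => ?_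
    rw [toReal_ofReal (Real.sin_pos_of_mem_Ioo hθ).le, real_smul]
  · exact Integrable.of_bound hc.aestronglyMeasurable C (.of_forall fun w => hC _)

/-- The unit tangent vector `∂_θ` of the sphere. -/
def sphereTangent (b : Frame) (θ φ : ℝ) : Space3 :=
  combination b (cos θ * cos φ) (cos θ * sin φ) (-sin θ)

theorem norm_sphereTangent (b : Frame) (θ φ : ℝ) : ‖sphereTangent b θ φ‖ = 1 := by
  rw [← sq_eq_sq₀ (norm_nonneg _) zero_le_one, sphereTangent, norm_sq_combination]
  nlinarith [sin_sq_add_cos_sq θ, sin_sq_add_cos_sq φ]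

theorem inner_combination (b : Frame) (x y z x' y' z' : ℝ) : inner ℝ (combination b x y z)
    (combination b x' y' z') = x * x' + y * y' + z * z' := by
  rw [combination_eq, combination_eq, LinearIsometryEquiv.inner_map_map, PiLp.inner_apply]
  simp [Fin.sum_univ_three, mul_comm]

theorem inner_spherePoint_sphereTangent (b : Frame) (θ φ : ℝ) : inner ℝ (spherePoint b θ φ : Space3)
    (sphereTangent b θ φ) = 0 := by
  rw [spherePoint, sphereTangent, inner_combination]
  linear_combination (sin θ * cos θ) * sin_sq_add_cos_sq φ

theorem inner_third_spherePoint (b : Frame) (θ φ : ℝ) : inner ℝ (b 2) (spherePoint b θ φ : Space3) =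
    cos θ := by
  have : b 2 = combination b 0 0 1 := by simp [combination]
  rw [this, spherePoint, inner_combination]; ring

theorem hasDerivAt_spherePoint (b : Frame) (θ φ : ℝ) : HasDerivAt (fun θ => (spherePoint b θ φ :
    Space3)) (sphereTangent b θ φ) θ := by
  have h1 := (((Real.hasDerivAt_sin θ).mul_const (cos φ)).smul_const (b 0))
  have h2 := (((Real.hasDerivAt_sin θ).mul_const (sin φ)).smul_const (b 1))
  have h3 := ((Real.hasDerivAt_cos θ).smul_const (b 2))
  exact (h1.add h2).add h3

theorem tendsto_integral_exp_cos {k : ℝ → ℂ} {p : ℝ} (hp : 0 < p) : Tendsto (fun r : ℝ => ∫ θ in Ioo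
    0 π, exp (-(I * (r * p * cos θ : ℝ))) * k θ) atTop (𝓝 0) := by
  let g : ℝ → ℂ := (Ioo (-1 : ℝ) 1).indicator fun c =>
    (sqrt (1 - c ^ 2) : ℂ)⁻¹ * k (arccos c)
  have himg : cos '' Ioo 0 π = Ioo (-1) 1 := by
    ext c
    simp only [mem_image, Set.mem_Ioo]
    constructor
    · rintro ⟨θ, ⟨h0, h1⟩, rfl⟩
      have a1 := Real.cos_lt_cos_of_nonneg_of_le_pi le_rfl h1.le h0
      have a2 := Real.cos_lt_cos_of_nonneg_of_le_pi h0.le le_rfl h1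
      rw [Real.cos_zero] at a1
      rw [cos_pi] at a2
      exact ⟨a2, a1⟩
    · rintro ⟨h0, h1⟩
      exact ⟨arccos c, ⟨Real.arccos_pos.2 h1, Real.arccos_lt_pi.2 h0⟩, Real.cos_arccos h0.le h1.le⟩
  have hinj : InjOn cos (Ioo 0 π) :=
    Real.injOn_cos.mono Set.Ioo_subset_Icc_self
  have key : ∀ r : ℝ, ∫ θ in Ioo 0 π, exp (-(I * (r * p * cos θ : ℝ))) * k θ =
      ∫ c : ℝ, exp (-(I * (r * p * c : ℝ))) * g c := by
    intro r
    have e1 : ∫ c : ℝ, exp (-(I * (r * p * c : ℝ))) * g c =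
        ∫ c in Ioo (-1 : ℝ) 1, exp (-(I * (r * p * c : ℝ))) *
        ((sqrt (1 - c ^ 2) : ℂ)⁻¹ * k (arccos c)) := by
      rw [← integral_indicator measurableSet_Ioo]
      refine integral_congr_fun fun c => ?_
      by_cases h : c ∈ Ioo (-1 : ℝ) 1 <;> simp [g, h]
    rw [e1, ← himg, integral_image_eq_integral_abs_deriv_smul measurableSet_Ioo
      (fun x _ => (Real.hasDerivAt_cos x).hasDerivWithinAt) hinj]
    refine setIntegral_congr_fun measurableSet_Ioo fun θ hθ => ?_
    have hs := Real.sin_pos_of_mem_Ioo hθ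
    have h2 : sqrt (1 - cos θ ^ 2) = sin θ := by
      rw [← Real.sin_sq, sqrt_sq hs.le]
    simp only [abs_neg, abs_of_pos hs, real_smul]
    rw [h2, Real.arccos_cos hθ.1.le hθ.2.le]
    have : (sin θ : ℂ) ≠ 0 := by exact_mod_cast hs.ne'
    field_simp
  simp_rw [key]
  have rl := Real.tendsto_integral_exp_smul_cocompact g
  have hto : Tendsto (fun r : ℝ => r * (p / (2 * π))) atTop (cocompact ℝ) := by
    refine Tendsto.mono_right (tendsto_id.atTop_mul_const (by positivity)) atTop_le_cocompact
  refine (rl.comp hto).congr fun r => ?_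
  simp only [Function.comp_apply]
  refine integral_congr_fun fun c => ?_
  simp only [Circle.smul_def, smul_eq_mul, Real.fourierChar_apply]
  congr 2
  push_cast
  have : (π : ℂ) ≠ 0 := by exact_mod_cast pi_ne_zero
  field_simp

/-- A function on the cone which is continuously differentiable and bounded on the unit sphere
together with its tangential derivatives. -/
structure SphereC1 (h : Space3 → ℂ) (D : ℝ) : Prop where
  diff : ∀ l, ‖l‖ = 1 → DifferentiableAt ℝ h l
  cont : ContinuousOn (fderiv ℝ h) (Metric.sphere 0 1)
  bound : ∀ l, ‖l‖ = 1 → ‖h l‖ ≤ D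
  bound_deriv : ∀ l v, ‖l‖ = 1 → ‖v‖ = 1 → inner ℝ l v = 0 → ‖fderiv ℝ h l v‖ ≤ D

theorem coe_sphere_ne_zero (l : S²) : (l : Space3) ≠ 0 := by
  intro h
  have := norm_eq_of_mem_sphere l
  rw [h, norm_zero] at this
  exact zero_ne_one this

namespace SphereC1

variable {h : Space3 → ℂ} {D : ℝ}

theorem continuous (hh : SphereC1 h D) : Continuous fun l : S² => h l :=
  continuous_iff_continuousAt.2 fun l =>
    (hh.diff l (norm_eq_of_mem_sphere l)).continuousAt.comp continuous_subtype_val.continuousAt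

/-- The derivative of `h` along the meridians. -/
def meridian (h : Space3 → ℂ) (b : Frame) (θ φ : ℝ) : ℂ :=
  fderiv ℝ h (spherePoint b θ φ) (sphereTangent b θ φ)

theorem continuous_meridian (hh : SphereC1 h D) (b : Frame) : Continuous fun w : ℝ × ℝ => meridian h
    b w.1 w.2 := by
  have h1 : Continuous fun w : ℝ × ℝ => fderiv ℝ h (spherePoint b w.1 w.2) :=
    hh.cont.comp_continuous (by fun_prop) fun w => Subtype.coe_prop _
  have h2 : Continuous fun w : ℝ × ℝ => sphereTangent b w.1 w.2 := by
    unfold sphereTangent; fun_prop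
  exact h1.clm_apply h2

theorem continuous_meridian_left (hh : SphereC1 h D) (b : Frame) (φ : ℝ) : Continuous fun θ : ℝ =>
    meridian h b θ φ := by
  have h1 : Continuous fun θ : ℝ => fderiv ℝ h (spherePoint b θ φ) :=
    hh.cont.comp_continuous (by fun_prop) fun w => Subtype.coe_prop _
  have h2 : Continuous fun θ : ℝ => sphereTangent b θ φ := by
    unfold sphereTangent; fun_prop
  exact h1.clm_apply h2

theorem norm_meridian_le (hh : SphereC1 h D) (b : Frame) (θ φ : ℝ) : ‖meridian h b θ φ‖ ≤ D :=
  hh.bound_deriv _ _ (norm_eq_of_mem_sphere _) (norm_sphereTangent b θ φ)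
    (inner_spherePoint_sphereTangent b θ φ)

theorem integral_meridian (hh : SphereC1 h D) (b : Frame) (ρ φ : ℝ) : I * ρ * ∫ θ in Ioo 0 π, (sin θ
    : ℂ) * (h (spherePoint b θ φ) * exp (-(I * (ρ * cos θ : ℝ)))) = exp (I * ρ) * h (-b 2) - exp
    (-(I * ρ)) * h (b 2) - ∫ θ in Ioo 0 π, exp (-(I * (ρ * cos θ : ℝ))) * meridian h b θ φ := by
  have hpi := pi_pos.le
  have ioo : ∀ f : ℝ → ℂ, ∫ θ in Ioo 0 π, f θ = ∫ θ in (0 : ℝ)..Real.pi, f θ := by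
    intro f
    rw [intervalIntegral.integral_of_le hpi, integral_Ioc_eq_integral_Ioo]
  have hu : ∀ θ ∈ Set.uIcc 0 π, HasDerivAt (fun θ : ℝ =>
      exp (-(I * (ρ * cos θ : ℝ)))) (I * ρ * sin θ *
      exp (-(I * (ρ * cos θ : ℝ)))) θ := by
    intro θ _
    have := (((((Real.hasDerivAt_cos θ).const_mul ρ).ofReal_comp).const_mul I).neg).cexp
    refine this.congr_deriv ?_
    simp only [Pi.neg_apply]
    push_cast; ring
  have hv : ∀ θ ∈ Set.uIcc 0 π, HasDerivAt (fun θ : ℝ => h (spherePoint b θ φ))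
      (meridian h b θ φ) θ := by
    intro θ _
    exact (hh.diff _ (norm_eq_of_mem_sphere _)).hasFDerivAt.comp_hasDerivAt θ
      (hasDerivAt_spherePoint b θ φ)
  have hmc : Continuous fun θ => meridian h b θ φ :=
    hh.continuous_meridian_left b φ
  have hc0 : Continuous fun θ : ℝ => exp (-(I * (ρ * cos θ : ℝ))) := by
    fun_prop
  have hs0 : Continuous fun θ : ℝ => I * ρ * sin θ := by fun_prop
  have huc : Continuous fun θ : ℝ => I * ρ * sin θ * exp (-(I * (ρ * cos θ : ℝ))) := hs0.mul hc0
  have ibp := intervalIntegral.integral_mul_deriv_eq_deriv_mul hu hv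
    (huc.intervalIntegrable _ _) (hmc.intervalIntegrable _ _)
  have hpt : ((spherePoint b π φ : Space3)) = -b 2 := by simp [spherePoint, combination]
  have hp0 : ((spherePoint b 0 φ : Space3)) = b 2 := by simp [spherePoint, combination]
  have hA : exp (-(I * (ρ * cos π : ℝ))) = exp (I * ρ) := by
    congr 1; rw [cos_pi]; push_cast; ring
  have hB : exp (-(I * (ρ * cos 0 : ℝ))) = exp (-(I * ρ)) := by
    congr 2; rw [Real.cos_zero, mul_one]
  have this : I * ρ * ∫ θ in Ioo 0 π, (sin θ : ℂ) *
      (h (spherePoint b θ φ) * exp (-(I * (ρ * cos θ : ℝ)))) =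
      ∫ θ in (0 : ℝ)..Real.pi,
      I * ρ * sin θ * exp (-(I * (ρ * cos θ : ℝ))) * h (spherePoint b θ φ) := by
    rw [← ioo, ← integral_const_mul]
    refine integral_congr_fun fun θ => ?_
    ring
  rw [this, ioo (fun θ => exp (-(I * (ρ * cos θ : ℝ))) * meridian h b θ φ),
    ← hA, ← hB, ← hpt, ← hp0]
  generalize (∫ θ in (0 : ℝ)..Real.pi, I * ρ * sin θ *
    exp (-(I * (ρ * cos θ : ℝ))) * h (spherePoint b θ φ)) = J at ibp ⊢
  generalize (∫ θ in (0 : ℝ)..Real.pi, exp (-(I * (ρ * cos θ : ℝ))) * meridian h b θ φ) = K at ibp ⊢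
  rw [ibp]
  ring

/-- The integral of the meridian derivative against the plane wave. -/
def remainder (h : Space3 → ℂ) (b : Frame) (ρ : ℝ) : ℂ :=
  ∫ φ in Ioo (-π) π, ∫ θ in Ioo 0 π, exp (-(I * (ρ * cos θ : ℝ))) * meridian h b θ φ

theorem norm_inner_integral_le (hh : SphereC1 h D) (b : Frame) (ρ φ : ℝ) : ‖∫ θ in Ioo 0 π, exp (-(I
    * (ρ * cos θ : ℝ))) * meridian h b θ φ‖ ≤ D * π := by
  have := norm_setIntegral_le_of_norm_le_const (μ := volume) (s := Ioo 0 π) (C := D)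
    (f := fun θ => exp (-(I * (ρ * cos θ : ℝ))) * meridian h b θ φ)
    (by simp) (fun θ _ => ?_)
  · simpa [Real.volume_real_Ioo_of_le pi_pos.le] using this
  · rw [norm_mul, norm_exp]
    have : (-(I * (ρ * cos θ : ℝ))).re = 0 := by simp
    rw [this, exp_zero, one_mul]
    exact hh.norm_meridian_le b θ φ

theorem norm_remainder_le (hh : SphereC1 h D) (b : Frame) (ρ : ℝ) : ‖remainder h b ρ‖ ≤ D * π * (2 *
    π) := by
  have := norm_setIntegral_le_of_norm_le_const (μ := volume) (s := Ioo (-π) π)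
    (C := D * π) (f := fun φ => ∫ θ in Ioo 0 π, exp (-(I * (ρ * cos θ : ℝ))) * meridian h b θ φ)
    (by simp) (fun φ _ => hh.norm_inner_integral_le b ρ φ)
  rwa [Real.volume_real_Ioo_of_le (by linarith [pi_pos]), sub_neg_eq_add, ← two_mul] at this

theorem tendsto_remainder (hh : SphereC1 h D) (b : Frame) {p : ℝ} (hp : 0 < p) : Tendsto (fun r : ℝ
    => remainder h b (r * p)) atTop (𝓝 0) := by
  have : (0 : ℂ) = ∫ φ in Ioo (-π) π, (0 : ℂ) := by simp
  rw [this]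
  refine tendsto_integral_filter_of_dominated_convergence (fun _ => D * π)
    (.of_forall fun r => ?_) (.of_forall fun r =>
    .of_forall fun φ => hh.norm_inner_integral_le b _ φ) (integrable_const _)
    (.of_forall fun φ => tendsto_integral_exp_cos hp)
  have hc : Continuous fun w : ℝ × ℝ => exp (-(I * (r * p * cos w.2 : ℝ))) *
      meridian h b w.2 w.1 := by
    have := (hh.continuous_meridian b).comp (by fun_prop : Continuous fun w : ℝ × ℝ => (w.2, w.1))
    exact (by fun_prop : Continuous fun w : ℝ × ℝ =>
      exp (-(I * (r * p * cos w.2 : ℝ)))).mul this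
  exact (hc.stronglyMeasurable.integral_prod_right' (ν := volume.restrict _)).aestronglyMeasurable

theorem integral_plane_wave (hh : SphereC1 h D) (b : Frame) {p r : ℝ} (hp : 0 < p) (hr : 0 < r) : r
    * ∫ l : S², h l * exp (-(I * (r * inner ℝ (p • b 2) (l : Space3) : ℝ))) ∂sphereMeasure = 2 * π *
    I / p * (exp (-(I * (r * p : ℝ))) * h (b 2) - exp (I * (r * p : ℝ)) * h (-b 2)) + I / p *
    remainder h b (r * p) := by
  have hc := hh.continuous
  have hc2 : Continuous fun l : S² => h l * exp (-(I * (r * inner ℝ (p • b 2) (l : Space3) : ℝ))) :=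
    hc.mul (by fun_prop)
  rw [integral_sphere b hc2]
  have hi : ∀ θ φ, r * inner ℝ (p • b 2) (spherePoint b θ φ : Space3) = r * p * cos θ := by
    intro θ φ
    rw [real_inner_smul_left, inner_third_spherePoint]; ring
  simp only [hi]
  have key := fun φ => hh.integral_meridian b (r * p) φ
  have hrp : (I * (r * p : ℝ)) ≠ 0 := by
    refine mul_ne_zero I_ne_zero ?_
    exact_mod_cast (mul_pos hr hp).ne'
  have e1 : ∀ φ, ∫ θ in Ioo 0 π, (sin θ : ℂ) * (h (spherePoint b θ φ) *
      exp (-(I * (r * p * cos θ : ℝ)))) = (I * (r * p : ℝ))⁻¹ *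
      (exp (I * (r * p : ℝ)) * h (-b 2) - exp (-(I * (r * p : ℝ))) * h (b 2) -
      ∫ θ in Ioo 0 π, exp (-(I * (r * p * cos θ : ℝ))) * meridian h b θ φ) := by
    intro φ
    rw [← key φ, inv_mul_cancel_left₀ hrp]
  simp_rw [e1]
  have hint : IntegrableOn (fun φ => ∫ θ in Ioo 0 π,
      exp (-(I * (r * p * cos θ : ℝ))) * meridian h b θ φ)
      (Ioo (-π) π) := by
    have hc : Continuous fun w : ℝ × ℝ => exp (-(I * (r * p * cos w.2 : ℝ))) *
        meridian h b w.2 w.1 := by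
      have := (hh.continuous_meridian b).comp (by fun_prop : Continuous fun w : ℝ × ℝ => (w.2, w.1))
      exact (by fun_prop : Continuous fun w : ℝ × ℝ =>
        exp (-(I * (r * p * cos w.2 : ℝ)))).mul this
    exact Integrable.of_bound (hc.stronglyMeasurable.integral_prod_right'
      (ν := volume.restrict _)).aestronglyMeasurable (D * π)
      (.of_forall fun φ => hh.norm_inner_integral_le b _ φ)
  rw [integral_const_mul, integral_sub (integrable_const _) hint, setIntegral_const,
    Real.volume_real_Ioo_of_le (by linarith [pi_pos]), sub_neg_eq_add, real_smul]
  change _ * (_ * (_ - remainder h b (r * p))) = _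
  have h1 : (r : ℂ) ≠ 0 := by exact_mod_cast hr.ne'
  have h2 : (p : ℂ) ≠ 0 := by exact_mod_cast hp.ne'
  rw [mul_inv, inv_I]
  push_cast
  field_simp
  ring

/-- Spherical integrals against plane waves, bound. -/
theorem norm_integral_plane_wave_le (hh : SphereC1 h D) {p : Space3} (hp : p ≠ 0) {r : ℝ} (hr : 0 <
    r) : ‖r * ∫ l : S², h l * exp (-(I * (r * inner ℝ p (l : Space3) : ℝ))) ∂sphereMeasure‖ ≤ 40 * D
    / ‖p‖ := by
  have hp' : 0 < ‖p‖ := norm_pos_iff.2 hp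
  obtain ⟨b, hb⟩ := exists_orthonormalBasis_third (n := ‖p‖⁻¹ • p) (by
    rw [norm_smul, norm_inv, norm_norm, inv_mul_cancel₀ hp'.ne'])
  have hpb : p = ‖p‖ • b 2 := by rw [hb, smul_inv_smul₀ hp'.ne']
  conv_lhs => rw [hpb]
  rw [hh.integral_plane_wave b hp' hr]
  have hI : ∀ t : ℝ, ‖exp (I * t)‖ = 1 := fun t => by
    rw [mul_comm]; exact norm_exp_ofReal_mul_I t
  have hI' : ∀ t : ℝ, ‖exp (-(I * t))‖ = 1 := fun t => by
    have := hI (-t); rwa [Complex.ofReal_neg, mul_neg] at this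
  have hb2 : ‖b 2‖ = 1 := b.orthonormal.1 2
  have h1 := hh.bound (b 2) hb2
  have h2 := hh.bound (-b 2) (by rw [norm_neg, hb2])
  have h3 := hh.norm_remainder_le b (r * ‖p‖)
  have hD : 0 ≤ D := (norm_nonneg _).trans h1
  calc _ ≤ 2 * π / ‖p‖ * (D + D) + 1 / ‖p‖ * (D * π * (2 * π)) := by
        refine (norm_add_le _ _).trans (add_le_add ?_ ?_)
        · rw [norm_mul]
          refine mul_le_mul (le_of_eq ?_) ((norm_sub_le _ _).trans (add_le_add ?_ ?_))
            (norm_nonneg _) (by positivity)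
          · simp [abs_of_pos pi_pos]
          · rw [norm_mul, hI', one_mul]; exact h1
          · rw [norm_mul, hI, one_mul]; exact h2
        · rw [norm_mul]
          refine mul_le_mul (le_of_eq (by simp)) h3 (norm_nonneg _) (by positivity)
    _ = D * (4 * π + 2 * (π * π)) / ‖p‖ := by ring
    _ ≤ _ := by
      have : π < 3.15 := Real.pi_lt_d2
      have : 4 * π + 2 * (π * π) ≤ 40 := by nlinarith [pi_pos]
      rw [mul_comm 40 D]
      gcongr

/-- Spherical integrals against plane waves, leading asymptotics. -/
theorem tendsto_integral_plane_wave (hh : SphereC1 h D) {p : Space3} (hp : p ≠ 0) : Tendsto (fun r :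
    ℝ => r * ∫ l : S², h l * exp (-(I * (r * inner ℝ p (l : Space3) : ℝ))) ∂sphereMeasure - 2 * π *
    I / ‖p‖ * (exp (-(I * (r * ‖p‖ : ℝ))) * h (‖p‖⁻¹ • p) - exp (I * (r * ‖p‖ : ℝ)) * h (-(‖p‖⁻¹ •
    p)))) atTop (𝓝 0) := by
  have hp' : 0 < ‖p‖ := norm_pos_iff.2 hp
  obtain ⟨b, hb⟩ := exists_orthonormalBasis_third (n := ‖p‖⁻¹ • p) (by
    rw [norm_smul, norm_inv, norm_norm, inv_mul_cancel₀ hp'.ne'])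
  have hpb : p = ‖p‖ • b 2 := by rw [hb, smul_inv_smul₀ hp'.ne']
  have h1 := (hh.tendsto_remainder b hp').const_mul (I / ‖p‖)
  rw [mul_zero] at h1
  refine h1.congr' ?_
  filter_upwards [eventually_gt_atTop 0] with r hr
  have := hh.integral_plane_wave b hp' hr
  rw [← hpb] at this
  rw [this, ← hb]
  ring

end SphereC1

/-! ### A smooth dyadic partition of the half-line -/

/-- A smooth function supported in `[1/2, 2]` whose dyadic dilations sum up to one. -/
def cutoff (u : ℝ) : ℝ := smoothTransition (2 * u - 1) - smoothTransition (u - 1)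

theorem contDiff_cutoff : ContDiff ℝ ∞ cutoff :=
  (smoothTransition.contDiff.comp (by fun_prop)).sub (smoothTransition.contDiff.comp (by fun_prop))

theorem continuous_cutoff : Continuous cutoff := contDiff_cutoff.continuous

theorem cutoff_of_le {u : ℝ} (hu : u ≤ 1 / 2) : cutoff u = 0 := by
  rw [cutoff, smoothTransition.zero_of_nonpos (by linarith),
    smoothTransition.zero_of_nonpos (by linarith), sub_zero]

theorem cutoff_of_ge {u : ℝ} (hu : 2 ≤ u) : cutoff u = 0 := by
  rw [cutoff, smoothTransition.one_of_one_le (by linarith),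
    smoothTransition.one_of_one_le (by linarith), sub_self]

theorem mem_Ioo_of_cutoff_ne_zero {u : ℝ} (hu : cutoff u ≠ 0) : u ∈ Ioo (1 / 2) 2 := by
  constructor
  · by_contra! h; exact hu (cutoff_of_le h)
  · by_contra! h; exact hu (cutoff_of_ge h)

theorem abs_cutoff_le (u : ℝ) : |cutoff u| ≤ 1 := by
  rw [cutoff, abs_le]
  have h1 := smoothTransition.le_one (2 * u - 1)
  have h2 := smoothTransition.le_one (u - 1)
  have h3 := smoothTransition.nonneg (2 * u - 1)
  have h4 := smoothTransition.nonneg (u - 1)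
  constructor <;> linarith

theorem hasSum_cutoff {u : ℝ} (hu : 0 < u) : HasSum (fun k : ℤ => cutoff (2 ^ k * u)) 1 := by
  obtain ⟨n, h1, h2⟩ := exists_mem_Ico_zpow hu (one_lt_two : (1 : ℝ) < 2)
  have hsum : ∑ k ∈ ({-n - 1, -n} : Finset ℤ), cutoff (2 ^ k * u) = 1 := by
    rw [Finset.sum_pair (by omega)]
    set v := (2 : ℝ) ^ (-n) * u with hv
    have e : (2 : ℝ) ^ (-n - 1) * u = v / 2 := by
      rw [zpow_sub₀ two_ne_zero, zpow_one, hv]; ring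
    have hv1 : 1 ≤ v := by
      rw [hv, zpow_neg, ← div_eq_inv_mul, le_div_iff₀ (by positivity), one_mul]; exact h1
    have hv2 : v < 2 := by
      rw [hv, zpow_neg, ← div_eq_inv_mul, div_lt_iff₀ (by positivity), mul_comm,
        ← zpow_add_one₀ two_ne_zero]
      exact h2
    rw [e, cutoff, cutoff, smoothTransition.zero_of_nonpos (x := v / 2 - 1) (by linarith),
      smoothTransition.one_of_one_le (x := 2 * v - 1) (by linarith),
      mul_div_cancel₀ _ two_ne_zero]
    ring
  rw [← hsum]
  refine hasSum_sum_of_ne_finset_zero fun k hk => ?_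
  by_contra hne
  obtain ⟨h3, h4⟩ := mem_Ioo_of_cutoff_ne_zero hne
  apply hk
  have hp : (0 : ℝ) < 2 ^ k := by positivity
  have a1 : (2 : ℝ) ^ (k + n) < 2 ^ (1 : ℤ) := by
    rw [zpow_add₀ two_ne_zero, zpow_one]
    exact (mul_le_mul_of_nonneg_left h1 hp.le).trans_lt h4
  have a2 : (2 : ℝ) ^ (-1 : ℤ) < 2 ^ (k + n + 1) := by
    rw [add_assoc, zpow_add₀ two_ne_zero, zpow_neg_one]
    have := mul_lt_mul_of_pos_left h2 hp
    norm_num at h3 ⊢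
    linarith
  rw [zpow_lt_zpow_iff_right₀ one_lt_two] at a1 a2
  simp only [Finset.mem_insert, Finset.mem_singleton]
  omega

/-- The function `χ(u) (-iu)^n`. -/
def cutoffPow (n : ℤ) (u : ℝ) : ℂ := cutoff u * (-(I * u)) ^ n

theorem contDiff_cutoffPow (n : ℤ) : ContDiff ℝ ∞ (cutoffPow n) := by
  refine contDiff_iff_contDiffAt.2 fun u => ?_
  have h1 : ContDiff ℝ ∞ fun u : ℝ => (cutoff u : ℂ) :=
    ofRealCLM.contDiff.comp contDiff_cutoff
  by_cases hu : u < 1 / 2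
  · refine (contDiffAt_const (c := (0 : ℂ))).congr_of_eventuallyEq ?_
    filter_upwards [gt_mem_nhds hu] with v hv
    rw [cutoffPow, cutoff_of_le hv.le]; simp
  · have hu0 : (-(I * u)) ≠ 0 := by
      simp only [ne_eq, neg_eq_zero, mul_eq_zero, I_ne_zero, false_or, Complex.ofReal_eq_zero]
      intro h; rw [h] at hu; norm_num at hu
    have h2 : ContDiff ℝ ∞ fun u : ℝ => -(I * (u : ℂ)) :=
      (contDiff_const.mul ofRealCLM.contDiff).neg
    refine h1.contDiffAt.mul ?_
    obtain ⟨m, rfl | rfl⟩ := n.eq_nat_or_neg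
    · simp only [zpow_natCast]; exact h2.contDiffAt.pow m
    · simp only [zpow_neg, zpow_natCast]
      exact (h2.contDiffAt.pow m).inv (pow_ne_zero _ hu0)

theorem hasCompactSupport_cutoffPow (n : ℤ) : HasCompactSupport (cutoffPow n) := by
  refine HasCompactSupport.intro (isCompact_Icc (a := (1 / 2 : ℝ)) (b := 2)) fun u hu => ?_
  have : cutoff u = 0 := by
    by_contra h; exact hu (Set.Ioo_subset_Icc_self (mem_Ioo_of_cutoff_ne_zero h))
  rw [cutoffPow, this]; simp

/-- The kernel `φ_n(s) = (2π)⁻¹ ∫ χ(u) (-iu)^n exp(-ius) du`. -/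
def dyadicKernel (n : ℤ) (s : ℝ) : ℂ :=
  (2 * π : ℂ)⁻¹ * ∫ u : ℝ, cutoffPow n u * exp (-(I * u * s))

open FourierTransform in
theorem exists_schwartz_dyadicKernel (n : ℤ) : ∃ g : SchwartzMap ℝ ℂ, ∀ s, dyadicKernel n s = (2 * π
    : ℂ)⁻¹ * g (s / (2 * π)) := by
  let f : SchwartzMap ℝ ℂ := (hasCompactSupport_cutoffPow n).toSchwartzMap (contDiff_cutoffPow n)
  refine ⟨𝓕 f, fun s => ?_⟩
  rw [dyadicKernel]
  congr 1
  rw [SchwartzMap.fourier_coe, Real.fourier_real_eq_integral_exp_smul]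
  refine integral_congr_fun fun u => ?_
  change _ = _ • cutoffPow n u
  rw [smul_eq_mul, mul_comm]
  congr 2
  have : (π : ℂ) ≠ 0 := by exact_mod_cast pi_ne_zero
  push_cast
  field_simp

theorem continuous_dyadicKernel (n : ℤ) : Continuous (dyadicKernel n) := by
  obtain ⟨g, hg⟩ := exists_schwartz_dyadicKernel n
  rw [funext hg]
  exact continuous_const.mul (g.continuous.comp (by fun_prop))

theorem integrable_dyadicKernel_weight (n : ℤ) (N : ℕ) {a : ℝ} (ha : 0 ≤ a) : Integrable fun s => (1
    + a * |s|) ^ N * ‖dyadicKernel n s‖ := by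
  obtain ⟨g, hg⟩ := exists_schwartz_dyadicKernel n
  have h2 : ∀ k : ℕ, Integrable fun s : ℝ => |s| ^ k * ‖dyadicKernel n s‖ := by
    intro k
    have h1 := g.integrable_pow_mul (μ := volume) k
    have h3 := (h1.comp_div (g := fun x => ‖x‖ ^ k * ‖g x‖) (by positivity : (2 * π) ≠ 0)).const_mul
      ((2 * π) ^ k * (2 * π)⁻¹)
    refine h3.congr (.of_forall fun s => ?_)
    have hp := pi_pos
    beta_reduce
    rw [hg, norm_mul, norm_div, norm_eq_abs, norm_eq_abs, abs_of_pos (a := 2 * π) (by positivity)]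
    have : ‖(2 * π : ℂ)⁻¹‖ = (2 * π)⁻¹ := by simp [abs_of_pos hp]
    rw [this, div_pow]
    field_simp
  have h4 : (fun s => (1 + a * |s|) ^ N * ‖dyadicKernel n s‖) = fun s => ∑ k ∈ Finset.range (N + 1),
      a ^ k * (N.choose k) * (|s| ^ k * ‖dyadicKernel n s‖) := by
    ext s
    rw [add_comm 1, add_pow, sum_mul]
    refine sum_congr rfl fun k _ => ?_
    rw [one_pow, mul_pow]; ring
  rw [h4]
  exact integrable_finsetSum _ fun k _ => (h2 k).const_mul _

/-- The weight `1 + |s|/lam`. -/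
def wt (lam s : ℝ) : ℝ := 1 + |s| / lam

section Weight
variable {lam : ℝ}

theorem one_le_wt (hl : 0 < lam) (s : ℝ) : 1 ≤ wt lam s := by
  rw [wt]; have := div_nonneg (abs_nonneg s) hl.le; linarith

theorem wt_pos (hl : 0 < lam) (s : ℝ) : 0 < wt lam s := zero_lt_one.trans_le (one_le_wt hl s)

theorem wt_add_le (hl : 0 < lam) (s t : ℝ) : wt lam (s + t) ≤ wt lam s * wt lam t := by
  have h1 : |s + t| / lam ≤ |s| / lam + |t| / lam := by
    rw [← add_div]; exact div_le_div_of_nonneg_right (abs_add_le s t) hl.le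
  have h2 : 0 ≤ |s| / lam * (|t| / lam) := by positivity
  simp only [wt]
  nlinarith

theorem wt_neg (s : ℝ) : wt lam (-s) = wt lam s := by rw [wt, wt, abs_neg]

theorem continuous_wt : Continuous (wt lam) := by unfold wt; fun_prop

theorem continuous_wt_rpow (hl : 0 < lam) (q : ℝ) : Continuous fun s => wt lam s ^ q :=
  continuous_wt.rpow_const fun s => Or.inl (wt_pos hl s).ne'

theorem wt_rpow_add_le (hl : 0 < lam) {q : ℝ} (hq : 0 ≤ q) (s t : ℝ) : wt lam (s + t) ^ q ≤ wt lam s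
    ^ q * wt lam t ^ q := by
  rw [← mul_rpow (wt_pos hl s).le (wt_pos hl t).le]
  exact rpow_le_rpow (wt_pos hl _).le (wt_add_le hl s t) hq

theorem integrable_wt_rpow (hl : 0 < lam) {a : ℝ} (ha : 1 < a) : Integrable fun s => wt lam s ^ (-a)
    := by
  have := (integrable_one_add_norm (E := ℝ) (μ := volume) (r := a) (by simpa using ha)).comp_div
    hl.ne'
  refine this.congr (.of_forall fun s => ?_)
  simp [wt, abs_div, abs_of_pos hl]

end Weight

/-- The derivative `∂_s^m b`. -/
def timeDeriv (b : TestFn) (m : ℕ) (s : ℝ) (l : Space3) : ℂ :=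
  iteratedDeriv m (fun s' => b s' l) s

theorem isOpen_cone : IsOpen {p : ℝ × Space3 | p.2 ≠ 0} :=
  isOpen_compl_singleton.preimage continuous_snd

namespace IsHomTestFn

variable {lam ε : ℝ} {n : ℤ} {b : TestFn}

theorem contDiffOn_timeDeriv (hb : IsHomTestFn lam ε n b) (m : ℕ) : ContDiffOn ℝ ∞ (fun p : ℝ ×
    Space3 => timeDeriv b m p.1 p.2) {p | p.2 ≠ 0} := by
  induction m with
  | zero => simpa [timeDeriv] using hb.smooth
  | succ m ih =>
    have h1 := (ih.fderiv_of_isOpen isOpen_cone (m := ∞) le_rfl).clm_apply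
      (contDiffOn_const (c := ((1 : ℝ), (0 : Space3))))
    refine h1.congr fun p hp => ?_
    rw [timeDeriv, iteratedDeriv_succ]
    have h2 : HasFDerivAt (fun p : ℝ × Space3 => timeDeriv b m p.1 p.2) _ p :=
      ((ih.contDiffAt (isOpen_cone.mem_nhds hp)).differentiableAt (by simp)).hasFDerivAt
    have h3 : HasDerivAt (fun s : ℝ => (s, p.2)) ((1 : ℝ), (0 : Space3)) p.1 :=
      (hasDerivAt_id p.1).prodMk (hasDerivAt_const p.1 p.2)
    exact (HasFDerivAt.comp_hasDerivAt (l := fun p : ℝ × Space3 => timeDeriv b m p.1 p.2) p.1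
      h2 h3).deriv

theorem continuousOn_timeDeriv (hb : IsHomTestFn lam ε n b) (m : ℕ) : ContinuousOn (fun p : ℝ ×
    Space3 => timeDeriv b m p.1 p.2) {p | p.2 ≠ 0} :=
  (hb.contDiffOn_timeDeriv m).continuousOn

theorem hasDerivAt_timeDeriv (hb : IsHomTestFn lam ε n b) (m : ℕ) (s : ℝ) {l : Space3} (hl : l ≠ 0)
    : HasDerivAt (fun s => timeDeriv b m s l) (timeDeriv b (m + 1) s l) s := by
  have h2 : HasFDerivAt (fun p : ℝ × Space3 => timeDeriv b m p.1 p.2) _ (s, l) :=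
    (((hb.contDiffOn_timeDeriv m).contDiffAt (isOpen_cone.mem_nhds hl)).differentiableAt
      (by simp)).hasFDerivAt
  have h3 : HasDerivAt (fun s : ℝ => (s, l)) ((1 : ℝ), (0 : Space3)) s :=
    (hasDerivAt_id s).prodMk (hasDerivAt_const s l)
  have h4 := HasFDerivAt.comp_hasDerivAt (l := fun p : ℝ × Space3 => timeDeriv b m p.1 p.2) s h2 h3
  have h5 : timeDeriv b (m + 1) s l = deriv (fun s => timeDeriv b m s l) s := by
    rw [timeDeriv, iteratedDeriv_succ]; rfl
  rw [h5]
  exact h4.differentiableAt.hasDerivAt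

theorem continuous_timeDeriv (hb : IsHomTestFn lam ε n b) (m : ℕ) {l : Space3} (hl : l ≠ 0) :
    Continuous fun s => timeDeriv b m s l :=
  continuous_iff_continuousAt.2 fun s => (hb.hasDerivAt_timeDeriv m s hl).continuousAt

/-- The derivative `∂_l ∂_s^m b`. -/
def angleDeriv (b : TestFn) (m : ℕ) (s : ℝ) (l : Space3) : Space3 →L[ℝ] ℂ :=
  (fderiv ℝ (fun p : ℝ × Space3 => timeDeriv b m p.1 p.2) (s, l)).comp (inr ℝ ℝ Space3)

theorem hasFDerivAt_timeDeriv (hb : IsHomTestFn lam ε n b) (m : ℕ) (s : ℝ) {l : Space3} (hl : l ≠ 0)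
    : HasFDerivAt (fun l => timeDeriv b m s l) (angleDeriv b m s l) l := by
  have h2 : HasFDerivAt (fun p : ℝ × Space3 => timeDeriv b m p.1 p.2) _ (s, l) :=
    (((hb.contDiffOn_timeDeriv m).contDiffAt (isOpen_cone.mem_nhds hl)).differentiableAt
      (by simp)).hasFDerivAt
  exact h2.comp l (hasFDerivAt_prodMk_right s l)

theorem continuousOn_angleDeriv (hb : IsHomTestFn lam ε n b) (m : ℕ) : ContinuousOn (fun p : ℝ ×
    Space3 => angleDeriv b m p.1 p.2) {p | p.2 ≠ 0} := by
  have h1 := ((hb.contDiffOn_timeDeriv m).fderiv_of_isOpen isOpen_cone (m := ∞) le_rfl).continuousOn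
  exact h1.clm_comp continuousOn_const

theorem exists_bound_of_ops (hb : IsHomTestFn lam ε n b) (hlam : 0 < lam) (hε : 0 < ε) (ops : List
    (Fin 4 × Fin 4)) (m : ℕ) : ∃ C, 0 ≤ C ∧ ∀ (s : ℝ) (l : Space3), ‖l‖ ∈ Icc (1 / 2 : ℝ) 2 →
    ‖ops.foldr coneOp (fun l' => timeDeriv b m s l') l‖ ≤ C * wt lam s ^ (-(1 + ε)) := by
  obtain ⟨C, hC⟩ := hb.bound ops m
  obtain ⟨K, hK⟩ : ∃ K : ℝ, ∀ x ∈ Icc (1 / 2 : ℝ) 2, ‖x ^ (n - (m : ℤ))‖ ≤ K := by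
    refine isCompact_Icc.exists_bound_of_continuousOn fun x hx => ?_
    exact (continuousAt_zpow₀ x _ (Or.inl (by have := hx.1; positivity))).continuousWithinAt
  have hK0 : 0 ≤ K := (norm_nonneg _).trans (hK 1 (by norm_num))
  set e : ℝ := (m : ℝ) + 1 + ε with he
  have he0 : 0 < e := by positivity
  refine ⟨|C| * K * (lam / 2) ^ (-e), by positivity, fun s l hl => ?_⟩
  have hl0 : 0 < ‖l‖ := by have := hl.1; linarith
  refine (hC s l (norm_pos_iff.1 hl0)).trans ?_
  have h1 : lam / 2 * wt lam s ≤ lam + |s| / ‖l‖ := by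
    have a1 : |s| / 2 ≤ |s| / ‖l‖ := div_le_div_of_nonneg_left (abs_nonneg s) hl0 hl.2
    have a2 : lam / 2 * wt lam s = lam / 2 + |s| / 2 := by
      rw [wt]; field_simp
    rw [a2]; linarith
  have hw := one_le_wt hlam s
  have h2 : (lam / 2) ^ e * wt lam s ^ (1 + ε) ≤ (lam + |s| / ‖l‖) ^ e := by
    calc _ ≤ (lam / 2) ^ e * wt lam s ^ e := by
          gcongr
          rw [he]
          have : (0 : ℝ) ≤ m := by positivity
          linarith
      _ = (lam / 2 * wt lam s) ^ e := (mul_rpow (by positivity) (by linarith)).symm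
      _ ≤ _ := rpow_le_rpow (by positivity) h1 he0.le
  have h3 : 0 < (lam / 2) ^ e * wt lam s ^ (1 + ε) := by positivity
  calc C * ‖l‖ ^ (n - (m : ℤ)) / (lam + |s| / ‖l‖) ^ e
      ≤ |C| * K / (lam + |s| / ‖l‖) ^ e := by
        gcongr
        · exact le_abs_self C
        · exact (le_abs_self _).trans (hK _ hl)
    _ ≤ |C| * K / ((lam / 2) ^ e * wt lam s ^ (1 + ε)) := by gcongr
    _ = _ := by
      rw [rpow_neg (by positivity), rpow_neg (by positivity)]
      field_simp

theorem exists_bound (hb : IsHomTestFn lam ε n b) (hl : 0 < lam) (hε : 0 < ε) (m : ℕ) : ∃ C, 0 ≤ C ∧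
    ∀ (s : ℝ) (l : Space3), ‖l‖ ∈ Icc (1 / 2 : ℝ) 2 → ‖timeDeriv b m s l‖ ≤ C * wt lam s ^ (-(1 +
    ε)) :=
  hb.exists_bound_of_ops hl hε [] m

theorem exists_bound_angleDeriv (hb : IsHomTestFn lam ε n b) (hlam : 0 < lam) (hε : 0 < ε) (m : ℕ) :
    ∃ C, 0 ≤ C ∧ ∀ (s : ℝ) (l : Space3), ‖l‖ ∈ Icc (1 / 2 : ℝ) 2 → ‖angleDeriv b m s l‖ ≤ C * wt lam
    s ^ (-(1 + ε)) := by
  choose C hC0 hC using fun j : Fin 3 => hb.exists_bound_of_ops hlam hε [(0, j.succ)] m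
  refine ⟨∑ j, 2 * C j, sum_nonneg fun j _ => by have := hC0 j; positivity,
    fun s l hl => ?_⟩
  have hl0 : 0 < ‖l‖ := by have := hl.1; linarith
  have hw := wt_pos hlam s
  have hj : ∀ j : Fin 3, ‖angleDeriv b m s l (EuclideanSpace.single j 1)‖ ≤
      2 * C j * wt lam s ^ (-(1 + ε)) := by
    intro j
    have h1 := hC j s l hl
    simp only [List.foldr, coneOp, lowerNull, partialNull, Fin.cons_zero, Fin.cons_succ, mul_zero,
      sub_zero, norm_mul, norm_real, norm_norm] at h1
    rw [(hb.hasFDerivAt_timeDeriv m s (norm_pos_iff.1 hl0)).fderiv] at h1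
    have h2 := mul_le_mul_of_nonneg_right hl.1
      (norm_nonneg (angleDeriv b m s l (EuclideanSpace.single j 1)))
    linarith
  refine opNorm_le_bound _ (mul_nonneg (sum_nonneg fun j _ => by
    have := hC0 j; positivity) (by positivity)) fun v => ?_
  have hv : v = ∑ j, v j • EuclideanSpace.single j (1 : ℝ) := by
    ext i
    simp [PiLp.smul_apply, Finset.sum_apply, Pi.single_apply]
  conv_lhs => rw [hv]
  rw [map_sum, sum_mul, sum_mul]
  refine norm_sum_le_of_le _ fun j _ => ?_
  rw [map_smul, norm_smul, mul_comm]
  exact mul_le_mul (hj j) (PiLp.norm_apply_le v j) (norm_nonneg _) (by have := hC0 j; positivity)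

theorem integrable_timeDeriv (hb : IsHomTestFn lam ε n b) (hlam : 0 < lam) (hε : 0 < ε) (m : ℕ) {l :
    Space3} (hl : ‖l‖ ∈ Icc (1 / 2 : ℝ) 2) : Integrable fun s => timeDeriv b m s l := by
  obtain ⟨C, hC0, hC⟩ := hb.exists_bound hlam hε m
  have hl0 : l ≠ 0 := norm_pos_iff.1 (by have := hl.1; linarith)
  exact ((integrable_wt_rpow hlam (by linarith : 1 < 1 + ε)).const_mul C).mono'
    (hb.continuous_timeDeriv m hl0).aestronglyMeasurable (.of_forall fun s => hC s l hl)

theorem timeFourier_timeDeriv_succ (hb : IsHomTestFn lam ε n b) (hlam : 0 < lam) (hε : 0 < ε) (m :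
    ℕ) (u : ℝ) {l : Space3} (hl : ‖l‖ ∈ Icc (1 / 2 : ℝ) 2) : timeFourier (timeDeriv b (m + 1)) u l =
    -(I * u) * timeFourier (timeDeriv b m) u l := by
  have hl0 : l ≠ 0 := norm_pos_iff.1 (by have := hl.1; linarith)
  have he : Continuous fun s : ℝ => exp (I * u * s) := by fun_prop
  have hne : ∀ s : ℝ, ‖exp (I * u * s)‖ = 1 := fun s => by
    rw [show I * u * s = (u * s : ℝ) * I by push_cast; ring]
    exact norm_exp_ofReal_mul_I _
  have hi : ∀ m, Integrable fun s : ℝ => exp (I * u * s) * timeDeriv b m s l := by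
    intro m
    exact (hb.integrable_timeDeriv hlam hε m hl).bdd_mul he.aestronglyMeasurable (c := 1)
      (.of_forall fun s => (hne s).le)
  have hd : ∀ s : ℝ, HasDerivAt (fun s : ℝ => exp (I * u * s)) (I * u * exp (I * u * s)) s := by
    intro s
    have := ((hasDerivAt_id (s : ℂ)).const_mul (I * u)).cexp.comp_ofReal
    refine this.congr_deriv ?_
    simp only [id, mul_one]; ring
  have h0 := (hi m).const_mul (I * u)
  have h1 := integral_mul_deriv_eq_deriv_mul_of_integrable (fun s _ => hd s)
    (fun s _ => hb.hasDerivAt_timeDeriv m s hl0) (hi (m + 1))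
    (h0.congr (.of_forall fun s => (mul_assoc _ _ _).symm)) (hi m)
  rw [timeFourier, timeFourier, h1]
  have h2 : ∫ s : ℝ, I * u * exp (I * u * s) * timeDeriv b m s l =
      I * u * ∫ s : ℝ, exp (I * u * s) * timeDeriv b m s l := by
    rw [← integral_const_mul]; simp only [mul_assoc]
  rw [h2]; ring

theorem timeFourier_timeDeriv (hb : IsHomTestFn lam ε n b) (hlam : 0 < lam) (hε : 0 < ε) (m : ℕ) (u
    : ℝ) {l : Space3} (hl : ‖l‖ ∈ Icc (1 / 2 : ℝ) 2) : timeFourier (timeDeriv b m) u l = (-(I * u))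
    ^ m * timeFourier b u l := by
  induction m with
  | zero => simp [timeDeriv]; rfl
  | succ m ih => rw [hb.timeFourier_timeDeriv_succ hlam hε m u hl, ih]; ring

theorem exists_norm_timeFourier_le (hb : IsHomTestFn lam ε n b) (hlam : 0 < lam) (hε : 0 < ε) (m :
    ℕ) : ∃ C, 0 ≤ C ∧ ∀ (u : ℝ) (l : Space3), ‖l‖ ∈ Icc (1 / 2 : ℝ) 2 → ‖timeFourier (timeDeriv b m)
    u l‖ ≤ C := by
  obtain ⟨C, hC0, hC⟩ := hb.exists_bound hlam hε m
  refine ⟨‖(2 * π : ℂ)⁻¹‖ * ∫ s, C * wt lam s ^ (-(1 + ε)), mul_nonneg (norm_nonneg _)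
    (integral_nonneg fun s => mul_nonneg hC0 (rpow_nonneg (wt_pos hlam s).le _)),
    fun u l hl => ?_⟩
  rw [timeFourier, norm_mul]
  refine mul_le_mul_of_nonneg_left (norm_integral_le_of_norm_le
    ((integrable_wt_rpow hlam (by linarith : 1 < 1 + ε)).const_mul C)
    (.of_forall fun s => ?_)) (norm_nonneg _)
  rw [norm_mul, show I * u * s = (u * s : ℝ) * I by push_cast; ring,
    norm_exp_ofReal_mul_I, one_mul]
  exact hC s l hl

theorem hasFDerivAt_timeFourier (hb : IsHomTestFn lam ε n b) (hlam : 0 < lam) (hε : 0 < ε) (m : ℕ)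
    (u : ℝ) {l : Space3} (hl : ‖l‖ = 1) : HasFDerivAt (fun l => timeFourier (timeDeriv b m) u l) ((2
    * π : ℂ)⁻¹ • ∫ s : ℝ, exp (I * u * s) • angleDeriv b m s l) l := by
  obtain ⟨C, hC0, hC⟩ := hb.exists_bound_angleDeriv hlam hε m
  have hball : ∀ l' ∈ ball l (1 / 2), ‖l'‖ ∈ Icc (1 / 2 : ℝ) 2 := by
    intro l' hl'
    rw [mem_ball_iff_norm] at hl'
    have h1 := norm_sub_norm_le l l'
    have h2 := norm_sub_norm_le l' l
    rw [norm_sub_rev, hl] at h1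
    rw [hl] at h2
    constructor <;> linarith
  have hn0 : ∀ l' ∈ ball l (1 / 2), l' ≠ 0 := fun l' h =>
    norm_pos_iff.1 (by have := (hball l' h).1; linarith)
  have hll : l ∈ ball l (1 / 2) := Metric.mem_ball_self (by norm_num)
  have he : Continuous fun s : ℝ => exp (I * u * s) := by fun_prop
  have hne : ∀ s : ℝ, ‖exp (I * u * s)‖ = 1 := fun s => by
    rw [show I * u * s = (u * s : ℝ) * I by push_cast; ring]
    exact norm_exp_ofReal_mul_I _
  refine HasFDerivAt.const_mul ?_ _
  refine hasFDerivAt_integral_of_dominated_of_fderiv_le (s := ball l (1 / 2))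
    (bound := fun s => C * wt lam s ^ (-(1 + ε)))
    (F := fun l (s : ℝ) => exp (I * u * s) * timeDeriv b m s l)
    (F' := fun l (s : ℝ) => exp (I * u * s) • angleDeriv b m s l)
    (Metric.ball_mem_nhds l (by norm_num)) ?_ ?_ ?_ ?_
    ((integrable_wt_rpow hlam (by linarith : 1 < 1 + ε)).const_mul C) ?_
  · filter_upwards [Metric.ball_mem_nhds l (by norm_num : (0 : ℝ) < 1 / 2)] with l' hl'
    exact (he.mul (hb.continuous_timeDeriv m (hn0 l' hl'))).aestronglyMeasurable
  · exact (hb.integrable_timeDeriv hlam hε m (hball l hll)).bdd_mul he.aestronglyMeasurable (c := 1)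
      (.of_forall fun s => (hne s).le)
  · have := (hb.continuousOn_angleDeriv m).comp_continuous
      (by fun_prop : Continuous fun s : ℝ => (s, l)) fun s => hn0 l hll
    exact (he.smul this).aestronglyMeasurable
  · refine .of_forall fun s l' hl' => ?_
    rw [norm_smul, hne, one_mul]
    exact hC s l' (hball l' hl')
  · refine .of_forall fun s l' hl' => ?_
    exact (hb.hasFDerivAt_timeDeriv m s (hn0 l' hl')).const_mul _

theorem exists_norm_fderiv_timeFourier_le (hb : IsHomTestFn lam ε n b) (hlam : 0 < lam) (hε : 0 < ε)
    (m : ℕ) : ∃ C, 0 ≤ C ∧ ∀ (u : ℝ) (l : Space3), ‖l‖ = 1 → ‖fderiv ℝ (fun l => timeFourier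
    (timeDeriv b m) u l) l‖ ≤ C := by
  obtain ⟨C, hC0, hC⟩ := hb.exists_bound_angleDeriv hlam hε m
  refine ⟨‖(2 * π : ℂ)⁻¹‖ * ∫ s, C * wt lam s ^ (-(1 + ε)), mul_nonneg (norm_nonneg _)
    (integral_nonneg fun s => mul_nonneg hC0 (rpow_nonneg (wt_pos hlam s).le _)),
    fun u l hl => ?_⟩
  rw [(hb.hasFDerivAt_timeFourier hlam hε m u hl).fderiv, norm_smul]
  refine mul_le_mul_of_nonneg_left (norm_integral_le_of_norm_le
    ((integrable_wt_rpow hlam (by linarith : 1 < 1 + ε)).const_mul C)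
    (.of_forall fun s => ?_)) (norm_nonneg _)
  rw [norm_smul, show I * u * s = (u * s : ℝ) * I by push_cast; ring,
    norm_exp_ofReal_mul_I, one_mul]
  exact hC s l (by rw [hl]; norm_num)

theorem continuousOn_fderiv_timeFourier (hb : IsHomTestFn lam ε n b) (hlam : 0 < lam) (hε : 0 < ε)
    (m : ℕ) (u : ℝ) : ContinuousOn (fderiv ℝ fun l => timeFourier (timeDeriv b m) u l)
    (Metric.sphere 0 1) := by
  obtain ⟨C, hC0, hC⟩ := hb.exists_bound_angleDeriv hlam hε m
  have h1 : ContinuousOn (fun l => (2 * π : ℂ)⁻¹ • ∫ s : ℝ,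
      exp (I * u * s) • angleDeriv b m s l) (Metric.sphere 0 1) := by
    suffices h0 : ContinuousOn (fun l => ∫ s : ℝ,
        exp (I * u * s) • angleDeriv b m s l) (Metric.sphere 0 1) from
      h0.const_smul (2 * π : ℂ)⁻¹
    have he : Continuous fun s : ℝ => exp (I * u * s) := by fun_prop
    refine continuousOn_of_dominated (bound := fun s => C * wt lam s ^ (-(1 + ε)))
      (fun l hl => ?_) (fun l hl => .of_forall fun s => ?_)
      ((integrable_wt_rpow hlam (by linarith : 1 < 1 + ε)).const_mul C)
      (.of_forall fun s => ?_)
    · have := (hb.continuousOn_angleDeriv m).comp_continuous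
        (by fun_prop : Continuous fun s : ℝ => (s, l)) fun s => coe_sphere_ne_zero ⟨l, hl⟩
      exact (he.smul this).aestronglyMeasurable
    · rw [norm_smul, show I * u * s = (u * s : ℝ) * I by push_cast; ring,
        norm_exp_ofReal_mul_I, one_mul]
      exact hC s l (by rw [mem_sphere_zero_iff_norm.1 hl]; norm_num)
    · have hc : Continuous fun l : Space3 => (s, l) := by fun_prop
      have h0 : ContinuousOn (fun l => angleDeriv b m s l) (Metric.sphere 0 1) :=
        (hb.continuousOn_angleDeriv m).comp hc.continuousOn fun l hl => coe_sphere_ne_zero ⟨l, hl⟩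
      exact h0.const_smul (exp (I * u * s))
  refine h1.congr fun l hl => ?_
  exact (hb.hasFDerivAt_timeFourier hlam hε m u (mem_sphere_zero_iff_norm.1 hl)).fderiv

theorem timeFourier_thirdDeriv (hb : IsHomTestFn lam ε n b) (hlam : 0 < lam) (hε : 0 < ε) (u : ℝ) {l
    : Space3} (hl : ‖l‖ ∈ Icc (1 / 2 : ℝ) 2) : timeFourier (thirdDeriv b) u l = (-(I * u)) ^ 3 *
    timeFourier b u l :=
  hb.timeFourier_timeDeriv hlam hε 3 u hl

theorem norm_neg_I_mul (u : ℝ) : ‖-(I * u)‖ = |u| := by simp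

/-- The Fourier transforms of the third derivatives on the sphere. -/
theorem exists_sphereC1 (hb : IsHomTestFn lam ε n b) (hlam : 0 < lam) (hε : 0 < ε) : ∃ C, 0 ≤ C ∧ ∀
    u : ℝ, 0 < u → SphereC1 (fun l => timeFourier (thirdDeriv b) u l) (C * sqrt u) := by
  obtain ⟨C1, h1, hC1⟩ := hb.exists_norm_timeFourier_le hlam hε 0
  obtain ⟨C2, h2, hC2⟩ := hb.exists_norm_timeFourier_le hlam hε 3
  obtain ⟨C3, h3, hC3⟩ := hb.exists_norm_fderiv_timeFourier_le hlam hε 0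
  obtain ⟨C4, h4, hC4⟩ := hb.exists_norm_fderiv_timeFourier_le hlam hε 3
  have hI : ∀ l : Space3, ‖l‖ = 1 → ‖l‖ ∈ Icc (1 / 2 : ℝ) 2 := fun l hl => by
    rw [hl]; norm_num
  have hb0 : timeDeriv b 0 = b := by ext s l; simp [timeDeriv]
  rw [hb0] at hC1 hC3
  have key : ∀ u x A B C : ℝ, 0 < u → 0 ≤ A → 0 ≤ B → x ≤ u ^ 3 * A → x ≤ B → A + B ≤ C →
      x ≤ C * sqrt u := by
    intro u x A B C hu hA hB h1 h2 h3
    rcases le_total u 1 with h | h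
    · have h5 : u ^ 3 ≤ u := pow_le_of_le_one hu.le h (by norm_num)
      have h4 : u ≤ sqrt u := Real.le_sqrt_of_sq_le (by nlinarith)
      nlinarith [Real.sqrt_nonneg u]
    · have h4 : 1 ≤ sqrt u := one_le_sqrt.2 h
      nlinarith
  refine ⟨C1 + C2 + C3 + C4, by positivity, fun u hu => ⟨fun l hl =>
    (hb.hasFDerivAt_timeFourier hlam hε 3 u hl).differentiableAt,
    hb.continuousOn_fderiv_timeFourier hlam hε 3 u, fun l hl => ?_, fun l v hl hv _ => ?_⟩⟩
  · refine key u _ C1 C2 _ hu h1 h2 ?_ (hC2 u l (hI l hl)) (by linarith)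
    rw [hb.timeFourier_thirdDeriv hlam hε u (hI l hl), norm_mul, norm_pow, norm_neg_I_mul,
      abs_of_pos hu]
    exact mul_le_mul_of_nonneg_left (hC1 u l (hI l hl)) (by positivity)
  · refine (le_opNorm _ v).trans ?_
    rw [hv, mul_one]
    refine key u _ C3 C4 _ hu h3 h4 ?_ (hC4 u l hl) (by linarith)
    have he : (fun l => timeFourier (thirdDeriv b) u l) =ᶠ[𝓝 l]
        fun l => (-(I * u)) ^ 3 * timeFourier b u l := by
      have : ∀ᶠ l' in 𝓝 l, ‖l'‖ ∈ Icc (1 / 2 : ℝ) 2 := by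
        refine continuous_norm.continuousAt.preimage_mem_nhds (Icc_mem_nhds ?_ ?_) <;>
          rw [hl] <;> norm_num
      filter_upwards [this] with l' hl'
      exact hb.timeFourier_thirdDeriv hlam hε u hl'
    have h5 := hb.hasFDerivAt_timeFourier hlam hε 0 u hl
    rw [hb0] at h5
    rw [he.fderiv_eq, fderiv_const_mul h5.differentiableAt, norm_smul, norm_pow, norm_neg_I_mul,
      abs_of_pos hu]
    exact mul_le_mul_of_nonneg_left (hC3 u l hl) (by positivity)

/-- Homogeneity of the Fourier transform. -/
theorem timeFourier_smul (hb : IsHomTestFn lam ε 1 b) (hlam : 0 < lam) (hε : 0 < ε) {γ : ℝ} (hγ : 0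
    < γ) {l : Space3} (hl : ‖l‖ = 1) : timeFourier (thirdDeriv b) 1 (γ • l) = (γ : ℂ)⁻¹ *
    timeFourier (thirdDeriv b) γ l := by
  have hl0 : l ≠ 0 := norm_pos_iff.1 (by rw [hl]; exact one_pos)
  have hγ' : (γ : ℂ) ≠ 0 := by exact_mod_cast hγ.ne'
  have h1 : (fun s => b s (γ • l)) = fun s => (γ : ℂ) * b (γ⁻¹ * s) l := by
    ext s
    have := hb.homogeneous γ hγ (γ⁻¹ * s) l hl0
    rwa [mul_inv_cancel_left₀ hγ.ne', zpow_one] at this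
  have hsm : ContDiff ℝ ∞ fun s => b s l := by
    have := hb.smooth.comp_contDiff (f := fun s : ℝ => (s, l)) (by fun_prop) fun s => hl0
    exact this
  have h2 : ∀ s, thirdDeriv b s (γ • l) = (γ : ℂ) * ((γ⁻¹ : ℝ) ^ 3 • thirdDeriv b (γ⁻¹ * s) l) := by
    intro s
    have hs3 : ContDiff ℝ 3 fun s => b s l := contDiff_infty.1 hsm 3
    have h3 := congrFun (iteratedDeriv_comp_const_smul (f := fun s => b s l) (n := 3) hs3 γ⁻¹) s
    rw [thirdDeriv, h1]
    change iteratedDeriv 3 ((γ : ℂ) • fun s => b (γ⁻¹ * s) l) s = _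
    rw [iteratedDeriv_const_smul_field, h3]
    rfl
  rw [timeFourier, timeFourier]
  have h3 := Measure.integral_comp_mul_left (fun s : ℝ => exp (I * γ * s) * thirdDeriv b s l) γ⁻¹
  have h4 : ∫ s : ℝ, exp (I * (1 : ℝ) * s) * thirdDeriv b s (γ • l) =
      (γ : ℂ)⁻¹ ^ 2 * ∫ s : ℝ, exp (I * γ * (γ⁻¹ * s : ℝ)) * thirdDeriv b (γ⁻¹ * s) l := by
    rw [← integral_const_mul]
    refine integral_congr_fun fun s => ?_
    have h5 : I * γ * (γ⁻¹ * s : ℝ) = I * (1 : ℝ) * s := by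
      push_cast
      field_simp
    rw [h2, real_smul, h5]
    push_cast
    field_simp
  rw [h4, h3, inv_inv, abs_of_pos hγ, real_smul]
  field_simp

end IsHomTestFn

/-! ### Amplitudes -/

/-- Measurable functions on the cone which on the sphere are dominated by a function of the time
variable whose integral with weight `(1 + |s|/lam)^q` is at most `A`. -/
structure IsAmplitude (lam q : ℝ) (h : TestFn) (A : ENNReal) : Prop where
  measurable : Measurable fun x : ℝ × S² => h x.1 x.2
  exists_majorant : ∃ m : ℝ → ENNReal, Measurable m ∧ (∀ s (l : S²), ‖h s l‖ₑ ≤ m s) ∧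
    ∫⁻ s, ofReal (wt lam s ^ q) * m s ≤ A

/-- The part of `f₊` of energies around `2^(-k)`. -/
def dyadicPart (f : TestFn) (k : ℤ) (s : ℝ) (l : Space3) : ℂ :=
  ∫ u : ℝ, cutoff (2 ^ k * u) * timeFourier f u l * exp (-(I * u * s))

theorem norm_exp_neg_I_mul (u s : ℝ) : ‖exp (-(I * u * s))‖ = 1 := by
  rw [show -(I * u * s) = (-(u * s) : ℝ) * I by push_cast; ring]
  exact norm_exp_ofReal_mul_I _

theorem norm_exp_I_mul (u s : ℝ) : ‖exp (I * u * s)‖ = 1 := by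
  rw [show I * u * s = (u * s : ℝ) * I by push_cast; ring]
  exact norm_exp_ofReal_mul_I _

theorem norm_sphere_mem (l : S²) : ‖(l : Space3)‖ ∈ Icc (1 / 2 : ℝ) 2 := by
  rw [norm_eq_of_mem_sphere l]; norm_num

theorem continuous_cutoffPow (n : ℤ) : Continuous (cutoffPow n) := (contDiff_cutoffPow n).continuous

theorem integrable_cutoffPow (n : ℤ) {a : ℝ} (ha : 0 < a) : Integrable fun v => cutoffPow n (a * v)
    :=
  ((continuous_cutoffPow n).integrable_of_hasCompactSupport
    (hasCompactSupport_cutoffPow n)).comp_mul_left' ha.ne'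

theorem dyadicKernel_div (n : ℤ) {a : ℝ} (ha : 0 < a) (s : ℝ) : dyadicKernel n (a⁻¹ * s) = (2 * π :
    ℂ)⁻¹ * a * ∫ v : ℝ, cutoffPow n (a * v) * exp (-(I * v * s)) := by
  rw [dyadicKernel, mul_assoc]
  congr 1
  have h := Measure.integral_comp_mul_left (fun u : ℝ => cutoffPow n u *
    exp (-(I * u * (a⁻¹ * s : ℝ)))) a
  have ha' : (a : ℂ) ≠ 0 := by exact_mod_cast ha.ne'
  have h2 : ∫ v : ℝ, cutoffPow n (a * v) * exp (-(I * v * s)) =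
      ∫ v : ℝ, cutoffPow n (a * v) * exp (-(I * (a * v : ℝ) * (a⁻¹ * s : ℝ))) := by
    refine integral_congr_fun fun v => ?_
    congr 3
    push_cast
    field_simp
  rw [h2, h, real_smul, abs_of_pos (inv_pos.2 ha), ← mul_assoc, Complex.ofReal_inv,
    mul_inv_cancel₀ ha', one_mul]

namespace IsHomTestFn

variable {lam ε : ℝ} {n : ℤ} {b : TestFn}

theorem dyadicPart_eq (hb : IsHomTestFn lam ε n b) (hlam : 0 < lam) (hε : 0 < ε) (j : ℕ) (k : ℤ) (s
    : ℝ) {l : Space3} (hl : ‖l‖ ∈ Icc (1 / 2 : ℝ) 2) : dyadicPart (thirdDeriv b) k s l = ((2 : ℂ) ^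
    k) ^ ((j : ℤ) - 3) * ((2 : ℂ) ^ k)⁻¹ * ∫ s' : ℝ, dyadicKernel (3 - j) ((2 ^ k : ℝ)⁻¹ * (s - s'))
    * timeDeriv b j s' l := by
  have hl0 : l ≠ 0 := norm_pos_iff.1 (by have := hl.1; linarith)
  set a : ℝ := 2 ^ k with ha
  have ha0 : 0 < a := by positivity
  have hac : ((2 : ℂ) ^ k) = (a : ℂ) := by rw [ha]; push_cast; rfl
  have ha' : (a : ℂ) ≠ 0 := by exact_mod_cast ha0.ne'
  have hpi : (π : ℂ) ≠ 0 := by exact_mod_cast pi_ne_zero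
  rw [hac]
  have h1 : ∀ s', dyadicKernel (3 - j) (a⁻¹ * (s - s')) * timeDeriv b j s' l =
      (2 * π : ℂ)⁻¹ * a * ∫ v : ℝ, cutoffPow (3 - j) (a * v) *
        exp (-(I * v * s)) * (exp (I * v * s') *
        timeDeriv b j s' l) := by
    intro s'
    rw [dyadicKernel_div _ ha0, mul_assoc ((2 * π : ℂ)⁻¹ * a), ← integral_mul_const]
    congr 1
    refine integral_congr_fun fun v => ?_
    have h2 : exp (-(I * v * (s - s' : ℝ))) = exp (-(I * v * s)) * exp (I * v * s') := by
      rw [← exp_add]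
      congr 1
      push_cast
      ring
    rw [h2]
    ring
  simp_rw [h1]
  rw [integral_const_mul, integral_integral_swap]
  · have h2 : ∀ v : ℝ, ∫ s' : ℝ, cutoffPow (3 - j) (a * v) * exp (-(I * v * s)) *
        (exp (I * v * s') * timeDeriv b j s' l) =
        (2 * π : ℂ) * (a : ℂ) ^ (3 - j : ℤ) *
        (cutoff (a * v) * timeFourier (thirdDeriv b) v l * exp (-(I * v * s))) := by
      intro v
      rw [integral_const_mul]
      have h3 : ∫ s' : ℝ, exp (I * v * s') * timeDeriv b j s' l =
          (2 * π : ℂ) * timeFourier (timeDeriv b j) v l := by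
        rw [timeFourier, mul_inv_cancel_left₀]
        exact mul_ne_zero two_ne_zero hpi
      rw [h3, hb.timeFourier_timeDeriv hlam hε j v hl, hb.timeFourier_thirdDeriv hlam hε v hl]
      by_cases hv : cutoff (a * v) = 0
      · simp [cutoffPow, hv]
      · have hv0 : v ≠ 0 := by
          rintro rfl
          rw [mul_zero] at hv
          exact hv (cutoff_of_le (by norm_num))
        have hv' : -(I * (v : ℂ)) ≠ 0 :=
          neg_ne_zero.2 (mul_ne_zero I_ne_zero (by exact_mod_cast hv0))
        have h4 : cutoffPow (3 - j) (a * v) = cutoff (a * v) * ((a : ℂ) ^ (3 - j : ℤ) *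
            (-(I * v)) ^ (3 - j : ℤ)) := by
          rw [cutoffPow, ← mul_zpow]
          congr 2
          push_cast; ring
        have h5 : (-(I * (v : ℂ))) ^ (3 : ℕ) = (-(I * v)) ^ (3 - j : ℤ) * (-(I * v)) ^ j := by
          rw [← zpow_natCast _ j, ← zpow_add₀ hv', sub_add_cancel]
          rfl
        rw [h4, h5]
        ring
    simp_rw [h2]
    rw [integral_const_mul, dyadicPart]
    have h6 : (a : ℂ) ^ ((j : ℤ) - 3) * (a : ℂ) ^ (3 - (j : ℤ)) = 1 := by
      rw [← zpow_add₀ ha']; simp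
    have h7 : ∀ X : ℂ, (a : ℂ) ^ ((j : ℤ) - 3) * (a : ℂ)⁻¹ * ((2 * π : ℂ)⁻¹ * a *
        (2 * π * (a : ℂ) ^ (3 - (j : ℤ)) * X)) = X := by
      intro X
      calc _ = ((a : ℂ) ^ ((j : ℤ) - 3) * (a : ℂ) ^ (3 - (j : ℤ))) * X * ((a : ℂ)⁻¹ * a) *
            ((2 * π : ℂ)⁻¹ * (2 * π)) := by ring
        _ = X := by
          rw [h6, inv_mul_cancel₀ ha', inv_mul_cancel₀ (mul_ne_zero two_ne_zero hpi)]; ring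
    rw [h7]
  · have hi := (hb.integrable_timeDeriv hlam hε j hl).mul_prod (integrable_cutoffPow (3 - j) ha0)
    have hc : Continuous fun z : ℝ × ℝ => exp (-(I * z.2 * s)) * exp (I * z.2 * z.1) := by fun_prop
    refine (hi.bdd_mul hc.aestronglyMeasurable (c := 1) (.of_forall fun z => ?_)).congr
      (.of_forall fun z => ?_)
    · rw [norm_mul, norm_exp_neg_I_mul, norm_exp_I_mul, one_mul]
    · simp only [Function.uncurry]; ring

theorem measurable_timeDeriv (hb : IsHomTestFn lam ε n b) (m : ℕ) : Continuous fun x : ℝ × S² =>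
    timeDeriv b m x.1 x.2 :=
  (hb.continuousOn_timeDeriv m).comp_continuous (f := fun x : ℝ × S² =>
    (x.1, (x.2 : Space3))) (by fun_prop) fun x => coe_sphere_ne_zero x.2

theorem measurable_timeFourier (hb : IsHomTestFn lam ε n b) : Measurable fun x : ℝ × S² =>
    timeFourier (thirdDeriv b) x.1 x.2 := by
  have h1 : Continuous fun z : (ℝ × S²) × ℝ =>
      exp (I * z.1.1 * z.2) * thirdDeriv b z.2 z.1.2 := by
    have := (hb.measurable_timeDeriv 3).comp (by fun_prop : Continuous
      fun z : (ℝ × S²) × ℝ => (z.2, z.1.2))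
    exact (by fun_prop : Continuous fun z : (ℝ × S²) × ℝ =>
      exp (I * z.1.1 * z.2)).mul this
  exact (h1.stronglyMeasurable.integral_prod_right' (ν := volume)).measurable.const_mul _

theorem continuous_timeFourier (hb : IsHomTestFn lam ε n b) (hlam : 0 < lam) (hε : 0 < ε) {l :
    Space3} (hl : ‖l‖ ∈ Icc (1 / 2 : ℝ) 2) : Continuous fun u => timeFourier (thirdDeriv b) u l :=
    by
  have hl0 : l ≠ 0 := norm_pos_iff.1 (by have := hl.1; linarith)
  refine continuous_const.mul (continuous_of_dominated (bound := fun s => ‖timeDeriv b 3 s l‖)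
    (fun u => ?_) (fun u => .of_forall fun s => ?_)
    (hb.integrable_timeDeriv hlam hε 3 hl).norm (.of_forall fun s => by fun_prop))
  · exact ((by fun_prop : Continuous fun s : ℝ => exp (I * u * s)).mul
      (hb.continuous_timeDeriv 3 hl0)).aestronglyMeasurable
  · rw [norm_mul, norm_exp_I_mul, one_mul]; exact le_rfl

theorem exists_norm_timeFourier_thirdDeriv_le (hb : IsHomTestFn lam ε n b) (hlam : 0 < lam) (hε : 0
    < ε) (m : ℕ) : ∃ C, 0 ≤ C ∧ ∀ (u : ℝ) (l : Space3), ‖l‖ ∈ Icc (1 / 2 : ℝ) 2 → |u| ^ m *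
    ‖timeFourier (thirdDeriv b) u l‖ ≤ C := by
  obtain ⟨C, h0, hC⟩ := hb.exists_norm_timeFourier_le hlam hε (m + 3)
  refine ⟨C, h0, fun u l hl => le_trans (le_of_eq ?_) (hC u l hl)⟩
  rw [hb.timeFourier_timeDeriv hlam hε (m + 3) u hl, hb.timeFourier_thirdDeriv hlam hε u hl,
    pow_add, norm_mul, norm_mul, norm_mul, norm_pow, norm_pow, norm_neg_I_mul, mul_assoc]

theorem integrable_timeFourier (hb : IsHomTestFn lam ε n b) (hlam : 0 < lam) (hε : 0 < ε) {l :
    Space3} (hl : ‖l‖ ∈ Icc (1 / 2 : ℝ) 2) : Integrable fun u => timeFourier (thirdDeriv b) u l :=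
    by
  obtain ⟨C, h0, hC⟩ := hb.exists_norm_timeFourier_thirdDeriv_le hlam hε 0
  obtain ⟨C', h0', hC'⟩ := hb.exists_norm_timeFourier_thirdDeriv_le hlam hε 2
  refine (integrable_inv_one_add_sq.const_mul (C + C')).mono'
    (hb.continuous_timeFourier hlam hε hl).aestronglyMeasurable (.of_forall fun u => ?_)
  have h1 := hC u l hl
  have h2 := hC' u l hl
  rw [sq_abs] at h2
  rw [← div_eq_mul_inv, le_div_iff₀ (by positivity)]
  linarith

theorem exists_integral_dyadicPart (hb : IsHomTestFn lam ε n b) (hlam : 0 < lam) (hε : 0 < ε) (k :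
    ℤ) {l : Space3} (hl : ‖l‖ ∈ Icc (1 / 2 : ℝ) 2) : ∃ G : ℝ → ℂ, Integrable G ∧ (∀ v, G v ≠ 0 → v ∈
    Ioo ((2 : ℝ) ^ (-k - 1)) (2 ^ (1 - k))) ∧ ∀ s : ℝ, dyadicPart (thirdDeriv b) k s l = ∫ v : ℝ, G
    v * exp (-(I * v * s)) := by
  have hc : Continuous fun u : ℝ => ((cutoff (2 ^ k * u) : ℝ) : ℂ) :=
    continuous_ofReal.comp (continuous_cutoff.comp (by fun_prop))
  refine ⟨fun v => cutoff (2 ^ k * v) * timeFourier (thirdDeriv b) v l, ?_, fun v hv => ?_,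
    fun s => rfl⟩
  · exact (hb.integrable_timeFourier hlam hε hl).bdd_mul hc.aestronglyMeasurable (c := 1)
      (.of_forall fun u => by simpa using abs_cutoff_le _)
  · have h1 : cutoff (2 ^ k * v) ≠ 0 := by
      intro h; simp [h] at hv
    obtain ⟨h2, h3⟩ := mem_Ioo_of_cutoff_ne_zero h1
    have hp : (0 : ℝ) < 2 ^ k := by positivity
    constructor
    · rw [zpow_sub₀ two_ne_zero, zpow_neg, zpow_one, div_lt_iff₀ two_pos, inv_lt_iff_one_lt_mul₀ hp]
      linarith
    · rw [zpow_sub₀ two_ne_zero, zpow_one, lt_div_iff₀ hp]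
      linarith

theorem measurable_dyadicPart (hb : IsHomTestFn lam ε n b) (k : ℤ) : Measurable fun x : ℝ × S² =>
    dyadicPart (thirdDeriv b) k x.1 x.2 := by
  have hc : Continuous fun u : ℝ => ((cutoff (2 ^ k * u) : ℝ) : ℂ) :=
    continuous_ofReal.comp (continuous_cutoff.comp (by fun_prop))
  have h2 := hb.measurable_timeFourier.comp (by fun_prop : Measurable
    fun z : (ℝ × S²) × ℝ => (z.2, z.1.2))
  have h1 : Measurable fun z : (ℝ × S²) × ℝ =>
      (cutoff (2 ^ k * z.2) : ℂ) * timeFourier (thirdDeriv b) z.2 z.1.2 *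
        exp (-(I * z.2 * z.1.1)) :=
    ((hc.measurable.comp measurable_snd).mul h2).mul (by fun_prop)
  exact (h1.stronglyMeasurable.integral_prod_right' (ν := volume)).measurable

theorem measurable_positivePart (hb : IsHomTestFn lam ε n b) : Measurable fun x : ℝ × S² =>
    positivePart (thirdDeriv b) x.1 x.2 := by
  have h2 := hb.measurable_timeFourier.comp (by fun_prop : Measurable
    fun z : (ℝ × S²) × ℝ => (z.2, z.1.2))
  have h1 : Measurable fun z : (ℝ × S²) × ℝ =>
      timeFourier (thirdDeriv b) z.2 z.1.2 * exp (-(I * z.2 * z.1.1)) :=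
    h2.mul (by fun_prop)
  exact (h1.stronglyMeasurable.integral_prod_right' (ν := volume.restrict (Ioi (0 : ℝ)))).measurable

end IsHomTestFn

theorem cutoff_nonneg (u : ℝ) : 0 ≤ cutoff u := by
  rcases le_total u 1 with h | h
  · rw [cutoff, smoothTransition.zero_of_nonpos (x := u - 1) (by linarith), sub_zero]
    exact smoothTransition.nonneg _
  · rw [cutoff, smoothTransition.one_of_one_le (x := 2 * u - 1) (by linarith), sub_nonneg]
    exact smoothTransition.le_one _

namespace IsAmplitude
variable {lam q q' : ℝ} {h : TestFn} {A A' : ENNReal}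

theorem mono (hh : IsAmplitude lam q h A) (hA : A ≤ A') : IsAmplitude lam q h A' := by
  obtain ⟨h1, m, h2, h3, h4⟩ := hh
  exact ⟨h1, m, h2, h3, h4.trans hA⟩

theorem mono_exponent (hl : 0 < lam) (hh : IsAmplitude lam q' h A) (hq : q ≤ q') : IsAmplitude lam q
    h A := by
  obtain ⟨h1, m, h2, h3, h4⟩ := hh
  refine ⟨h1, m, h2, h3, le_trans (lintegral_mono fun s => ?_) h4⟩
  gcongr
  exact one_le_wt hl s

theorem conj (hh : IsAmplitude lam q h A) : IsAmplitude lam q (fun s l => star (h s l)) A := by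
  obtain ⟨h1, m, h2, h3, h4⟩ := hh
  exact ⟨continuous_conj.measurable.comp h1, m, h2, fun s l => by simpa using h3 s l, h4⟩

theorem indicator (hh : IsAmplitude lam q h A) {S : Set ℝ} (hS : MeasurableSet S) : IsAmplitude lam
    q (fun s l => S.indicator (fun s => h s l) s) A := by
  obtain ⟨h1, m, h2, h3, h4⟩ := hh
  refine ⟨?_, m, h2, fun s l => ?_, h4⟩
  · have : (fun x : ℝ × S² => S.indicator (fun s => h s x.2) x.1) =
      (Prod.fst ⁻¹' S).indicator fun x : ℝ × S² => h x.1 x.2 := rfl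
    rw [this]
    exact h1.indicator (measurable_fst hS)
  · by_cases hs : s ∈ S <;> simp [hs, h3]

/-- Amplitudes restricted to large times are small. -/
theorem indicator_tail (hl : 0 < lam) (hh : IsAmplitude lam q' h A) (hq : q ≤ q') {d : ℝ} (hd : 0 ≤
    d) : IsAmplitude lam q (fun s l => {s | d < |s|}.indicator (fun s => h s l) s) (ofReal (wt lam d
    ^ (q - q')) * A) := by
  obtain ⟨h1, m, h2, h3, h4⟩ := hh
  have hS : MeasurableSet {s : ℝ | d < |s|} :=
    measurableSet_lt measurable_const continuous_abs.measurable
  refine ⟨?_, {s : ℝ | d < |s|}.indicator m, h2.indicator hS, fun s l => ?_, ?_⟩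
  · have : (fun x : ℝ × S² =>
      {s | d < |s|}.indicator (fun s => h s x.2) x.1) =
      (Prod.fst ⁻¹' {s : ℝ | d < |s|}).indicator fun x : ℝ × S² => h x.1 x.2 := rfl
    rw [this]
    exact h1.indicator (measurable_fst hS)
  · by_cases hs : s ∈ {s : ℝ | d < |s|}
    · rw [indicator_of_mem hs, indicator_of_mem hs]; exact h3 s l
    · rw [indicator_of_notMem hs, indicator_of_notMem hs]; simp
  · calc _ ≤ ∫⁻ s, ofReal (wt lam d ^ (q - q')) * (ofReal (wt lam s ^ q') * m s) := by
          refine lintegral_mono fun s => ?_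
          by_cases hs : s ∈ {s : ℝ | d < |s|}
          · rw [indicator_of_mem hs, ← mul_assoc, ← ofReal_mul (rpow_nonneg (wt_pos hl d).le _)]
            gcongr
            have h5 : wt lam s ^ q = wt lam s ^ (q - q') * wt lam s ^ q' := by
              rw [← rpow_add (wt_pos hl s)]; congr 1; ring
            rw [h5]
            refine mul_le_mul_of_nonneg_right ?_ (rpow_nonneg (wt_pos hl s).le _)
            refine Real.rpow_le_rpow_of_nonpos (wt_pos hl d) ?_ (by linarith)
            have hs' : d < |s| := hs
            rw [wt, wt, abs_of_nonneg hd]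
            gcongr
          · rw [indicator_of_notMem hs]; simp
      _ = ofReal (wt lam d ^ (q - q')) * ∫⁻ s, ofReal (wt lam s ^ q') * m s := by
          rw [lintegral_const_mul]
          exact ((continuous_wt_rpow hl q').measurable.ennreal_ofReal).mul h2
      _ ≤ _ := by gcongr

/-- The sum of a series of amplitudes. -/
theorem hasSum {ι : Type*} [Countable ι] {f : ι → TestFn} {a : ι → ENNReal} (hl : 0 < lam) (hf : ∀
    k, IsAmplitude lam q (f k) (a k)) (hm : Measurable fun x : ℝ × S² => h x.1 x.2) (hs : ∀ s (l :
    S²), HasSum (fun k => f k s l) (h s l)) : IsAmplitude lam q h (∑' k, a k) := by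
  choose m h2 h3 h4 using fun k => (hf k).exists_majorant
  refine ⟨hm, fun s => ∑' k, m k s, Measurable.tsum h2, fun s l => ?_, ?_⟩
  · rw [← (hs s l).tsum_eq]
    exact (enorm_tsum_le_tsum_enorm).trans (ENNReal.tsum_le_tsum fun k => h3 k s l)
  · have : ∀ s, ofReal (wt lam s ^ q) * ∑' k, m k s =
        ∑' k, ofReal (wt lam s ^ q) * m k s := fun s => ENNReal.tsum_mul_left.symm
    simp_rw [this]
    have h5 : ∀ k, Measurable fun s => ofReal (wt lam s ^ q) * m k s := fun k =>
      ((continuous_wt_rpow hl q).measurable.ennreal_ofReal).mul (h2 k)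
    rw [lintegral_tsum fun k => (h5 k).aemeasurable]
    exact ENNReal.tsum_le_tsum fun k => h4 k

end IsAmplitude

theorem lintegral_convolution_weight {lam q : ℝ} (hl : 0 < lam) (hq : 0 ≤ q) {φ m : ℝ → ENNReal} (hφ
    : Measurable φ) (hm : Measurable m) : ∫⁻ s, ofReal (wt lam s ^ q) * ∫⁻ s', φ (s - s') * m s' ≤
    (∫⁻ v, ofReal (wt lam v ^ q) * φ v) * ∫⁻ s', ofReal (wt lam s' ^ q) * m s' := by
  have hW : Measurable fun s => ofReal (wt lam s ^ q) :=
    (continuous_wt_rpow hl q).measurable.ennreal_ofReal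
  calc _ = ∫⁻ s, ∫⁻ s', ofReal (wt lam s ^ q) * (φ (s - s') * m s') := by
        refine lintegral_congr fun s => ?_
        rw [lintegral_const_mul]
        exact (hφ.comp (by fun_prop)).mul hm
    _ = ∫⁻ s', ∫⁻ s, ofReal (wt lam s ^ q) * (φ (s - s') * m s') := by
        refine lintegral_lintegral_swap (Measurable.aemeasurable ?_)
        exact (hW.comp measurable_fst).mul ((hφ.comp (by fun_prop : Measurable
          fun z : ℝ × ℝ => z.1 - z.2)).mul (hm.comp measurable_snd))
    _ ≤ ∫⁻ s', ∫⁻ s, (ofReal (wt lam (s - s') ^ q) * φ (s - s')) *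
          (ofReal (wt lam s' ^ q) * m s') := by
        refine lintegral_mono fun s' => lintegral_mono fun s => ?_
        have h := wt_rpow_add_le hl hq (s - s') s'
        rw [sub_add_cancel] at h
        calc _ ≤ ofReal (wt lam (s - s') ^ q * wt lam s' ^ q) * (φ (s - s') * m s') := by
              gcongr
          _ = _ := by
            rw [ofReal_mul (rpow_nonneg (wt_pos hl _).le _)]; ring
    _ = ∫⁻ s', (∫⁻ v, ofReal (wt lam v ^ q) * φ v) * (ofReal (wt lam s' ^ q) * m s') := by
        refine lintegral_congr fun s' => ?_
        have h5 : Measurable fun s => ofReal (wt lam (s - s') ^ q) * φ (s - s') :=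
          (hW.mul hφ).comp (by fun_prop : Measurable fun s : ℝ => s - s')
        rw [lintegral_mul_const _ h5,
          lintegral_sub_right_eq_self (fun v => ofReal (wt lam v ^ q) * φ v) s']
    _ = _ := lintegral_const_mul _ (hW.mul hm)

theorem lintegral_weight_dyadicKernel {lam q : ℝ} (hl : 0 < lam) (hq : 0 ≤ q) (hq3 : q ≤ 3) (n : ℤ)
    : ∃ K : ℝ, 0 ≤ K ∧ ∀ a : ℝ, 0 < a → ∫⁻ v, ofReal (wt lam v ^ q) * (ofReal a⁻¹ * ‖dyadicKernel n
    (a⁻¹ * v)‖ₑ) ≤ ofReal (K * max 1 a ^ q) := by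
  have hi := integrable_dyadicKernel_weight n 3 (a := lam⁻¹) (by positivity)
  have hnn : ∀ v : ℝ, 0 ≤ (1 + lam⁻¹ * |v|) ^ 3 * ‖dyadicKernel n v‖ := fun v => by positivity
  refine ⟨∫ v, (1 + lam⁻¹ * |v|) ^ 3 * ‖dyadicKernel n v‖, integral_nonneg hnn, fun a ha => ?_⟩
  have h1 : ∀ v : ℝ, wt lam (a * v) ^ q ≤ max 1 a ^ q * (1 + lam⁻¹ * |v|) ^ 3 := by
    intro v
    have h2 : wt lam (a * v) ≤ max 1 a * wt lam v := by
      have a1 : (1 : ℝ) ≤ max 1 a := le_max_left _ _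
      have a2 : a * (|v| / lam) ≤ max 1 a * (|v| / lam) :=
        mul_le_mul_of_nonneg_right (le_max_right _ _) (by positivity)
      rw [wt, wt, abs_mul, abs_of_pos ha, mul_div_assoc, mul_add]
      linarith
    calc wt lam (a * v) ^ q ≤ (max 1 a * wt lam v) ^ q :=
          rpow_le_rpow (wt_pos hl _).le h2 hq
      _ = max 1 a ^ q * wt lam v ^ q := mul_rpow (by positivity) (wt_pos hl _).le
      _ ≤ max 1 a ^ q * wt lam v ^ (3 : ℝ) := by
          gcongr
          exact one_le_wt hl v
      _ = _ := by
          rw [show (3 : ℝ) = (3 : ℕ) by norm_num, rpow_natCast, wt, div_eq_inv_mul]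
  have hWm : Measurable fun s => ofReal (wt lam s ^ q) :=
    (continuous_wt_rpow hl q).measurable.ennreal_ofReal
  have hφm := (continuous_dyadicKernel n).enorm.measurable
  have h3 : ∫⁻ v, ofReal (wt lam v ^ q) * (ofReal a⁻¹ * ‖dyadicKernel n (a⁻¹ * v)‖ₑ)
      = ∫⁻ v, ofReal (wt lam (a * v) ^ q) * ‖dyadicKernel n v‖ₑ := by
    have hG : Measurable fun v => ofReal (wt lam (a * v) ^ q) * ‖dyadicKernel n v‖ₑ :=
      (hWm.comp (by fun_prop)).mul hφm
    have h4 := lintegral_map hG (by fun_prop : Measurable fun v : ℝ => a⁻¹ * v) (μ := volume)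
    rw [Real.map_volume_mul_left (inv_pos.2 ha).ne', lintegral_smul_measure, inv_inv,
      abs_of_pos ha] at h4
    have h5 : ∀ v, ofReal (wt lam v ^ q) * (ofReal a⁻¹ *
        ‖dyadicKernel n (a⁻¹ * v)‖ₑ) = ofReal a⁻¹ * (ofReal
        (wt lam (a * (a⁻¹ * v)) ^ q) * ‖dyadicKernel n (a⁻¹ * v)‖ₑ) := by
      intro v
      rw [mul_inv_cancel_left₀ ha.ne']; ring
    simp_rw [h5]
    rw [lintegral_const_mul' _ _ ofReal_ne_top, ← h4, smul_eq_mul, ← mul_assoc,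
      ← ofReal_mul (inv_pos.2 ha).le, inv_mul_cancel₀ ha.ne', ofReal_one, one_mul]
  rw [h3, ← integral_mul_const,
    ofReal_integral_eq_lintegral_ofReal (hi.mul_const _) (.of_forall fun v =>
      mul_nonneg (hnn v) (by positivity))]
  refine lintegral_mono fun v => ?_
  rw [← ofReal_norm, ← ofReal_mul (rpow_nonneg (wt_pos hl _).le _)]
  refine ofReal_le_ofReal ?_
  have := mul_le_mul_of_nonneg_right (h1 v) (norm_nonneg (dyadicKernel n v))
  linarith

namespace IsHomTestFn

variable {lam ε : ℝ} {n : ℤ} {b : TestFn}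

theorem exists_isAmplitude_dyadicPart (hb : IsHomTestFn lam ε n b) (hl : 0 < lam) {q : ℝ} (hq : 0 ≤
    q) (hq3 : q ≤ 3) (hqε : q < ε) (j : ℕ) : ∃ K : ℝ, 0 ≤ K ∧ ∀ k : ℤ, IsAmplitude lam q (dyadicPart
    (thirdDeriv b) k) (ofReal (K * ((2 : ℝ) ^ k) ^ ((j : ℤ) - 3) * max 1 (2 ^ k) ^ q)) := by
  have hε : 0 < ε := hq.trans_lt hqε
  obtain ⟨K, hK0, hK⟩ := lintegral_weight_dyadicKernel hl hq hq3 (3 - j)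
  obtain ⟨C, hC0, hC⟩ := hb.exists_bound hl hε j
  have hi := (integrable_wt_rpow hl (by linarith : 1 < 1 + ε - q)).const_mul C
  have hnn : ∀ s, 0 ≤ C * wt lam s ^ (-(1 + ε - q)) := fun s =>
    mul_nonneg hC0 (rpow_nonneg (wt_pos hl s).le _)
  set J := ∫ s, C * wt lam s ^ (-(1 + ε - q)) with hJ
  have hJ0 : 0 ≤ J := integral_nonneg hnn
  refine ⟨K * J, by positivity, fun k => ⟨hb.measurable_dyadicPart k, ?_⟩⟩
  set a : ℝ := 2 ^ k with ha
  have ha0 : 0 < a := by positivity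
  have hφ : Measurable fun v => ofReal a⁻¹ * ‖dyadicKernel (3 - j) (a⁻¹ * v)‖ₑ :=
    (((continuous_dyadicKernel (3 - j)).enorm.measurable).comp (by fun_prop)).const_mul _
  have hm : Measurable fun s => ofReal (C * wt lam s ^ (-(1 + ε))) :=
    ((continuous_wt_rpow hl _).measurable.const_mul C).ennreal_ofReal
  have hconv : Measurable fun s => ∫⁻ s', (ofReal a⁻¹ *
      ‖dyadicKernel (3 - j) (a⁻¹ * (s - s'))‖ₑ) * ofReal (C * wt lam s' ^ (-(1 + ε))) :=
    Measurable.lintegral_prod_right' (f := fun z : ℝ × ℝ => (ofReal a⁻¹ *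
      ‖dyadicKernel (3 - j) (a⁻¹ * (z.1 - z.2))‖ₑ) * ofReal (C * wt lam z.2 ^ (-(1 + ε))))
      ((hφ.comp (by fun_prop : Measurable fun z : ℝ × ℝ => z.1 - z.2)).mul (hm.comp measurable_snd))
  refine ⟨fun s => ofReal (a ^ ((j : ℤ) - 3)) * ∫⁻ s', (ofReal a⁻¹ *
    ‖dyadicKernel (3 - j) (a⁻¹ * (s - s'))‖ₑ) * ofReal (C * wt lam s' ^ (-(1 + ε))),
    hconv.const_mul _, fun s l => ?_, ?_⟩
  · have hac : ((2 : ℂ) ^ k) = (a : ℂ) := by rw [ha]; push_cast; rfl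
    rw [hb.dyadicPart_eq hl hε j k s (norm_sphere_mem l), hac, ← ha, enorm_mul, enorm_mul,
      mul_assoc]
    have e1 : ‖(a : ℂ) ^ ((j : ℤ) - 3)‖ₑ = ofReal (a ^ ((j : ℤ) - 3)) := by
      rw [← ofReal_norm, norm_zpow, norm_real, norm_of_nonneg ha0.le]
    have e2 : ‖(a : ℂ)⁻¹‖ₑ = ofReal a⁻¹ := by
      rw [← ofReal_norm, norm_inv, norm_real, norm_of_nonneg ha0.le]
    rw [e1, e2]
    refine mul_le_mul_right ?_ _
    calc _ ≤ ofReal a⁻¹ * ∫⁻ s', ‖dyadicKernel (3 - j) (a⁻¹ * (s - s')) *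
          timeDeriv b j s' l‖ₑ := by gcongr; exact enorm_integral_le_lintegral_enorm _
      _ = ∫⁻ s', ofReal a⁻¹ * ‖dyadicKernel (3 - j) (a⁻¹ * (s - s')) *
          timeDeriv b j s' l‖ₑ := (lintegral_const_mul' _ _ ofReal_ne_top).symm
      _ ≤ _ := by
        refine lintegral_mono fun s' => ?_
        rw [enorm_mul, mul_assoc]
        gcongr
        rw [← ofReal_norm]
        exact ofReal_le_ofReal (hC s' l (norm_sphere_mem l))
  · have hW : Measurable fun s => ofReal (wt lam s ^ q) :=
      (continuous_wt_rpow hl q).measurable.ennreal_ofReal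
    have e3 : ∫⁻ s', ofReal (wt lam s' ^ q) * ofReal (C * wt lam s' ^ (-(1 + ε))) = ofReal J := by
      rw [hJ, ofReal_integral_eq_lintegral_ofReal hi (.of_forall hnn)]
      refine lintegral_congr fun s => ?_
      rw [← ofReal_mul (rpow_nonneg (wt_pos hl _).le _), mul_left_comm, ← rpow_add (wt_pos hl s)]
      congr 3; ring
    calc _ = ofReal (a ^ ((j : ℤ) - 3)) * ∫⁻ s, ofReal (wt lam s ^ q) *
          ∫⁻ s', (ofReal a⁻¹ * ‖dyadicKernel (3 - j) (a⁻¹ * (s - s'))‖ₑ) *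
            ofReal (C * wt lam s' ^ (-(1 + ε))) := by
          rw [← lintegral_const_mul' _ _ ofReal_ne_top]
          refine lintegral_congr fun s => ?_
          ring
      _ ≤ ofReal (a ^ ((j : ℤ) - 3)) * (ofReal (K * max 1 a ^ q) * ofReal J) := by
          gcongr
          exact (lintegral_convolution_weight hl hq hφ hm).trans (by rw [e3]; gcongr; exact hK a ha0)
      _ = _ := by
          rw [← ofReal_mul (by positivity), ← ofReal_mul (by positivity)]
          congr 1; ring

theorem hasSum_dyadicPart (hb : IsHomTestFn lam ε n b) (hlam : 0 < lam) (hε : 0 < ε) (s : ℝ) {l :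
    Space3} (hl : ‖l‖ ∈ Icc (1 / 2 : ℝ) 2) : HasSum (fun k => dyadicPart (thirdDeriv b) k s l)
    (positivePart (thirdDeriv b) s l) := by
  let F : ℝ → ℂ := fun u => timeFourier (thirdDeriv b) u l * exp (-(I * u * s))
  have hF : Integrable F := by
    refine (hb.integrable_timeFourier hlam hε hl).mul_bdd (c := 1)
      (by fun_prop : Continuous _).aestronglyMeasurable (.of_forall fun u => ?_)
    rw [norm_exp_neg_I_mul]
  have hpos : ∀ k : ℤ, dyadicPart (thirdDeriv b) k s l =
      ∫ u in Ioi (0 : ℝ), (cutoff (2 ^ k * u) : ℂ) * F u := by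
    intro k
    rw [dyadicPart, ← integral_indicator measurableSet_Ioi]
    refine integral_congr_fun fun u => ?_
    by_cases hu : u ∈ Ioi (0 : ℝ)
    · rw [indicator_of_mem hu]; simp only [F]; ring
    · have h0 : 2 ^ k * u ≤ 0 := mul_nonpos_of_nonneg_of_nonpos (by positivity) (not_lt.1 hu)
      rw [indicator_of_notMem hu, cutoff_of_le (by linarith)]
      simp
  simp_rw [hpos]
  have hc : ∀ k : ℤ, Continuous fun u : ℝ => ((cutoff (2 ^ k * u) : ℝ) : ℂ) := fun k =>
    continuous_ofReal.comp (continuous_cutoff.comp (by fun_prop))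
  have hint : ∀ k : ℤ, Integrable (fun u => (cutoff (2 ^ k * u) : ℂ) * F u)
      (volume.restrict (Ioi 0)) := fun k =>
    (hF.bdd_mul (c := 1) (hc k).aestronglyMeasurable (.of_forall fun u => by
      simpa using abs_cutoff_le _)).integrableOn
  have hlim : positivePart (thirdDeriv b) s l = ∫ u in Ioi (0 : ℝ),
      ∑' k : ℤ, (cutoff (2 ^ k * u) : ℂ) * F u := by
    refine setIntegral_congr_fun measurableSet_Ioi fun u hu => ?_
    have h1 := (Complex.hasSum_ofReal.2 (hasSum_cutoff hu)).mul_right (F u)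
    rw [Complex.ofReal_one, one_mul] at h1
    exact h1.tsum_eq.symm
  rw [hlim]
  refine hasSum_integral_of_summable_integral_norm hint ?_
  refine summable_of_sum_le (c := ∫ u in Ioi (0 : ℝ), ‖F u‖)
    (fun k => integral_nonneg fun u => norm_nonneg _) fun S => ?_
  rw [← integral_finsetSum _ fun k _ => (hint k).norm]
  refine setIntegral_mono_on (integrable_finsetSum _ fun k _ => (hint k).norm)
    hF.norm.integrableOn measurableSet_Ioi fun u hu => ?_
  simp only [norm_mul, norm_real, norm_of_nonneg (cutoff_nonneg _)]
  rw [← sum_mul]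
  exact mul_le_of_le_one_left (norm_nonneg _)
    (sum_le_hasSum S (fun k _ => cutoff_nonneg _) (hasSum_cutoff hu))

/-- Bounds on the dyadic parts; `N` is the order of the decay at high energies. -/
theorem exists_isAmplitude_dyadicPart_le (hb : IsHomTestFn lam ε n b) (hl : 0 < lam) {q : ℝ} (hq : 0
    ≤ q) (hq3 : q ≤ 3) (hqε : q < ε) (N : ℕ) : ∃ a : ℤ → ℝ, ∃ K : ℝ, 0 ≤ K ∧ (∀ k, 0 ≤ a k) ∧ (∀ k,
    IsAmplitude lam q (dyadicPart (thirdDeriv b) k) (ofReal (a k))) ∧ (∀ k : ℕ, a k ≤ K * (2 : ℝ) ^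
    ((q - 3) * k)) ∧ ∀ k : ℕ, a (-k) ≤ K * (2 : ℝ) ^ (-(N * k : ℝ)) := by
  obtain ⟨K1, h1, hK1⟩ := hb.exists_isAmplitude_dyadicPart hl hq hq3 hqε 0
  obtain ⟨K2, h2, hK2⟩ := hb.exists_isAmplitude_dyadicPart hl hq hq3 hqε (N + 3)
  refine ⟨fun k => min (K1 * ((2 : ℝ) ^ k) ^ (((0 : ℕ) : ℤ) - 3) * max 1 (2 ^ k) ^ q)
    (K2 * ((2 : ℝ) ^ k) ^ (((N + 3 : ℕ) : ℤ) - 3) * max 1 (2 ^ k) ^ q), K1 + K2, by positivity,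
    fun k => by positivity, fun k => ?_, fun k => ?_, fun k => ?_⟩
  · rcases min_choice (K1 * ((2 : ℝ) ^ k) ^ (((0 : ℕ) : ℤ) - 3) * max 1 (2 ^ k) ^ q)
      (K2 * ((2 : ℝ) ^ k) ^ (((N + 3 : ℕ) : ℤ) - 3) * max 1 (2 ^ k) ^ q) with h | h <;> beta_reduce <;> rw [h]
    · exact hK1 k
    · exact hK2 k
  · refine (min_le_left _ _).trans ?_
    have h3 : (1 : ℝ) ≤ 2 ^ (k : ℤ) := one_le_zpow₀ one_le_two (by positivity)
    rw [max_eq_right h3, mul_assoc]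
    have h4 : ((2 : ℝ) ^ (k : ℤ)) ^ (((0 : ℕ) : ℤ) - 3) * ((2 : ℝ) ^ (k : ℤ)) ^ q =
        (2 : ℝ) ^ ((q - 3) * k) := by
      rw [← zpow_mul, ← rpow_intCast, ← rpow_intCast, ← rpow_mul two_pos.le, ← rpow_add two_pos]
      congr 1; push_cast; ring
    rw [h4]
    gcongr
    linarith
  · refine (min_le_right _ _).trans ?_
    have h3 : (2 : ℝ) ^ (-(k : ℤ)) ≤ 1 := zpow_le_one_of_nonpos₀ one_le_two (by simp)
    rw [max_eq_left h3, one_rpow, mul_one]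
    have h4 : ((2 : ℝ) ^ (-(k : ℤ))) ^ (((N + 3 : ℕ) : ℤ) - 3) = (2 : ℝ) ^ (-(N * k : ℝ)) := by
      rw [← zpow_mul, ← rpow_intCast]
      congr 1; push_cast; ring
    rw [h4]
    gcongr
    linarith

theorem exists_isAmplitude_positivePart (hb : IsHomTestFn lam ε n b) (hl : 0 < lam) {q : ℝ} (hq : 0
    ≤ q) (hq3 : q < 3) (hqε : q < ε) : ∃ A : ℝ, 0 ≤ A ∧ IsAmplitude lam q (positivePart (thirdDeriv
    b)) (ofReal A) := by
  obtain ⟨a, K, hK, ha0, ha, hp, hn⟩ := hb.exists_isAmplitude_dyadicPart_le hl hq hq3.le hqε 1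
  have h1 := IsAmplitude.hasSum hl ha hb.measurable_positivePart fun s l =>
    hb.hasSum_dyadicPart hl (hq.trans_lt hqε) s (norm_sphere_mem l)
  have hsum : Summable a := by
    refine of_nat_of_neg ?_ ?_
    · refine of_nonneg_of_le (fun k => ha0 _) hp (mul_left _ ?_)
      simp_rw [rpow_mul two_pos.le, rpow_natCast]
      refine summable_geometric_of_lt_one (by positivity) ?_
      exact Real.rpow_lt_one_of_one_lt_of_neg one_lt_two (by linarith)
    · refine of_nonneg_of_le (fun k => ha0 _) hn (mul_left _ ?_)
      simp_rw [← neg_mul, rpow_mul two_pos.le, rpow_natCast]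
      refine summable_geometric_of_lt_one (by positivity) ?_
      exact Real.rpow_lt_one_of_one_lt_of_neg one_lt_two (by norm_num)
  exact ⟨∑' k, a k, tsum_nonneg ha0, h1.mono (ENNReal.ofReal_tsum_of_nonneg ha0 hsum).ge⟩

open FourierTransform in
/-- Fourier inversion for the positive part. -/
theorem integral_positivePart (hb : IsHomTestFn lam ε n b) (hlam : 0 < lam) (hε : 0 < ε) (l : S²) {u
    : ℝ} (hu : 0 ≤ u) (hi : Integrable fun s => positivePart (thirdDeriv b) s l) : ∫ s : ℝ,
    positivePart (thirdDeriv b) s l * exp (I * u * s) = 2 * π * timeFourier (thirdDeriv b) u l := by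
  have hl := norm_sphere_mem l
  have hc := hb.continuous_timeFourier hlam hε hl
  let F : ℝ → ℂ := fun u => if 0 ≤ u then timeFourier (thirdDeriv b) u l else 0
  have h0 : timeFourier (thirdDeriv b) 0 l = 0 := by
    rw [hb.timeFourier_thirdDeriv hlam hε 0 hl]; simp
  have hFc : Continuous F := by
    refine Continuous.if_le hc continuous_const continuous_const continuous_id fun u hu => ?_
    rw [← hu, h0]
  have hFi : Integrable F := by
    have : F = (Ici (0 : ℝ)).indicator fun u => timeFourier (thirdDeriv b) u l := by
      ext u; simp [F, Set.indicator_apply]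
    rw [this]
    exact (hb.integrable_timeFourier hlam hε hl).indicator measurableSet_Ici
  have hpi := pi_pos
  have hpc : (π : ℂ) ≠ 0 := by exact_mod_cast hpi.ne'
  have hFF : ∀ s, 𝓕 F s = positivePart (thirdDeriv b) (2 * π * s) l := by
    intro s
    rw [Real.fourier_real_eq_integral_exp_smul, positivePart, ← integral_Ici_eq_integral_Ioi,
      ← integral_indicator measurableSet_Ici]
    refine integral_congr_fun fun v => ?_
    by_cases hv : 0 ≤ v
    · simp only [F, hv, if_true, Set.indicator_apply, Set.mem_Ici, smul_eq_mul]
      rw [mul_comm]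
      congr 2
      push_cast; ring
    · simp [F, hv]
  have hFFi : Integrable (𝓕 F) := by
    rw [funext hFF]
    exact hi.comp_mul_left' (by positivity)
  have inv := congrFun (hFc.fourierInv_fourier_eq hFi hFFi) u
  rw [Real.fourierInv_eq', funext hFF] at inv
  have h1 := Measure.integral_comp_mul_left (fun s : ℝ =>
    positivePart (thirdDeriv b) s l * exp (I * u * s)) (2 * π)
  rw [abs_of_pos (by positivity), real_smul] at h1
  have h2 : F u = timeFourier (thirdDeriv b) u l := by simp [F, hu]
  rw [← h2, ← inv]
  have h3 : ∫ v : ℝ, exp ((2 * π * inner ℝ v u : ℝ) * I) •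
      positivePart (thirdDeriv b) (2 * π * v) l = ∫ s : ℝ,
      positivePart (thirdDeriv b) (2 * π * s) l * exp (I * u * (2 * π * s : ℝ)) := by
    refine integral_congr_fun fun s => ?_
    rw [smul_eq_mul, mul_comm]
    congr 2
    simp
    ring
  rw [h3, h1]
  push_cast
  rw [← mul_assoc, mul_inv_cancel₀ (mul_ne_zero two_ne_zero hpc), one_mul]

end IsHomTestFn

/-! ### Smeared fields -/

theorem integral_lie_integral {X Y R : Type*} [MeasurableSpace X] [MeasurableSpace Y] {μ : Measure
    X} {ν : Measure Y} [SFinite μ] [SFinite ν] [NormedRing R] [NormedAlgebra ℂ R] [CompleteSpace R]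
    {F : X → R} {G : Y → R} (hF : Integrable F μ) (hG : Integrable G ν) : Integrable (fun z : X × Y
    => ⁅F z.1, G z.2⁆) (μ.prod ν) ∧ ⁅∫ x, F x ∂μ, ∫ y, G y ∂ν⁆ = ∫ z, ⁅F z.1, G z.2⁆ ∂μ.prod ν := by
  have h1 : Integrable (fun z : X × Y => F z.1 * G z.2) (μ.prod ν) := hF.mul_prod hG
  have h2 : Integrable (fun z : X × Y => G z.2 * F z.1) (μ.prod ν) :=
    hF.op_fst_snd (op := fun a b => b * a) (continuous_snd.mul continuous_fst)
      ⟨1, fun a b => (norm_mul_le _ _).trans_eq (by ring)⟩ hG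
  refine ⟨h1.sub h2, ?_⟩
  have e1 := integral_prod_bilin (μ := μ) (ν := ν) (ContinuousLinearMap.mul ℂ R) hF hG
  have e2 := integral_prod_bilin (μ := μ) (ν := ν) (ContinuousLinearMap.mul ℂ R).flip hF hG
  simp only [flip_apply, mul_apply'] at e1 e2
  rw [Ring.lie_def, ← e1, ← e2, ← integral_sub h1 h2]
  rfl

namespace TranslationRep
variable (T : TranslationRep H) (B : Op H)

theorem norm_field_le (x : Mink) : ‖T.field B x‖ ≤ ‖B‖ := by
  rw [field]
  refine (norm_mul_le _ _).trans ((mul_le_of_le_one_right (norm_nonneg _) (T.norm_U_le _)).trans ?_)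
  exact (norm_mul_le _ _).trans (mul_le_of_le_one_left (norm_nonneg _) (T.norm_U_le _))

theorem star_field (x : Mink) : star (T.field B x) = T.field (star B) x := by
  rw [field, field, star_mul, star_mul, T.star_eq, T.star_eq, neg_neg, mul_assoc]

theorem U_mul_field_mul (a x : Mink) : T.U a * T.field B x * T.U (-a) = T.field B (a + x) := by
  rw [field, field, T.map_add, neg_add_rev, T.map_add]
  simp only [mul_assoc]

theorem field_mul_U (a x : Mink) : T.field B (a + x) * T.U a = T.U a * T.field B x := by
  rw [← U_mul_field_mul, mul_assoc (T.U a * _), ← T.map_add, neg_add_cancel, T.map_zero, mul_one]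

theorem field_zero : T.field B 0 = B := by simp [field, T.map_zero]

theorem norm_lie_field (B₁ B₂ : Op H) (x x' : Mink) : ‖⁅T.field B₁ x, T.field B₂ x'⁆‖ ≤ ‖⁅B₁,
    T.field B₂ (x' - x)⁆‖ := by
  have h : ⁅T.field B₁ x, T.field B₂ x'⁆ = T.field ⁅B₁, T.field B₂ (x' - x)⁆ x := by
    have h1 : T.U (-x) * T.U x = 1 := by rw [← T.map_add, neg_add_cancel, T.map_zero]
    have h2 : T.field B₂ x' = T.U x * T.field B₂ (x' - x) * T.U (-x) := by
      rw [U_mul_field_mul, add_sub_cancel]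
    have h3 : ∀ A C : Op H, T.U x * A * T.U (-x) * (T.U x * C * T.U (-x)) =
        T.U x * (A * C) * T.U (-x) := by
      intro A C
      calc _ = T.U x * A * (T.U (-x) * T.U x) * C * T.U (-x) := by simp only [mul_assoc]
        _ = _ := by rw [h1]; simp only [mul_assoc, one_mul]
    rw [h2]
    simp only [field, Ring.lie_def, h3, mul_sub, sub_mul]
  rw [h]
  exact T.norm_field_le _ x

end TranslationRep

theorem decayFn_le {lam κ q : ℝ} (hl : 0 < lam) (hq : 0 ≤ q) (hqκ : q ≤ κ) {a : Mink} {t ρ e : ℝ}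
    (ha : a.1 = t + ρ) (he : 0 ≤ e) (hea : e ≤ ‖a.2‖ - |ρ|) : decayFn lam κ a ≤ wt lam t ^ q * wt
    lam e ^ (-q) := by
  have hwt := wt_pos hl t
  have hwe := wt_pos hl e
  rw [rpow_neg hwe.le, ← div_eq_mul_inv, ← div_rpow hwt.le hwe.le]
  have h1 : wt lam t / wt lam e = (lam + |t|) / (lam + e) := by
    rw [wt, wt, abs_of_nonneg he]; field_simp
  rw [h1]
  have hat : |a.1| ≤ |t| + |ρ| := by rw [ha]; exact abs_add_le _ _
  have big : e ≤ |t| → 1 ≤ ((lam + |t|) / (lam + e)) ^ q := fun h => by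
    refine one_le_rpow ?_ hq
    rw [one_le_div (by linarith)]; linarith
  rw [decayFn]
  split_ifs with h
  · apply big
    rw [mdot, real_inner_self_eq_norm_sq] at h
    have : ‖a.2‖ ≤ |a.1| := abs_le_of_sq_le_sq' (by rw [sq_abs]; linarith) (abs_nonneg _) |>.2
    linarith
  · rw [mdot, real_inner_self_eq_norm_sq, not_le] at h
    have h2 : |a.1| < ‖a.2‖ := by
      refine lt_of_pow_lt_pow_left₀ 2 (norm_nonneg _) ?_
      rw [sq_abs]; linarith
    have hpos : 0 < lam + ‖a.2‖ - |a.1| := by linarith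
    rw [← div_rpow hl.le hpos.le]
    have hle1 : lam / (lam + ‖a.2‖ - |a.1|) ≤ 1 := by rw [div_le_one hpos]; linarith
    have hnn : 0 < lam / (lam + ‖a.2‖ - |a.1|) := by positivity
    by_cases het : e ≤ |t|
    · exact (Real.rpow_le_one hnn.le hle1 (hq.trans hqκ)).trans (big het)
    · push Not at het
      calc _ ≤ (lam / (lam + ‖a.2‖ - |a.1|)) ^ q :=
            Real.rpow_le_rpow_of_exponent_ge hnn hle1 hqκ
        _ ≤ _ := by
            refine rpow_le_rpow hnn.le ?_ hq
            rw [div_le_div_iff₀ hpos (by linarith)]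
            have h3 := abs_nonneg t
            nlinarith [mul_nonneg h3 (sub_nonneg.2 het.le), mul_nonneg hl.le h3]

/-- The point `st + rl`. -/
def conePoint (r : ℝ) (x : ℝ × S²) : Mink := (x.1 + r, r • (x.2 : Space3))

theorem continuous_conePoint (r : ℝ) : Continuous (conePoint r) := by unfold conePoint; fun_prop

/-- The measure `ds dΩ(l)`. -/
abbrev coneMeasure : Measure (ℝ × S²) := volume.prod sphereMeasure

/-- The total angle. -/
def totalAngle : ℝ := sphereMeasure.real Set.univ

theorem totalAngle_nonneg : 0 ≤ totalAngle := measureReal_nonneg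

theorem sphereMeasure_univ : sphereMeasure Set.univ = ofReal totalAngle := by
  rw [totalAngle, measureReal_def, ENNReal.ofReal_toReal (measure_ne_top _ _)]

theorem smearRadius_eq (T : TranslationRep H) (B : Op H) (r : ℝ) (h : TestFn) :
    smearRadius T B r h = ((r / (2 * π) : ℝ) : ℂ) •
      ∫ x, h x.1 x.2 • T.field B (conePoint r x) ∂coneMeasure := rfl

namespace IsAmplitude

variable {lam q : ℝ} {h : TestFn} {A : ENNReal}

/-- Integrals of amplitudes times functions on the sphere. -/
theorem lintegral_mul_le (hl : 0 < lam) (hh : IsAmplitude lam q h A) {g : S² → ENNReal} (hg :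
    Measurable g) : ∫⁻ x, ofReal (wt lam x.1 ^ q) * ‖h x.1 x.2‖ₑ * g x.2 ∂coneMeasure ≤ A * ∫⁻ l, g
    l ∂sphereMeasure := by
  obtain ⟨_, m, h2, h3, h4⟩ := hh
  calc _ ≤ ∫⁻ x : ℝ × S²,
        (ofReal (wt lam x.1 ^ q) * m x.1) * g x.2 ∂coneMeasure := by
        refine lintegral_mono fun x => ?_
        gcongr
        exact h3 _ _
    _ = (∫⁻ s, ofReal (wt lam s ^ q) * m s) * ∫⁻ l, g l ∂sphereMeasure :=
        lintegral_prod_mul (((continuous_wt_rpow hl q).measurable.ennreal_ofReal.mul h2).aemeasurable)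
          hg.aemeasurable
    _ ≤ _ := by gcongr

theorem lintegral_le (hl : 0 < lam) (hq : 0 ≤ q) (hh : IsAmplitude lam q h A) : ∫⁻ x, ‖h x.1 x.2‖ₑ
    ∂coneMeasure ≤ A * ofReal totalAngle := by
  have h1 := (hh.mono_exponent hl hq).lintegral_mul_le hl (measurable_const (a := 1))
  rw [lintegral_one, sphereMeasure_univ] at h1
  simpa using h1

theorem integrable (hl : 0 < lam) (hq : 0 ≤ q) (hA : A ≠ ⊤) (hh : IsAmplitude lam q h A) :
    Integrable (fun x => h x.1 x.2) coneMeasure :=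
  ⟨hh.measurable.aestronglyMeasurable, (hh.lintegral_le hl hq).trans_lt
    (ENNReal.mul_lt_top hA.lt_top ofReal_lt_top)⟩

theorem integrable_left (hl : 0 < lam) (hq : 0 ≤ q) (hA : A ≠ ⊤) (hh : IsAmplitude lam q h A) (l :
    S²) : Integrable fun s => h s l := by
  obtain ⟨h1, m, h2, h3, h4⟩ := hh.mono_exponent hl hq
  refine ⟨(h1.comp measurable_prodMk_right).aestronglyMeasurable, ?_⟩
  refine lt_of_le_of_lt ((lintegral_mono fun s => ?_).trans h4) hA.lt_top
  simpa using h3 s l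

variable {T : TranslationRep H} {B : Op H}

theorem integrable_smul (hl : 0 < lam) (hq : 0 ≤ q) (hA : A ≠ ⊤) (hh : IsAmplitude lam q h A) (hB :
    Continuous (T.field B)) (r : ℝ) : Integrable (fun x => h x.1 x.2 • T.field B (conePoint r x))
    coneMeasure :=
  (hh.integrable hl hq hA).smul_bdd ‖B‖ (hB.comp (continuous_conePoint r)).aestronglyMeasurable
    (.of_forall fun x => T.norm_field_le B _)

theorem norm_smearRadius_le (hl : 0 < lam) (hq : 0 ≤ q) {a : ℝ} (ha : 0 ≤ a) (hh : IsAmplitude lam q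
    h (ofReal a)) (r : ℝ) : ‖smearRadius T B r h‖ ≤ |r| * ‖B‖ * totalAngle * a := by
  rw [smearRadius_eq, norm_smul, norm_real]
  have hpi := pi_gt_three
  have h1 : ‖∫ x, h x.1 x.2 • T.field B (conePoint r x) ∂coneMeasure‖ ≤ ‖B‖ * totalAngle * a := by
    have h0 := totalAngle_nonneg
    rw [← ofReal_le_ofReal_iff (by positivity), ofReal_norm]
    calc _ ≤ ∫⁻ x, ‖h x.1 x.2 • T.field B (conePoint r x)‖ₑ ∂coneMeasure :=
          enorm_integral_le_lintegral_enorm _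
      _ ≤ ∫⁻ x, ‖B‖ₑ * ‖h x.1 x.2‖ₑ ∂coneMeasure := by
          refine lintegral_mono fun x => ?_
          rw [enorm_smul, mul_comm]
          gcongr
          exact enorm_le_iff_norm_le.2 (T.norm_field_le B _)
      _ = ‖B‖ₑ * ∫⁻ x, ‖h x.1 x.2‖ₑ ∂coneMeasure := lintegral_const_mul' _ _ enorm_ne_top
      _ ≤ ‖B‖ₑ * (ofReal a * ofReal totalAngle) := by
          gcongr; exact hh.lintegral_le hl hq
      _ = _ := by
          rw [← ofReal_norm, ← ofReal_mul ha, ← ofReal_mul (norm_nonneg _)]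
          congr 1; ring
  have h2 : ‖r / (2 * π)‖ ≤ |r| := by
    rw [norm_eq_abs, abs_div, abs_of_pos (a := 2 * π) (by positivity)]
    exact div_le_self (abs_nonneg r) (by linarith)
  calc _ ≤ |r| * (‖B‖ * totalAngle * a) :=
        mul_le_mul h2 h1 (norm_nonneg _) (abs_nonneg _)
    _ = _ := by ring

end IsAmplitude

theorem star_smearRadius (T : TranslationRep H) (B : Op H) (r : ℝ) (h : TestFn) : star (smearRadius
    T B r h) = smearRadius T (star B) r fun s l => star (h s l) := by
  rw [smearRadius_eq, smearRadius_eq, star_smul]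
  congr 1
  · simp
  · have : star (∫ x, h x.1 x.2 • T.field B (conePoint r x) ∂coneMeasure) =
        (starL' ℝ : (Op H) ≃L[ℝ] (Op H))
          (∫ x, h x.1 x.2 • T.field B (conePoint r x) ∂coneMeasure) := rfl
    rw [this, ← ContinuousLinearEquiv.integral_comp_comm]
    refine integral_congr_fun fun x => ?_
    change star (_ • _) = _
    rw [star_smul, T.star_field]

/-- Series of amplitudes give norm convergent series of operators. -/
theorem hasSum_smearRadius {lam q : ℝ} (hl : 0 < lam) (hq : 0 ≤ q) {ι : Type*} [Countable ι] {f : ι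
    → TestFn} {h : TestFn} {a : ι → ℝ} (ha0 : ∀ k, 0 ≤ a k) (ha : Summable a) (hf : ∀ k, IsAmplitude
    lam q (f k) (ofReal (a k))) (hs : ∀ s (l : S²), HasSum (fun k => f k s l) (h s l)) {T :
    TranslationRep H} {B : Op H} (hB : Continuous (T.field B)) (r : ℝ) : HasSum (fun k =>
    smearRadius T B r (f k)) (smearRadius T B r h) := by
  simp_rw [smearRadius_eq]
  refine HasSum.const_smul _ ?_
  have h1 : ∫ x, h x.1 x.2 • T.field B (conePoint r x) ∂coneMeasure =
      ∫ x, ∑' k, f k x.1 x.2 • T.field B (conePoint r x) ∂coneMeasure := by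
    refine integral_congr_fun fun x => ?_
    exact ((hs x.1 x.2).smul_const _).tsum_eq.symm
  rw [h1]
  refine hasSum_integral_of_summable_integral_norm
    (fun k => (hf k).integrable_smul hl hq ofReal_ne_top hB r) ?_
  refine of_nonneg_of_le (fun k => integral_nonneg fun x => norm_nonneg _) (fun k => ?_)
    (ha.mul_left (totalAngle * ‖B‖))
  have h2 := (hf k).integrable hl hq ofReal_ne_top
  have h3 := (hf k).lintegral_le hl hq
  rw [← ofReal_mul (ha0 k)] at h3
  have h4 : ∫ x, ‖f k x.1 x.2‖ ∂coneMeasure ≤ a k * totalAngle := by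
    rw [← ofReal_le_ofReal_iff (mul_nonneg (ha0 k) totalAngle_nonneg),
      ofReal_integral_norm_eq_lintegral_enorm h2]
    exact h3
  calc _ ≤ ∫ x, ‖f k x.1 x.2‖ * ‖B‖ ∂coneMeasure := by
        refine integral_mono ((hf k).integrable_smul hl hq ofReal_ne_top hB r).norm
          (h2.norm.mul_const _) fun x => ?_
        beta_reduce
        rw [norm_smul]
        exact mul_le_mul_of_nonneg_left (T.norm_field_le B _) (norm_nonneg _)
    _ = (∫ x, ‖f k x.1 x.2‖ ∂coneMeasure) * ‖B‖ := integral_mul_const _ _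
    _ ≤ a k * totalAngle * ‖B‖ := by gcongr
    _ = _ := by ring

/-! ### Commutators of smeared fields -/

/-- Decay of the commutators of two fields, with exponent `q`. -/
def CommutatorDecay (T : TranslationRep H) (lam q c : ℝ) (B₁ B₂ : Op H) : Prop :=
  ∀ (x x' : Mink) (t ρ e : ℝ), x'.1 - x.1 = t + ρ → 0 ≤ e → e ≤ ‖x'.2 - x.2‖ - |ρ| →
    ‖⁅T.field B₁ x, T.field B₂ x'⁆‖ ≤ c * (wt lam t ^ q * wt lam e ^ (-q))

namespace VacuumTheory

variable {lam κ : ℝ} (T : VacuumTheory H lam κ) {B B₁ B₂ : Op H}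

theorem continuous_field (hB : B ∈ T.𝓕) : Continuous (T.field B) :=
  (T.commutators B hB B hB).1.continuous

theorem exists_commutatorDecay (hl : 0 < lam) {q : ℝ} (hq : 0 ≤ q) (hqκ : q ≤ κ) (h₁ : B₁ ∈ T.𝓕) (h₂
    : B₂ ∈ T.𝓕) : ∃ c, 0 ≤ c ∧ CommutatorDecay T lam q c B₁ B₂ := by
  obtain ⟨c, hc⟩ := (T.commutators B₁ h₁ B₂ h₂).2.2 0 0 Fin.elim0 Fin.elim0
  simp only [iteratedFDeriv_zero_apply, TranslationRep.field_zero] at hc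
  refine ⟨|c|, abs_nonneg c, fun x x' t ρ e h1 h2 h3 => ?_⟩
  refine (T.norm_lie_field B₁ B₂ x x').trans ((hc _).trans ?_)
  have h4 := decayFn_le (κ := κ) hl hq hqκ (a := x' - x) h1 h2 h3
  have h5 : 0 ≤ decayFn lam κ (x' - x) := by
    rw [decayFn]
    split_ifs with h
    · exact zero_le_one
    · rw [mdot, real_inner_self_eq_norm_sq, not_le] at h
      have h2 : |(x' - x).1| < ‖(x' - x).2‖ := by
        refine lt_of_pow_lt_pow_left₀ 2 (norm_nonneg _) ?_
        rw [sq_abs]; linarith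
      exact div_nonneg (by positivity) (rpow_nonneg (by linarith) _)
  exact mul_le_mul (le_abs_self c) h4 h5 (abs_nonneg c)

end VacuumTheory

/-- The part of the commutator of two smeared fields with arguments in `E`. -/
def pairComm (T : TranslationRep H) (B₁ : Op H) (r₁ : ℝ) (h₁ : TestFn) (B₂ : Op H) (r₂ : ℝ) (h₂ :
    TestFn) (E : Set ((ℝ × S²) × (ℝ × S²))) : Op H :=
  ((r₁ / (2 * π) * (r₂ / (2 * π)) : ℝ) : ℂ) • ∫ z in E,
    ⁅h₁ z.1.1 z.1.2 • T.field B₁ (conePoint r₁ z.1), h₂ z.2.1 z.2.2 • T.field B₂ (conePoint r₂ z.2)⁆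
      ∂coneMeasure.prod coneMeasure

section PairComm

variable {T : TranslationRep H} {B₁ B₂ : Op H} {lam q r₁ r₂ a₁ a₂ c M : ℝ}
  {h₁ h₂ : TestFn}
  {E : Set ((ℝ × S²) × (ℝ × S²))}

theorem integrable_lie (hl : 0 < lam) (hq : 0 ≤ q) (H₁ : IsAmplitude lam q h₁ (ofReal a₁)) (H₂ :
    IsAmplitude lam q h₂ (ofReal a₂)) (hB₁ : Continuous (T.field B₁)) (hB₂ : Continuous (T.field
    B₂)) (r₁ r₂ : ℝ) : Integrable (fun z : (ℝ × S²) × (ℝ × S²) => ⁅h₁ z.1.1 z.1.2 • T.field B₁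
    (conePoint r₁ z.1), h₂ z.2.1 z.2.2 • T.field B₂ (conePoint r₂ z.2)⁆) (coneMeasure.prod
    coneMeasure) :=
  (integral_lie_integral (H₁.integrable_smul hl hq ofReal_ne_top hB₁ r₁)
    (H₂.integrable_smul hl hq ofReal_ne_top hB₂ r₂)).1

theorem lie_smearRadius (hl : 0 < lam) (hq : 0 ≤ q) (H₁ : IsAmplitude lam q h₁ (ofReal a₁)) (H₂ :
    IsAmplitude lam q h₂ (ofReal a₂)) (hB₁ : Continuous (T.field B₁)) (hB₂ : Continuous (T.field
    B₂)) : ⁅smearRadius T B₁ r₁ h₁, smearRadius T B₂ r₂ h₂⁆ = pairComm T B₁ r₁ h₁ B₂ r₂ h₂ Set.univ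
    := by
  rw [pairComm, setIntegral_univ, ← (integral_lie_integral
    (H₁.integrable_smul hl hq ofReal_ne_top hB₁ r₁)
    (H₂.integrable_smul hl hq ofReal_ne_top hB₂ r₂)).2, smearRadius_eq, smearRadius_eq]
  simp only [Ring.lie_def, smul_mul_smul_comm, smul_sub]
  push_cast
  rw [mul_comm ((r₂ : ℂ) / _)]

theorem pairComm_add_compl (hl : 0 < lam) (hq : 0 ≤ q) (H₁ : IsAmplitude lam q h₁ (ofReal a₁)) (H₂ :
    IsAmplitude lam q h₂ (ofReal a₂)) (hB₁ : Continuous (T.field B₁)) (hB₂ : Continuous (T.field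
    B₂)) (hE : MeasurableSet E) : pairComm T B₁ r₁ h₁ B₂ r₂ h₂ E + pairComm T B₁ r₁ h₁ B₂ r₂ h₂ Eᶜ =
    ⁅smearRadius T B₁ r₁ h₁, smearRadius T B₂ r₂ h₂⁆ := by
  rw [lie_smearRadius hl hq H₁ H₂ hB₁ hB₂]
  simp only [pairComm]
  rw [← smul_add, integral_add_compl hE (integrable_lie hl hq H₁ H₂ hB₁ hB₂ _ _), setIntegral_univ]

/-- Integrals over pairs of points of the cone. -/
theorem lintegral_pair_le (hl : 0 < lam) (H₁ : IsAmplitude lam q h₁ (ofReal a₁)) (H₂ : IsAmplitude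
    lam q h₂ (ofReal a₂)) (ha₁ : 0 ≤ a₁) (ha₂ : 0 ≤ a₂) (hM0 : 0 ≤ M) {γ : S² → S² → ENNReal} (hγ :
    Measurable γ.uncurry) (hM : ∀ l, ∫⁻ l', γ l l' ∂sphereMeasure ≤ ofReal M) {k : S² → ENNReal} (hk
    : Measurable k) : ∫⁻ z, (ofReal (wt lam z.1.1 ^ q) * ‖h₁ z.1.1 z.1.2‖ₑ * k z.1.2) * (ofReal (wt
    lam z.2.1 ^ q) * ‖h₂ z.2.1 z.2.2‖ₑ * γ z.1.2 z.2.2) ∂coneMeasure.prod coneMeasure ≤ ofReal (a₁ *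
    a₂ * M) * ∫⁻ l, k l ∂sphereMeasure := by
  have hW : Measurable fun s => ofReal (wt lam s ^ q) :=
    (continuous_wt_rpow hl q).measurable.ennreal_ofReal
  have m1 : Measurable fun x : ℝ × S² =>
      ofReal (wt lam x.1 ^ q) * ‖h₁ x.1 x.2‖ₑ :=
    (hW.comp measurable_fst).mul H₁.measurable.enorm
  have m2 : Measurable fun x : ℝ × S² =>
      ofReal (wt lam x.1 ^ q) * ‖h₂ x.1 x.2‖ₑ :=
    (hW.comp measurable_fst).mul H₂.measurable.enorm
  have m3 : Measurable fun z : (ℝ × S²) × (ℝ × S²) => γ z.1.2 z.2.2 :=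
    hγ.comp (by fun_prop : Measurable fun z : (ℝ × S²) ×
      (ℝ × S²) => (z.1.2, z.2.2))
  have m4 : Measurable fun x : ℝ × S² => k x.2 := hk.comp measurable_snd
  refine (le_of_eq (lintegral_prod _ (Measurable.aemeasurable ?_))).trans ?_
  · exact ((m1.mul m4).comp measurable_fst).mul ((m2.comp measurable_snd).mul m3)
  calc _ ≤ ∫⁻ x, ofReal (a₂ * M) *
        (ofReal (wt lam x.1 ^ q) * ‖h₁ x.1 x.2‖ₑ * k x.2) ∂coneMeasure := by
        refine lintegral_mono fun x => ?_
        have m5 : Measurable fun l' => γ x.2 l' := hγ.comp (measurable_const.prodMk measurable_id)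
        have m6 : Measurable fun y : ℝ × S² => ofReal
            (wt lam y.1 ^ q) * ‖h₂ y.1 y.2‖ₑ * γ x.2 y.2 := m2.mul (m5.comp measurable_snd)
        dsimp only
        rw [lintegral_const_mul _ m6, mul_comm]
        gcongr
        refine (H₂.lintegral_mul_le hl m5).trans ?_
        rw [ofReal_mul ha₂]
        gcongr
        exact hM _
    _ = ofReal (a₂ * M) * ∫⁻ x, (ofReal (wt lam x.1 ^ q) * ‖h₁ x.1 x.2‖ₑ * k x.2) ∂coneMeasure :=
        lintegral_const_mul' _ _ ofReal_ne_top
    _ ≤ ofReal (a₂ * M) * (ofReal a₁ * ∫⁻ l, k l ∂sphereMeasure) := by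
        gcongr
        exact H₁.lintegral_mul_le hl hk
    _ = _ := by
        rw [← mul_assoc, ← ofReal_mul (by positivity)]
        congr 2; ring

/-- The basic norm estimate of commutators. -/
theorem norm_pairComm_le (hl : 0 < lam) (hq : 0 ≤ q) (H₁ : IsAmplitude lam q h₁ (ofReal a₁)) (H₂ :
    IsAmplitude lam q h₂ (ofReal a₂)) (ha₁ : 0 ≤ a₁) (ha₂ : 0 ≤ a₂) (hM0 : 0 ≤ M) (hc : 0 ≤ c) {γ :
    S² → S² → ℝ} (hγ : Measurable γ.uncurry) (hM : ∀ l, ∫⁻ l', ofReal (γ l l') ∂sphereMeasure ≤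
    ofReal M) (hE : MeasurableSet E) (hb : ∀ z ∈ E, h₁ z.1.1 z.1.2 ≠ 0 → h₂ z.2.1 z.2.2 ≠ 0 →
    ‖⁅T.field B₁ (conePoint r₁ z.1), T.field B₂ (conePoint r₂ z.2)⁆‖ ≤ c * (wt lam (z.2.1 - z.1.1) ^
    q * γ z.1.2 z.2.2)) : ‖pairComm T B₁ r₁ h₁ B₂ r₂ h₂ E‖ ≤ |r₁ * r₂| * c * (a₁ * a₂ * (M *
    totalAngle)) := by
  have h0 := totalAngle_nonneg
  rw [pairComm, norm_smul, norm_real, mul_assoc]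
  refine mul_le_mul ?_ ?_ (norm_nonneg _) (abs_nonneg _)
  · rw [div_mul_div_comm, norm_eq_abs, abs_div]
    have hpi := pi_gt_three
    refine div_le_self (abs_nonneg _) ?_
    rw [abs_of_pos (by positivity)]
    nlinarith
  rw [← ofReal_le_ofReal_iff (by positivity), ofReal_norm]
  refine (enorm_integral_le_lintegral_enorm _).trans ?_
  rw [ofReal_mul hc]
  refine le_trans (setLIntegral_mono' (g := fun z => ofReal c *
    ((ofReal (wt lam z.1.1 ^ q) * ‖h₁ z.1.1 z.1.2‖ₑ) *
      (ofReal (wt lam z.2.1 ^ q) * ‖h₂ z.2.1 z.2.2‖ₑ *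
        ofReal (γ z.1.2 z.2.2)))) hE fun z hz => ?_) ?_
  · by_cases hz1 : h₁ z.1.1 z.1.2 = 0
    · simp [hz1, Ring.lie_def]
    by_cases hz2 : h₂ z.2.1 z.2.2 = 0
    · simp [hz2, Ring.lie_def]
    have h1 : ∀ (a b : ℂ) (x y : Op H), ⁅a • x, b • y⁆ = (a * b) • ⁅x, y⁆ := by
      intro a b x y
      simp only [Ring.lie_def, smul_mul_smul_comm, smul_sub, mul_comm b a]
    rw [h1, enorm_smul, enorm_mul]
    have h2 : ‖⁅T.field B₁ (conePoint r₁ z.1), T.field B₂ (conePoint r₂ z.2)⁆‖ₑ ≤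
        ofReal c * (ofReal (wt lam z.1.1 ^ q) * ofReal (wt lam z.2.1 ^ q) *
          ofReal (γ z.1.2 z.2.2)) := by
      have hw := wt_rpow_add_le hl hq z.2.1 (-z.1.1)
      rw [← sub_eq_add_neg, wt_neg, mul_comm] at hw
      have p1 := rpow_nonneg (wt_pos hl z.1.1).le q
      have p2 := rpow_nonneg (wt_pos hl z.2.1).le q
      have p3 := Real.rpow_pos_of_pos (wt_pos hl (z.2.1 - z.1.1)) q
      rw [← ofReal_mul p1, ← ofReal_mul (mul_nonneg p1 p2), ← ofReal_mul hc, ← ofReal_norm]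
      refine ofReal_le_ofReal ((hb z hz hz1 hz2).trans ?_)
      rcases le_or_gt 0 (γ z.1.2 z.2.2) with hγ0 | hγ0
      · gcongr
      · rcases hc.eq_or_lt with rfl | hc'
        · simp
        · have := (norm_nonneg _).trans (hb z hz hz1 hz2)
          have := mul_neg_of_pos_of_neg hc' (mul_neg_of_pos_of_neg p3 hγ0)
          linarith
    refine (mul_le_mul_right h2 _).trans (le_of_eq ?_)
    ring
  · rw [lintegral_const_mul' _ _ ofReal_ne_top]
    gcongr
    refine (setLIntegral_le_lintegral _ _).trans ?_
    have := lintegral_pair_le hl H₁ H₂ ha₁ ha₂ hM0 (γ := fun l l' => ofReal (γ l l'))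
      hγ.ennreal_ofReal hM (measurable_const (a := 1))
    rw [lintegral_one, sphereMeasure_univ, ← ofReal_mul (by positivity), mul_assoc (a₁ * a₂)]
      at this
    simpa using this

theorem le_norm_smul_sub_smul {r₁ r₂ : ℝ} (hr₁ : 0 < r₁) (hr₂ : 0 < r₂) (l l' : S²) : ‖r₂ • (l' :
    Space3) - r₁ • (l : Space3)‖ ^ 2 = (r₂ - r₁) ^ 2 + r₁ * r₂ * ‖(l : Space3) - l'‖ ^ 2 := by
  rw [norm_sub_sq_real, norm_sub_sq_real, norm_smul, norm_smul, inner_smul_left, inner_smul_right,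
    norm_eq_of_mem_sphere, norm_eq_of_mem_sphere, norm_of_nonneg hr₁.le,
    norm_of_nonneg hr₂.le, real_inner_comm]
  simp only [conj_trivial]
  ring

theorem sqrt_mul_norm_sub_le {r₁ r₂ : ℝ} (hr₁ : 0 < r₁) (hr₂ : 0 < r₂) (l l' : S²) : sqrt (r₁ * r₂)
    * ‖(l : Space3) - l'‖ ≤ ‖r₂ • (l' : Space3) - r₁ • (l : Space3)‖ := by
  refine le_of_sq_le_sq ?_ (norm_nonneg _)
  rw [le_norm_smul_sub_smul hr₁ hr₂, mul_pow, sq_sqrt (by positivity)]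
  nlinarith [sq_nonneg (r₂ - r₁)]

theorem norm_pairComm_far_le (hl : 0 < lam) (hq : 2 < q) (H₁ : IsAmplitude lam q h₁ (ofReal a₁)) (H₂
    : IsAmplitude lam q h₂ (ofReal a₂)) (ha₁ : 0 ≤ a₁) (ha₂ : 0 ≤ a₂) (hc : 0 ≤ c) (hdec :
    CommutatorDecay T lam q c B₁ B₂) (hr₁ : 0 < r₁) (hr₂ : 0 < r₂) {d : ℝ} (hd : 0 ≤ d) (hE :
    MeasurableSet E) (hEd : ∀ z ∈ E, d ≤ sqrt (r₁ * r₂) * ‖(z.1.2 : Space3) - z.2.2‖) : ‖pairComm T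
    B₁ r₁ h₁ B₂ r₂ h₂ E‖ ≤ 2 * π * lam ^ 2 / (q - 2) * totalAngle * c * a₁ * a₂ * (wt lam (r₂ - r₁)
    ^ q * wt lam d ^ (2 - q)) := by
  have hq0 : 0 ≤ q := by linarith
  set ρ := sqrt (r₁ * r₂) with hρ
  have hρ0 : 0 < ρ := by positivity
  have hρ2 : ρ ^ 2 = r₁ * r₂ := sq_sqrt (by positivity)
  have hw := Real.rpow_pos_of_pos (wt_pos hl (r₂ - r₁)) q
  have hwd := Real.rpow_pos_of_pos (wt_pos hl d) (2 - q)
  have hlamw : ∀ x : ℝ, 0 ≤ x → lam + x = lam * wt lam x := by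
    intro x hx
    rw [wt, abs_of_nonneg hx]; field_simp
  have hq2 : 0 < q - 2 := by linarith
  have key := norm_pairComm_le (E := E) (r₁ := r₁) (r₂ := r₂) (c := c * wt lam (r₂ - r₁) ^ q)
    (M := 2 * π * lam ^ 2 / (q - 2) * wt lam d ^ (2 - q) / ρ ^ 2) hl hq0 H₁ H₂ ha₁ ha₂
    (by positivity) (by positivity)
    (γ := fun l l' => if d ≤ ρ * ‖(l : Space3) - l'‖ then
      wt lam (ρ * ‖(l : Space3) - l'‖) ^ (-q) else 0) ?_ (fun l => ?_) hE fun z hz _ _ =>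
        (hdec _ _ _ 0 _ (add_zero _).symm (by positivity : 0 ≤ ρ * ‖(z.1.2 : Space3) - z.2.2‖)
          ?_).trans ?_
  · refine key.trans (le_of_eq ?_)
    rw [abs_of_pos (by positivity), hρ2]
    field_simp
  · refine Measurable.ite ?_ ?_ measurable_const
    · exact measurableSet_le measurable_const (by fun_prop)
    · exact (continuous_wt_rpow hl (-q)).measurable.comp (by fun_prop)
  · have h1 := lintegral_sphere_decay l hl hq hd hρ0
    calc _ = ofReal (lam ^ q) * ∫⁻ l' : S²,
          (if d ≤ ρ * ‖(l : Space3) - l'‖ then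
            ofReal ((lam + ρ * ‖(l : Space3) - l'‖) ^ (-q)) else 0) ∂sphereMeasure := by
          rw [← lintegral_const_mul' _ _ ofReal_ne_top]
          refine lintegral_congr fun l' => ?_
          split_ifs
          · rw [← ofReal_mul (by positivity), hlamw _ (by positivity),
              mul_rpow hl.le (wt_pos hl _).le, ← mul_assoc, ← rpow_add hl, add_neg_cancel,
              Real.rpow_zero, one_mul]
          · simp
      _ ≤ _ := mul_le_mul_right h1 _
      _ = _ := by
          rw [← ofReal_mul (by positivity), hlamw d hd, mul_rpow hl.le (wt_pos hl _).le]
          congr 1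
          have h2 : lam ^ q * lam ^ (2 - q) = lam ^ 2 := by
            rw [← rpow_add hl, add_sub_cancel, rpow_two]
          rw [← h2]
          field_simp
  · rw [abs_zero, sub_zero]
    exact sqrt_mul_norm_sub_le hr₁ hr₂ _ _
  · rw [if_pos (hEd z hz), mul_assoc c, mul_comm (wt lam (r₂ - r₁) ^ q), mul_assoc]
    have h3 : wt lam ((conePoint r₂ z.2).1 - (conePoint r₁ z.1).1) ^ q ≤
        wt lam (z.2.1 - z.1.1) ^ q * wt lam (r₂ - r₁) ^ q := by
      refine le_trans (le_of_eq ?_) (wt_rpow_add_le hl hq0 _ _)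
      congr 2
      simp only [conePoint]; ring
    have h4 := rpow_nonneg (wt_pos hl (ρ * ‖(z.1.2 : Space3) - z.2.2‖)).le (-q)
    refine mul_le_mul_of_nonneg_left ?_ hc
    calc _ ≤ (wt lam (z.2.1 - z.1.1) ^ q * wt lam (r₂ - r₁) ^ q) * _ :=
          mul_le_mul_of_nonneg_right h3 h4
      _ = _ := by ring

/-- The commutator of two fields smeared over neighbouring spheres is bounded. -/
theorem norm_lie_smearRadius_le (hl : 0 < lam) (hq : 2 < q) (H₁ : IsAmplitude lam q h₁ (ofReal a₁))
    (H₂ : IsAmplitude lam q h₂ (ofReal a₂)) (ha₁ : 0 ≤ a₁) (ha₂ : 0 ≤ a₂) (hc : 0 ≤ c) (hdec :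
    CommutatorDecay T lam q c B₁ B₂) (hB₁ : Continuous (T.field B₁)) (hB₂ : Continuous (T.field B₂))
    {r : ℝ} (hr : 0 < r) : ‖⁅smearRadius T B₁ r h₁, smearRadius T B₂ r h₂⁆‖ ≤ 2 * π * lam ^ 2 / (q -
    2) * totalAngle * c * a₁ * a₂ := by
  rw [lie_smearRadius hl (by linarith) H₁ H₂ hB₁ hB₂]
  refine (norm_pairComm_far_le hl hq H₁ H₂ ha₁ ha₂ hc hdec hr hr le_rfl MeasurableSet.univ
    fun z _ => by positivity).trans (le_of_eq ?_)
  simp [wt]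

end PairComm

/-! ### Vectors of bounded energy -/

namespace TranslationRep
variable (T : TranslationRep H)

theorem integrable_smul_U {h : ℝ → ℂ} (hh : Integrable h) (ψ : H) : Integrable fun t : ℝ => h t •
    T.U (t, 0) ψ :=
  hh.smul_bdd ‖ψ‖ ((T.strongly_continuous ψ).comp (by fun_prop)).aestronglyMeasurable
    (.of_forall fun t => (T.norm_U _ ψ).le)

/-- The operator `∫ h(t) U(t) dt`. -/
def timeSmear (h : ℝ → ℂ) (hh : Integrable h) : Op H :=
  LinearMap.mkContinuous
    { toFun := fun ψ => ∫ t, h t • T.U (t, 0) ψ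
      map_add' := fun ψ φ => by
        simp only [_root_.map_add, smul_add]
        exact integral_add (T.integrable_smul_U hh ψ) (T.integrable_smul_U hh φ)
      map_smul' := fun c ψ => by
        simp only [map_smul, RingHom.id_apply]
        rw [← integral_smul]
        simp only [smul_comm c] }
    (∫ t, ‖h t‖) fun ψ => by
      rw [← integral_mul_const]
      refine norm_integral_le_of_norm_le (hh.norm.mul_const _) (.of_forall fun t => ?_)
      rw [norm_smul, T.norm_U]

/-- The vectors with energy at most `E`. -/
def energySubspace (E : ℝ) : Submodule ℂ H :=
  ⨅ (h : ℝ → ℂ) (hh : Integrable h) (_ : ∀ w : ℝ, w ≤ E → ∫ t, h t * exp (I * w * t) = 0),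
    LinearMap.ker (T.timeSmear h hh).toLinearMap

theorem mem_energySubspace {E : ℝ} {ψ : H} : ψ ∈ T.energySubspace E ↔ ∀ (h : ℝ → ℂ), Integrable h →
    (∀ w : ℝ, w ≤ E → ∫ t, h t * exp (I * w * t) = 0) → ∫ t, h t • T.U (t, 0) ψ = 0 := by
  simp only [energySubspace, Submodule.mem_iInf, LinearMap.mem_ker]
  rfl

theorem energySubspace_mono {E E' : ℝ} (h : E ≤ E') : T.energySubspace E ≤ T.energySubspace E' := by
  intro ψ hψ
  rw [mem_energySubspace] at hψ ⊢
  exact fun k hk h0 => hψ k hk fun w hw => h0 w (hw.trans h)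

theorem integral_mem_energySubspace {E : ℝ} {X : Type*} [MeasurableSpace X] {μ : Measure X} {F : X →
    H} (hF : ∀ x, F x ∈ T.energySubspace E) : ∫ x, F x ∂μ ∈ T.energySubspace E := by
  by_cases hi : Integrable F μ
  · rw [energySubspace]
    simp only [Submodule.mem_iInf, LinearMap.mem_ker]
    intro h hh h0
    change T.timeSmear h hh (∫ x, F x ∂μ) = 0
    rw [← integral_comp_comm _ hi]
    have : ∀ x, T.timeSmear h hh (F x) = 0 := fun x => (T.mem_energySubspace.1 (hF x)) h hh h0
    simp [this]
  · rw [integral_undef hi]; exact zero_mem _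

theorem mem_energySubspace_of_invariant {ψ : H} (hψ : ∀ a, T.U a ψ = ψ) : ψ ∈ T.energySubspace 0 :=
    by
  rw [mem_energySubspace]
  intro h hh h0
  simp_rw [hψ]
  rw [integral_smul_const]
  have := h0 0 le_rfl
  simp only [ofReal_zero, mul_zero, zero_mul, Complex.exp_zero, mul_one] at this
  rw [this, zero_smul]

/-- Fourier inversion for the dyadic kernel. -/
theorem _root_.NullAsymptotics.integral_dyadicKernel (w : ℝ) : ∫ s, dyadicKernel 0 s * exp (I * w *
    s) = cutoff w := by
  let f : SchwartzMap ℝ ℂ := (hasCompactSupport_cutoffPow 0).toSchwartzMap (contDiff_cutoffPow 0)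
  have hpi := pi_pos
  have hpc : (π : ℂ) ≠ 0 := by exact_mod_cast hpi.ne'
  have hF : ∀ v, FourierTransform.fourier (f : ℝ → ℂ) v = 2 * π * dyadicKernel 0 (2 * π * v) := by
    intro v
    rw [Real.fourier_real_eq_integral_exp_smul, dyadicKernel,
      mul_inv_cancel_left₀ (mul_ne_zero two_ne_zero hpc)]
    refine integral_congr_fun fun u => ?_
    change _ • cutoffPow 0 u = _
    rw [smul_eq_mul, mul_comm]
    congr 2
    push_cast; ring
  have inv := congrFun (f.continuous.fourierInv_fourier_eq f.integrable (by
    rw [← SchwartzMap.fourier_coe]; exact SchwartzMap.integrable _)) w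
  rw [Real.fourierInv_eq', funext hF] at inv
  have h1 := Measure.integral_comp_mul_left (fun s : ℝ =>
    dyadicKernel 0 s * exp (I * w * s)) (2 * π)
  rw [abs_of_pos (by positivity), real_smul] at h1
  have h2 : (f : ℝ → ℂ) w = cutoff w := by
    change cutoffPow 0 w = _
    simp [cutoffPow]
  rw [← h2, ← inv]
  have h3 : ∫ v : ℝ, exp ((2 * π * inner ℝ v w : ℝ) * I) •
      (2 * π * dyadicKernel 0 (2 * π * v)) = 2 * π * ∫ s : ℝ,
      dyadicKernel 0 (2 * π * s) * exp (I * w * (2 * π * s : ℝ)) := by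
    rw [← integral_const_mul]
    refine integral_congr_fun fun s => ?_
    rw [smul_eq_mul, mul_comm, mul_assoc]
    congr 3
    simp
    ring
  rw [h3, h1]
  push_cast
  rw [← mul_assoc, mul_inv_cancel₀ (mul_ne_zero two_ne_zero hpc), one_mul]

theorem integrable_dyadicKernel : Integrable (dyadicKernel 0) := by
  have := integrable_dyadicKernel_weight 0 0 (a := 0) le_rfl
  simp only [pow_zero, one_mul] at this
  exact (integrable_norm_iff (continuous_dyadicKernel 0).aestronglyMeasurable).1 this

/-- There are no vectors of negative energy. -/
theorem energySubspace_eq_zero (hs : ∀ ψ, T.spectralMeasure ψ {p | ¬ ‖p.2‖ ≤ p.1} = 0) {E : ℝ} (hE :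
    E < 0) {ψ : H} (hψ : ψ ∈ T.energySubspace E) : ψ = 0 := by
  rw [mem_energySubspace] at hψ
  have key : ∀ k : ℤ, ∀ᵐ p ∂T.spectralMeasure ψ, cutoff (2 ^ k * (p.1 - E)) = 0 := by
    intro k
    set a : ℝ := 2 ^ k with ha
    have ha0 : 0 < a := by positivity
    have hac : (a : ℂ) ≠ 0 := by exact_mod_cast ha0.ne'
    let h : ℝ → ℂ := fun t => (a : ℂ)⁻¹ * (exp (-(I * E * t)) * dyadicKernel 0 (a⁻¹ * t))
    have hh : Integrable h := by
      refine ((integrable_dyadicKernel.comp_mul_left' (inv_pos.2 ha0).ne').bdd_mul (c := 1)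
        (by fun_prop : Continuous fun t : ℝ => exp (-(I * E * t))).aestronglyMeasurable
        (.of_forall fun t => (norm_exp_neg_I_mul E t).le)).const_mul _
    have hF : ∀ w : ℝ, ∫ t, h t * exp (I * w * t) = cutoff (a * (w - E)) := by
      intro w
      rw [← integral_dyadicKernel]
      have h1 := Measure.integral_comp_mul_left (fun s : ℝ => dyadicKernel 0 s *
        exp (I * (a * (w - E) : ℝ) * s)) a⁻¹
      rw [inv_inv, abs_of_pos ha0, real_smul] at h1
      have h2 : ∫ t, h t * exp (I * w * t) = (a : ℂ)⁻¹ *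
          ∫ t : ℝ, dyadicKernel 0 (a⁻¹ * t) * exp (I * (a * (w - E) : ℝ) * (a⁻¹ * t : ℝ)) := by
        rw [← integral_const_mul]
        refine integral_congr_fun fun t => ?_
        simp only [h]
        have : exp (I * (a * (w - E) : ℝ) * (a⁻¹ * t : ℝ)) =
            exp (-(I * E * t)) * exp (I * w * t) := by
          rw [← exp_add]
          congr 1
          push_cast
          field_simp
          ring
        rw [this]; ring
      rw [h2, h1, inv_mul_cancel_left₀ hac]
    have h0 := hψ h hh fun w hw => by
      rw [hF, cutoff_of_le, ofReal_zero]
      have : a * (w - E) ≤ 0 := mul_nonpos_of_nonneg_of_nonpos ha0.le (by linarith)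
      linarith
    have hc : StronglyMeasurable h := by
      have := continuous_dyadicKernel 0
      exact (by fun_prop : Continuous h).stronglyMeasurable
    obtain ⟨hb, h3⟩ := T.functionOf_integral_planeWave (ρ := volume) (k := h)
      (a := fun t : ℝ => ((t, 0) : Mink)) hh hc (by fun_prop) ψ
    rw [h0] at h3
    have h4 := T.norm_sq_functionOf hb ψ
    rw [h3, norm_zero] at h4
    have h5 : ∀ p : Mink, ∫ t, h t * planeWave (t, 0) p = cutoff (a * (p.1 - E)) := by
      intro p
      rw [← hF]
      refine integral_congr_fun fun t => ?_
      simp only [planeWave, mdot, inner_zero_right, sub_zero]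
      push_cast
      rw [← mul_assoc I]
    simp only [h5] at h4 hb
    have h6 : Integrable (fun p : Mink => ‖(cutoff (a * (p.1 - E)) : ℂ)‖ ^ 2) (T.spectralMeasure ψ) := by
      refine Integrable.of_bound (hb.1.norm.pow_const 2).aestronglyMeasurable 1
        (.of_forall fun p => ?_)
      rw [norm_pow, norm_norm, norm_real]
      exact pow_le_one₀ (norm_nonneg _) (abs_cutoff_le _)
    rw [zero_pow two_ne_zero, eq_comm, integral_eq_zero_iff_of_nonneg (fun p => by positivity) h6]
      at h4
    filter_upwards [h4] with p hp
    simpa using hp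
  have h7 : ∀ᵐ p ∂T.spectralMeasure ψ, False := by
    have hsp : ∀ᵐ p ∂T.spectralMeasure ψ, ‖p.2‖ ≤ p.1 := by
      rw [ae_iff]; exact hs ψ
    filter_upwards [ae_all_iff.2 key, hsp] with p hp h8
    have h9 : 0 < p.1 - E := by have := (norm_nonneg p.2).trans h8; linarith
    have := hasSum_cutoff h9
    simp only [hp] at this
    exact zero_ne_one (hasSum_zero.unique this)
  have h8 : T.spectralMeasure ψ Set.univ = 0 := by
    rw [ae_iff] at h7; simpa using h7
  have h9 := T.spectralMeasure_univ ψ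
  rw [measureReal_def, h8, ENNReal.toReal_zero] at h9
  exact norm_eq_zero.1 (pow_eq_zero_iff two_ne_zero |>.1 h9.symm)

/-- Energy-momentum transfer of smeared fields. -/
theorem smearRadius_mem_energySubspace {lam q : ℝ} (hl : 0 < lam) (hq : 0 ≤ q) {f : TestFn} {A :
    ENNReal} (hA : A ≠ ⊤) (hf : IsAmplitude lam q f A) {B : Op H} (hB : Continuous (T.field B)) {β :
    ℝ} (hG : ∀ l : S², ∃ G : ℝ → ℂ, Integrable G ∧ (∀ v, G v ≠ 0 → v ≤ β) ∧ ∀ s : ℝ, f s l = ∫ v :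
    ℝ, G v * exp (-(I * v * s))) (r : ℝ) {E : ℝ} {ψ : H} (hψ : ψ ∈ T.energySubspace E) : smearRadius
    T B r f ψ ∈ T.energySubspace (E + β) := by
  rw [mem_energySubspace] at hψ ⊢
  intro h hh h0
  have hfi := hf.integrable_smul (T := T) hl hq hA hB r
  let Φ : ℝ × (ℝ × S²) → H := fun z =>
    (h z.1 * f z.2.1 z.2.2) • T.U (z.1, 0) (T.field B (conePoint r z.2) ψ)
  have hΦ : Integrable Φ (volume.prod coneMeasure) := by
    refine (hh.mul_prod (hf.integrable hl hq hA)).smul_bdd (‖B‖ * ‖ψ‖) ?_ (.of_forall fun z => ?_)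
    · have h1 : Continuous fun z : ℝ × (ℝ × S²) =>
          T.field B ((z.1, 0) + conePoint r z.2) (T.U (z.1, 0) ψ) :=
        (hB.comp (by have := continuous_conePoint r; fun_prop)).clm_apply
          ((T.strongly_continuous ψ).comp (by fun_prop))
      refine (h1.congr fun z => ?_).aestronglyMeasurable
      exact DFunLike.congr_fun (T.field_mul_U B (z.1, 0) (conePoint r z.2)) ψ
    · rw [T.norm_U]
      exact (le_opNorm _ _).trans (mul_le_mul_of_nonneg_right (T.norm_field_le B _) (norm_nonneg _))
  let S : ℝ × (ℝ × S²) → ℝ × (ℝ × S²) :=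
    fun z => (z.1, (z.2.1 - z.1, z.2.2))
  have hS : MeasurePreserving S (volume.prod coneMeasure) (volume.prod coneMeasure) := by
    refine MeasurePreserving.skew_product (f := id) (g := fun t (x : ℝ × S²) => (x.1 - t, x.2))
      (MeasurePreserving.id _) (by fun_prop) (.of_forall fun t => ?_)
    exact ((measurePreserving_sub_right volume t).prod (MeasurePreserving.id sphereMeasure)).map_eq
  have e1 : ∫ t, h t • T.U (t, 0) (smearRadius T B r f ψ) = ((r / (2 * π) : ℝ) : ℂ) •
      ∫ z, Φ z ∂volume.prod coneMeasure := by
    rw [integral_prod _ hΦ, ← integral_smul]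
    refine integral_congr_fun fun t => ?_
    rw [smearRadius_eq, smul_apply, map_smul, smul_comm, integral_apply hfi,
      ← integral_comp_comm _ (hfi.apply_continuousLinearMap ψ), ← integral_smul]
    congr 1
    refine integral_congr_fun fun x => ?_
    simp only [Φ, smul_apply, map_smul, smul_smul]
  have e2 : ∫ z, Φ z ∂volume.prod coneMeasure = ∫ z, Φ (S z) ∂volume.prod coneMeasure := by
    conv_lhs => rw [← hS.map_eq]
    rw [integral_map hS.measurable.aemeasurable]
    rw [hS.map_eq]; exact hΦ.aestronglyMeasurable
  have e3 : ∫ z, Φ (S z) ∂volume.prod coneMeasure = 0 := by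
    have hi : Integrable (fun z => Φ (S z)) (volume.prod coneMeasure) :=
      hS.integrable_comp_of_integrable hΦ
    rw [integral_prod_symm _ hi]
    refine (integral_congr_fun fun x => ?_).trans (integral_zero _ _)
    obtain ⟨G, hGi, hGs, hGf⟩ := hG x.2
    let h' : ℝ → ℂ := fun t => h t * f (x.1 - t) x.2
    have hfc : Continuous fun s => f s x.2 := by
      rw [funext hGf]
      refine continuous_of_dominated (bound := fun v => ‖G v‖) (fun s => ?_) (fun s =>
        .of_forall fun v => ?_) hGi.norm (.of_forall fun v => by fun_prop)
      · exact hGi.aestronglyMeasurable.mul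
          (by fun_prop : Continuous fun v : ℝ => exp (-(I * v * s))).aestronglyMeasurable
      · rw [norm_mul, norm_exp_neg_I_mul, mul_one]
    have hh' : Integrable h' := by
      refine hh.mul_bdd (c := ∫ v, ‖G v‖) (hfc.comp (by fun_prop)).aestronglyMeasurable
        (.of_forall fun t => ?_)
      rw [hGf]
      refine norm_integral_le_of_norm_le hGi.norm (.of_forall fun v => ?_)
      rw [norm_mul, norm_exp_neg_I_mul, mul_one]
    have hz := hψ h' hh' fun w hw => by
      have h1 : ∀ t : ℝ, h' t * exp (I * w * t) = ∫ v : ℝ, G v * exp (-(I * v * x.1)) *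
            (h t * exp (I * (w + v : ℝ) * t)) := by
        intro t
        simp only [h', hGf]
        rw [mul_right_comm, ← integral_const_mul]
        refine integral_congr_fun fun v => ?_
        have h2 : exp (-(I * v * (x.1 - t : ℝ))) * exp (I * w * t) =
            exp (-(I * v * x.1)) * exp (I * (w + v : ℝ) * t) := by
          rw [← exp_add, ← exp_add]
          congr 1
          push_cast; ring
        linear_combination (h t * G v) * h2
      simp_rw [h1]
      rw [integral_integral_swap]
      · refine (integral_congr_fun fun v => ?_).trans (integral_zero _ _)
        beta_reduce
        rw [integral_const_mul]
        by_cases hv : G v = 0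
        · rw [hv, zero_mul, zero_mul]
        · rw [h0 _ (add_le_add hw (hGs v hv)), mul_zero]
      · have hc : Continuous fun z : ℝ × ℝ => exp (-(I * z.2 * x.1)) *
            exp (I * (w + z.2 : ℝ) * z.1) := by fun_prop
        refine ((hh.mul_prod hGi).bdd_mul (c := 1) hc.aestronglyMeasurable
          (.of_forall fun z => ?_)).congr (.of_forall fun z => ?_)
        · rw [norm_mul, norm_exp_neg_I_mul, norm_exp_I_mul, one_mul]
        · simp only [Function.uncurry]; ring
    have h3 : ∀ t : ℝ, Φ (S (t, x)) = T.field B (conePoint r x) (h' t • T.U (t, 0) ψ) := by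
      intro t
      have h4 := DFunLike.congr_fun (T.field_mul_U B (t, 0) (conePoint r (x.1 - t, x.2))) ψ
      have h5 : ((t, 0) : Mink) + conePoint r (x.1 - t, x.2) = conePoint r x := by
        simp only [conePoint, Prod.mk_add_mk, zero_add]
        congr 1; ring
      rw [h5] at h4
      simp only [Φ, S, map_smul, h']
      congr 1
      exact h4.symm
    simp only [h3]
    rw [integral_comp_comm _ (T.integrable_smul_U hh' ψ), hz, _root_.map_zero]
  rw [e1, e2, e3, smul_zero]

end TranslationRep

/-! ### Energy bounds -/

theorem norm_sq_star_apply (A : Op H) (ψ : H) : ‖star A ψ‖ ^ 2 ≤ ‖A ψ‖ ^ 2 + ‖⁅A, star A⁆‖ * ‖ψ‖ ^ 2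
    := by
  have h1 : ∀ D : Op H, (‖D ψ‖ ^ 2 : ℝ) = (inner ℂ ψ ((star D * D) ψ)).re := by
    intro D
    rw [star_eq_adjoint, mul_apply_eq_comp, adjoint_inner_right, inner_self_eq_norm_sq_to_K]
    norm_cast
  have h2 : inner ℂ ψ ((A * star A) ψ) = inner ℂ ψ ((star A * A) ψ) + inner ℂ ψ (⁅A, star A⁆ ψ) := by
    rw [Ring.lie_def, sub_apply, inner_sub_right]; ring
  have h3 : (inner ℂ ψ (⁅A, star A⁆ ψ)).re ≤ ‖⁅A, star A⁆‖ * ‖ψ‖ ^ 2 := by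
    refine (Complex.re_le_norm _).trans ((norm_inner_le_norm _ _).trans ?_)
    have := mul_le_mul_of_nonneg_left (⁅A, star A⁆.le_opNorm ψ) (norm_nonneg ψ)
    linarith
  have h4 := h1 (star A)
  rw [star_star, h2, Complex.add_re, ← h1] at h4
  linarith

theorem hasSum_apply {ι : Type*} {Y : ι → Op H} {X : Op H} (hY : HasSum Y X) (ψ : H) : HasSum (fun k
    => Y k ψ) (X ψ) :=
  let Φ : (Op H) →+ H := { toFun := fun A => A ψ, map_zero' := rfl, map_add' := fun _ _ => rfl }
  hY.map Φ (by fun_prop : Continuous fun A : Op H => A ψ)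

namespace TranslationRep
variable (T : TranslationRep H)

/-- Operators which lower the energy by a gap are bounded by the square root of the energy. -/
theorem norm_sq_le_of_gap (hs : ∀ ψ, T.spectralMeasure ψ {p | ¬ ‖p.2‖ ≤ p.1} = 0) {A : Op H} {gap C
    : ℝ} (hC : ‖⁅A, star A⁆‖ ≤ C) (hA : ∀ E, ∀ ψ ∈ T.energySubspace E, A ψ ∈ T.energySubspace (E -
    gap)) (n : ℕ) : ∀ E : ℝ, E < n * gap → ∀ ψ ∈ T.energySubspace E, ‖A ψ‖ ^ 2 ≤ C * n * ‖ψ‖ ^ 2 :=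
    by
  have hC0 : 0 ≤ C := (norm_nonneg _).trans hC
  induction n with
  | zero =>
    intro E hE ψ hψ
    rw [Nat.cast_zero, zero_mul] at hE
    simp [T.energySubspace_eq_zero hs hE hψ]
  | succ n ih =>
    intro E hE ψ hψ
    push_cast at hE ⊢
    have h1 := ih (E - gap) (by linarith) (A ψ) (hA E ψ hψ)
    have h2 : ‖star A (A ψ)‖ ^ 2 ≤ C * (n + 1) * ‖A ψ‖ ^ 2 := by
      have := norm_sq_star_apply A (A ψ)
      have := mul_le_mul_of_nonneg_right hC (sq_nonneg ‖A ψ‖)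
      linarith
    have h3 : ‖A ψ‖ ^ 2 ≤ ‖ψ‖ * ‖star A (A ψ)‖ := by
      have h4 : ((‖A ψ‖ ^ 2 : ℝ) : ℂ) = inner ℂ ψ (star A (A ψ)) := by
        rw [star_eq_adjoint, adjoint_inner_right, inner_self_eq_norm_sq_to_K]
        norm_cast
      have h5 := norm_inner_le_norm (𝕜 := ℂ) ψ (star A (A ψ))
      rw [← h4, norm_real, norm_of_nonneg (sq_nonneg _)] at h5
      exact h5
    have h6 : (‖A ψ‖ ^ 2) ^ 2 ≤ ‖ψ‖ ^ 2 * (C * (n + 1) * ‖A ψ‖ ^ 2) := by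
      calc _ ≤ (‖ψ‖ * ‖star A (A ψ)‖) ^ 2 := pow_le_pow_left₀ (sq_nonneg _) h3 2
        _ = ‖ψ‖ ^ 2 * ‖star A (A ψ)‖ ^ 2 := mul_pow _ _ _
        _ ≤ _ := mul_le_mul_of_nonneg_left h2 (sq_nonneg _)
    rcases (sq_nonneg ‖A ψ‖).eq_or_lt with h0 | h0
    · rw [← h0]; positivity
    · refine le_of_mul_le_mul_right ?_ h0
      nlinarith

/-- Sums of operators with energy transfers `e k` and norms `t k` relative to the energy. -/
def EnergyRegular (t e : ℤ → ℝ) (X : Op H) : Prop := ∃ Y : ℤ → Op H, HasSum Y X ∧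
  ∀ k E, 0 ≤ E → ∀ ψ ∈ T.energySubspace E, Y k ψ ∈ T.energySubspace (E + e k) ∧
    ‖Y k ψ‖ ≤ t k * (1 + E) * ‖ψ‖

/-- The vector `ψ` is a sum of vectors of bounded energy, with weight `s` bounded by `c`. -/
def EnergySum (s : ℕ) (ψ : H) (c : ℝ) : Prop := ∃ (ι : Type) (x : ι → H) (E : ι → ℝ),
  HasSum x ψ ∧ (∀ i, 0 ≤ E i ∧ x i ∈ T.energySubspace (E i)) ∧
    Summable (fun i => (1 + E i) ^ s * ‖x i‖) ∧ ∑' i, (1 + E i) ^ s * ‖x i‖ ≤ c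

/-- Families of operators with uniform energy bounds. -/
def TameFamily (X : ℝ → Op H) : Prop := ∀ s : ℕ, ∃ t e : ℤ → ℝ, (∀ k, 0 ≤ t k ∧ 0 ≤ e k) ∧
  Summable (fun k => t k * (1 + e k) ^ s) ∧ ∀ᶠ R in atTop, T.EnergyRegular t e (X R)

/-- Families of vectors with uniform energy bounds. -/
def TameVector (v : ℝ → H) : Prop := ∀ s : ℕ, ∃ c : ℝ, ∀ᶠ R in atTop, T.EnergySum s (v R) c

variable {T}

theorem EnergyRegular.energySum {t e : ℤ → ℝ} {X : Op H} {s : ℕ} {ψ : H} {c : ℝ} (hX :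
    T.EnergyRegular t e X) (hte : ∀ k, 0 ≤ t k ∧ 0 ≤ e k) (hsum : Summable fun k => t k * (1 + e k)
    ^ s) (hψ : T.EnergySum (s + 1) ψ c) : T.EnergySum s (X ψ) ((∑' k, t k * (1 + e k) ^ s) * c) :=
    by
  obtain ⟨Y, hY, hYb⟩ := hX
  obtain ⟨ι, x, E, hx, hxE, hxs, hxc⟩ := hψ
  have hn : ∀ k i, (1 + (E i + e k)) ^ s * ‖Y k (x i)‖ ≤
      (t k * (1 + e k) ^ s) * ((1 + E i) ^ (s + 1) * ‖x i‖) := by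
    intro k i
    have hE := (hxE i).1
    have he := (hte k).2
    have ht := (hte k).1
    have h1 : 1 + (E i + e k) ≤ (1 + E i) * (1 + e k) := by nlinarith
    calc _ ≤ ((1 + E i) * (1 + e k)) ^ s * (t k * (1 + E i) * ‖x i‖) := by
          gcongr
          exact (hYb k (E i) hE (x i) (hxE i).2).2
      _ = _ := by rw [mul_pow]; ring
  have hprod := hsum.mul_of_nonneg hxs (fun k => mul_nonneg (hte k).1
    (pow_nonneg (by linarith [(hte k).2]) _)) (fun i => mul_nonneg
    (pow_nonneg (by linarith [(hxE i).1]) _) (norm_nonneg _))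
  have hs1 : Summable fun p : ℤ × ι => (1 + (E p.2 + e p.1)) ^ s * ‖Y p.1 (x p.2)‖ :=
    of_nonneg_of_le (fun p => mul_nonneg (pow_nonneg
      (by linarith [(hxE p.2).1, (hte p.1).2]) _) (norm_nonneg _)) (fun p => hn p.1 p.2) hprod
  have hs2 : Summable fun p : ℤ × ι => Y p.1 (x p.2) := by
    refine Summable.of_norm_bounded hs1 fun p => ?_
    refine le_mul_of_one_le_left (norm_nonneg _) (one_le_pow₀ ?_)
    linarith [(hxE p.2).1, (hte p.1).2]
  refine ⟨ℤ × ι, fun p => Y p.1 (x p.2), fun p => E p.2 + e p.1, ?_, fun p =>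
    ⟨add_nonneg (hxE p.2).1 (hte p.1).2, (hYb p.1 _ (hxE p.2).1 _ (hxE p.2).2).1⟩, hs1, ?_⟩
  · have h1 : ∀ k, HasSum (fun i => Y k (x i)) (Y k ψ) := fun k => (Y k).hasSum hx
    have h2 : HasSum (fun k => Y k ψ) (X ψ) := hasSum_apply hY ψ
    have h3 : HasSum (fun k => Y k ψ) (∑' p : ℤ × ι, Y p.1 (x p.2)) :=
      HasSum.prod_fiberwise (f := fun p : ℤ × ι => Y p.1 (x p.2)) hs2.hasSum h1
    have h4 := hs2.hasSum
    rwa [← h2.unique h3] at h4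
  · have h5 : ∑' p : ℤ × ι, (1 + (E p.2 + e p.1)) ^ s * ‖Y p.1 (x p.2)‖ ≤ ∑' p : ℤ × ι,
        t p.1 * (1 + e p.1) ^ s * ((1 + E p.2) ^ (s + 1) * ‖x p.2‖) :=
      Summable.tsum_le_tsum (fun p => hn p.1 p.2) hs1 hprod
    refine h5.trans ?_
    rw [← hsum.tsum_mul_tsum hxs hprod]
    refine mul_le_mul_of_nonneg_left hxc (tsum_nonneg fun k => mul_nonneg (hte k).1
      (pow_nonneg (by linarith [(hte k).2]) _))

theorem EnergySum.norm_le {s : ℕ} {ψ : H} {c : ℝ} (h : T.EnergySum s ψ c) : ‖ψ‖ ≤ c := by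
  obtain ⟨ι, x, E, hx, hxE, hxs, hxc⟩ := h
  have h1 : ∀ i, ‖x i‖ ≤ (1 + E i) ^ s * ‖x i‖ := fun i =>
    le_mul_of_one_le_left (norm_nonneg _) (one_le_pow₀ (by linarith [(hxE i).1]))
  have h2 : Summable fun i => ‖x i‖ := of_nonneg_of_le (fun i => norm_nonneg _) h1 hxs
  rw [← hx.tsum_eq]
  exact (norm_tsum_le_tsum_norm h2).trans ((h2.tsum_le_tsum h1 hxs).trans hxc)

theorem TameFamily.tameVector {X : ℝ → Op H} {v : ℝ → H} (hX : T.TameFamily X) (hv : T.TameVector v)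
    : T.TameVector fun R => X R (v R) := by
  intro s
  obtain ⟨t, e, hte, hsum, hR⟩ := hX s
  obtain ⟨c, hc⟩ := hv (s + 1)
  exact ⟨_, by filter_upwards [hR, hc] with R h1 h2 using h1.energySum hte hsum h2⟩

theorem TameVector.exists_norm_le {v : ℝ → H} (hv : T.TameVector v) : ∃ c, ∀ᶠ R in atTop, ‖v R‖ ≤ c
    := by
  obtain ⟨c, hc⟩ := hv 0
  exact ⟨c, hc.mono fun R h => h.norm_le⟩

theorem tameVector_const {ψ : H} (hψ : ∀ a, T.U a ψ = ψ) : T.TameVector fun _ => ψ := by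
  intro s
  refine ⟨‖ψ‖, .of_forall fun R => ⟨Unit, fun _ => ψ, fun _ => 0, ?_, fun _ =>
    ⟨le_rfl, T.mem_energySubspace_of_invariant hψ⟩, Summable.of_finite, ?_⟩⟩
  · simpa using hasSum_unique (fun _ : Unit => ψ)
  · simp

end TranslationRep

/-! ### Smearing in the radius -/

section Smear

variable {T : TranslationRep H} {B : Op H} {lam q a : ℝ} {h : TestFn} {γ : ℝ → ℝ}

theorem continuous_smearRadius (hl : 0 < lam) (hq : 0 ≤ q) {A : ENNReal} (hA : A ≠ ⊤) (hh :
    IsAmplitude lam q h A) (hB : Continuous (T.field B)) : Continuous fun r => smearRadius T B r h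
    := by
  simp_rw [smearRadius_eq]
  refine (continuous_ofReal.comp (by fun_prop)).smul ?_
  refine continuous_of_dominated (bound := fun x => ‖h x.1 x.2‖ * ‖B‖) (fun r =>
    (hh.integrable_smul hl hq hA hB r).aestronglyMeasurable) (fun r => .of_forall fun x => ?_)
    ((hh.integrable hl hq hA).norm.mul_const _) (.of_forall fun x => ?_)
  · rw [norm_smul]
    exact mul_le_mul_of_nonneg_left (T.norm_field_le B _) (norm_nonneg _)
  · have h1 : Continuous fun r => conePoint r x := by unfold conePoint; fun_prop
    exact (hB.comp h1).const_smul (h x.1 x.2)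

theorem integrable_smear (hl : 0 < lam) (hq : 0 ≤ q) {A : ENNReal} (hA : A ≠ ⊤) (hh : IsAmplitude
    lam q h A) (hB : Continuous (T.field B)) (hγ : Continuous γ) (hγc : HasCompactSupport γ) :
    Integrable fun r => (γ r : ℂ) • smearRadius T B r h := by
  refine Continuous.integrable_of_hasCompactSupport ((continuous_ofReal.comp hγ).smul
    (continuous_smearRadius hl hq hA hh hB)) ?_
  exact (hγc.comp_left (g := fun x : ℝ => (x : ℂ)) ofReal_zero).smul_right

theorem smear_apply (hl : 0 < lam) (hq : 0 ≤ q) {A : ENNReal} (hA : A ≠ ⊤) (hh : IsAmplitude lam q h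
    A) (hB : Continuous (T.field B)) (hγ : Continuous γ) (hγc : HasCompactSupport γ) (ψ : H) : smear
    T B γ h ψ = ∫ r, (γ r : ℂ) • smearRadius T B r h ψ := by
  rw [smear, integral_apply (integrable_smear hl hq hA hh hB hγ hγc)]
  rfl

theorem star_smear : star (smear T B γ h) = ∫ r, (γ r : ℂ) • star (smearRadius T B r h) := by
  have : star (smear T B γ h) = (starL' ℝ : (Op H) ≃L[ℝ] (Op H)) (smear T B γ h) := rfl
  rw [this, smear, ← ContinuousLinearEquiv.integral_comp_comm]
  refine integral_congr_fun fun r => ?_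
  change star (_ • _) = _
  simp [star_smul]

theorem star_smear_apply (hl : 0 < lam) (hq : 0 ≤ q) {A : ENNReal} (hA : A ≠ ⊤) (hh : IsAmplitude
    lam q h A) (hB : Continuous (T.field B)) (hγ : Continuous γ) (hγc : HasCompactSupport γ) (ψ : H)
    : star (smear T B γ h) ψ = ∫ r, (γ r : ℂ) • star (smearRadius T B r h) ψ := by
  have hi : Integrable fun r => (γ r : ℂ) • star (smearRadius T B r h) := by
    have := (starL' ℝ : (Op H) ≃L[ℝ] (Op H)).toContinuousLinearMap.integrable_comp
      (integrable_smear hl hq hA hh hB hγ hγc)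
    refine this.congr (.of_forall fun r => ?_)
    change star (_ • _) = _
    simp [star_smul]
  rw [star_smear, integral_apply hi]
  rfl

theorem hasSum_smear (hl : 0 < lam) (hq : 0 ≤ q) {f : ℤ → TestFn} {a : ℤ → ℝ} (ha0 : ∀ k, 0 ≤ a k)
    (ha : Summable a) (hf : ∀ k, IsAmplitude lam q (f k) (ofReal (a k))) (hs : ∀ s (l : S²), HasSum
    (fun k => f k s l) (h s l)) (hB : Continuous (T.field B)) (hγ : Continuous γ) (hγc :
    HasCompactSupport γ) : HasSum (fun k => smear T B γ (f k)) (smear T B γ h) := by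
  have h1 : smear T B γ h = ∫ r, ∑' k, (γ r : ℂ) • smearRadius T B r (f k) := by
    refine integral_congr_fun fun r => ?_
    exact ((hasSum_smearRadius hl hq ha0 ha hf hs hB r).const_smul (γ r : ℂ)).tsum_eq.symm
  rw [h1]
  have hi := fun k => integrable_smear hl hq ofReal_ne_top (hf k) hB hγ hγc
  refine hasSum_integral_of_summable_integral_norm hi ?_
  have hi2 : Integrable fun r => ‖γ r‖ * |r| := by
    refine Continuous.integrable_of_hasCompactSupport (by fun_prop) ?_
    exact (hγc.norm).mul_right
  refine of_nonneg_of_le (fun k => integral_nonneg fun x => norm_nonneg _) (fun k => ?_)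
    (ha.mul_left ((∫ r, ‖γ r‖ * |r|) * (‖B‖ * totalAngle)))
  rw [mul_assoc, ← integral_mul_const]
  refine integral_mono (hi k).norm (hi2.mul_const _) fun r => ?_
  beta_reduce
  rw [norm_smul, norm_real, mul_assoc]
  refine mul_le_mul_of_nonneg_left ?_ (norm_nonneg _)
  have := (hf k).norm_smearRadius_le (T := T) (B := B) hl hq (ha0 k) r
  linarith

end Smear

/-! ### The radial window -/

section Window

variable {lam η τ₁ τ₂ R r : ℝ} {g : ℝ → ℝ}

theorem width_pos (hl : 0 < lam) (hR : 0 < R) : 0 < width lam η R := by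
  unfold width; positivity

theorem width_le (hl : 0 < lam) (hη : η ≤ 1) (hR : lam ≤ R) : width lam η R ≤ R := by
  have h1 : 1 ≤ R / lam := (one_le_div hl).2 hR
  have h2 := Real.rpow_le_rpow_of_exponent_le h1 hη
  rw [rpow_one] at h2
  calc width lam η R ≤ lam * (R / lam) := mul_le_mul_of_nonneg_left h2 hl.le
    _ = R := by field_simp

theorem le_of_mem_window (hl : 0 < lam) (hη : η ≤ 1) (hR : lam ≤ R) (hr : r ∈ window lam η τ₁ τ₂ R)
    : min 1 τ₁ * R ≤ r := by
  have hR0 := hl.trans_le hR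
  have h1 := width_le hl hη hR
  have h2 := (width_pos (η := η) hl hR0).le
  refine le_trans ?_ hr.1
  rcases le_total 1 τ₁ with h | h
  · rw [min_eq_left h]; nlinarith
  · rw [min_eq_right h]; nlinarith

theorem le_of_mem_window' (hl : 0 < lam) (hη : η ≤ 1) (hR : lam ≤ R) (hτ : 0 ≤ τ₂) (hr : r ∈ window
    lam η τ₁ τ₂ R) : r ≤ (1 + τ₂) * R := by
  have hR0 := hl.trans_le hR
  have h1 := width_le hl hη hR
  have h2 := (width_pos (η := η) hl hR0).le
  refine hr.2.trans ?_
  nlinarith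

theorem abs_sub_le_of_mem_window {r' : ℝ} (hr : r ∈ window lam η τ₁ τ₂ R) (hr' : r' ∈ window lam η
    τ₁ τ₂ R) : |r' - r| ≤ (τ₂ - τ₁) * width lam η R := by
  have h1 := hr.1; have h2 := hr.2; have h3 := hr'.1; have h4 := hr'.2
  rw [abs_le]
  constructor <;> nlinarith

theorem continuous_scaled (hg : Continuous g) : Continuous (scaled lam η g R) := by
  unfold scaled; fun_prop

theorem mem_window_of_scaled_ne_zero (hl : 0 < lam) (hR : 0 < R) (hg : tsupport g ⊆ Icc τ₁ τ₂) (h :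
    scaled lam η g R r ≠ 0) : r ∈ window lam η τ₁ τ₂ R := by
  have hw := width_pos (η := η) hl hR
  have h1 := hg (subset_tsupport g (Function.mem_support.2 (right_ne_zero_of_mul h)))
  have h2 : r = R + (((width lam η R)⁻¹ * (r - R) + 1) - 1) * width lam η R := by
    field_simp; ring
  constructor
  · conv_rhs => rw [h2]
    nlinarith [h1.1]
  · conv_lhs => rw [h2]
    nlinarith [h1.2]

theorem hasCompactSupport_scaled (hl : 0 < lam) (hR : 0 < R) (hg : tsupport g ⊆ Icc τ₁ τ₂) :
    HasCompactSupport (scaled lam η g R) :=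
  HasCompactSupport.intro isCompact_Icc fun r hr => by
    by_contra h
    exact hr (mem_window_of_scaled_ne_zero hl hR hg h)

theorem integral_scaled_comp (φ : ℝ → ℝ) (hl : 0 < lam) (hR : 0 < R) : ∫ r, (width lam η R)⁻¹ * φ
    ((width lam η R)⁻¹ * (r - R) + 1) = ∫ r, φ r := by
  have hw := width_pos (η := η) hl hR
  rw [integral_const_mul, integral_sub_right_eq_self (fun r => φ ((width lam η R)⁻¹ * r + 1)) R,
    Measure.integral_comp_mul_left (fun r => φ (r + 1)), integral_add_right_eq_self φ 1, inv_inv,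
    abs_of_pos hw, smul_eq_mul, ← mul_assoc, inv_mul_cancel₀ hw.ne', one_mul]

theorem integral_scaled (hl : 0 < lam) (hR : 0 < R) : ∫ r, scaled lam η g R r = ∫ r, g r :=
  integral_scaled_comp g hl hR

theorem integral_abs_scaled (hl : 0 < lam) (hR : 0 < R) : ∫ r, |scaled lam η g R r| = ∫ r, |g r| :=
    by
  rw [← integral_scaled_comp (η := η) (fun r => |g r|) hl hR]
  refine integral_congr_fun fun r => ?_
  simp [scaled, abs_mul, abs_of_pos (width_pos (η := η) hl hR)]

end Window

/-! ### Energy bounds for the smeared fields -/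

namespace VacuumTheory

variable {lam κ : ℝ} {T : VacuumTheory H lam κ} {q ε a : ℝ} {h : TestFn} {n : ℤ}
  {b : TestFn} {B : Op H}

/-- Amplitudes with frequencies in `[gap, β]`. -/
def HasBand (gap β : ℝ) (h : TestFn) : Prop :=
  ∀ l : S², ∃ G : ℝ → ℂ, Integrable G ∧ (∀ v, G v ≠ 0 → v ∈ Icc gap β) ∧
    ∀ s : ℝ, h s l = ∫ v : ℝ, G v * exp (-(I * v * s))

theorem HasBand.raise {gap β : ℝ} (hh : HasBand gap β h) (hl : 0 < lam) (hq : 0 ≤ q) (hA :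
    IsAmplitude lam q h (ofReal a)) (hB : B ∈ T.𝓕) (r : ℝ) {E : ℝ} {ψ : H} (hψ : ψ ∈
    T.energySubspace E) : smearRadius T B r h ψ ∈ T.energySubspace (E + β) :=
  T.smearRadius_mem_energySubspace hl hq ofReal_ne_top hA (T.continuous_field hB) (fun l => by
      obtain ⟨G, h1, h2, h3⟩ := hh l
      exact ⟨G, h1, fun v hv => (h2 v hv).2, h3⟩) r hψ

theorem HasBand.lower {gap β : ℝ} (hh : HasBand gap β h) (hl : 0 < lam) (hq : 0 ≤ q) (hA :
    IsAmplitude lam q h (ofReal a)) (hB : B ∈ T.𝓕) (r : ℝ) {E : ℝ} {ψ : H} (hψ : ψ ∈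
    T.energySubspace E) : star (smearRadius T B r h) ψ ∈ T.energySubspace (E - gap) := by
  rw [star_smearRadius, sub_eq_add_neg]
  refine T.smearRadius_mem_energySubspace hl hq ofReal_ne_top hA.conj
    (T.continuous_field (star_mem hB)) (fun l => ?_) r hψ
  obtain ⟨G, h1, h2, h3⟩ := hh l
  refine ⟨fun v => star (G (-v)), ?_, fun v hv => ?_, fun s => ?_⟩
  · exact (conjCLE : ℂ →L[ℝ] ℂ).integrable_comp h1.comp_neg
  · have := (h2 (-v) fun h0 => hv (by simp [h0])).1
    linarith
  · rw [h3, ← integral_neg_eq_self]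
    have : star (∫ v : ℝ, G (-v) * exp (-(I * (-v : ℝ) * s))) =
      ∫ v : ℝ, star (G (-v) * exp (-(I * (-v : ℝ) * s))) := integral_conj.symm
    rw [this]
    refine integral_congr_fun fun v => ?_
    rw [star_mul']
    congr 1
    rw [Complex.star_def, ← exp_conj]
    simp

/-- The bound of the field operators with frequencies in a band by the energy. -/
theorem HasBand.norm_le {gap β K : ℝ} (hh : HasBand gap β h) (hgap : 0 < gap) (hl : 0 < lam) (hq : 0
    ≤ q) (hA : IsAmplitude lam q h (ofReal a)) (hB : B ∈ T.𝓕) {r : ℝ} (hK : ‖⁅smearRadius T B r h,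
    star (smearRadius T B r h)⁆‖ ≤ K) {E : ℝ} (hE : 0 ≤ E) {ψ : H} (hψ : ψ ∈ T.energySubspace E) :
    ‖smearRadius T B r h ψ‖ ≤ sqrt (2 * K * (1 + gap⁻¹)) * (1 + E) * ‖ψ‖ ∧ ‖star (smearRadius T B r
    h) ψ‖ ≤ sqrt (2 * K * (1 + gap⁻¹)) * (1 + E) * ‖ψ‖ := by
  set X := smearRadius T B r h with hX
  have hK0 : 0 ≤ K := (norm_nonneg _).trans hK
  have hK' : ‖⁅star X, star (star X)⁆‖ ≤ K := by
    rw [star_star, Ring.lie_def, norm_sub_rev, ← Ring.lie_def]; exact hK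
  have h1 := T.norm_sq_le_of_gap T.spectrum_condition hK'
    (fun E ψ hψ => hh.lower hl hq hA hB r hψ) (⌊E / gap⌋₊ + 1) E
    (by have := Nat.lt_floor_add_one (E / gap)
        rw [div_lt_iff₀ hgap] at this
        exact_mod_cast this) ψ hψ
  have h2 := norm_sq_star_apply (star X) ψ
  rw [star_star] at h2
  have h3 : (⌊E / gap⌋₊ : ℝ) ≤ E / gap := Nat.floor_le (by positivity)
  rw [star_star] at hK'
  have h4 : ‖⁅star X, X⁆‖ * ‖ψ‖ ^ 2 ≤ K * ‖ψ‖ ^ 2 := mul_le_mul_of_nonneg_right hK' (sq_nonneg _)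
  have h5 : K * (⌊E / gap⌋₊ + 1) * ‖ψ‖ ^ 2 ≤ K * (E / gap + 1) * ‖ψ‖ ^ 2 := by gcongr
  push_cast at h1
  have h6 : E / gap + 2 ≤ 2 * (1 + gap⁻¹) * (1 + E) ^ 2 := by
    rw [div_eq_mul_inv]
    have : 0 < gap⁻¹ := by positivity
    nlinarith [mul_nonneg hE this.le, mul_nonneg hE (mul_nonneg hE this.le), mul_nonneg hE hE]
  have h7 : K * (E / gap + 2) * ‖ψ‖ ^ 2 ≤ (sqrt (2 * K * (1 + gap⁻¹)) * (1 + E) * ‖ψ‖) ^ 2 := by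
    rw [mul_pow, mul_pow, sq_sqrt (by positivity)]
    calc _ ≤ K * (2 * (1 + gap⁻¹) * (1 + E) ^ 2) * ‖ψ‖ ^ 2 := by gcongr
      _ = _ := by ring
  have h8 : 0 ≤ K * ‖ψ‖ ^ 2 := by positivity
  constructor <;> refine le_of_sq_le_sq (le_trans ?_ h7) (by positivity) <;> nlinarith

end VacuumTheory

theorem summable_dyadic_weight {a : ℤ → ℝ} {K q : ℝ} (hK : 0 ≤ K) (hq : q < 5 / 2) (s : ℕ) (ha0 : ∀
    k, 0 ≤ a k) (hp : ∀ k : ℕ, a k ≤ K * (2 : ℝ) ^ ((q - 3) * k)) (hn : ∀ k : ℕ, a (-k) ≤ K * (2 :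
    ℝ) ^ (-((s + 1 : ℕ) * k : ℝ))) : Summable fun k : ℤ => a k * sqrt (1 + (2 : ℝ) ^ (k + 1)) * (1 +
    (2 : ℝ) ^ (1 - k)) ^ s := by
  have h0 : ∀ k, 0 ≤ a k * sqrt (1 + (2 : ℝ) ^ (k + 1)) * (1 + (2 : ℝ) ^ (1 - k)) ^ s :=
    fun k => mul_nonneg (mul_nonneg (ha0 k) (Real.sqrt_nonneg _)) (by positivity)
  refine of_nat_of_neg (of_nonneg_of_le (fun k => h0 _)
    (f := fun k : ℕ => (K * 2 * 3 ^ s) * ((2 : ℝ) ^ (q - 5 / 2)) ^ k) (fun k => ?_) ?_)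
    (of_nonneg_of_le (fun k => h0 _)
    (f := fun k : ℕ => (K * 2 * 3 ^ s) * ((2 : ℝ)⁻¹) ^ k) (fun k => ?_) ?_)
  · have h1 : (1 : ℝ) ≤ 2 ^ k := one_le_pow₀ one_le_two
    have h2 : sqrt (1 + (2 : ℝ) ^ ((k : ℤ) + 1)) ≤ 2 * (2 : ℝ) ^ ((1 / 2 : ℝ) * k) := by
      refine sqrt_le_iff.2 ⟨by positivity, ?_⟩
      rw [mul_pow, ← rpow_natCast ((2 : ℝ) ^ _), ← rpow_mul two_pos.le,
        show (1 / 2 : ℝ) * k * (2 : ℕ) = k by push_cast; ring, rpow_natCast,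
        zpow_add₀ two_ne_zero, zpow_natCast, zpow_one]
      linarith
    have h3 : (1 + (2 : ℝ) ^ (1 - (k : ℤ))) ^ s ≤ 3 ^ s := by
      refine pow_le_pow_left₀ (by positivity) ?_ s
      rw [zpow_sub₀ two_ne_zero, zpow_natCast, zpow_one]
      have : (2 : ℝ) / 2 ^ k ≤ 2 := div_le_self two_pos.le h1
      linarith
    calc _ ≤ K * (2 : ℝ) ^ ((q - 3) * k) * (2 * (2 : ℝ) ^ ((1 / 2 : ℝ) * k)) * 3 ^ s := by
          gcongr
          exact hp k
      _ = _ := by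
          rw [← rpow_natCast ((2 : ℝ) ^ _), ← rpow_mul two_pos.le,
            show (q - 5 / 2) * k = (q - 3) * k + 1 / 2 * k by ring, rpow_add two_pos]
          ring
  · exact (summable_geometric_of_lt_one (by positivity)
      (Real.rpow_lt_one_of_one_lt_of_neg one_lt_two (by linarith))).mul_left _
  · have h1 : (1 : ℝ) ≤ 2 ^ k := one_le_pow₀ one_le_two
    have h2 : sqrt (1 + (2 : ℝ) ^ (-(k : ℤ) + 1)) ≤ 2 := by
      refine sqrt_le_iff.2 ⟨by positivity, ?_⟩
      rw [zpow_add₀ two_ne_zero, zpow_neg, zpow_natCast, zpow_one]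
      have : ((2 : ℝ) ^ k)⁻¹ ≤ 1 := inv_le_one_of_one_le₀ h1
      linarith
    have h3 : (1 + (2 : ℝ) ^ (1 - -(k : ℤ))) ^ s ≤ 3 ^ s * (2 ^ k) ^ s := by
      rw [← mul_pow]
      refine pow_le_pow_left₀ (by positivity) ?_ s
      rw [sub_neg_eq_add, zpow_add₀ two_ne_zero, zpow_natCast, zpow_one]
      linarith
    have h4 : (2 : ℝ) ^ (-((s + 1 : ℕ) * k : ℝ)) = ((2 ^ k) ^ s * 2 ^ k)⁻¹ := by
      rw [rpow_neg two_pos.le, ← pow_succ, ← pow_mul, ← rpow_natCast]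
      push_cast; ring_nf
    calc _ ≤ K * (2 : ℝ) ^ (-((s + 1 : ℕ) * k : ℝ)) * 2 * (3 ^ s * (2 ^ k) ^ s) := by
          gcongr
          exact hn k
      _ = _ := by
          rw [h4, inv_pow]
          field_simp
  · exact (summable_geometric_of_lt_one (by positivity) (by norm_num)).mul_left _

namespace VacuumTheory

variable {lam κ : ℝ} {T : VacuumTheory H lam κ} {q ε : ℝ} {n : ℤ} {b : TestFn} {B : Op H}

theorem hasBand_dyadicPart (hb : IsHomTestFn lam ε n b) (hl : 0 < lam) (hε : 0 < ε) (k : ℤ) :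
    HasBand (2 ^ (-k - 1)) (2 ^ (1 - k)) (dyadicPart (thirdDeriv b) k) := fun l => by
  obtain ⟨G, h1, h2, h3⟩ := hb.exists_integral_dyadicPart hl hε k (norm_sphere_mem l)
  exact ⟨G, h1, fun v hv => Set.Ioo_subset_Icc_self (h2 v hv), h3⟩

theorem tameFamily_smear (hb : IsHomTestFn lam ε n b) (hl : 0 < lam) (hκ : 2 < κ) (hε : 2 < ε) (hB :
    B ∈ T.𝓕) {γ : ℝ → ℝ → ℝ} {Γ : ℝ} (hγ : ∀ᶠ R in atTop, Continuous (γ R) ∧ HasCompactSupport (γ R)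
    ∧ (∀ r, γ R r ≠ 0 → 0 < r) ∧ ∫ r, |γ R r| ≤ Γ) : T.TameFamily (fun R => smear T B (γ R)
    (positivePart (thirdDeriv b))) ∧ T.TameFamily (fun R => star (smear T B (γ R) (positivePart
    (thirdDeriv b)))) := by
  obtain ⟨q, hq2, hqκ, hqε, hq5⟩ : ∃ q : ℝ, 2 < q ∧ q ≤ κ ∧ q < ε ∧ q < 5 / 2 :=
    ⟨min κ (min ((2 + ε) / 2) (9 / 4)), by simp [hκ]; constructor <;> linarith, min_le_left _ _,
      lt_of_le_of_lt ((min_le_right _ _).trans (min_le_left _ _)) (by linarith),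
      lt_of_le_of_lt ((min_le_right _ _).trans (min_le_right _ _)) (by norm_num)⟩
  have hq0 : 0 ≤ q := by linarith
  have hBc := T.continuous_field hB
  unfold TranslationRep.TameFamily
  rw [← forall_and]
  intro s
  obtain ⟨c, hc0, hc⟩ := T.exists_commutatorDecay hl hq0 hqκ hB (star_mem hB)
  obtain ⟨a, K, hK, ha0, ha, hp, hn⟩ :=
    hb.exists_isAmplitude_dyadicPart_le hl hq0 (by linarith) hqε (s + 1)
  set K0 : ℝ := 2 * π * lam ^ 2 / (q - 2) * totalAngle * c with hK0
  have hK00 : 0 ≤ K0 := by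
    have := totalAngle_nonneg
    have := pi_pos
    have : 0 < q - 2 := by linarith
    positivity
  have hasum : Summable a := by
    refine of_nonneg_of_le ha0 (fun k => ?_) (summable_dyadic_weight hK hq5 s ha0 hp hn)
    rw [mul_assoc]
    refine le_mul_of_one_le_right (ha0 k) (one_le_mul_of_one_le_of_one_le ?_ (one_le_pow₀ ?_))
    · refine one_le_sqrt.2 ?_; linarith [zpow_pos (two_pos (α := ℝ)) (k + 1)]
    · linarith [zpow_pos (two_pos (α := ℝ)) (1 - k)]
  have hband := fun k => hasBand_dyadicPart hb hl (by linarith) k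
  have hKk : ∀ k r, 0 < r → ‖⁅smearRadius T B r (dyadicPart (thirdDeriv b) k),
      star (smearRadius T B r (dyadicPart (thirdDeriv b) k))⁆‖ ≤ K0 * a k * a k := fun k r hr => by
    rw [star_smearRadius]
    exact norm_lie_smearRadius_le hl hq2 (ha k) (ha k).conj (ha0 k) (ha0 k) hc0 hc hBc
      (T.continuous_field (star_mem hB)) hr
  have hgap : ∀ k : ℤ, (0 : ℝ) < 2 ^ (-k - 1) := fun k => by positivity
  let β : ℤ → ℝ := fun k => sqrt (2 * (K0 * a k * a k) * (1 + ((2 : ℝ) ^ (-k - 1))⁻¹))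
  have hsumβ : Summable fun k => β k * |Γ| * (1 + (2 : ℝ) ^ (1 - k)) ^ s := by
    refine ((summable_dyadic_weight hK hq5 s ha0 hp hn).mul_left (sqrt (2 * K0) * |Γ|)).congr
      fun k => ?_
    have : β k = sqrt (2 * K0) * (a k * sqrt (1 + (2 : ℝ) ^ (k + 1))) := by
      simp only [β]
      rw [← zpow_neg, show -(-k - 1) = k + 1 by ring, show 2 * (K0 * a k * a k) = 2 * K0 * a k ^ 2 by
        ring, mul_assoc (2 * K0), Real.sqrt_mul (by positivity), Real.sqrt_mul (sq_nonneg (a k)),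
        sqrt_sq (ha0 k)]
    rw [this]; ring
  have hint : ∀ {γ : ℝ → ℝ} (_ : Continuous γ) (_ : HasCompactSupport γ) (_ : ∀ r, γ r ≠ 0 → 0 < r)
      (_ : ∫ r, |γ r| ≤ Γ) (F : ℝ → H) (C : ℝ) (_ : 0 ≤ C) (_ : ∀ r, 0 < r → ‖F r‖ ≤ C),
      ‖∫ r, (γ r : ℂ) • F r‖ ≤ C * |Γ| := by
    intro γ hγ1 hγ2 hγ3 hγ4 F C hC hF
    refine (norm_integral_le_of_norm_le ((hγ1.integrable_of_hasCompactSupport hγ2).abs.mul_const C)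
      (.of_forall fun r => ?_)).trans ?_
    · rw [norm_smul, norm_real, norm_eq_abs]
      by_cases h : γ r = 0
      · simp [h]
      · exact mul_le_mul_of_nonneg_left (hF r (hγ3 r h)) (abs_nonneg _)
    · rw [integral_mul_const, mul_comm]
      exact mul_le_mul_of_nonneg_left (hγ4.trans (le_abs_self _)) hC
  have hs := fun s (l : S²) =>
    hb.hasSum_dyadicPart hl (by linarith) s (norm_sphere_mem l)
  have hte : ∀ k, 0 ≤ β k * |Γ| ∧ (0 : ℝ) ≤ 2 ^ (1 - k) := fun k => ⟨by positivity, by positivity⟩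
  constructor
  · refine ⟨fun k => β k * |Γ|, fun k => 2 ^ (1 - k), hte, hsumβ, ?_⟩
    filter_upwards [hγ] with R ⟨hγ1, hγ2, hγ3, hγ4⟩
    refine ⟨_, hasSum_smear hl hq0 ha0 hasum ha hs hBc hγ1 hγ2, fun k E hE ψ hψ => ?_⟩
    rw [smear_apply hl hq0 ofReal_ne_top (ha k) hBc hγ1 hγ2]
    refine ⟨T.integral_mem_energySubspace fun r => smul_mem _ _
      ((hband k).raise hl hq0 (ha k) hB r hψ), ?_⟩
    refine (hint hγ1 hγ2 hγ3 hγ4 _ (β k * (1 + E) * ‖ψ‖) (by positivity) fun r hr =>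
      ((hband k).norm_le (hgap k) hl hq0 (ha k) hB (hKk k r hr) hE hψ).1).trans (le_of_eq (by ring))
  · refine ⟨fun k => β k * |Γ|, fun k => 2 ^ (1 - k), hte, hsumβ, ?_⟩
    filter_upwards [hγ] with R ⟨hγ1, hγ2, hγ3, hγ4⟩
    refine ⟨_, (hasSum_smear hl hq0 ha0 hasum ha hs hBc hγ1 hγ2).star, fun k E hE ψ hψ => ?_⟩
    rw [star_smear_apply hl hq0 ofReal_ne_top (ha k) hBc hγ1 hγ2]
    refine ⟨T.energySubspace_mono ?_ (T.integral_mem_energySubspace fun r => smul_mem _ _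
      ((hband k).lower hl hq0 (ha k) hB r hψ)), ?_⟩
    · have := (hgap k).le; have := (hte k).2; linarith
    refine (hint hγ1 hγ2 hγ3 hγ4 _ (β k * (1 + E) * ‖ψ‖) (by positivity) fun r hr =>
      ((hband k).norm_le (hgap k) hl hq0 (ha k) hB (hKk k r hr) hE hψ).2).trans (le_of_eq (by ring))

/-- The adjoints of the creation operators annihilate the vacuum. -/
theorem star_smearRadius_vacuum (hb : IsHomTestFn lam ε n b) (hl : 0 < lam) (hε : 2 < ε) (hB : B ∈
    T.𝓕) (r : ℝ) : star (smearRadius T B r (positivePart (thirdDeriv b))) T.Ω = 0 := by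
  obtain ⟨a, K, hK, ha0, ha, hp, hn⟩ :=
    hb.exists_isAmplitude_dyadicPart_le hl (zero_le_two (α := ℝ)) (by linarith) hε 1
  have hasum : Summable a := by
    refine of_nonneg_of_le ha0 (fun k => ?_)
      (summable_dyadic_weight hK (by norm_num : (2 : ℝ) < 5 / 2) 0 ha0 hp (by simpa using hn))
    rw [pow_zero, mul_one]
    refine le_mul_of_one_le_right (ha0 k) (one_le_sqrt.2 ?_)
    linarith [zpow_pos (two_pos (α := ℝ)) (k + 1)]
  have h1 := hasSum_apply (hasSum_smearRadius hl zero_le_two ha0 hasum ha (fun s l =>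
    hb.hasSum_dyadicPart hl (by linarith) s (norm_sphere_mem l)) (T.continuous_field hB) r).star T.Ω
  have h2 : ∀ k, star (smearRadius T B r (dyadicPart (thirdDeriv b) k)) T.Ω = 0 := by
    intro k
    have h3 := (hasBand_dyadicPart hb hl (by linarith) k).lower hl zero_le_two (ha k) hB r
      (T.mem_energySubspace_of_invariant T.vacuum_invariant)
    refine T.energySubspace_eq_zero T.spectrum_condition ?_ h3
    have : (0 : ℝ) < 2 ^ (-k - 1) := by positivity
    linarith
  simp_rw [h2] at h1
  exact h1.unique hasSum_zero

end VacuumTheory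

/-! ### Localization of commutators -/

theorem smul_lie_smul_eq (a b : ℂ) (x y : Op H) : ⁅a • x, b • y⁆ = (a * b) • ⁅x, y⁆ := by
  simp only [Ring.lie_def, smul_mul_smul_comm, smul_sub, mul_comm b a]

/-- The amplitude restricted to times `|s| ≤ d`. -/
def truncate (d : ℝ) (h : TestFn) (s : ℝ) (l : Space3) : ℂ :=
  {s | |s| ≤ d}.indicator (fun s => h s l) s

/-- Pairs of points of the cone with directions of distance at most `d / √(r₁ r₂)`. -/
def nearSet (r₁ r₂ d : ℝ) : Set ((ℝ × S²) × (ℝ × S²)) :=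
  {z | sqrt (r₁ * r₂) * ‖(z.1.2 : Space3) - z.2.2‖ ≤ d}

theorem measurableSet_nearSet (r₁ r₂ d : ℝ) : MeasurableSet (nearSet r₁ r₂ d) :=
  measurableSet_le (by fun_prop) measurable_const

/-- The part of the commutator with times at most `d` and directions close to each other. -/
def nearComm (T : TranslationRep H) (B₁ : Op H) (r₁ : ℝ) (h₁ : TestFn) (B₂ : Op H) (r₂ : ℝ) (h₂ :
    TestFn) (d : ℝ) : Op H :=
  pairComm T B₁ r₁ (truncate d h₁) B₂ r₂ (truncate d h₂) (nearSet r₁ r₂ d)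

section Near

variable {T : TranslationRep H} {B B₁ B₂ : Op H} {lam q q' r r₁ r₂ a a₁ a₂ c d : ℝ}
  {h h' h₁ h₂ : TestFn}

theorem IsAmplitude.truncate {A : ENNReal} (hh : IsAmplitude lam q h A) (d : ℝ) : IsAmplitude lam q
    (truncate d h) A :=
  hh.indicator (measurableSet_le continuous_abs.measurable measurable_const)

theorem abs_le_of_truncate_ne_zero {s : ℝ} {l : Space3} (h0 : truncate d h s l ≠ 0) : |s| ≤ d ∧ h s
    l ≠ 0 := by
  have h1 : s ∈ {s | |s| ≤ d} := by
    by_contra h2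
    exact h0 (indicator_of_notMem h2 _)
  exact ⟨h1, by rwa [NullAsymptotics.truncate, indicator_of_mem h1] at h0⟩

theorem smearRadius_split (hl : 0 < lam) (hq : 0 ≤ q) (hh : IsAmplitude lam q h (ofReal a)) (hB :
    Continuous (T.field B)) (r d : ℝ) : smearRadius T B r h = smearRadius T B r (truncate d h) +
    smearRadius T B r fun s l => {s | d < |s|}.indicator (fun s => h s l) s := by
  have h2 := hh.indicator (measurableSet_lt (measurable_const (a := d)) continuous_abs.measurable)
  rw [smearRadius_eq, smearRadius_eq, smearRadius_eq, ← smul_add, ← integral_add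
    ((hh.truncate d).integrable_smul hl hq ofReal_ne_top hB r)
    (h2.integrable_smul hl hq ofReal_ne_top hB r)]
  congr 2
  ext1 x
  rw [← add_smul]
  congr 1
  rcases le_or_gt |x.1| d with h3 | h3
  · have h4 : x.1 ∉ {s : ℝ | d < |s|} := fun h5 => absurd h3 (not_le.2 h5)
    rw [indicator_of_notMem h4, add_zero, truncate, indicator_of_mem (by exact h3)]
  · have h4 : x.1 ∉ {s : ℝ | |s| ≤ d} := fun h5 => absurd h3 (not_lt.2 h5)
    rw [truncate, indicator_of_notMem h4, zero_add, indicator_of_mem (by exact h3)]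

/-- The commutator is localized up to a small error. -/
theorem norm_lie_sub_nearComm_le (hl : 0 < lam) (hq : 2 < q) (hqq : q ≤ q') (H₁ : IsAmplitude lam q'
    h₁ (ofReal a₁)) (H₂ : IsAmplitude lam q' h₂ (ofReal a₂)) (ha₁ : 0 ≤ a₁) (ha₂ : 0 ≤ a₂) (hc : 0 ≤
    c) (hdec : CommutatorDecay T lam q c B₁ B₂) (hB₁ : Continuous (T.field B₁)) (hB₂ : Continuous
    (T.field B₂)) (hr₁ : 0 < r₁) (hr₂ : 0 < r₂) (hd : 0 ≤ d) : ‖⁅smearRadius T B₁ r₁ h₁, smearRadius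
    T B₂ r₂ h₂⁆ - nearComm T B₁ r₁ h₁ B₂ r₂ h₂ d‖ ≤ 2 * π * lam ^ 2 / (q - 2) * totalAngle * c * a₁
    * a₂ * (wt lam (r₂ - r₁) ^ q * (2 * wt lam d ^ (q - q') + wt lam d ^ (2 - q))) := by
  have hq0 : 0 ≤ q := by linarith
  have G₁ := H₁.mono_exponent hl hqq
  have G₂ := H₂.mono_exponent hl hqq
  have hw : 0 ≤ wt lam d ^ (q - q') := rpow_nonneg (wt_pos hl d).le _
  have t₁ := H₁.indicator_tail hl hqq hd
  have t₂ := H₂.indicator_tail hl hqq hd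
  rw [← ofReal_mul hw] at t₁ t₂
  have far : ∀ {g₁ g₂ : TestFn} {b₁ b₂ : ℝ}, IsAmplitude lam q g₁ (ofReal b₁) →
      IsAmplitude lam q g₂ (ofReal b₂) → 0 ≤ b₁ → 0 ≤ b₂ →
      ‖⁅smearRadius T B₁ r₁ g₁, smearRadius T B₂ r₂ g₂⁆‖ ≤ 2 * π * lam ^ 2 / (q - 2) * totalAngle *
        c * b₁ * b₂ * wt lam (r₂ - r₁) ^ q := by
    intro g₁ g₂ b₁ b₂ k₁ k₂ p₁ p₂
    rw [lie_smearRadius hl hq0 k₁ k₂ hB₁ hB₂]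
    refine (norm_pairComm_far_le hl hq k₁ k₂ p₁ p₂ hc hdec hr₁ hr₂ le_rfl MeasurableSet.univ
      fun z _ => by positivity).trans (le_of_eq ?_)
    rw [show wt lam 0 = 1 by simp [wt], one_rpow, mul_one]
  have e1 := smearRadius_split (T := T) hl hq0 G₁ hB₁ r₁ d
  have e2 := smearRadius_split (T := T) hl hq0 G₂ hB₂ r₂ d
  set X₁ := smearRadius T B₁ r₁ h₁
  set X₂ := smearRadius T B₂ r₂ h₂
  set Y₁ := smearRadius T B₁ r₁ (truncate d h₁) with hY₁
  set Y₂ := smearRadius T B₂ r₂ (truncate d h₂) with hY₂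
  set Z₁ := smearRadius T B₁ r₁ fun s l => {s | d < |s|}.indicator (fun s => h₁ s l) s
  set Z₂ := smearRadius T B₂ r₂ fun s l => {s | d < |s|}.indicator (fun s => h₂ s l) s
  have f1 := far t₁ G₂ (by positivity) ha₂
  have f2 := far (G₁.truncate d) t₂ ha₁ (by positivity)
  have f3 := norm_pairComm_far_le hl hq (G₁.truncate d) (G₂.truncate d) ha₁ ha₂ hc hdec hr₁ hr₂ hd
    (measurableSet_nearSet r₁ r₂ d).compl fun z hz =>
      (not_le.1 (show ¬ _ ≤ d from hz)).le
  have e3 := pairComm_add_compl (r₁ := r₁) (r₂ := r₂) hl hq0 (G₁.truncate d) (G₂.truncate d) hB₁ hB₂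
    (measurableSet_nearSet r₁ r₂ d)
  have e4 : ⁅X₁, X₂⁆ - nearComm T B₁ r₁ h₁ B₂ r₂ h₂ d = ⁅Z₁, X₂⁆ + ⁅Y₁, Z₂⁆ +
      pairComm T B₁ r₁ (truncate d h₁) B₂ r₂ (truncate d h₂) (nearSet r₁ r₂ d)ᶜ := by
    rw [nearComm, sub_eq_iff_eq_add, add_assoc, add_comm (pairComm _ _ _ _ _ _ _ _), e3, e1, e2]
    simp only [Ring.lie_def]
    noncomm_ring
  rw [e4]
  refine (norm_add₃_le).trans ((add_le_add (add_le_add f1 f2) f3).trans (le_of_eq (by ring)))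

/-- Bounds of linear functionals of the localized commutator. -/
theorem norm_apply_nearComm_le {F : Type*} [NormedAddCommGroup F] [NormedSpace ℂ F] [CompleteSpace
    F] (Λ : (Op H) →L[ℂ] F) (hl : 0 < lam) (hq : 0 ≤ q) (H₁ : IsAmplitude lam q h₁ (ofReal a₁)) (H₂
    : IsAmplitude lam q h₂ (ofReal a₂)) (ha₁ : 0 ≤ a₁) (ha₂ : 0 ≤ a₂) (hB₁ : Continuous (T.field
    B₁)) (hB₂ : Continuous (T.field B₂)) (hr₁ : 0 < r₁) (hr₂ : 0 < r₂) (hd : 0 ≤ d) {S : Set S²} (hS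
    : MeasurableSet S) {κ₁ κ₂ : ℝ} (hκ₁ : 0 ≤ κ₁) (hκ₂ : 0 ≤ κ₂) (hb : ∀ z ∈ nearSet r₁ r₂ d,
    truncate d h₁ z.1.1 z.1.2 ≠ 0 → truncate d h₂ z.2.1 z.2.2 ≠ 0 → ‖Λ ⁅T.field B₁ (conePoint r₁
    z.1), T.field B₂ (conePoint r₂ z.2)⁆‖ ≤ κ₁ + S.indicator (fun _ => κ₂) z.1.2) : ‖Λ (nearComm T
    B₁ r₁ h₁ B₂ r₂ h₂ d)‖ ≤ a₁ * a₂ * d ^ 2 * (κ₁ * totalAngle + κ₂ * sphereMeasure.real S) := by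
  have h0 := totalAngle_nonneg
  have hpi := pi_gt_three
  have K₁ := (H₁.truncate d).mono_exponent hl hq
  have K₂ := (H₂.truncate d).mono_exponent hl hq
  set ρ := sqrt (r₁ * r₂) with hρ
  have hρ0 : 0 < ρ := by positivity
  have hρ2 : ρ ^ 2 = r₁ * r₂ := sq_sqrt (by positivity)
  rw [nearComm, pairComm, map_smul, ← integral_comp_comm Λ
    (integrable_lie hl le_rfl K₁ K₂ hB₁ hB₂ r₁ r₂).integrableOn, norm_smul, norm_real,
    norm_of_nonneg (by positivity)]
  have key : ‖∫ z in nearSet r₁ r₂ d, Λ ⁅truncate d h₁ z.1.1 z.1.2 • T.field B₁ (conePoint r₁ z.1),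
      truncate d h₂ z.2.1 z.2.2 • T.field B₂ (conePoint r₂ z.2)⁆ ∂coneMeasure.prod coneMeasure‖ ≤
      a₁ * a₂ * (2 * π * (d / ρ) ^ 2) * (κ₁ * totalAngle + κ₂ * sphereMeasure.real S) := by
    rw [← ofReal_le_ofReal_iff (by positivity), ofReal_norm]
    have hk : Measurable fun l : S² =>
        ofReal (κ₁ + S.indicator (fun _ => κ₂) l) :=
      (measurable_const.add (measurable_const.indicator hS)).ennreal_ofReal
    have hcap : ∀ l : S², MeasurableSet {l' : S² | ‖(l : Space3) - l'‖ ≤ d / ρ} := fun l =>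
      measurableSet_le (by fun_prop) measurable_const
    have p1 := lintegral_pair_le (k := fun l => ofReal (κ₁ + S.indicator (fun _ => κ₂) l))
      (M := 2 * π * (d / ρ) ^ 2) hl K₁ K₂ ha₁ ha₂ (by positivity)
      (γ := fun l l' => if ‖(l : Space3) - l'‖ ≤ d / ρ then 1 else 0) ?_ (fun l => ?_) hk
    · have p2 : ∫⁻ l, ofReal (κ₁ + S.indicator (fun _ => κ₂) l) ∂sphereMeasure =
          ofReal (κ₁ * totalAngle + κ₂ * sphereMeasure.real S) := by
        have hi : Integrable (fun l => κ₁ + S.indicator (fun _ => κ₂) l) sphereMeasure :=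
          (integrable_const _).add ((integrable_const _).indicator hS)
        rw [← ofReal_integral_eq_lintegral_ofReal hi (.of_forall fun l =>
            add_nonneg hκ₁ (Set.indicator_nonneg (fun _ _ => hκ₂) _)),
          integral_add (integrable_const _) ((integrable_const _).indicator hS),
          integral_indicator_const _ hS, integral_const]
        simp only [smul_eq_mul, totalAngle, mul_comm]
      rw [p2, ← ofReal_mul (by positivity)] at p1
      refine (enorm_integral_le_lintegral_enorm _).trans (le_trans ?_ p1)
      rw [← lintegral_indicator (measurableSet_nearSet r₁ r₂ d)]
      refine lintegral_mono fun z => ?_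
      by_cases hz : z ∈ nearSet r₁ r₂ d
      · rw [indicator_of_mem hz, smul_lie_smul_eq, map_smul, enorm_smul, enorm_mul]
        have hz' : ‖(z.1.2 : Space3) - z.2.2‖ ≤ d / ρ := by
          rw [le_div_iff₀ hρ0, mul_comm]; exact hz
        simp only [Real.rpow_zero, ofReal_one, one_mul, hz', if_true, mul_one]
        by_cases hz1 : truncate d h₁ z.1.1 z.1.2 = 0
        · simp [hz1]
        by_cases hz2 : truncate d h₂ z.2.1 z.2.2 = 0
        · simp [hz2]
        rw [mul_right_comm]
        gcongr
        rw [← ofReal_norm]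
        exact ofReal_le_ofReal (hb z hz hz1 hz2)
      · rw [indicator_of_notMem hz]; exact zero_le
    · exact Measurable.ite (measurableSet_le (by fun_prop) measurable_const) measurable_const
        measurable_const
    · refine le_trans (le_of_eq ?_) (sphereMeasure_cap_le l (by positivity : 0 ≤ d / ρ))
      rw [← lintegral_indicator_one (hcap l)]
      rfl
  refine (mul_le_mul_of_nonneg_left key (by positivity)).trans ?_
  rw [div_pow, hρ2]
  have hX : 0 ≤ a₁ * a₂ * d ^ 2 * (κ₁ * totalAngle + κ₂ * sphereMeasure.real S) := by positivity
  refine le_trans (le_of_eq ?_) (div_le_self hX (by linarith : (1 : ℝ) ≤ 2 * π))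
  field_simp

/-- The square of the norm of a localized commutator applied to a vector. -/
theorem norm_sq_apply_nearComm_le (Λ : (Op H) →L[ℂ] H) (hl : 0 < lam) (hq : 0 ≤ q) (H₁ : IsAmplitude
    lam q h₁ (ofReal a₁)) (H₂ : IsAmplitude lam q h₂ (ofReal a₂)) (ha₁ : 0 ≤ a₁) (ha₂ : 0 ≤ a₂) (hB₁
    : Continuous (T.field B₁)) (hB₂ : Continuous (T.field B₂)) (hr₁ : 0 < r₁) (hr₂ : 0 < r₂) (hd : 0
    ≤ d) {κ₁ κ₂ ρ₀ : ℝ} (hκ₁ : 0 ≤ κ₁) (hκ₂ : 0 ≤ κ₂) (hρ₀ : 0 ≤ ρ₀) (hb : ∀ z ∈ nearSet r₁ r₂ d,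
    |z.1.1| ≤ d → |z.2.1| ≤ d → ∀ z' ∈ nearSet r₁ r₂ d, |z'.1.1| ≤ d → |z'.2.1| ≤ d → ‖inner ℂ (Λ
    ⁅T.field B₁ (conePoint r₁ z.1), T.field B₂ (conePoint r₂ z.2)⁆) (Λ ⁅T.field B₁ (conePoint r₁
    z'.1), T.field B₂ (conePoint r₂ z'.2)⁆)‖ ≤ if ‖(z.1.2 : Space3) - z'.1.2‖ ≤ ρ₀ then κ₂ else κ₁)
    : ‖Λ (nearComm T B₁ r₁ h₁ B₂ r₂ h₂ d)‖ ^ 2 ≤ (a₁ * a₂ * d ^ 2) ^ 2 * totalAngle * (κ₁ *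
    totalAngle + κ₂ * (2 * π * ρ₀ ^ 2)) := by
  have h0 := totalAngle_nonneg
  have hpi := pi_pos
  set Ψ := Λ (nearComm T B₁ r₁ h₁ B₂ r₂ h₂ d) with hΨ
  set Q := a₁ * a₂ * d ^ 2 * (κ₁ * totalAngle + κ₂ * (2 * π * ρ₀ ^ 2)) with hQ
  have s1 : ∀ z ∈ nearSet r₁ r₂ d, |z.1.1| ≤ d → |z.2.1| ≤ d →
      ‖inner ℂ (Λ ⁅T.field B₁ (conePoint r₁ z.1), T.field B₂ (conePoint r₂ z.2)⁆) Ψ‖ ≤ Q := by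
    intro z hz hz1 hz2
    have hS : MeasurableSet {l' : S² | ‖(z.1.2 : Space3) - l'‖ ≤ ρ₀} :=
      measurableSet_le (by fun_prop) measurable_const
    have := norm_apply_nearComm_le ((innerSL ℂ (Λ ⁅T.field B₁ (conePoint r₁ z.1),
      T.field B₂ (conePoint r₂ z.2)⁆)).comp Λ) hl hq H₁ H₂ ha₁ ha₂ hB₁ hB₂ hr₁ hr₂ hd hS hκ₁ hκ₂
      fun z' hz' n1 n2 => ?_
    · refine this.trans ?_
      rw [hQ]
      gcongr
      rw [measureReal_def]
      exact ENNReal.toReal_le_of_le_ofReal (by positivity) (sphereMeasure_cap_le z.1.2 hρ₀)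
    · refine (hb z hz hz1 hz2 z' hz' (abs_le_of_truncate_ne_zero n1).1
        (abs_le_of_truncate_ne_zero n2).1).trans ?_
      split_ifs with h1
      · rw [indicator_of_mem (by exact h1)]; linarith
      · rw [indicator_of_notMem (by exact h1), add_zero]
  have s2 := norm_apply_nearComm_le ((innerSL ℂ Ψ).comp Λ) hl hq H₁ H₂ ha₁ ha₂ hB₁ hB₂ hr₁ hr₂ hd
    MeasurableSet.empty (κ₁ := Q) (κ₂ := 0) (by positivity) le_rfl fun z hz n1 n2 => ?_
  · have s3 : ‖((innerSL ℂ Ψ).comp Λ) (nearComm T B₁ r₁ h₁ B₂ r₂ h₂ d)‖ = ‖Ψ‖ ^ 2 := by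
      change ‖inner ℂ Ψ Ψ‖ = _
      rw [inner_self_eq_norm_sq_to_K]; simp
    rw [s3] at s2
    refine s2.trans (le_of_eq ?_)
    rw [hQ]; ring
  · simp only [Set.indicator_empty, add_zero]
    refine le_trans (le_of_eq ?_) (s1 z hz (abs_le_of_truncate_ne_zero n1).1
      (abs_le_of_truncate_ne_zero n2).1)
    exact norm_inner_symm _ _

end Near

/-! ### Clustering of localized commutators -/

theorem tendsto_rpow_div_of_neg {lam p : ℝ} (hl : 0 < lam) (hp : p < 0) : Tendsto (fun R : ℝ => (R /
    lam) ^ p) atTop (𝓝 0) := by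
  have h1 := tendsto_rpow_neg_atTop (y := -p) (by linarith)
  rw [neg_neg] at h1
  exact h1.comp (tendsto_id.atTop_div_const hl)

theorem norm_lie_le (A B : Op H) : ‖⁅A, B⁆‖ ≤ 2 * (‖A‖ * ‖B‖) := by
  rw [Ring.lie_def]
  have h1 := norm_mul_le A B
  have h2 := norm_mul_le B A
  have := norm_sub_le (A * B) (B * A)
  linarith

namespace VacuumTheory

variable {lam κ : ℝ} (T : VacuumTheory H lam κ)

theorem vacuumPerp_apply (ψ : H) : T.vacuumPerp ψ = ψ - inner ℂ T.Ω ψ • T.Ω := by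
  rw [vacuumPerp, Submodule.starProjection_orthogonal]
  simp [Submodule.starProjection_unit_singleton ℂ T.norm_vacuum]

theorem norm_vacuumPerp_le (ψ : H) : ‖T.vacuumPerp ψ‖ ≤ ‖ψ‖ :=
  Submodule.norm_starProjection_apply_le _ _

theorem inner_vacuumPerp (φ ψ : H) : inner ℂ (T.vacuumPerp φ) (T.vacuumPerp ψ) = inner ℂ φ
    (T.vacuumPerp ψ) := by
  rw [vacuumPerp, Submodule.inner_starProjection_left_eq_right,
    Submodule.starProjection_eq_self_iff.2 (Submodule.starProjection_apply_mem _ _)]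

theorem vacuumPerp_U (a : Mink) (ψ : H) : T.vacuumPerp (T.U a ψ) = T.U a (T.vacuumPerp ψ) := by
  rw [vacuumPerp_apply, vacuumPerp_apply, map_sub, map_smul, T.vacuum_invariant]
  congr 2
  have := T.inner_U_left (-a) T.Ω ψ
  rwa [T.vacuum_invariant, neg_neg, eq_comm] at this

theorem lie_field_eq (A₁ A₂ : Op H) (x x' : Mink) : ⁅T.field A₁ x, T.field A₂ x'⁆ T.Ω = T.U ((1 / 2
    : ℝ) • (x + x')) (T.relComm A₁ A₂ (x - x') T.Ω) := by
  have h1 : ∀ (B : Op H) (a y : Mink), T.field B (a + y) = T.U a * T.field B y * T.U (-a) :=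
    fun B a y => (T.U_mul_field_mul B a y).symm
  have h2 : x = (1 / 2 : ℝ) • (x + x') + (1 / 2 : ℝ) • (x - x') := by module
  have h3 : x' = (1 / 2 : ℝ) • (x + x') + -((1 / 2 : ℝ) • (x - x')) := by module
  set ξ := (1 / 2 : ℝ) • (x + x')
  rw [relComm]
  conv_lhs => rw [h2, h3, h1, h1]
  rw [← h3]
  set F := T.field A₁ ((1 / 2 : ℝ) • (x - x'))
  set G := T.field A₂ (-((1 / 2 : ℝ) • (x - x')))
  simp only [Ring.lie_def, sub_apply, mul_apply_eq_comp, T.vacuum_invariant, map_sub, T.U_neg_U]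

theorem inner_eq_clusterFn (A₁ A₂ : Op H) (x x' u u' : Mink) : inner ℂ (T.vacuumPerp (⁅T.field A₁ x,
    T.field A₂ x'⁆ T.Ω)) (T.vacuumPerp (⁅T.field A₁ u, T.field A₂ u'⁆ T.Ω)) = T.clusterFn (star A₂)
    (star A₁) A₁ A₂ (-(x - x')) (u - u') ((1 / 2 : ℝ) • (x + x') - (1 / 2 : ℝ) • (u + u')) := by
  rw [inner_vacuumPerp, lie_field_eq, lie_field_eq, clusterFn]
  have h1 : T.relComm (star A₂) (star A₁) (-(x - x')) = star (T.relComm A₁ A₂ (x - x')) := by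
    rw [relComm, relComm, Ring.lie_def, Ring.lie_def, star_sub, star_mul, star_mul, T.star_field,
      T.star_field, smul_neg, neg_neg]
  rw [h1, star_eq_adjoint, adjoint_inner_right,
    T.inner_U_left, vacuumPerp_U, vacuumPerp_U, ← T.U_add_apply, neg_sub (_ • (x + x')),
    sub_eq_neg_add (_ • (u + u'))]

variable {T} {A₁ A₂ : Op H} {h₁ h₂ : TestFn} {a₁ a₂ : ℝ}

set_option maxHeartbeats 1000000 in
/-- Localized commutators create from the vacuum only the vacuum, asymptotically. -/
theorem Clustering.exists_vacuumPerp_nearComm_lt (hT : T.Clustering) (hl : 0 < lam) (hA₁ : A₁ ∈ T.𝓕)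
    (hA₂ : A₂ ∈ T.𝓕) : ∃ σ₀ > 0, ∀ σ : ℝ, 0 < σ → σ ≤ σ₀ → ∀ {h₁ h₂ : TestFn} {a₁ a₂ q τ : ℝ}, 0 ≤ q
    → IsAmplitude lam q h₁ (ofReal a₁) → IsAmplitude lam q h₂ (ofReal a₂) → 0 ≤ a₁ → 0 ≤ a₂ → 0 < τ
    → ∀ δ > 0, ∀ᶠ R in atTop, ∀ r₁ r₂, τ * R ≤ r₁ → τ * R ≤ r₂ → |r₂ - r₁| ≤ width lam σ R →
    ‖T.vacuumPerp (nearComm T A₁ r₁ h₁ A₂ r₂ h₂ (width lam σ R) T.Ω)‖ < δ := by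
  obtain ⟨c₁, hc₁, c₂, hc₂, c₃, hc₃, M, hM, ν, hν, d₀, hd₀, hcl⟩ :=
    hT _ (star_mem hA₂) _ (star_mem hA₁) _ hA₁ _ hA₂ 5 (by norm_num)
  refine ⟨min (1 / 8) (ν / (4 * (4 + M))), by positivity, fun σ hσ hσ0 h₁ h₂ a₁ a₂ q τ hq H₁ H₂ ha₁ ha₂
    hτ δ hδ => ?_⟩
  have hσ1 : σ ≤ 1 / 8 := hσ0.trans (min_le_left _ _)
  have hσ2 : σ * (4 + M) ≤ ν / 4 := by
    have := hσ0.trans (min_le_right _ _)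
    rw [le_div_iff₀ (by positivity)] at this
    linarith
  have hTA := totalAngle_nonneg
  have hpi := pi_pos
  let κ₂ : ℝ := (2 * (‖A₁‖ * ‖A₂‖)) ^ 2
  let e₁ : ℝ := c₂ * (4 * lam) ^ M / (τ * lam / 2) ^ ν
  let e₂ : ℝ := c₃ * (4 * lam) ^ (-(5 : ℝ))
  let κ₁ : ℝ → ℝ := fun R => e₁ * (R / lam) ^ (σ * M - ν / 2) + e₂ * (R / lam) ^ (-(5 * σ))
  let F : ℝ → ℝ := fun R => (a₁ * a₂ * lam ^ 2) ^ 2 * totalAngle *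
    (totalAngle * e₁ * (R / lam) ^ (4 * σ + (σ * M - ν / 2)) + totalAngle * e₂ * (R / lam) ^ (-σ) +
      κ₂ * (2 * π) * (R / lam) ^ (4 * σ + -1))
  have hF : Tendsto F atTop (𝓝 0) := by
    have t1 := (tendsto_rpow_div_of_neg hl (p := 4 * σ + (σ * M - ν / 2)) (by linarith)).const_mul
      (totalAngle * e₁)
    have t2 := (tendsto_rpow_div_of_neg hl (p := -σ) (by linarith)).const_mul (totalAngle * e₂)
    have t3 := (tendsto_rpow_div_of_neg hl (p := 4 * σ + -1) (by linarith)).const_mul (κ₂ * (2 * π))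
    simpa using ((t1.add t2).add t3).const_mul ((a₁ * a₂ * lam ^ 2) ^ 2 * totalAngle)
  have hX : Tendsto (fun R : ℝ => R / lam) atTop atTop := tendsto_id.atTop_div_const hl
  have ev1 := (tendsto_rpow_div_of_neg hl (p := σ - 1 / 2) (by linarith)).eventually_lt_const
    (show 0 < τ / (8 + 8 * c₁) by positivity)
  have ev2 := ((tendsto_rpow_atTop hσ).comp hX).eventually_ge_atTop (d₀ / (4 * lam))
  filter_upwards [ev1, ev2, hF.eventually_lt_const (show 0 < δ ^ 2 by positivity),
    eventually_ge_atTop lam] with R g1 g2 g3 g4 r₁ r₂ hr₁ hr₂ hr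
  have hR : 0 < R := hl.trans_le g4
  set X := R / lam with hXdef
  have hX0 : 0 < X := by positivity
  set d := width lam σ R with hd
  have hdX : d = lam * X ^ σ := rfl
  have hd0 : 0 < d := width_pos hl hR
  have hr₁0 : 0 < r₁ := (by positivity : 0 < τ * R).trans_le hr₁
  have hr₂0 : 0 < r₂ := (by positivity : 0 < τ * R).trans_le hr₂
  set ρ₀ := X ^ (-(1 / 2) : ℝ) with hρ₀
  have hρ0 : 0 < ρ₀ := by positivity
  have hρX : X * ρ₀ = X ^ (1 / 2 : ℝ) := by
    rw [hρ₀]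
    nth_rewrite 1 [← rpow_one X]
    rw [← rpow_add hX0]; norm_num
  have hρ2 : ρ₀ ^ 2 = X ^ (-1 : ℝ) := by
    rw [hρ₀, ← rpow_natCast, ← rpow_mul hX0.le]; norm_num
  have hdρ : (8 + 8 * c₁) * d ≤ τ * R * ρ₀ := by
    have h3 : X ^ σ = X ^ (σ - 1 / 2) * X ^ (1 / 2 : ℝ) := by
      rw [← rpow_add hX0]; ring_nf
    rw [lt_div_iff₀ (by positivity)] at g1
    have h4 : R = lam * X := by rw [hXdef]; field_simp
    rw [hdX, h3, h4, mul_assoc τ, mul_assoc lam, hρX]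
    have : 0 < lam * X ^ (1 / 2 : ℝ) := by positivity
    nlinarith
  let Λ : (Op H) →L[ℂ] H := T.vacuumPerp.comp (ContinuousLinearMap.apply ℂ H T.Ω)
  have hΛ : ∀ A, Λ A = T.vacuumPerp (A T.Ω) := fun A => rfl
  have hκ₁ : 0 ≤ κ₁ R := by positivity
  have geo : ∀ z ∈ nearSet r₁ r₂ d, ‖r₂ • (z.2.2 : Space3) - r₁ • (z.1.2 : Space3)‖ ^ 2 ≤ 2 * d ^ 2 := by
    intro z hz
    rw [le_norm_smul_sub_smul hr₁0 hr₂0]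
    have h1 : (sqrt (r₁ * r₂) * ‖(z.1.2 : Space3) - z.2.2‖) ^ 2 ≤ d ^ 2 :=
      pow_le_pow_left₀ (by positivity) hz 2
    rw [mul_pow, sq_sqrt (by positivity)] at h1
    have h2 : (r₂ - r₁) ^ 2 ≤ d ^ 2 := sq_le_sq' (abs_le.1 hr).1 (abs_le.1 hr).2
    linarith
  have key := norm_sq_apply_nearComm_le (T := T) (κ₁ := κ₁ R) (κ₂ := κ₂) (ρ₀ := ρ₀) Λ hl
    hq H₁ H₂ ha₁ ha₂ (T.continuous_field hA₁) (T.continuous_field hA₂) hr₁0 hr₂0 hd0.le hκ₁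
    (by positivity) hρ0.le fun z hz z1 z2 z' hz' z1' z2' => ?_
  · refine lt_of_pow_lt_pow_left₀ 2 hδ.le (lt_of_le_of_lt key (lt_of_eq_of_lt ?_ g3))
    have h1 : (X ^ σ) ^ 4 = X ^ (4 * σ) := by
      rw [← rpow_natCast, ← rpow_mul hX0.le]; push_cast; ring_nf
    have h2 : X ^ (-σ) = X ^ (4 * σ) * X ^ (-(5 * σ)) := by
      rw [← rpow_add hX0]; ring_nf
    simp only [F, κ₁]
    rw [hρ2, hdX, rpow_add hX0 (4 * σ), rpow_add hX0 (4 * σ), h2, ← h1]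
    ring
  · have nb : ∀ z : (ℝ × S²) × (ℝ × S²),
        ‖Λ ⁅T.field A₁ (conePoint r₁ z.1), T.field A₂ (conePoint r₂ z.2)⁆‖ ≤ 2 * (‖A₁‖ * ‖A₂‖) := by
      intro z
      rw [hΛ]
      refine (T.norm_vacuumPerp_le _).trans ((le_opNorm _ _).trans ?_)
      rw [T.norm_vacuum, mul_one]
      refine (norm_lie_le _ _).trans ?_
      gcongr <;> exact T.norm_field_le _ _
    split_ifs with hll
    · refine (norm_inner_le_norm _ _).trans ?_
      simp only [κ₂]
      rw [sq]
      exact mul_le_mul (nb z) (nb z') (norm_nonneg _) (by positivity)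
    · rw [hΛ, hΛ, inner_eq_clusterFn]
      have hlen : ∀ z ∈ nearSet r₁ r₂ d, |z.1.1| ≤ d → |z.2.1| ≤ d → ∀ y : Mink,
          y.1 ^ 2 = (z.1.1 + r₁ - (z.2.1 + r₂)) ^ 2 →
          ‖y.2‖ = ‖r₂ • (z.2.2 : Space3) - r₁ • (z.1.2 : Space3)‖ → euclLen y ≤ 4 * d := by
        intro z hz z1 z2 y y1 y2
        rw [euclLen, y1, y2]
        refine sqrt_le_iff.2 ⟨by positivity, ?_⟩
        have h1 := geo z hz
        rw [abs_le] at z1 z2 hr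
        have h2 : (z.1.1 + r₁ - (z.2.1 + r₂)) ^ 2 ≤ (3 * d) ^ 2 :=
          sq_le_sq' (by linarith [z1.1, z2.2, hr.2]) (by linarith [z1.2, z2.1, hr.1])
        refine (add_le_add h2 h1).trans ?_
        rw [mul_pow, mul_pow]
        linarith [sq_nonneg d]
      have hgeo' : ∀ z ∈ nearSet r₁ r₂ d,
          ‖r₂ • (z.2.2 : Space3) - r₁ • (z.1.2 : Space3)‖ ≤ 2 * d := fun z hz =>
        le_of_sq_le_sq ((geo z hz).trans (by rw [mul_pow]; linarith [sq_nonneg d])) (by positivity)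
      set y : Mink := (1 / 2 : ℝ) • (conePoint r₁ z.1 + conePoint r₂ z.2) -
        (1 / 2 : ℝ) • (conePoint r₁ z'.1 + conePoint r₂ z'.2) with hy
      have hy1 : |y.1| ≤ 2 * d := by
        have : y.1 = (z.1.1 + z.2.1 - z'.1.1 - z'.2.1) / 2 := by
          simp only [hy, conePoint, Prod.fst_sub, Prod.smul_fst, Prod.fst_add, smul_eq_mul]; ring
        rw [this, abs_le]
        rw [abs_le] at z1 z2 z1' z2'
        constructor <;> linarith [z1.1, z1.2, z2.1, z2.2, z1'.1, z1'.2, z2'.1, z2'.2]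
      have hy2 : τ * R * ρ₀ - 2 * d ≤ ‖y.2‖ := by
        have h1 : r₁ • ((z.1.2 : Space3) - z'.1.2) = y.2 -
            ((1 / 2 : ℝ) • (r₂ • (z.2.2 : Space3) - r₁ • (z.1.2 : Space3)) -
              (1 / 2 : ℝ) • (r₂ • (z'.2.2 : Space3) - r₁ • (z'.1.2 : Space3))) := by
          simp only [hy, conePoint, Prod.snd_sub, Prod.smul_snd, Prod.snd_add]
          module
        have h2 := congrArg norm h1
        rw [norm_smul, norm_of_nonneg hr₁0.le] at h2
        have h3 := norm_sub_le y.2 ((1 / 2 : ℝ) • (r₂ • (z.2.2 : Space3) - r₁ • (z.1.2 : Space3)) -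
              (1 / 2 : ℝ) • (r₂ • (z'.2.2 : Space3) - r₁ • (z'.1.2 : Space3)))
        have h4 := norm_sub_le ((1 / 2 : ℝ) • (r₂ • (z.2.2 : Space3) - r₁ • (z.1.2 : Space3)))
              ((1 / 2 : ℝ) • (r₂ • (z'.2.2 : Space3) - r₁ • (z'.1.2 : Space3)))
        rw [norm_smul, norm_smul, norm_of_nonneg (by norm_num : (0 : ℝ) ≤ 1 / 2)] at h4
        have h5 := hgeo' z hz
        have h6 := hgeo' z' hz'
        have h7 : τ * R * ρ₀ ≤ r₁ * ‖(z.1.2 : Space3) - z'.1.2‖ :=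
          mul_le_mul hr₁ (not_le.1 hll).le hρ0.le hr₁0.le
        linarith
      have h4d : d₀ ≤ 4 * d := by
        rw [hdX]
        have : d₀ / (4 * lam) ≤ X ^ σ := g2
        rw [div_le_iff₀ (by positivity)] at this
        linarith
      have hgap : τ * R * ρ₀ / 2 ≤ ‖y.2‖ - |y.1| := by
        have : 0 < c₁ * d := by positivity
        linarith
      refine (hcl (4 * d) h4d _ _ y ?_ ?_ ?_).trans ?_
      · refine hlen z hz z1 z2 _ ?_ ?_
        · simp only [conePoint, Prod.fst_neg, Prod.fst_sub]; ring
        · simp only [conePoint, Prod.snd_neg, Prod.snd_sub, neg_sub]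
      · refine hlen z' hz' z1' z2' _ rfl ?_
        simp only [conePoint, Prod.snd_sub]
        exact norm_sub_rev _ _
      · linarith
      · refine add_le_add ?_ (le_of_eq ?_)
        · have h1 : τ * R * ρ₀ / 2 = τ * lam / 2 * X ^ (1 / 2 : ℝ) := by
            rw [← hρX, hXdef]; field_simp
          calc _ ≤ c₂ * (4 * d) ^ M / (τ * R * ρ₀ / 2) ^ ν := by gcongr
            _ = _ := by
              rw [h1, hdX, ← mul_assoc, mul_rpow (x := 4 * lam) (by positivity) (by positivity),
                mul_rpow (x := τ * lam / 2) (by positivity) (by positivity),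
                ← rpow_mul hX0.le, ← rpow_mul hX0.le, ← hXdef, Real.rpow_sub hX0, show 1 / 2 * ν = ν / 2 by ring]
              simp only [e₁]
              field_simp
        · rw [hdX, ← mul_assoc, mul_rpow (by positivity) (by positivity), ← rpow_mul hX0.le]
          simp only [e₂]
          push_cast
          rw [show σ * -5 = -(5 * σ) by ring]
          ring

end VacuumTheory

theorem exists_decay_exponent {κ ε : ℝ} (hκ : 2 < κ) (hε : 2 < ε) : ∃ p : ℝ, 0 < p ∧ 2 + p ≤ κ ∧ 2 +
    2 * p < ε ∧ 2 + 2 * p < 3 := by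
  have h1 := min_le_left (κ - 2) (min ((ε - 2) / 4) (1 / 4))
  have h2 := (min_le_right (κ - 2) (min ((ε - 2) / 4) (1 / 4))).trans (min_le_left _ _)
  have h3 := (min_le_right (κ - 2) (min ((ε - 2) / 4) (1 / 4))).trans (min_le_right _ _)
  refine ⟨min (κ - 2) (min ((ε - 2) / 4) (1 / 4)), lt_min (by linarith)
    (lt_min (by linarith) (by norm_num)), ?_, ?_, ?_⟩ <;> linarith

theorem wt_window_le {lam η τ₁ τ₂ R r₁ r₂ : ℝ} (hl : 0 < lam) (hη : 0 ≤ η) (hτ : τ₁ ≤ τ₂) (hR : lam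
    ≤ R) (h₁ : r₁ ∈ window lam η τ₁ τ₂ R) (h₂ : r₂ ∈ window lam η τ₁ τ₂ R) : wt lam (r₂ - r₁) ≤ (1 +
    (τ₂ - τ₁)) * (R / lam) ^ η := by
  have h3 := abs_sub_le_of_mem_window h₁ h₂
  have h4 : 1 ≤ (R / lam) ^ η := one_le_rpow ((one_le_div hl).2 hR) hη
  have h5 : |r₂ - r₁| / lam ≤ (τ₂ - τ₁) * (R / lam) ^ η := by
    rw [div_le_iff₀ hl]
    refine h3.trans (le_of_eq ?_)
    rw [width]; ring
  rw [wt]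
  linarith

theorem wt_width_rpow_le {lam σ R p : ℝ} (hl : 0 < lam) (hR : 0 < R) (hp : p ≤ 0) : wt lam (width
    lam σ R) ^ p ≤ (R / lam) ^ (σ * p) := by
  rw [rpow_mul (by positivity)]
  refine Real.rpow_le_rpow_of_nonpos (by positivity) ?_ hp
  rw [wt, abs_of_pos (width_pos hl hR), width, mul_div_cancel_left₀ _ hl.ne']
  linarith

namespace VacuumTheory

variable {lam κ : ℝ} {T : VacuumTheory H lam κ} {A₁ A₂ B₁ B₂ : Op H} {h₁ h₂ : TestFn}
  {p σ η τ₁ τ₂ ε : ℝ}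

theorem eventually_norm_lie_sub_nearComm_lt (hl : 0 < lam) (hA₁ : A₁ ∈ T.𝓕) (hA₂ : A₂ ∈ T.𝓕) (hp : 0
    < p) (hpκ : 2 + p ≤ κ) {a₁ a₂ : ℝ} (H₁ : IsAmplitude lam (2 + 2 * p) h₁ (ofReal a₁)) (H₂ :
    IsAmplitude lam (2 + 2 * p) h₂ (ofReal a₂)) (ha₁ : 0 ≤ a₁) (ha₂ : 0 ≤ a₂) (hη : 0 < η) (hη1 : η
    ≤ 1) (hησ : η * (2 + p) < σ * p) (hτ₁ : 0 < τ₁) (hτ : τ₁ ≤ τ₂) {δ : ℝ} (hδ : 0 < δ) : ∀ᶠ R in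
    atTop, ∀ r₁ ∈ window lam η τ₁ τ₂ R, ∀ r₂ ∈ window lam η τ₁ τ₂ R, ‖⁅smearRadius T A₁ r₁ h₁,
    smearRadius T A₂ r₂ h₂⁆ - nearComm T A₁ r₁ h₁ A₂ r₂ h₂ (width lam σ R)‖ < δ := by
  obtain ⟨c, hc, hdec⟩ := T.exists_commutatorDecay hl (by linarith : 0 ≤ 2 + p) hpκ hA₁ hA₂
  set K := 2 * π * lam ^ 2 / (2 + p - 2) * totalAngle * c * a₁ * a₂ with hK
  have hK0 : 0 ≤ K := by
    have := totalAngle_nonneg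
    have := pi_pos
    have : 0 < 2 + p - 2 := by linarith
    positivity
  have hF : Tendsto (fun R : ℝ => K * (1 + (τ₂ - τ₁)) ^ (2 + p) * 3 *
      (R / lam) ^ (η * (2 + p) + σ * -p)) atTop (𝓝 0) := by
    simpa using (tendsto_rpow_div_of_neg hl (p := η * (2 + p) + σ * -p) (by linarith)).const_mul
      (K * (1 + (τ₂ - τ₁)) ^ (2 + p) * 3)
  filter_upwards [hF.eventually_lt_const hδ, eventually_ge_atTop lam] with R g1 hR r₁ hr₁ r₂ hr₂
  have hR0 := hl.trans_le hR
  have hτ0 : 0 < min 1 τ₁ * R := mul_pos (lt_min one_pos hτ₁) hR0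
  refine (norm_lie_sub_nearComm_le hl (by linarith) (by linarith) H₁ H₂ ha₁ ha₂ hc hdec
    (T.continuous_field hA₁) (T.continuous_field hA₂) (hτ0.trans_le (le_of_mem_window hl hη1 hR hr₁))
    (hτ0.trans_le (le_of_mem_window hl hη1 hR hr₂)) (width_pos hl hR0).le).trans_lt
    (lt_of_le_of_lt ?_ g1)
  rw [← hK, show 2 + p - (2 + 2 * p) = -p by ring, show 2 - (2 + p) = -p by ring]
  have e1 : wt lam (r₂ - r₁) ^ (2 + p) ≤ (1 + (τ₂ - τ₁)) ^ (2 + p) * (R / lam) ^ (η * (2 + p)) := by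
    rw [rpow_mul (by positivity), ← mul_rpow (by linarith) (by positivity)]
    exact rpow_le_rpow (wt_pos hl _).le (wt_window_le hl hη.le hτ hR hr₁ hr₂) (by linarith)
  have e2 := wt_width_rpow_le (σ := σ) hl hR0 (neg_nonpos.2 hp.le)
  have e3 : 0 ≤ wt lam (width lam σ R) ^ (-p) := rpow_nonneg (wt_pos hl _).le _
  have e4 : 0 ≤ 1 + (τ₂ - τ₁) := by linarith
  calc _ ≤ K * (((1 + (τ₂ - τ₁)) ^ (2 + p) * (R / lam) ^ (η * (2 + p))) *
        (2 * (R / lam) ^ (σ * -p) + (R / lam) ^ (σ * -p))) := by gcongr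
    _ = _ := by rw [rpow_add (by positivity : 0 < R / lam)]; ring

variable (T) in
/-- Exponents of a localization scale for which the commutators of `A₁` and `A₂` cluster. -/
def ClusterExponent (A₁ A₂ : Op H) (σ : ℝ) : Prop :=
  0 < σ ∧ σ ≤ 1 / 5 ∧ ∀ {h₁ h₂ : TestFn} {a₁ a₂ q τ : ℝ},
    0 ≤ q → IsAmplitude lam q h₁ (ofReal a₁) → IsAmplitude lam q h₂ (ofReal a₂) →
    0 ≤ a₁ → 0 ≤ a₂ → 0 < τ → ∀ δ > 0, ∀ᶠ R in atTop, ∀ r₁ r₂, τ * R ≤ r₁ → τ * R ≤ r₂ →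
      |r₂ - r₁| ≤ width lam σ R → ‖T.vacuumPerp (nearComm T A₁ r₁ h₁ A₂ r₂ h₂
        (width lam σ R) T.Ω)‖ < δ

theorem Clustering.exists_clusterExponent (hT : T.Clustering) (hl : 0 < lam) (hA₁ : A₁ ∈ T.𝓕) (hA₂ :
    A₂ ∈ T.𝓕) : ∃ σ, T.ClusterExponent A₁ A₂ σ := by
  obtain ⟨σ₀, h0, h1⟩ := hT.exists_vacuumPerp_nearComm_lt hl hA₁ hA₂
  exact ⟨min σ₀ (1 / 5), lt_min h0 (by norm_num), min_le_right _ _,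
    h1 _ (lt_min h0 (by norm_num)) (min_le_left _ _)⟩

theorem eventually_width_le (hl : 0 < lam) (hησ : η < σ) (c : ℝ) : ∀ᶠ R in atTop, c * width lam η R
    ≤ width lam σ R := by
  have h1 := (tendsto_rpow_div_of_neg hl (p := η - σ) (by linarith)).eventually_lt_const
    (show 0 < 1 / (|c| + 1) by positivity)
  filter_upwards [h1, eventually_gt_atTop 0] with R h2 hR
  rw [lt_div_iff₀ (by positivity)] at h2
  have h3 : width lam η R = width lam σ R * (R / lam) ^ (η - σ) := by
    rw [width, width, mul_assoc, ← rpow_add (by positivity)]; ring_nf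
  have h4 := width_pos (η := σ) hl hR
  have h5 : 0 < (R / lam) ^ (η - σ) := by positivity
  rw [h3]
  have h6 : c * (R / lam) ^ (η - σ) ≤ 1 := by nlinarith [le_abs_self c]
  nlinarith

theorem ClusterExponent.eventually_vacuumPerp_nearComm_lt (hσ : T.ClusterExponent A₁ A₂ σ) (hl : 0 <
    lam) {q a₁ a₂ : ℝ} (hq : 0 ≤ q) (H₁ : IsAmplitude lam q h₁ (ofReal a₁)) (H₂ : IsAmplitude lam q
    h₂ (ofReal a₂)) (ha₁ : 0 ≤ a₁) (ha₂ : 0 ≤ a₂) (hη1 : η ≤ 1) (hησ : η < σ) (hτ₁ : 0 < τ₁) {δ : ℝ}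
    (hδ : 0 < δ) : ∀ᶠ R in atTop, ∀ r₁ ∈ window lam η τ₁ τ₂ R, ∀ r₂ ∈ window lam η τ₁ τ₂ R,
    ‖T.vacuumPerp (nearComm T A₁ r₁ h₁ A₂ r₂ h₂ (width lam σ R) T.Ω)‖ < δ := by
  filter_upwards [hσ.2.2 hq H₁ H₂ ha₁ ha₂ (lt_min one_pos hτ₁) δ hδ,
    eventually_width_le hl hησ (τ₂ - τ₁), eventually_ge_atTop lam] with R g1 g2 hR r₁ hr₁ r₂ hr₂
  exact g1 r₁ r₂ (le_of_mem_window hl hη1 hR hr₁) (le_of_mem_window hl hη1 hR hr₂)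
    ((abs_sub_le_of_mem_window hr₁ hr₂).trans g2)

/-- The commutators create asymptotically only the vacuum from the vacuum. -/
theorem ClusterExponent.eventually_vacuumPerp_lie_lt (hσ : T.ClusterExponent A₁ A₂ σ) (hl : 0 < lam)
    (hA₁ : A₁ ∈ T.𝓕) (hA₂ : A₂ ∈ T.𝓕) (hp : 0 < p) (hpκ : 2 + p ≤ κ) {a₁ a₂ : ℝ} (H₁ : IsAmplitude
    lam (2 + 2 * p) h₁ (ofReal a₁)) (H₂ : IsAmplitude lam (2 + 2 * p) h₂ (ofReal a₂)) (ha₁ : 0 ≤ a₁)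
    (ha₂ : 0 ≤ a₂) (hη : 0 < η) (hη1 : η ≤ 1) (hησ : η * (2 + p) < σ * p) (hτ₁ : 0 < τ₁) (hτ : τ₁ ≤
    τ₂) {δ : ℝ} (hδ : 0 < δ) : ∀ᶠ R in atTop, ∀ r₁ ∈ window lam η τ₁ τ₂ R, ∀ r₂ ∈ window lam η τ₁ τ₂
    R, ‖T.vacuumPerp (⁅smearRadius T A₁ r₁ h₁, smearRadius T A₂ r₂ h₂⁆ T.Ω)‖ < δ := by
  have hησ' : η < σ := by nlinarith [hσ.1]
  filter_upwards [hσ.eventually_vacuumPerp_nearComm_lt (τ₂ := τ₂) hl (by linarith) H₁ H₂ ha₁ ha₂ hη1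
    hησ' hτ₁ (half_pos hδ), eventually_norm_lie_sub_nearComm_lt hl hA₁ hA₂ hp hpκ H₁ H₂ ha₁ ha₂ hη hη1
    hησ hτ₁ hτ (half_pos hδ)] with R g1 g2 r₁ hr₁ r₂ hr₂
  have k1 := g1 r₁ hr₁ r₂ hr₂
  have k2 := g2 r₁ hr₁ r₂ hr₂
  set C := ⁅smearRadius T A₁ r₁ h₁, smearRadius T A₂ r₂ h₂⁆
  set N := nearComm T A₁ r₁ h₁ A₂ r₂ h₂ (width lam σ R)
  have k3 : C T.Ω = N T.Ω + (C - N) T.Ω := by rw [sub_apply]; abel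
  have k4 : ‖(C - N) T.Ω‖ < δ / 2 := by
    refine ((C - N).le_opNorm _).trans_lt ?_
    rwa [T.norm_vacuum, mul_one]
  rw [k3, _root_.map_add]
  exact (norm_add_le _ _).trans_lt (by linarith [T.norm_vacuumPerp_le ((C - N) T.Ω)])

end VacuumTheory

/-! ### Energy and momentum of one-particle vectors -/

namespace TranslationRep

variable (T : TranslationRep H)

theorem functionOf_planeWave (a : Mink) : T.functionOf (planeWave a) = T.U a :=
  T.functionOf_eq (isBoundedBorel_planeWave a) fun ψ => (T.integral_planeWave ψ a).symm

/-- The energy in vectors which are differentiable under time translations. -/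
theorem inner_U_deriv {ψ ψ' : H} (h : HasDerivAt (fun t : ℝ => T.U (t, 0) ψ) ψ' 0) : Integrable (fun
    p : Mink => p.1) (T.spectralMeasure ψ) ∧ ∀ x, inner ℂ ψ (T.U x ψ') = ∫ p, I * p.1 * planeWave x
    p ∂T.spectralMeasure ψ := by
  set μ := T.spectralMeasure ψ
  let e : ℕ → ℝ := fun n => 1 / ((n : ℝ) + 1)
  have he0 : ∀ n, 0 < e n := fun n => Nat.one_div_pos_of_nat
  have he : Tendsto e atTop (𝓝[≠] 0) := tendsto_nhdsWithin_iff.2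
    ⟨tendsto_one_div_add_atTop_nhds_zero_nat, .of_forall fun n => (he0 n).ne'⟩
  let D : ℕ → Mink → ℂ := fun n p => ((e n : ℂ)⁻¹) * (planeWave (e n, 0) p - planeWave 0 p)
  have hD0 : ∀ n, IsBoundedBorel (fun p => planeWave (e n, 0) p - planeWave 0 p) := fun n =>
    (isBoundedBorel_planeWave _).sub (isBoundedBorel_planeWave 0)
  have hD : ∀ n, IsBoundedBorel (D n) := fun n => (IsBoundedBorel.const _).mul (hD0 n)
  let v : ℕ → H := fun n => (e n : ℂ)⁻¹ • (T.U (e n, 0) ψ - ψ)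
  have hfn : ∀ n, T.functionOf (D n) ψ = v n := fun n => by
    simp only [D]
    rw [T.functionOf_const_mul _ (hD0 n), T.functionOf_sub (isBoundedBorel_planeWave _)
      (isBoundedBorel_planeWave 0), functionOf_planeWave, functionOf_planeWave, T.map_zero]
    rfl
  have hv : Tendsto v atTop (𝓝 ψ') := by
    have h1 := (hasDerivAt_iff_tendsto_slope.1 h).comp he
    refine h1.congr fun n => ?_
    simp only [v, Function.comp, slope_def_module, sub_zero]
    rw [show ((0 : ℝ), (0 : Space3)) = 0 from rfl, T.U_zero_apply, ← coe_smul]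
    simp
  have hlim : ∀ p, Tendsto (fun n => D n p) atTop (𝓝 (I * p.1)) := by
    intro p
    have h1 : HasDerivAt (fun t : ℝ => exp (I * (p.1 * t : ℝ))) (I * p.1) 0 := by
      have h2 : HasDerivAt (fun t : ℝ => ((p.1 * t : ℝ) : ℂ)) ((p.1 : ℝ) : ℂ) 0 := by
        simpa using ((hasDerivAt_id (0 : ℝ)).const_mul p.1).ofReal_comp
      simpa using (h2.const_mul I).cexp
    have h2 := (hasDerivAt_iff_tendsto_slope.1 h1).comp he
    refine h2.congr fun n => ?_
    simp only [Function.comp, slope_def_module, sub_zero, D, planeWave, mdot, inner_zero_right,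
      Prod.fst_zero, Prod.snd_zero, mul_zero]
    rw [← coe_smul, smul_eq_mul]
    simp
  have hbd : ∀ n p, ‖D n p‖ ≤ ‖p.1‖ := by
    intro n p
    simp only [D, planeWave, mdot, inner_zero_right, Prod.fst_zero, Prod.snd_zero, mul_zero, sub_zero]
    rw [ofReal_zero, mul_zero, Complex.exp_zero, norm_mul, norm_inv, norm_real,
      norm_of_nonneg (he0 n).le, inv_mul_le_iff₀ (he0 n)]
    refine (Real.norm_exp_I_mul_ofReal_sub_one_le).trans (le_of_eq ?_)
    rw [norm_mul, norm_of_nonneg (he0 n).le, mul_comm]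
  have hint : Integrable (fun p : Mink => p.1) μ := by
    obtain ⟨C, hC⟩ := hv.norm.bddAbove_range
    have hC' : ∀ n, ‖v n‖ ≤ C := fun n => hC ⟨n, rfl⟩
    have h1 : ∀ n, ∫⁻ p, ‖D n p‖ₑ ^ 2 ∂μ ≤ ofReal (C ^ 2) := by
      intro n
      have h2 := T.norm_sq_functionOf (hD n) ψ
      rw [hfn] at h2
      have h3 : ∫⁻ p, ‖D n p‖ₑ ^ 2 ∂μ = ofReal (∫ p, ‖D n p‖ ^ 2 ∂μ) := by
        have hi : Integrable (fun p => ‖D n p‖ ^ 2) μ := by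
          obtain ⟨hm, K, hK⟩ := hD n
          refine Integrable.of_bound (hm.norm.pow_const 2).aestronglyMeasurable (K ^ 2)
            (.of_forall fun p => ?_)
          rw [norm_pow, norm_norm]
          exact pow_le_pow_left₀ (norm_nonneg _) (hK p) 2
        rw [ofReal_integral_eq_lintegral_ofReal hi (.of_forall fun p => sq_nonneg _)]
        simp_rw [ENNReal.ofReal_pow (norm_nonneg _), ofReal_norm]
      rw [h3, ← h2]
      exact ofReal_le_ofReal (pow_le_pow_left₀ (norm_nonneg _) (hC' n) 2)
    have h2 : ∫⁻ p : Mink, ‖p.1‖ₑ ^ 2 ∂μ ≤ ofReal (C ^ 2) := by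
      calc _ = ∫⁻ p, liminf (fun n => ‖D n p‖ₑ ^ 2) atTop ∂μ := by
            refine lintegral_congr fun p => ?_
            have : Tendsto (fun n => ‖D n p‖ₑ ^ 2) atTop (𝓝 (‖I * (p.1 : ℂ)‖ₑ ^ 2)) :=
              ((ENNReal.continuous_pow 2).tendsto _).comp (hlim p).enorm
            rw [Tendsto.liminf_eq this]
            rw [enorm_mul, ← ofReal_norm I, norm_I, ofReal_one, one_mul,
              ← ofReal_norm, ← ofReal_norm, norm_real]
        _ ≤ liminf (fun n => ∫⁻ p, ‖D n p‖ₑ ^ 2 ∂μ) atTop :=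
            lintegral_liminf_le fun n => (hD n).1.enorm.pow_const 2
        _ ≤ _ := by
            refine (liminf_le_liminf (.of_forall h1)).trans (le_of_eq ?_)
            exact liminf_const _
    have h3 : MemLp (fun p : Mink => p.1) 2 μ := by
      refine ⟨continuous_fst.aestronglyMeasurable, ?_⟩
      rw [eLpNorm_lt_top_iff_lintegral_rpow_enorm_lt_top two_ne_zero ENNReal.ofNat_ne_top]
      refine lt_of_le_of_lt (le_of_eq ?_) (h2.trans_lt ofReal_lt_top)
      refine lintegral_congr fun p => ?_
      rw [ENNReal.toReal_ofNat, ← ENNReal.rpow_natCast]; norm_num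
    exact h3.integrable one_le_two
  refine ⟨hint, fun x => ?_⟩
  have h1 : Tendsto (fun n => inner ℂ ψ (T.U x (v n))) atTop (𝓝 (inner ℂ ψ (T.U x ψ'))) :=
    ((innerSL ℂ ψ).continuous.tendsto _).comp (((T.U x).continuous.tendsto _).comp hv)
  refine tendsto_nhds_unique h1 ?_
  have h2 : ∀ n, inner ℂ ψ (T.U x (v n)) = ∫ p, D n p * planeWave x p ∂μ := by
    intro n
    rw [← hfn, T.inner_U_functionOf (hD n)]
    simp_rw [mul_comm]
    rfl
  simp_rw [h2]
  refine tendsto_integral_of_dominated_convergence (fun p => ‖p.1‖) (fun n =>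
    ((hD n).1.mul (isBoundedBorel_planeWave x).1).aestronglyMeasurable) hint.norm (fun n =>
    .of_forall fun p => ?_) (.of_forall fun p => (hlim p).mul_const _)
  rw [norm_mul, norm_planeWave, mul_one]
  exact hbd n p

end TranslationRep

/-! ### Gaussian averages -/

theorem integral_gaussian_planeWave {t : ℝ} (ht : 0 < t) (p : Mink) : ∫ x : Space3, (rexp (-(t / 4 *
    ‖x‖ ^ 2)) : ℂ) * planeWave (0, x) p = ((4 * π / t) ^ (3 / 2 : ℝ) * rexp (-(‖p.2‖ ^ 2 / t)) : ℝ)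
    := by
  have h1 := GaussianFourier.integral_cexp_neg_mul_sq_norm_add (V := Space3)
    (b := ((t / 4 : ℝ) : ℂ)) (by rw [ofReal_re]; positivity) (-I) p.2
  have h2 : (Module.finrank ℝ Space3 / 2 : ℂ) = ((3 / 2 : ℝ) : ℂ) := by simp
  have h3 : (π / ((t / 4 : ℝ) : ℂ)) = ((4 * π / t : ℝ) : ℂ) := by
    push_cast; field_simp
  rw [h2, h3, ← ofReal_cpow (by positivity)] at h1
  have h4 : (-I) ^ 2 * (‖p.2‖ : ℂ) ^ 2 / (4 * ((t / 4 : ℝ) : ℂ)) =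
      ((-(‖p.2‖ ^ 2 / t) : ℝ) : ℂ) := by
    rw [neg_sq, I_sq]; push_cast; field_simp
  rw [h4, ← ofReal_exp, ← Complex.ofReal_mul] at h1
  rw [← h1]
  refine integral_congr_fun fun x => ?_
  simp only [planeWave, mdot, mul_zero, zero_sub]
  rw [ofReal_exp, ← exp_add]
  congr 1
  push_cast; ring

theorem integrable_gaussian_space {t : ℝ} (ht : 0 < t) : Integrable fun x : Space3 => (rexp (-(t / 4
    * ‖x‖ ^ 2)) : ℂ) := by
  have := GaussianFourier.integrable_cexp_neg_mul_sq_norm_add (V := Space3)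
    (b := ((t / 4 : ℝ) : ℂ)) (by rw [ofReal_re]; positivity) 0 0
  refine this.congr (.of_forall fun x => ?_)
  simp

theorem integral_gaussian_energy {μ : Measure Mink} [IsFiniteMeasure μ] (hμ : Integrable (fun p :
    Mink => p.1) μ) {t : ℝ} (ht : 0 < t) : ∫ x : Space3, (rexp (-(t / 4 * ‖x‖ ^ 2)) : ℂ) * ∫ p, I *
    p.1 * planeWave (0, x) p ∂μ = I * (((4 * π / t) ^ (3 / 2 : ℝ) * ∫ p, p.1 * rexp (-(‖p.2‖ ^ 2 /
    t)) ∂μ : ℝ) : ℂ) := by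
  simp_rw [← integral_const_mul]
  have hc : Continuous fun w : Space3 × Mink => planeWave (0, w.1) w.2 := by
    have : Continuous fun w : Mink × Mink => planeWave w.1 w.2 := by fun_prop
    exact this.comp (by fun_prop : Continuous fun w : Space3 × Mink => (((0 : ℝ), w.1), w.2))
  have hi : Integrable (fun w : Space3 × Mink => (rexp (-(t / 4 * ‖w.1‖ ^ 2)) : ℂ) *
      (I * w.2.1 * planeWave (0, w.1) w.2)) (volume.prod μ) := by
    have h1 := (integrable_gaussian_space ht).mul_prod (hμ.ofReal.const_mul I)
    refine (h1.mul_bdd (c := 1) hc.aestronglyMeasurable (.of_forall fun w =>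
      (norm_planeWave _ _).le)).congr (.of_forall fun w => ?_)
    exact mul_assoc _ _ _
  rw [integral_integral_swap hi, ← integral_complex_ofReal, ← integral_const_mul]
  refine integral_congr_fun fun p => ?_
  have h1 : ∀ x : Space3, (rexp (-(t / 4 * ‖x‖ ^ 2)) : ℂ) *
      (I * p.1 * planeWave (0, x) p) = I * p.1 *
        ((rexp (-(t / 4 * ‖x‖ ^ 2)) : ℂ) * planeWave (0, x) p) := fun x => by ring
  simp_rw [h1]
  rw [integral_const_mul, integral_gaussian_planeWave ht]
  push_cast; ring

theorem inv_le_lintegral_exp_neg_div {a : ℝ} (ha : 0 ≤ a) : ofReal (rexp (-1)) * (ofReal a)⁻¹ ≤ ∫⁻ t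
    in Ioi (0 : ℝ), ofReal (t ^ (-2 : ℝ) * rexp (-(a / t))) := by
  have key : ∀ s : ℝ, 0 < s → a ≤ s → ofReal (rexp (-1) * s⁻¹) ≤
      ∫⁻ t in Ioi (0 : ℝ), ofReal (t ^ (-2 : ℝ) * rexp (-(a / t))) := by
    intro s hs has
    have h1 := integral_Ioi_rpow_of_lt (a := -2) (by norm_num) hs
    have h2 := integrableOn_Ioi_rpow_of_lt (a := -2) (by norm_num) hs
    have h3 : rexp (-1) * s⁻¹ = ∫ t in Ioi s, t ^ (-2 : ℝ) * rexp (-1) := by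
      rw [integral_mul_const, h1]
      norm_num
      rw [Real.rpow_neg_one, mul_comm]
    rw [h3, ofReal_integral_eq_lintegral_ofReal (h2.mul_const _) ((ae_restrict_iff'
      measurableSet_Ioi).2 (.of_forall fun t ht => mul_nonneg (rpow_nonneg
        (hs.le.trans (le_of_lt ht)) _) (exp_pos _).le))]
    refine le_trans (setLIntegral_mono' measurableSet_Ioi fun t ht => ?_)
      (lintegral_mono_set (Set.Ioi_subset_Ioi hs.le))
    have ht0 : 0 < t := hs.trans ht
    refine ofReal_le_ofReal (mul_le_mul_of_nonneg_left (Real.exp_le_exp.2 ?_)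
      (rpow_nonneg ht0.le _))
    have : a / t ≤ 1 := (div_le_one ht0).2 (has.trans (le_of_lt ht))
    linarith
  rcases ha.eq_or_lt with rfl | ha'
  · have h1 : Tendsto (fun s : ℝ => ofReal (rexp (-1) * s⁻¹)) (𝓝[>] 0) (𝓝 ⊤) :=
      ENNReal.tendsto_ofReal_atTop.comp (tendsto_inv_nhdsGT_zero.const_mul_atTop (exp_pos _))
    exact le_top.trans (le_of_tendsto h1 (by
      filter_upwards [self_mem_nhdsWithin] with s hs using key s hs (le_of_lt hs)))
  · refine le_trans (le_of_eq ?_) (key a ha' le_rfl)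
    rw [ofReal_mul (exp_pos _).le, ENNReal.ofReal_inv_of_pos ha']

theorem lintegral_rpow_mul_exp_neg {r : ℝ} (hr : 0 < r) : ∫⁻ t in Ioi (0 : ℝ), ofReal (t ^ (-(1 / 2)
    : ℝ) * rexp (-(r * t))) = ofReal ((1 / r) ^ (1 / 2 : ℝ) * Gamma (1 / 2)) := by
  have h1 := Real.integral_rpow_mul_exp_neg_mul_Ioi (a := 1 / 2) (by norm_num) hr
  have h2 : (0 : ℝ) < (1 / r) ^ (1 / 2 : ℝ) * Gamma (1 / 2) :=
    mul_pos (by positivity) (Real.Gamma_pos_of_pos (by norm_num))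
  rw [← h1] at h2 ⊢
  rw [show (1 / 2 - 1 : ℝ) = -(1 / 2) by norm_num] at h2 ⊢
  rw [ofReal_integral_eq_lintegral_ofReal]
  · by_contra h3
    rw [integral_undef h3] at h2
    exact h2.ne rfl
  · exact (ae_restrict_iff' measurableSet_Ioi).2 (.of_forall fun t ht =>
      mul_nonneg (rpow_nonneg (le_of_lt ht) _) (exp_pos _).le)

theorem integrable_inv_norm_mul_wt {lam κ : ℝ} (hl : 0 < lam) (hκ : 2 < κ) : Integrable fun x :
    Space3 => ‖x‖⁻¹ * wt lam ‖x‖ ^ (-κ) := by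
  rw [integrable_fun_norm_addHaar (volume : Measure Space3) (f := fun y : ℝ => y⁻¹ * wt lam y ^ (-κ))]
  have h1 : Module.finrank ℝ Space3 - 1 = 2 := by simp
  rw [h1]
  refine ((integrable_wt_rpow hl (a := κ - 1) (by linarith)).const_mul lam).integrableOn.mono'
    (Measurable.aestronglyMeasurable ?_) ((ae_restrict_iff' measurableSet_Ioi).2
      (.of_forall fun y hy => ?_))
  · have := (continuous_wt_rpow hl (-κ)).measurable
    fun_prop
  · have hy0 : 0 < y := hy
    have hw := wt_pos hl y
    have h2 : y ≤ lam * wt lam y := by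
      rw [wt, abs_of_pos hy0, mul_add, mul_one, mul_div_cancel₀ _ hl.ne']; linarith
    have h3 := rpow_nonneg hw.le (-κ)
    rw [smul_eq_mul, norm_of_nonneg (by positivity),
      show -(κ - 1) = 1 + -κ by ring, rpow_add hw, rpow_one]
    calc _ = y * wt lam y ^ (-κ) := by field_simp
      _ ≤ (lam * wt lam y) * wt lam y ^ (-κ) := by gcongr
      _ = _ := by ring

namespace VacuumTheory

variable {lam κ : ℝ} {T : VacuumTheory H lam κ} {B : Op H}

theorem hasDerivAt_field (hB : B ∈ T.𝓕) : HasDerivAt (fun t : ℝ => T.field B (t, 0)) (iteratedFDeriv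
    ℝ 1 (T.field B) 0 fun _ => ((1 : ℝ), (0 : Space3))) 0 := by
  have h1 := ((T.commutators B hB B hB).1.differentiable (by simp)).differentiableAt (x := 0)
  have h2 : HasDerivAt (fun t : ℝ => (t, (0 : Space3))) ((1 : ℝ), (0 : Space3)) 0 :=
    (hasDerivAt_id 0).prodMk (hasDerivAt_const 0 _)
  have h3 := (h1.hasFDerivAt : HasFDerivAt _ _ ((fun t : ℝ => (t, (0 : Space3))) 0)).comp_hasDerivAt 0 h2
  rw [iteratedFDeriv_one_apply]
  exact h3

theorem field_apply_vacuum (B : Op H) (a : Mink) : T.field B a T.Ω = T.U a (B T.Ω) := by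
  rw [TranslationRep.field, mul_apply_eq_comp, mul_apply_eq_comp, T.vacuum_invariant]

theorem hasDerivAt_U_vacuum {A : Op H} (h : HasDerivAt (fun t : ℝ => T.field B (t, 0)) A 0) :
    HasDerivAt (fun t : ℝ => T.U (t, 0) (B T.Ω)) (A T.Ω) 0 := by
  rw [hasDerivAt_iff_tendsto_slope] at h ⊢
  refine (((by fun_prop : Continuous fun A : Op H => A T.Ω).tendsto A).comp h).congr fun t => ?_
  simp [slope_def_module, field_apply_vacuum]

theorem energy_nonneg_ae (T : VacuumTheory H lam κ) (ψ : H) :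
    ∀ᵐ p ∂T.spectralMeasure ψ, ‖p.2‖ ≤ p.1 := T.spectrum_condition ψ

/-- The inverse square of the momentum is integrable, relative to the energy. -/
theorem lintegral_energy_mul_inv_sq_lt_top (hl : 0 < lam) (hκ : 2 < κ) (hB : B ∈ T.𝓕) : ∫⁻ p, ofReal
    p.1 * (ofReal (‖p.2‖ ^ 2))⁻¹ ∂T.spectralMeasure (B T.Ω) < ⊤ := by
  set A := iteratedFDeriv ℝ 1 (T.field B) 0 fun _ => ((1 : ℝ), (0 : Space3)) with hA
  have hdB : HasDerivAt (fun t : ℝ => T.field B (t, 0)) A 0 := hasDerivAt_field hB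
  have hdB' : HasDerivAt (fun t : ℝ => T.field (star B) (t, 0)) (star A) 0 := by
    refine hdB.star.congr_of_eventuallyEq (.of_forall fun t => ?_)
    exact (T.star_field B _).symm
  set μ := T.spectralMeasure (B T.Ω)
  set ν := T.spectralMeasure (star B T.Ω)
  obtain ⟨hμ, hμ'⟩ := T.inner_U_deriv (hasDerivAt_U_vacuum hdB)
  obtain ⟨hν, hν'⟩ := T.inner_U_deriv (hasDerivAt_U_vacuum hdB')
  obtain ⟨c, hc⟩ := (T.commutators _ (star_mem hB) B hB).2.2 0 1 Fin.elim0
    (fun _ => ((1 : ℝ), (0 : Space3)))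
  rw [iteratedFDeriv_zero_apply, TranslationRep.field_zero, ← hA] at hc
  have hc' : ∀ x : Space3, ‖⁅star B, T.field A (0, x)⁆‖ ≤ |c| * wt lam ‖x‖ ^ (-κ) := by
    intro x
    have h1 := decayFn_le (κ := κ) hl (by linarith) le_rfl (a := ((0 : ℝ), x)) (t := 0) (ρ := 0)
      (e := ‖x‖) (by simp) (norm_nonneg _) (by simp)
    rw [show wt lam 0 = 1 by simp [wt], one_rpow, one_mul] at h1
    have h2 : 0 ≤ decayFn lam κ ((0 : ℝ), x) := by
      rw [decayFn]
      split_ifs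
      · exact zero_le_one
      · have : 0 < lam + ‖x‖ - |(0 : ℝ)| := by rw [abs_zero]; linarith [norm_nonneg x]
        exact div_nonneg (by positivity) (rpow_nonneg this.le _)
    exact (hc _).trans ((mul_le_mul_of_nonneg_right (le_abs_self c) h2).trans
      (mul_le_mul_of_nonneg_left h1 (abs_nonneg c)))
  let I₀ : ℝ → ℝ := fun t => ∫ p, p.1 * rexp (-(‖p.2‖ ^ 2 / t)) ∂μ
  have hexp : ∀ {t : ℝ}, 0 < t → ∀ p : Mink, ‖rexp (-(‖p.2‖ ^ 2 / t))‖ ≤ 1 := fun ht p => by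
    rw [norm_of_nonneg (exp_pos _).le, exp_le_one_iff, neg_nonpos]; positivity
  have hexpc : ∀ t : ℝ, Measurable fun p : Mink => rexp (-(‖p.2‖ ^ 2 / t)) := fun t => by fun_prop
  have step : ∀ t : ℝ, 0 < t → ofReal ((4 * π / t) ^ (3 / 2 : ℝ)) *
      ∫⁻ p, ofReal p.1 * ofReal (rexp (-(‖p.2‖ ^ 2 / t))) ∂μ ≤
      ∫⁻ x : Space3, ofReal (|c| * wt lam ‖x‖ ^ (-κ)) * ofReal (rexp (-(t / 4 * ‖x‖ ^ 2))) := by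
    intro t ht
    have e1 := integral_gaussian_energy hμ ht
    have e2 := integral_gaussian_energy hν ht
    set J : ℝ := ∫ p, p.1 * rexp (-(‖p.2‖ ^ 2 / t)) ∂ν with hJ
    have hJ0 : 0 ≤ J := integral_nonneg_of_ae (by
      filter_upwards [T.energy_nonneg_ae (star B T.Ω)] with p hp
      exact mul_nonneg ((norm_nonneg _).trans hp) (exp_pos _).le)
    have hI0 : 0 ≤ I₀ t := integral_nonneg_of_ae (by
      filter_upwards [T.energy_nonneg_ae (B T.Ω)] with p hp
      exact mul_nonneg ((norm_nonneg _).trans hp) (exp_pos _).le)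
    have key : ∀ x : Space3, inner ℂ T.Ω (⁅star B, T.field A (0, x)⁆ T.Ω) =
        (∫ p, I * p.1 * planeWave (0, x) p ∂μ) -
          (starRingEnd ℂ) (∫ p, I * p.1 * planeWave (0, x) p ∂ν) := by
      intro x
      rw [← hμ' (0, x), ← hν' (0, x), inner_conj_symm, Ring.lie_def, sub_apply, mul_apply_eq_comp,
        mul_apply_eq_comp, inner_sub_right, star_eq_adjoint,
        adjoint_inner_right, field_apply_vacuum, ← field_apply_vacuum (star A),
        ← T.star_field, star_eq_adjoint, adjoint_inner_left]
    have hG := integrable_gaussian_space ht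
    have hk : ∀ {ρ : Measure Mink} [IsFiniteMeasure ρ], Integrable (fun p : Mink => p.1) ρ →
        Integrable fun x : Space3 => (rexp (-(t / 4 * ‖x‖ ^ 2)) : ℂ) *
          ∫ p, I * p.1 * planeWave (0, x) p ∂ρ := by
      intro ρ _ hρ
      have hm : StronglyMeasurable fun w : Space3 × Mink =>
          I * w.2.1 * planeWave (0, w.1) w.2 := by
        have : Continuous fun w : Mink × Mink => planeWave w.1 w.2 := by fun_prop
        have := this.comp (by fun_prop : Continuous fun w : Space3 × Mink => (((0 : ℝ), w.1), w.2))
        exact ((by fun_prop : Continuous fun w : Space3 × Mink =>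
          I * (w.2.1 : ℂ)).mul this).stronglyMeasurable
      refine hG.mul_bdd (c := ∫ p : Mink, ‖p.1‖ ∂ρ) hm.integral_prod_right.aestronglyMeasurable
        (.of_forall fun x => ?_)
      refine norm_integral_le_of_norm_le hρ.norm (.of_forall fun p => ?_)
      rw [norm_mul, norm_mul, norm_planeWave, norm_I, one_mul, mul_one, norm_real]
    have total : ∫ x : Space3, (rexp (-(t / 4 * ‖x‖ ^ 2)) : ℂ) *
        inner ℂ T.Ω (⁅star B, T.field A (0, x)⁆ T.Ω) =
        I * ((4 * π / t) ^ (3 / 2 : ℝ) * (I₀ t + J) : ℝ) := by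
      have h1 : ∀ x : Space3, (rexp (-(t / 4 * ‖x‖ ^ 2)) : ℂ) *
          inner ℂ T.Ω (⁅star B, T.field A (0, x)⁆ T.Ω) =
          (rexp (-(t / 4 * ‖x‖ ^ 2)) : ℂ) * (∫ p, I * p.1 * planeWave (0, x) p ∂μ) -
          (starRingEnd ℂ) ((rexp (-(t / 4 * ‖x‖ ^ 2)) : ℂ) *
            (∫ p, I * p.1 * planeWave (0, x) p ∂ν)) := fun x => by
        rw [key, map_mul, conj_ofReal, mul_sub]
      simp_rw [h1]
      have h2 : Integrable fun x : Space3 => (starRingEnd ℂ) ((rexp (-(t / 4 * ‖x‖ ^ 2)) : ℂ) *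
          (∫ p, I * p.1 * planeWave (0, x) p ∂ν)) :=
        (conjCLE : ℂ →L[ℝ] ℂ).integrable_comp (hk hν)
      rw [integral_sub (hk hμ) h2, integral_conj, e1, e2, map_mul, conj_ofReal, conj_I]
      simp only [I₀]
      push_cast; ring
    have h2 : ofReal ((4 * π / t) ^ (3 / 2 : ℝ)) *
        ∫⁻ p, ofReal p.1 * ofReal (rexp (-(‖p.2‖ ^ 2 / t))) ∂μ =
        ofReal ((4 * π / t) ^ (3 / 2 : ℝ) * I₀ t) := by
      rw [ofReal_mul (by positivity)]
      congr 1
      simp only [I₀]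
      rw [ofReal_integral_eq_lintegral_ofReal]
      · refine lintegral_congr fun p => (ofReal_mul' (exp_pos _).le).symm
      · exact hμ.mul_bdd (hexpc t).aestronglyMeasurable (.of_forall (hexp ht))
      · filter_upwards [T.energy_nonneg_ae (B T.Ω)] with p hp
        exact mul_nonneg ((norm_nonneg _).trans hp) (exp_pos _).le
    rw [h2]
    have h3 : ofReal ((4 * π / t) ^ (3 / 2 : ℝ) * I₀ t) ≤
        ‖∫ x : Space3, (rexp (-(t / 4 * ‖x‖ ^ 2)) : ℂ) *
          inner ℂ T.Ω (⁅star B, T.field A (0, x)⁆ T.Ω)‖ₑ := by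
      rw [total, ← ofReal_norm, norm_mul, norm_I, one_mul, norm_real,
        norm_of_nonneg (by positivity)]
      refine ofReal_le_ofReal (mul_le_mul_of_nonneg_left (by linarith) (by positivity))
    refine h3.trans ((enorm_integral_le_lintegral_enorm _).trans (lintegral_mono fun x => ?_))
    rw [← ofReal_norm, norm_mul, norm_real, norm_of_nonneg (exp_pos _).le, mul_comm,
      ofReal_mul (norm_nonneg _)]
    gcongr
    refine (norm_inner_le_norm _ _).trans ?_
    rw [T.norm_vacuum, one_mul]
    refine (le_opNorm _ _).trans ?_
    rw [T.norm_vacuum, mul_one]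
    exact hc' x
  have up : ∫⁻ t in Ioi (0 : ℝ), ofReal (t ^ (-(1 / 2) : ℝ)) *
      ∫⁻ x : Space3, ofReal (|c| * wt lam ‖x‖ ^ (-κ)) * ofReal (rexp (-(t / 4 * ‖x‖ ^ 2))) < ⊤ := by
    simp_rw [← lintegral_const_mul' _ _ ofReal_ne_top]
    have hw := (continuous_wt_rpow hl (-κ)).measurable
    have hw' : Measurable fun z : ℝ × Space3 => wt lam ‖z.2‖ ^ (-κ) := hw.comp (by fun_prop)
    rw [lintegral_lintegral_swap (by fun_prop)]
    refine lt_of_le_of_lt (le_of_eq (lintegral_congr_ae ?_)) ((integrable_inv_norm_mul_wt hl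
      hκ).const_mul (|c| * (2 * Gamma (1 / 2)))).lintegral_lt_top
    filter_upwards [compl_mem_ae_iff.2 (measure_singleton (0 : Space3))] with x hx
    have hx0 : 0 < ‖x‖ := norm_pos_iff.2 hx
    have h1 : (1 / (‖x‖ ^ 2 / 4)) ^ (1 / 2 : ℝ) = 2 * ‖x‖⁻¹ := by
      rw [← Real.sqrt_eq_rpow, Real.sqrt_eq_iff_eq_sq (by positivity) (by positivity)]
      field_simp; norm_num
    have h2 := lintegral_rpow_mul_exp_neg (r := ‖x‖ ^ 2 / 4) (by positivity)
    rw [h1] at h2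
    have h3 := rpow_nonneg (wt_pos hl ‖x‖).le (-κ)
    calc _ = ∫⁻ t in Ioi (0 : ℝ), ofReal (|c| * wt lam ‖x‖ ^ (-κ)) *
          ofReal (t ^ (-(1 / 2) : ℝ) * rexp (-(‖x‖ ^ 2 / 4 * t))) := by
          refine lintegral_congr fun t => ?_
          rw [ofReal_mul' (exp_pos _).le, show t / 4 * ‖x‖ ^ 2 = ‖x‖ ^ 2 / 4 * t by ring]
          ring
      _ = _ := by
          rw [lintegral_const_mul' _ _ ofReal_ne_top, h2, ← ofReal_mul (by positivity)]
          congr 1; ring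
  have down : ofReal ((4 * π) ^ (3 / 2 : ℝ) * rexp (-1)) *
      ∫⁻ p, ofReal p.1 * (ofReal (‖p.2‖ ^ 2))⁻¹ ∂μ ≤
      ∫⁻ t in Ioi (0 : ℝ), ofReal (t ^ (-(1 / 2) : ℝ)) * (ofReal ((4 * π / t) ^ (3 / 2 : ℝ)) *
          ∫⁻ p, ofReal p.1 * ofReal (rexp (-(‖p.2‖ ^ 2 / t))) ∂μ) := by
    simp_rw [← lintegral_const_mul' _ _ ofReal_ne_top]
    rw [lintegral_lintegral_swap (by fun_prop)]
    refine lintegral_mono fun p => ?_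
    have h1 := inv_le_lintegral_exp_neg_div (sq_nonneg ‖p.2‖)
    calc _ = ofReal ((4 * π) ^ (3 / 2 : ℝ)) * ofReal p.1 *
          (ofReal (rexp (-1)) * (ofReal (‖p.2‖ ^ 2))⁻¹) := by
          rw [ofReal_mul (by positivity)]; ring
      _ ≤ _ := mul_le_mul_right h1 _
      _ = _ := by
          rw [← lintegral_const_mul' _ _ (ENNReal.mul_ne_top ofReal_ne_top ofReal_ne_top)]
          refine setLIntegral_congr_fun measurableSet_Ioi fun t ht => ?_
          have ht0 : 0 < t := ht
          have h2 : (4 * π) ^ (3 / 2 : ℝ) * t ^ (-2 : ℝ) =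
              t ^ (-(1 / 2) : ℝ) * (4 * π / t) ^ (3 / 2 : ℝ) := by
            rw [div_rpow (by positivity) ht0.le, div_eq_mul_inv (_ ^ _), ← rpow_neg ht0.le,
              mul_left_comm, ← rpow_add ht0]
            norm_num
          rw [ofReal_mul' (exp_pos _).le, ← mul_assoc, mul_right_comm _ (ofReal p.1),
            ← ofReal_mul (by positivity), h2, ofReal_mul (by positivity)]
          ring
  have h1 := (down.trans (setLIntegral_mono' measurableSet_Ioi fun t ht =>
    mul_le_mul_right (step t ht) _)).trans_lt up
  refine lt_of_not_ge fun h2 => ?_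
  rw [top_le_iff.1 h2, mul_top (by simp; positivity)] at h1
  exact h1.ne rfl

end VacuumTheory

/-! ### The symbol of the asymptotic creation operators -/

/-- Oscillating radial averages. -/
theorem tendsto_integral_scaled_exp {lam η : ℝ} {g : ℝ → ℝ} (hl : 0 < lam) (hη : 0 < η) (hg1 : ∫ r,
    g r = 1) (θ : ℝ) : Tendsto (fun R : ℝ => ∫ r, (scaled lam η g R r : ℂ) * exp (I * (θ * r : ℝ)))
    atTop (𝓝 (if θ = 0 then 1 else 0)) := by
  split_ifs with hθ
  · refine tendsto_const_nhds.congr' ?_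
    filter_upwards [eventually_gt_atTop 0] with R hR
    simp_rw [hθ, zero_mul, ofReal_zero, mul_zero, Complex.exp_zero, mul_one]
    rw [integral_complex_ofReal, integral_scaled hl hR, hg1, Complex.ofReal_one]
  · have h1 := (Real.tendsto_integral_exp_smul_cocompact (fun r => (g r : ℂ)))
    have hw : Tendsto (fun R => width lam η R) atTop atTop :=
      (((tendsto_rpow_atTop hη).comp (tendsto_id.atTop_div_const hl)).const_mul_atTop hl)
    have h2 : Tendsto (fun R => -(θ / (2 * π)) * width lam η R) atTop (cocompact ℝ) := by
      have h3 : -(θ / (2 * π)) ≠ 0 := neg_ne_zero.2 (div_ne_zero hθ (by positivity))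
      rw [cocompact_eq_atBot_atTop]
      rcases lt_or_gt_of_ne h3 with h4 | h4
      · exact (hw.const_mul_atTop_of_neg h4).mono_right le_sup_left
      · exact (hw.const_mul_atTop h4).mono_right le_sup_right
    refine tendsto_zero_iff_norm_tendsto_zero.2 ((tendsto_zero_iff_norm_tendsto_zero.1
      (h1.comp h2)).congr' ?_)
    filter_upwards [eventually_gt_atTop 0] with R hR
    have hw0 := width_pos (η := η) hl hR
    set w := width lam η R with hwd
    let φ : ℝ → ℂ := fun u => (g u : ℂ) * exp (I * (θ * (R + w * (u - 1)) : ℝ))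
    have e1 : ∫ r, (scaled lam η g R r : ℂ) * exp (I * (θ * r : ℝ)) = ∫ u, φ u := by
      have e2 : ∀ r, (scaled lam η g R r : ℂ) * exp (I * (θ * r : ℝ)) =
          (w : ℂ)⁻¹ * φ (w⁻¹ * (r - R) + 1) := by
        intro r
        simp only [φ, scaled, ← hwd]
        rw [show R + w * (w⁻¹ * (r - R) + 1 - 1) = r by field_simp; ring]
        push_cast; ring
      simp_rw [e2]
      rw [integral_const_mul, integral_sub_right_eq_self (fun r => φ (w⁻¹ * r + 1)) R,
        Measure.integral_comp_mul_left (fun r => φ (r + 1)), integral_add_right_eq_self φ 1, inv_inv,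
        abs_of_pos hw0, real_smul, ← mul_assoc, inv_mul_cancel₀ (by exact_mod_cast hw0.ne'),
        one_mul]
    have e3 : ∫ u, φ u = exp (I * (θ * (R - w) : ℝ)) *
        ∫ v, Real.fourierChar (-(v * (-(θ / (2 * π)) * w))) • (g v : ℂ) := by
      rw [← integral_const_mul]
      refine integral_congr_fun fun v => ?_
      simp only [φ]
      rw [Circle.smul_def, Real.fourierChar_apply, smul_eq_mul, ← mul_assoc, ← exp_add, mul_comm]
      congr 2
      have : (π : ℂ) ≠ 0 := by exact_mod_cast pi_ne_zero
      push_cast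
      field_simp
      ring
    rw [e1, e3, norm_mul, mul_comm I, norm_exp_ofReal_mul_I, one_mul]
    rfl

section Symbol

variable {lam ε : ℝ} {b : TestFn}

/-- The symbol of the field at radius `r`. -/
def radiusSymbol (b : TestFn) (r : ℝ) (p : Mink) : ℂ :=
  exp (I * (p.1 * r : ℝ)) * (r * ∫ l : S², timeFourier (thirdDeriv b) p.1 l *
      exp (-(I * (r * inner ℝ p.2 (l : Space3) : ℝ))) ∂sphereMeasure)

theorem exists_norm_radiusSymbol_le (hb : IsHomTestFn lam ε 1 b) (hl : 0 < lam) (hε : 0 < ε) : ∃ C,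
    0 ≤ C ∧ ∀ (r : ℝ) (p : Mink), 0 < r → 0 < p.1 → p.2 ≠ 0 → ‖radiusSymbol b r p‖ ≤ C * (sqrt p.1 /
    ‖p.2‖) := by
  obtain ⟨C, hC0, hC⟩ := hb.exists_sphereC1 hl hε
  refine ⟨40 * C, by positivity, fun r p hr hp1 hp2 => ?_⟩
  rw [radiusSymbol, norm_mul, mul_comm I, norm_exp_ofReal_mul_I, one_mul]
  exact ((hC p.1 hp1).norm_integral_plane_wave_le hp2 hr).trans (le_of_eq (by ring))

theorem radiusSymbol_zero (hb : IsHomTestFn lam ε 1 b) (hl : 0 < lam) (hε : 0 < ε) (r : ℝ) :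
    radiusSymbol b r 0 = 0 := by
  have h1 : ∀ l : S², timeFourier (thirdDeriv b) 0 l = 0 := fun l => by
    rw [hb.timeFourier_thirdDeriv hl hε 0 (norm_sphere_mem l)]; simp
  simp [radiusSymbol, h1]

theorem integral_cone_planeWave (hb : IsHomTestFn lam ε 1 b) (hl : 0 < lam) (hε : 2 < ε) (r : ℝ) {p
    : Mink} (hp : 0 ≤ p.1) : ∫ x, ((r / (2 * π) : ℝ) * positivePart (thirdDeriv b) x.1 x.2) *
    planeWave (conePoint r x) p ∂coneMeasure = radiusSymbol b r p := by
  obtain ⟨A, hA0, hA⟩ := hb.exists_isAmplitude_positivePart hl (q := 0) le_rfl (by norm_num) (by linarith)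
  have hi := hA.integrable hl le_rfl ofReal_ne_top
  have hpw : Continuous fun x => planeWave (conePoint r x) p := by
    have : Continuous fun w : Mink × Mink => planeWave w.1 w.2 := by fun_prop
    exact this.comp ((continuous_conePoint r).prodMk continuous_const)
  have h1 : Integrable (fun x : ℝ × S² => ((r / (2 * π) : ℝ) *
      positivePart (thirdDeriv b) x.1 x.2) * planeWave (conePoint r x) p) coneMeasure :=
    (hi.const_mul _).mul_bdd (c := 1) hpw.aestronglyMeasurable (.of_forall fun x =>
      (norm_planeWave _ _).le)
  rw [integral_prod_symm _ h1, radiusSymbol, ← integral_const_mul, ← integral_const_mul]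
  refine integral_congr_fun fun l => ?_
  have h2 := hb.integral_positivePart hl (by linarith) l hp (hA.integrable_left hl le_rfl
    ofReal_ne_top l)
  have hpi : (π : ℂ) ≠ 0 := by exact_mod_cast pi_ne_zero
  have h3 : timeFourier (thirdDeriv b) p.1 l = (2 * π : ℂ)⁻¹ *
      ∫ s : ℝ, positivePart (thirdDeriv b) s l * exp (I * p.1 * s) := by
    rw [h2]; field_simp
  simp only
  rw [h3, ← integral_const_mul, ← integral_mul_const, ← integral_const_mul, ← integral_const_mul]
  refine integral_congr_fun fun s => ?_
  simp only [planeWave, mdot, conePoint, inner_smul_right]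
  rw [show exp (I * ((p.1 * (s + r) - r * inner ℝ p.2 (l : Space3) : ℝ) : ℂ)) =
    exp (I * p.1 * s) * (exp (I * (p.1 * r : ℝ)) *
      exp (-(I * (r * inner ℝ p.2 (l : Space3) : ℝ)))) by
    rw [← exp_add, ← exp_add]; congr 1; push_cast; ring]
  push_cast
  field_simp

theorem exists_norm_timeFourier_le_mul (hb : IsHomTestFn lam ε 1 b) (hl : 0 < lam) (hε : 0 < ε) : ∃
    C, 0 ≤ C ∧ ∀ (u : ℝ) (l : S²), 0 < u → ‖timeFourier (thirdDeriv b) u l‖ ≤ C * u := by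
  obtain ⟨C1, h1, hC1⟩ := hb.exists_norm_timeFourier_thirdDeriv_le hl hε 0
  obtain ⟨C2, h2, hC2⟩ := hb.exists_norm_timeFourier_le hl hε 0
  refine ⟨C1 + C2, by positivity, fun u l hu => ?_⟩
  rcases le_total 1 u with h | h
  · have := hC1 u l (norm_sphere_mem l)
    rw [pow_zero, one_mul] at this
    nlinarith
  · have h3 := hC2 u l (norm_sphere_mem l)
    have hb0 : timeDeriv b 0 = b := by ext s l; simp [timeDeriv]
    rw [hb0] at h3
    rw [hb.timeFourier_thirdDeriv hl hε u (norm_sphere_mem l), norm_mul, norm_pow, IsHomTestFn.norm_neg_I_mul,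
      abs_of_pos hu]
    have : u ^ 3 ≤ u := by
      calc u ^ 3 ≤ u ^ 1 := pow_le_pow_of_le_one hu.le h (by norm_num)
        _ = u := pow_one u
    calc u ^ 3 * ‖timeFourier b u l‖ ≤ u * C2 := mul_le_mul this h3 (norm_nonneg _) hu.le
      _ ≤ _ := by nlinarith

theorem tildeOne_eq (hb : IsHomTestFn lam ε 1 b) (hl : 0 < lam) (hε : 0 < ε) {p : Mink} (hp : p.2 ≠
    0) : tildeOne (thirdDeriv b) p = if p.1 = ‖p.2‖ then (‖p.2‖ : ℂ)⁻¹ * timeFourier (thirdDeriv b)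
    ‖p.2‖ (‖p.2‖⁻¹ • p.2) else 0 := by
  have hp' : 0 < ‖p.2‖ := norm_pos_iff.2 hp
  rw [tildeOne]
  simp only [ne_eq, hp, not_false_eq_true, true_and]
  split_ifs with h
  · rw [← hb.timeFourier_smul hl hε hp' (by rw [norm_smul, norm_inv, norm_norm,
      inv_mul_cancel₀ hp'.ne']), smul_inv_smul₀ hp'.ne']
  · rfl

theorem isBoundedBorel_tildeOne (hb : IsHomTestFn lam ε 1 b) (hl : 0 < lam) (hε : 0 < ε) :
    IsBoundedBorel (tildeOne (thirdDeriv b)) := by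
  have hne : ∀ p : Mink, p.2 ≠ 0 → ‖p.2‖⁻¹ • p.2 ∈ S² := fun p hp => by
    rw [mem_sphere_zero_iff_norm, norm_smul, norm_inv, norm_norm, inv_mul_cancel₀ (norm_ne_zero_iff.2 hp)]
  obtain ⟨C, hC0, hC⟩ := exists_norm_timeFourier_le_mul hb hl hε
  have hS : MeasurableSet {p : Mink | p.2 ≠ 0} :=
    (isClosed_singleton.preimage continuous_snd).isOpen_compl.measurableSet
  refine ⟨?_, C, fun p => ?_⟩
  · let l₀ : S² := ⟨EuclideanSpace.single 0 1, by simp⟩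
    let ν : Mink → S² := fun p =>
      if h : p.2 ≠ 0 then ⟨‖p.2‖⁻¹ • p.2, hne p h⟩ else l₀
    have hν : Measurable ν := by
      have h1 : (fun p => (ν p : Space3)) = fun p : Mink => if p.2 ≠ 0 then ‖p.2‖⁻¹ • p.2 else l₀ := by
        ext1 p
        simp only [ν]
        split_ifs <;> rfl
      have h2 : Measurable fun p => (ν p : Space3) := by
        rw [h1]
        exact Measurable.ite hS (by fun_prop) measurable_const
      exact h2.subtype_mk (p := fun x => x ∈ S²)
    have h3 := hb.measurable_timeFourier.comp ((by fun_prop : Measurable fun p : Mink => ‖p.2‖).prodMk hν)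
    have h4 : tildeOne (thirdDeriv b) = ({p : Mink | p.2 ≠ 0} ∩ {p | p.1 = ‖p.2‖}).indicator fun p =>
        (‖p.2‖ : ℂ)⁻¹ * timeFourier (thirdDeriv b) ‖p.2‖ (ν p) := by
      ext1 p
      by_cases h : p.2 ≠ 0
      · rw [tildeOne_eq hb hl hε h]
        by_cases h' : p.1 = ‖p.2‖ <;> simp [Set.indicator, h, h', ν]
      · rw [indicator_of_notMem (fun h' => h h'.1), tildeOne, if_neg fun h' => h h'.1]
    rw [h4]
    refine Measurable.indicator ?_ (hS.inter (measurableSet_eq_fun measurable_fst (by fun_prop)))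
    have h5 : Measurable fun p : Mink => (‖p.2‖ : ℂ)⁻¹ := by fun_prop
    exact h5.mul h3
  · by_cases h : p.2 ≠ 0
    · have hp' : 0 < ‖p.2‖ := norm_pos_iff.2 h
      rw [tildeOne_eq hb hl hε h]
      split_ifs
      · have := hC ‖p.2‖ ⟨_, hne p h⟩ hp'
        rw [norm_mul, norm_inv, norm_real, norm_norm, inv_mul_le_iff₀ hp', mul_comm]
        exact this
      · simpa using hC0
    · rw [tildeOne, if_neg fun h' => h h'.1, norm_zero]; exact hC0

end Symbol

/-! ### The asymptotic one-particle vectors -/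

/-- The properties of the radial weights which are used: `γ` is a weight of total mass at most `Γ`
on the window. -/
structure IsWeight (lam η τ₁ τ₂ Γ R : ℝ) (γ : ℝ → ℝ) : Prop where
  continuous : Continuous γ
  hasCompactSupport : HasCompactSupport γ
  mem_window : ∀ r, γ r ≠ 0 → r ∈ window lam η τ₁ τ₂ R
  integral_abs_le : ∫ r, |γ r| ≤ Γ

section Weight

variable {lam η τ₁ τ₂ Γ R : ℝ} {γ : ℝ → ℝ}

theorem IsRadialSmearing.exists_isWeight {g : ℝ → ℝ} (hg : IsRadialSmearing g) (hl : 0 < lam) : ∃ τ₁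
    τ₂ Γ, 0 < τ₁ ∧ τ₁ ≤ τ₂ ∧ 0 ≤ Γ ∧ ∀ η R, 0 < R → IsWeight lam η τ₁ τ₂ Γ R (scaled lam η g R) :=
    by
  obtain ⟨τ₁, τ₂, h1, h2⟩ := hg.support
  refine ⟨τ₁, τ₂, ∫ r, |g r|, h1, ?_, integral_nonneg fun r => abs_nonneg _, fun η R hR =>
    ⟨continuous_scaled hg.smooth.continuous, hasCompactSupport_scaled hl hR h2,
      fun r hr => mem_window_of_scaled_ne_zero hl hR h2 hr, (integral_abs_scaled hl hR).le⟩⟩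
  by_contra h
  have : g = 0 := by
    rw [← tsupport_eq_empty_iff]
    rw [Set.Icc_eq_empty h] at h2
    exact Set.subset_empty_iff.1 h2
  have h3 := hg.integral_eq_one
  simp [this] at h3

theorem IsWeight.integrable (hγ : IsWeight lam η τ₁ τ₂ Γ R γ) : Integrable fun r => (γ r : ℂ) :=
  (hγ.continuous.integrable_of_hasCompactSupport hγ.hasCompactSupport).ofReal

theorem IsWeight.norm_integral_le {E : Type*} [NormedAddCommGroup E] [NormedSpace ℂ E] (hγ :
    IsWeight lam η τ₁ τ₂ Γ R γ) {F : ℝ → E} {C : ℝ} (hC : 0 ≤ C) (hF : ∀ r ∈ window lam η τ₁ τ₂ R,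
    ‖F r‖ ≤ C) : ‖∫ r, (γ r : ℂ) • F r‖ ≤ C * Γ := by
  refine (norm_integral_le_of_norm_le ((hγ.continuous.integrable_of_hasCompactSupport
    hγ.hasCompactSupport).abs.mul_const C) (.of_forall fun r => ?_)).trans ?_
  · rw [norm_smul, norm_real, norm_eq_abs]
    by_cases h : γ r = 0
    · simp [h]
    · exact mul_le_mul_of_nonneg_left (hF r (hγ.mem_window r h)) (abs_nonneg _)
  · rw [integral_mul_const, mul_comm]
    exact mul_le_mul_of_nonneg_left hγ.integral_abs_le hC

end Weight

section Symbol

variable {lam ε η : ℝ} {b : TestFn} {g : ℝ → ℝ}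

theorem measurable_radiusSymbol (hb : IsHomTestFn lam ε 1 b) (p : Mink) : StronglyMeasurable fun r
    => radiusSymbol b r p := by
  have h1 : Measurable fun z : ℝ × S² => timeFourier (thirdDeriv b) p.1 z.2 *
      exp (-(I * (z.1 * inner ℝ p.2 (z.2 : Space3) : ℝ))) := by
    refine (hb.measurable_timeFourier.comp (measurable_const.prodMk measurable_snd)).mul ?_
    refine Continuous.measurable ?_
    fun_prop
  have h2 := StronglyMeasurable.integral_prod_right' (ν := sphereMeasure) h1.stronglyMeasurable
  refine Measurable.stronglyMeasurable (Measurable.mul (by fun_prop) (Measurable.mul (by fun_prop)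
    h2.measurable))

theorem tendsto_integral_radiusSymbol (hb : IsHomTestFn lam ε 1 b) (hl : 0 < lam) (hε : 0 < ε) (hg :
    IsRadialSmearing g) (hη : 0 < η) (hη1 : η ≤ 1) {p : Mink} (hp2 : p.2 ≠ 0) (hp : ‖p.2‖ ≤ p.1) :
    Tendsto (fun R => ∫ r, (scaled lam η g R r : ℂ) * radiusSymbol b r p) atTop (𝓝 (2 * π * I *
    tildeOne (thirdDeriv b) p)) := by
  have hn : 0 < ‖p.2‖ := norm_pos_iff.2 hp2
  have hp1 : 0 < p.1 := hn.trans_le hp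
  obtain ⟨τ₁, τ₂, Γ, hτ₁, hτ, hΓ, hw⟩ := hg.exists_isWeight hl
  obtain ⟨C, hC0, hC⟩ := exists_norm_radiusSymbol_le hb hl hε
  obtain ⟨C', hC'0, hC'⟩ := hb.exists_sphereC1 hl hε
  have h1 := (hC' p.1 hp1).tendsto_integral_plane_wave hp2
  set c := 2 * π * I / ‖p.2‖ with hc
  set hp' := timeFourier (thirdDeriv b) p.1 (‖p.2‖⁻¹ • p.2)
  set hm := timeFourier (thirdDeriv b) p.1 (-(‖p.2‖⁻¹ • p.2))
  let L : ℝ → ℂ := fun r => c * hp' * exp (I * ((p.1 - ‖p.2‖) * r : ℝ)) -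
    c * hm * exp (I * ((p.1 + ‖p.2‖) * r : ℝ))
  have h2 : Tendsto (fun r => ‖radiusSymbol b r p - L r‖) atTop (𝓝 0) := by
    refine (tendsto_zero_iff_norm_tendsto_zero.1 h1).congr fun r => ?_
    refine Eq.trans ((one_mul _).symm.trans (congrArg (· * _)
      (norm_exp_ofReal_mul_I (p.1 * r)).symm)) ?_
    rw [← norm_mul, mul_sub]
    congr 1
    have e1 : exp (I * ((p.1 - ‖p.2‖) * r : ℝ)) =
        exp ((p.1 * r : ℝ) * I) * exp (-(I * (r * ‖p.2‖ : ℝ))) := by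
      rw [← exp_add]; congr 1; push_cast; ring
    have e2 : exp (I * ((p.1 + ‖p.2‖) * r : ℝ)) =
        exp ((p.1 * r : ℝ) * I) * exp (I * (r * ‖p.2‖ : ℝ)) := by
      rw [← exp_add]; congr 1; push_cast; ring
    simp only [radiusSymbol, L]
    rw [e1, e2, mul_comm I ((p.1 * r : ℝ) : ℂ)]
    ring
  have hLc : Continuous L := by fun_prop
  have h3 : Tendsto (fun R => ∫ r, (scaled lam η g R r : ℂ) * (radiusSymbol b r p - L r)) atTop (𝓝 0) := by
    refine Metric.tendsto_atTop.2 fun δ hδ => ?_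
    obtain ⟨r₀, hr₀⟩ := Metric.tendsto_atTop.1 h2 (δ / (2 * (Γ + 1))) (by positivity)
    have hm0 : 0 < min 1 τ₁ := lt_min one_pos hτ₁
    refine ⟨max lam (r₀ / min 1 τ₁), fun R hR => ?_⟩
    have hRl := (le_max_left _ _).trans hR
    have hR2 := (div_le_iff₀' hm0).1 ((le_max_right _ _).trans hR)
    rw [dist_zero_right]
    refine lt_of_le_of_lt ((hw η R (hl.trans_le hRl)).norm_integral_le (C := δ / (2 * (Γ + 1)))
      (by positivity) fun r hr => ?_) ?_
    · have := hr₀ r (hR2.trans (le_of_mem_window hl hη1 hRl hr))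
      rw [Real.dist_eq, sub_zero, abs_norm] at this
      exact this.le
    · rw [div_mul_eq_mul_div, div_lt_iff₀ (by positivity)]
      nlinarith
  have h4 : Tendsto (fun R => ∫ r, (scaled lam η g R r : ℂ) * L r) atTop
      (𝓝 (2 * π * I * tildeOne (thirdDeriv b) p)) := by
    have e1 := (tendsto_integral_scaled_exp hl hη hg.integral_eq_one (p.1 - ‖p.2‖)).const_mul (c * hp')
    have e2 := (tendsto_integral_scaled_exp hl hη hg.integral_eq_one (p.1 + ‖p.2‖)).const_mul (c * hm)
    rw [if_neg (by positivity), mul_zero] at e2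
    have e3 := e1.sub e2
    rw [sub_zero] at e3
    have e4 : 2 * π * I * tildeOne (thirdDeriv b) p =
        c * hp' * if p.1 - ‖p.2‖ = 0 then 1 else 0 := by
      rw [tildeOne_eq hb hl hε hp2]
      simp only [sub_eq_zero]
      split_ifs with h
      · simp only [hp', hc, h]; ring
      · simp
    rw [e4]
    refine e3.congr' ?_
    filter_upwards [eventually_gt_atTop 0] with R hR
    have i1 : ∀ θ : ℝ, Integrable fun r => (scaled lam η g R r : ℂ) * exp (I * (θ * r : ℝ)) :=
      fun θ => (hw η R hR).integrable.mul_bdd (c := 1) (by fun_prop)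
        (.of_forall fun r => by rw [mul_comm I, norm_exp_ofReal_mul_I])
    rw [← integral_const_mul, ← integral_const_mul, ← integral_sub ((i1 _).const_mul _) ((i1 _).const_mul _)]
    refine integral_congr_fun fun r => ?_
    simp only [L]; ring
  refine (zero_add (2 * π * I * tildeOne (thirdDeriv b) p) ▸ h3.add h4).congr' ?_
  filter_upwards [eventually_ge_atTop lam] with R hR
  have hwR := hw η R (hl.trans_le hR)
  have hLi : Integrable fun r => (scaled lam η g R r : ℂ) * L r := by
    refine hwR.integrable.mul_bdd (c := ‖c * hp'‖ + ‖c * hm‖) hLc.aestronglyMeasurable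
      (.of_forall fun r => (norm_sub_le _ _).trans (le_of_eq ?_))
    rw [norm_mul, norm_mul _ (exp _), mul_comm I, mul_comm I,
      norm_exp_ofReal_mul_I, norm_exp_ofReal_mul_I, mul_one, mul_one]
  have hSi : Integrable fun r => (scaled lam η g R r : ℂ) * radiusSymbol b r p := by
    refine Integrable.mono' (hwR.integrable.norm.mul_const (C * (sqrt p.1 / ‖p.2‖)))
      (hwR.integrable.aestronglyMeasurable.mul (measurable_radiusSymbol hb p).aestronglyMeasurable)
      (.of_forall fun r => ?_)
    rw [norm_mul]
    by_cases h : scaled lam η g R r = 0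
    · simp [h]
    · exact mul_le_mul_of_nonneg_left (hC r p ((mul_pos (lt_min one_pos hτ₁) (hl.trans_le hR)).trans_le
        (le_of_mem_window hl hη1 hR (hwR.mem_window r h))) hp1 hp2) (norm_nonneg _)
  have hDi : Integrable fun r => (scaled lam η g R r : ℂ) * (radiusSymbol b r p - L r) := by
    refine (hSi.sub hLi).congr (.of_forall fun r => ?_)
    simp only [Pi.sub_apply]; ring
  rw [← integral_add hDi hLi]
  refine integral_congr_fun fun r => ?_
  ring

end Symbol

namespace VacuumTheory

variable {lam κ ε η : ℝ} {T : VacuumTheory H lam κ} {b : TestFn} {g : ℝ → ℝ} {B : Op H}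

/-- Smeared fields on the vacuum as functions of the momentum. -/
theorem smear_vacuum (hb : IsHomTestFn lam ε 1 b) (hl : 0 < lam) (hε : 2 < ε) (hB : B ∈ T.𝓕) {γ : ℝ
    → ℝ} (hγ : Continuous γ) (hγc : HasCompactSupport γ) : ∃ F : Mink → ℂ, IsBoundedBorel F ∧ (∀ p :
    Mink, 0 ≤ p.1 → F p = ∫ r, (γ r : ℂ) * radiusSymbol b r p) ∧ smear T B γ (positivePart
    (thirdDeriv b)) T.Ω = T.functionOf F (B T.Ω) := by
  obtain ⟨A, hA0, hA⟩ := hb.exists_isAmplitude_positivePart hl (q := 0) le_rfl (by norm_num) (by linarith)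
  have hi := hA.integrable hl le_rfl ofReal_ne_top
  set h := positivePart (thirdDeriv b) with hh
  let k : ℝ × (ℝ × S²) → ℂ := fun z =>
    ((γ z.1 : ℂ) * (z.1 / (2 * π) : ℝ)) * h z.2.1 z.2.2
  have hk1 : Continuous fun r : ℝ => (γ r : ℂ) * (r / (2 * π) : ℝ) := by fun_prop
  have hk2 : Integrable fun r : ℝ => (γ r : ℂ) * (r / (2 * π) : ℝ) :=
    hk1.integrable_of_hasCompactSupport
      (hγc.comp_left (g := fun x : ℝ => (x : ℂ)) ofReal_zero).mul_right
  have hk : Integrable k (volume.prod coneMeasure) := hk2.mul_prod hi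
  have hkm : StronglyMeasurable k := Measurable.stronglyMeasurable
    ((hk1.measurable.comp measurable_fst).mul (hA.measurable.comp measurable_snd))
  have ha : Continuous fun z : ℝ × (ℝ × S²) => conePoint z.1 z.2 := by
    unfold conePoint; fun_prop
  obtain ⟨hF, hFe⟩ := T.functionOf_integral_planeWave hk hkm ha.measurable (B T.Ω)
  refine ⟨_, hF, fun p hp => ?_, ?_⟩
  · have i1 : Integrable (fun z => k z * planeWave (conePoint z.1 z.2) p) (volume.prod coneMeasure) := by
      refine hk.mul_bdd (c := 1) ?_ (.of_forall fun z => (norm_planeWave _ _).le)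
      have : Continuous fun w : Mink × Mink => planeWave w.1 w.2 := by fun_prop
      exact (this.comp (ha.prodMk continuous_const)).aestronglyMeasurable
    rw [integral_prod _ i1]
    refine integral_congr_fun fun r => ?_
    simp only [k]
    rw [← integral_cone_planeWave hb hl hε r hp, ← integral_const_mul]
    refine integral_congr_fun fun x => ?_
    ring
  · have i2 : Integrable (fun z => k z • T.U (conePoint z.1 z.2) (B T.Ω)) (volume.prod coneMeasure) :=
      hk.smul_bdd ‖B T.Ω‖ ((T.strongly_continuous _).comp ha).aestronglyMeasurable
        (.of_forall fun z => (T.norm_U _ _).le)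
    rw [hFe, integral_prod _ i2, smear_apply hl le_rfl ofReal_ne_top hA (T.continuous_field hB) hγ hγc]
    refine integral_congr_fun fun r => ?_
    simp only [k]
    rw [smearRadius_eq, smul_apply, integral_apply (hA.integrable_smul hl le_rfl
      ofReal_ne_top (T.continuous_field hB) r), smul_smul, ← integral_smul]
    refine integral_congr_fun fun x => ?_
    rw [smul_apply, field_apply_vacuum, smul_smul]

theorem tendsto_creation_vacuum (hb : IsHomTestFn lam ε 1 b) (hl : 0 < lam) (hκ : 2 < κ) (hε : 2 <
    ε) (hB : B ∈ T.𝓕) (hg : IsRadialSmearing g) (hη : 0 < η) (hη1 : η ≤ 1) : Tendsto (fun R =>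
    creation T lam η g B (thirdDeriv b) R T.Ω) atTop (𝓝 ((2 * π * I : ℂ) • T.functionOf (tildeOne
    (thirdDeriv b)) (B T.Ω))) := by
  obtain ⟨τ₁, τ₂, Γ, hτ₁, hτ, hΓ, hw⟩ := hg.exists_isWeight hl
  obtain ⟨C, hC0, hC⟩ := exists_norm_radiusSymbol_le hb hl (by linarith)
  have hchoose : ∀ R, ∃ F : Mink → ℂ, 0 < R → IsBoundedBorel F ∧
      (∀ p : Mink, 0 ≤ p.1 → F p = ∫ r, (scaled lam η g R r : ℂ) * radiusSymbol b r p) ∧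
      creation T lam η g B (thirdDeriv b) R T.Ω = T.functionOf F (B T.Ω) := fun R => by
    by_cases hR : 0 < R
    · obtain ⟨F, hF⟩ := smear_vacuum hb hl hε hB (hw η R hR).continuous (hw η R hR).hasCompactSupport
      exact ⟨F, fun _ => hF⟩
    · exact ⟨0, fun h => absurd h hR⟩
  choose F hF using hchoose
  have ht := isBoundedBorel_tildeOne hb hl (by linarith)
  let t : Mink → ℂ := fun p => 2 * π * I * tildeOne (thirdDeriv b) p
  have ht' : IsBoundedBorel t := (IsBoundedBorel.const _).mul ht
  rw [← smul_apply, ← T.functionOf_const_mul _ ht, tendsto_iff_norm_sub_tendsto_zero]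
  set μ := T.spectralMeasure (B T.Ω) with hμ
  have hfin := T.lintegral_energy_mul_inv_sq_lt_top hl hκ hB
  rw [← hμ] at hfin
  have hae : ∀ᵐ p ∂μ, ‖p.2‖ ≤ p.1 ∧ (p.2 = 0 → p = 0) := by
    have h1 := ae_lt_top (by fun_prop) hfin.ne
    filter_upwards [T.energy_nonneg_ae (B T.Ω), h1] with p hp1 hp2
    refine ⟨hp1, fun h => Prod.ext ?_ h⟩
    by_contra h0
    have : 0 < p.1 := lt_of_le_of_ne ((norm_nonneg _).trans hp1) (Ne.symm h0)
    rw [h, norm_zero, zero_pow two_ne_zero, ENNReal.ofReal_zero, ENNReal.inv_zero,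
      mul_top (ENNReal.ofReal_pos.2 this).ne'] at hp2
    exact lt_irrefl _ hp2
  have hbd : ∀ p : Mink, ‖p.2‖ ≤ p.1 → (p.2 = 0 → p = 0) → ∀ R, lam ≤ R →
      ‖F R p‖ ≤ C * (sqrt p.1 / ‖p.2‖) * Γ := fun p hp1 hp2 R hR => by
    rw [(hF R (hl.trans_le hR)).2.1 p ((norm_nonneg _).trans hp1)]
    refine (hw η R (hl.trans_le hR)).norm_integral_le (by positivity) fun r hr => ?_
    by_cases h0 : p.2 = 0
    · rw [hp2 h0, radiusSymbol_zero hb hl (by linarith), norm_zero]; positivity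
    · exact hC r p ((mul_pos (lt_min one_pos hτ₁) (hl.trans_le hR)).trans_le
        (le_of_mem_window hl hη1 hR hr)) ((norm_pos_iff.2 h0).trans_le hp1) h0
  have hlim : ∀ p : Mink, ‖p.2‖ ≤ p.1 → (p.2 = 0 → p = 0) → Tendsto (fun R => F R p) atTop (𝓝 (t p)) :=
    fun p hp1 hp2 => by
    by_cases h0 : p.2 = 0
    · have : t p = 0 := by simp [t, tildeOne, h0]
      rw [this]
      refine tendsto_const_nhds.congr' ?_
      filter_upwards [eventually_gt_atTop 0] with R hR
      rw [(hF R hR).2.1 p ((norm_nonneg _).trans hp1), hp2 h0]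
      simp [radiusSymbol_zero hb hl (by linarith : 0 < ε)]
    · refine (tendsto_integral_radiusSymbol hb hl (by linarith) hg hη hη1 h0 hp1).congr' ?_
      filter_upwards [eventually_gt_atTop 0] with R hR
      rw [(hF R hR).2.1 p ((norm_nonneg _).trans hp1)]
  have hint : Integrable (fun p : Mink => p.1 / ‖p.2‖ ^ 2) μ := by
    refine ⟨(by fun_prop : Measurable fun p : Mink => p.1 / ‖p.2‖ ^ 2).aestronglyMeasurable,
      lt_of_le_of_lt (lintegral_mono_ae ?_) hfin⟩
    filter_upwards [hae] with p hp
    by_cases h0 : p.2 = 0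
    · simp [h0]
    · rw [Real.enorm_eq_ofReal (div_nonneg ((norm_nonneg _).trans hp.1) (by positivity)), div_eq_mul_inv,
        ofReal_mul ((norm_nonneg _).trans hp.1), ENNReal.ofReal_inv_of_pos
          (pow_pos (norm_pos_iff.2 h0) 2)]
  have hmain : Tendsto (fun R => ∫ p, ‖F R p - t p‖ ^ 2 ∂μ) atTop (𝓝 (∫ _p : Mink, (0 : ℝ) ∂μ)) := by
    refine tendsto_integral_filter_of_dominated_convergence
      (fun p => (2 * C * Γ) ^ 2 * (p.1 / ‖p.2‖ ^ 2)) ?_ ?_ (hint.const_mul _) ?_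
    · filter_upwards [eventually_gt_atTop 0] with R hR
      have h1 := (hF R hR).1.1
      have h2 := ht'.1
      exact ((h1.sub h2).norm.pow_const 2).aestronglyMeasurable
    · filter_upwards [eventually_ge_atTop lam] with R hR
      filter_upwards [hae] with p hp
      have h1 := hbd p hp.1 hp.2 R hR
      have h2 : ‖t p‖ ≤ C * (sqrt p.1 / ‖p.2‖) * Γ := le_of_tendsto (hlim p hp.1 hp.2).norm
        (by filter_upwards [eventually_ge_atTop lam] with R hR using hbd p hp.1 hp.2 R hR)
      rw [norm_pow, norm_norm]
      calc ‖F R p - t p‖ ^ 2 ≤ (2 * C * Γ * (sqrt p.1 / ‖p.2‖)) ^ 2 := by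
            refine pow_le_pow_left₀ (norm_nonneg _) ((norm_sub_le _ _).trans ?_) 2
            linarith
        _ = _ := by rw [mul_pow, div_pow, sq_sqrt ((norm_nonneg _).trans hp.1)]
    · filter_upwards [hae] with p hp
      have h1 := (((hlim p hp.1 hp.2).sub_const (t p)).norm.pow 2)
      simpa using h1
  rw [integral_zero] at hmain
  have h5 := hmain.sqrt
  rw [Real.sqrt_zero] at h5
  refine h5.congr' ?_
  filter_upwards [eventually_gt_atTop 0] with R hR
  rw [(hF R hR).2.2, ← sub_apply, ← T.functionOf_sub (hF R hR).1 ht', ← T.norm_sq_functionOf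
    ((hF R hR).1.sub ht'), sqrt_sq (norm_nonneg _)]

theorem massProjection_functionOf_tildeOne (hb : IsHomTestFn lam ε 1 b) (hl : 0 < lam) (hε : 0 < ε)
    (ψ : H) : T.massProjection 0 (T.functionOf (tildeOne (thirdDeriv b)) ψ) = T.functionOf (tildeOne
    (thirdDeriv b)) ψ := by
  have ht := isBoundedBorel_tildeOne hb hl hε
  set S : Set Mink := {p | 0 ≤ mdot p p ∧ mdot p p ≤ 0 ^ 2 ∧ 0 ≤ p.1}
  have hm : Measurable fun p : Mink => mdot p p := by unfold mdot; fun_prop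
  have hS : MeasurableSet S := (measurableSet_le measurable_const hm).inter
    ((measurableSet_le hm measurable_const).inter (measurableSet_le measurable_const measurable_fst))
  have h1 : IsBoundedBorel (S.indicator fun _ => (1 : ℂ)) := by
    refine ⟨measurable_const.indicator hS, 1, fun p => ?_⟩
    exact (norm_indicator_le_norm_self _ _).trans (by simp)
  rw [TranslationRep.massProjection, TranslationRep.spectralProjection, ← mul_apply_eq_comp, ← T.functionOf_mul h1 ht]
  congr 2
  ext1 p
  rw [tildeOne]
  split_ifs with h
  · have : mdot p p = 0 := by rw [mdot, real_inner_self_eq_norm_sq, h.2]; ring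
    rw [indicator_of_mem (show p ∈ S from ⟨this.ge, by rw [this]; norm_num, by rw [h.2]; positivity⟩), one_mul]
  · rw [mul_zero]

/-- The two-point functions of the asymptotic fields. -/
theorem tendsto_inner_creation {b' : TestFn} {B' : Op H} {η' : ℝ} (hb : IsHomTestFn lam ε 1 b) (hb'
    : IsHomTestFn lam ε 1 b') (hl : 0 < lam) (hκ : 2 < κ) (hε : 2 < ε) (hB : B ∈ T.𝓕) (hB' : B' ∈
    T.𝓕) (hg : IsRadialSmearing g) (hη : 0 < η) (hη1 : η ≤ 1) (hη' : 0 < η') (hη1' : η' ≤ 1) :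
    Tendsto (fun R => inner ℂ (creation T lam η g B (thirdDeriv b) R T.Ω) (creation T lam η' g B'
    (thirdDeriv b') R T.Ω)) atTop (𝓝 (T.twoPoint B (thirdDeriv b) B' (thirdDeriv b'))) := by
  have h := (tendsto_creation_vacuum hb hl hκ hε hB hg hη hη1).inner
    (tendsto_creation_vacuum (T := T) hb' hl hκ hε hB' hg hη' hη1') (𝕜 := ℂ)
  convert h using 2
  rw [twoPoint, massProjection_functionOf_tildeOne hb' hl (by linarith), inner_smul_left, inner_smul_right]
  simp only [map_mul, conj_I, conj_ofReal, map_ofNat]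
  linear_combination ((4 * π ^ 2 : ℂ) * inner ℂ (T.functionOf (tildeOne (thirdDeriv b)) (B T.Ω))
    (T.functionOf (tildeOne (thirdDeriv b')) (B' T.Ω))) * I_sq

end VacuumTheory

/-! ### Fields in different directions -/

/-- Directions in the supports of `h` and `h'` have distance at least `α`. -/
def Separated (α : ℝ) (h h' : TestFn) : Prop :=
  ∀ x y : ℝ × S², h x.1 x.2 ≠ 0 → h' y.1 y.2 ≠ 0 → α ≤ ‖(x.2 : Space3) - y.2‖

/-- Left commutation. -/
def adL (G : Op H) : (Op H) →L[ℂ] (Op H) :=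
  ContinuousLinearMap.mul ℂ (Op H) G - (ContinuousLinearMap.mul ℂ (Op H)).flip G

theorem adL_apply (G Y : Op H) : adL G Y = ⁅G, Y⁆ := rfl

theorem norm_lie_comm (X Y : Op H) : ‖⁅X, Y⁆‖ = ‖⁅Y, X⁆‖ := by
  rw [Ring.lie_def, Ring.lie_def, norm_sub_rev]

theorem lie_lie_eq (X Y Z : Op H) : ⁅X, ⁅Y, Z⁆⁆ = ⁅⁅X, Y⁆, Z⁆ + ⁅Y, ⁅X, Z⁆⁆ := by
  simp only [Ring.lie_def]; noncomm_ring

section Far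

variable {T : TranslationRep H} {A B G : Op H} {lam q r r₁ r₂ a a₁ a₂ c c₀ C R K α : ℝ}
  {h h₁ h₂ : TestFn}

theorem norm_lie_smearRadius_le_of_field (hl : 0 < lam) (hq : 0 ≤ q) (hh : IsAmplitude lam q h
    (ofReal a)) (ha : 0 ≤ a) (hB : Continuous (T.field B)) (hK : 0 ≤ K) (hr : 0 ≤ r) (hb : ∀ x : ℝ ×
    S², h x.1 x.2 ≠ 0 → ‖⁅G, T.field B (conePoint r x)⁆‖ ≤ K * wt lam x.1 ^ q) : ‖⁅G, smearRadius T
    B r h⁆‖ ≤ r * (K * (a * totalAngle)) := by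
  have h0 := totalAngle_nonneg
  have hpi := pi_gt_three
  rw [← adL_apply, smearRadius_eq, map_smul, ← integral_comp_comm _
    (hh.integrable_smul hl hq ofReal_ne_top hB r), norm_smul, norm_real,
    norm_of_nonneg (by positivity)]
  have key : ‖∫ x, adL G (h x.1 x.2 • T.field B (conePoint r x)) ∂coneMeasure‖ ≤ K * (a * totalAngle) := by
    rw [← ofReal_le_ofReal_iff (by positivity), ofReal_norm]
    calc _ ≤ ∫⁻ x, ‖adL G (h x.1 x.2 • T.field B (conePoint r x))‖ₑ ∂coneMeasure :=
          enorm_integral_le_lintegral_enorm _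
      _ ≤ ∫⁻ x, ofReal (wt lam x.1 ^ q) * ‖h x.1 x.2‖ₑ * ofReal K ∂coneMeasure := by
          refine lintegral_mono fun x => ?_
          by_cases hx : h x.1 x.2 = 0
          · simp [hx]
          rw [map_smul, enorm_smul, mul_comm (ofReal _), mul_assoc,
            ← ofReal_mul (rpow_nonneg (wt_pos hl _).le _), mul_comm _ K]
          gcongr
          rw [← ofReal_norm]
          exact ofReal_le_ofReal (hb x hx)
      _ ≤ ofReal a * ∫⁻ _l, ofReal K ∂sphereMeasure :=
          hh.lintegral_mul_le hl measurable_const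
      _ = _ := by
          rw [lintegral_const, sphereMeasure_univ, ← ofReal_mul hK, ← ofReal_mul ha]
          ring_nf
  refine (mul_le_mul_of_nonneg_left key (by positivity)).trans ?_
  gcongr
  exact div_le_self hr (by linarith)

theorem norm_lie_field_cone_le (hl : 0 < lam) (hq : 0 ≤ q) (hc : 0 ≤ c) (hdec : CommutatorDecay T
    lam q c A B) (hc₀ : 0 < c₀) (hC : 0 < C) (hα : 0 ≤ α) (hR : 0 < R) (hr₁ : r₁ ∈ Icc (c₀ * R) (C *
    R)) (hr₂ : r₂ ∈ Icc (c₀ * R) (C * R)) {x y : ℝ × S²} (hxy : α ≤ ‖(x.2 : Space3) - y.2‖) :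
    ‖⁅T.field A (conePoint r₁ x), T.field B (conePoint r₂ y)⁆‖ ≤ c * wt lam (c₀ ^ 2 * α ^ 2 / (4 *
    C) * R) ^ (-q) * wt lam x.1 ^ q * wt lam y.1 ^ q := by
  have hcR : 0 < c₀ * R := by positivity
  have h1 : 0 < r₁ := hcR.trans_le hr₁.1
  have h2 : 0 < r₂ := hcR.trans_le hr₂.1
  obtain ⟨N, hN⟩ : ∃ N, N = ‖r₂ • (y.2 : Space3) - r₁ • (x.2 : Space3)‖ := ⟨_, rfl⟩
  obtain ⟨e, he⟩ : ∃ e, e = c₀ ^ 2 * α ^ 2 / (4 * C) * R := ⟨_, rfl⟩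
  rw [← he]
  have e0 : 0 ≤ e := by rw [he]; positivity
  have h3 : N ^ 2 = (r₂ - r₁) ^ 2 + r₁ * r₂ * ‖(x.2 : Space3) - y.2‖ ^ 2 := by
    rw [hN]; exact le_norm_smul_sub_smul h1 h2 _ _
  have h4 : N ≤ 2 * (C * R) := by
    refine hN.trans_le ((norm_sub_le _ _).trans ?_)
    rw [norm_smul, norm_smul, norm_eq_of_mem_sphere, norm_eq_of_mem_sphere,
      norm_of_nonneg h1.le, norm_of_nonneg h2.le]
    linarith [hr₁.2, hr₂.2]
  have h5 : (c₀ * R) * (c₀ * R) * α ^ 2 ≤ r₁ * r₂ * ‖(x.2 : Space3) - y.2‖ ^ 2 := by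
    gcongr
    exacts [hr₁.1, hr₂.1]
  have h6 : e * (4 * (C * R)) = (c₀ * R) * (c₀ * R) * α ^ 2 := by rw [he]; field_simp
  have h7 : e ≤ N - |r₂ - r₁| := by
    have h8 : N ^ 2 - |r₂ - r₁| ^ 2 = r₁ * r₂ * ‖(x.2 : Space3) - y.2‖ ^ 2 := by rw [h3, sq_abs]; ring
    have hN0 : 0 ≤ N := hN ▸ norm_nonneg _
    have h9 : |r₂ - r₁| ≤ N := abs_le_of_sq_le_sq (by rw [h3]; exact le_add_of_nonneg_right (by positivity)) hN0
    by_contra hlt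
    rw [not_le] at hlt
    have : (N - |r₂ - r₁|) * (N + |r₂ - r₁|) ≤ (N - |r₂ - r₁|) * (4 * (C * R)) :=
      mul_le_mul_of_nonneg_left (by linarith) (by linarith)
    have h10 : (N - |r₂ - r₁|) * (4 * (C * R)) < e * (4 * (C * R)) :=
      mul_lt_mul_of_pos_right hlt (by positivity)
    have h11 : (N - |r₂ - r₁|) * (N + |r₂ - r₁|) = N ^ 2 - |r₂ - r₁| ^ 2 := by ring
    linarith
  have h14 := hdec (conePoint r₁ x) (conePoint r₂ y) (y.1 - x.1) (r₂ - r₁) e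
    (by simp only [conePoint]; ring) e0 (hN ▸ h7)
  refine h14.trans ?_
  have h13 := wt_rpow_add_le hl hq y.1 (-x.1)
  rw [← sub_eq_add_neg, wt_neg] at h13
  have h12 := rpow_nonneg (wt_pos hl e).le (-q)
  calc _ ≤ c * ((wt lam y.1 ^ q * wt lam x.1 ^ q) * wt lam e ^ (-q)) := by gcongr
    _ = _ := by ring

theorem rpow_wt_scale_le {θ : ℝ} (hl : 0 < lam) (hq : 0 ≤ q) (hθ : 0 < θ) (hR : 0 < R) : wt lam (θ *
    R) ^ (-q) ≤ θ ^ (-q) * (R / lam) ^ (-q) := by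
  rw [← mul_rpow hθ.le (by positivity)]
  refine Real.rpow_le_rpow_of_nonpos (by positivity) ?_ (neg_nonpos.2 hq)
  rw [wt, abs_of_pos (by positivity), mul_div_assoc]; linarith

end Far

namespace VacuumTheory

variable {lam κ : ℝ} {T : VacuumTheory H lam κ} {A₁ A₂ A₃ : Op H} {q a₁ a₂ a₃ c₀ C α σ : ℝ}
  {h₁ h₂ h₃ : TestFn}

theorem eventually_norm_lie_separated_lt (hl : 0 < lam) (hA₁ : A₁ ∈ T.𝓕) (hA₂ : A₂ ∈ T.𝓕) (hq : 2 <
    q) (hqκ : q ≤ κ) (H₁ : IsAmplitude lam q h₁ (ofReal a₁)) (H₂ : IsAmplitude lam q h₂ (ofReal a₂))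
    (ha₁ : 0 ≤ a₁) (ha₂ : 0 ≤ a₂) (hα : 0 < α) (hs : Separated α h₁ h₂) (hc₀ : 0 < c₀) (hC : 0 < C)
    {δ : ℝ} (hδ : 0 < δ) : ∀ᶠ R in atTop, ∀ r₁ ∈ Icc (c₀ * R) (C * R), ∀ r₂ ∈ Icc (c₀ * R) (C * R),
    ‖⁅smearRadius T A₁ r₁ h₁, smearRadius T A₂ r₂ h₂⁆‖ < δ := by
  have hq0 : 0 ≤ q := by linarith
  have hθ : 0 < c₀ ^ 2 * α ^ 2 / (4 * C) := by positivity
  obtain ⟨c, hc, hdec⟩ := T.exists_commutatorDecay hl hq0 hqκ hA₁ hA₂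
  have h0 := totalAngle_nonneg
  set θ := c₀ ^ 2 * α ^ 2 / (4 * C)
  have h1 := ((tendsto_rpow_div_of_neg hl (p := 2 - q) (by linarith)).const_mul
    (C ^ 2 * lam ^ 2 * c * θ ^ (-q) * a₁ * a₂ * totalAngle ^ 2))
  rw [mul_zero] at h1
  filter_upwards [h1.eventually_lt_const hδ, eventually_gt_atTop 0] with R g1 hR r₁ hr₁ r₂ hr₂
  have hcR : 0 < c₀ * R := by positivity
  have p1 : 0 < r₁ := hcR.trans_le hr₁.1
  have p2 : 0 < r₂ := hcR.trans_le hr₂.1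
  have hk := rpow_nonneg (wt_pos hl (θ * R)).le (-q)
  set k := wt lam (θ * R) ^ (-q) with hkd
  have h2 : ‖⁅smearRadius T A₂ r₂ h₂, smearRadius T A₁ r₁ h₁⁆‖ ≤
      r₁ * (r₂ * (c * k * (a₂ * totalAngle)) * (a₁ * totalAngle)) := by
    refine norm_lie_smearRadius_le_of_field hl hq0 H₁ ha₁ (T.continuous_field hA₁) (by positivity) p1.le
      fun x hx => ?_
    have hw := rpow_nonneg (wt_pos hl x.1).le q
    rw [norm_lie_comm]
    refine (norm_lie_smearRadius_le_of_field hl hq0 H₂ ha₂ (T.continuous_field hA₂)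
      (K := c * k * wt lam x.1 ^ q) (by positivity) p2.le fun y hy =>
      norm_lie_field_cone_le hl hq0 hc hdec hc₀ hC hα.le hR hr₁ hr₂ (hs x y hx hy)).trans (le_of_eq (by ring))
  rw [norm_lie_comm]
  refine (h2.trans ?_).trans_lt g1
  have h3 := rpow_wt_scale_le hl hq0 hθ hR
  calc _ ≤ (C * R) * ((C * R) * (c * (θ ^ (-q) * (R / lam) ^ (-q)) * (a₂ * totalAngle)) *
        (a₁ * totalAngle)) := by
        gcongr
        exacts [hr₁.2, hr₂.2]
    _ = C ^ 2 * lam ^ 2 * c * θ ^ (-q) * a₁ * a₂ * totalAngle ^ 2 * ((R / lam) ^ (2 : ℝ) * (R / lam) ^ (-q)) := by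
        rw [rpow_two, div_pow]; field_simp
    _ = _ := by rw [← rpow_add (by positivity), ← sub_eq_add_neg]

theorem eventually_norm_lie_nearComm_lt (hl : 0 < lam) (hA₁ : A₁ ∈ T.𝓕) (hA₂ : A₂ ∈ T.𝓕) (hA₃ : A₃ ∈
    T.𝓕) (hq : 2 < q) (hqκ : q ≤ κ) (H₁ : IsAmplitude lam q h₁ (ofReal a₁)) (H₂ : IsAmplitude lam q
    h₂ (ofReal a₂)) (H₃ : IsAmplitude lam q h₃ (ofReal a₃)) (ha₁ : 0 ≤ a₁) (ha₂ : 0 ≤ a₂) (ha₃ : 0 ≤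
    a₃) (hα : 0 < α) (hs : Separated α h₂ h₃) (hσ : 0 < σ) (hσ' : σ ≤ 1 / 5) (hc₀ : 0 < c₀) (hC : 0
    < C) {δ : ℝ} (hδ : 0 < δ) : ∀ᶠ R in atTop, ∀ r₁ ∈ Icc (c₀ * R) (C * R), ∀ r₂ ∈ Icc (c₀ * R) (C *
    R), ∀ r₃ ∈ Icc (c₀ * R) (C * R), ‖⁅smearRadius T A₃ r₃ h₃, nearComm T A₁ r₁ h₁ A₂ r₂ h₂ (width
    lam σ R)⁆‖ < δ := by
  have hq0 : 0 ≤ q := by linarith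
  have hθ : 0 < c₀ ^ 2 * (α / 2) ^ 2 / (4 * C) := by positivity
  obtain ⟨c₁, hc₁, hd₁⟩ := T.exists_commutatorDecay hl hq0 hqκ hA₁ hA₃
  obtain ⟨c₂, hc₂, hd₂⟩ := T.exists_commutatorDecay hl hq0 hqκ hA₂ hA₃
  have h0 := totalAngle_nonneg
  set θ := c₀ ^ 2 * (α / 2) ^ 2 / (4 * C)
  have h1 := ((tendsto_rpow_div_of_neg hl (p := σ * 2 + 1 + -q + σ * q) (by nlinarith)).const_mul
    (a₁ * a₂ * lam ^ 2 * (2 * (‖A₁‖ * c₂ + ‖A₂‖ * c₁) * (C * lam) * θ ^ (-q) * 2 ^ q * (a₃ * totalAngle)) *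
      totalAngle))
  rw [mul_zero] at h1
  filter_upwards [h1.eventually_lt_const hδ, eventually_ge_atTop lam,
    eventually_width_le hl (show σ < 1 by linarith) (1 / (c₀ * (α / 2)))] with R g1 hRl g2 r₁ hr₁ r₂ hr₂ r₃ hr₃
  have hR : 0 < R := hl.trans_le hRl
  have hcR : 0 < c₀ * R := by positivity
  have p1 : 0 < r₁ := hcR.trans_le hr₁.1
  have p2 : 0 < r₂ := hcR.trans_le hr₂.1
  have p3 : 0 < r₃ := hcR.trans_le hr₃.1
  have hd0 := width_pos (η := σ) hl hR
  have hdw : width lam σ R = lam * (R / lam) ^ σ := rfl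
  set d := width lam σ R with hd
  have hX : 1 ≤ (R / lam) ^ σ := one_le_rpow ((one_le_div hl).2 hRl) hσ.le
  have hwd : wt lam d ^ q ≤ 2 ^ q * (R / lam) ^ (σ * q) := by
    rw [rpow_mul (by positivity), ← mul_rpow two_pos.le (by positivity)]
    refine rpow_le_rpow (wt_pos hl _).le ?_ hq0
    rw [wt, abs_of_pos hd0, hdw, mul_div_cancel_left₀ _ hl.ne']; linarith
  have hk := rpow_nonneg (wt_pos hl (θ * R)).le (-q)
  have hw0 := rpow_nonneg (wt_pos hl d).le q
  set k := wt lam (θ * R) ^ (-q) with hkd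
  have single : ∀ {B : Op H} {c : ℝ} {r : ℝ} {x : ℝ × S²}, 0 ≤ c →
      CommutatorDecay T lam q c B A₃ → r ∈ Icc (c₀ * R) (C * R) → |x.1| ≤ d →
      (∀ y : ℝ × S², h₃ y.1 y.2 ≠ 0 → α / 2 ≤ ‖(x.2 : Space3) - y.2‖) →
      ‖⁅T.field B (conePoint r x), smearRadius T A₃ r₃ h₃⁆‖ ≤
        r₃ * (c * k * wt lam d ^ q * (a₃ * totalAngle)) := fun {B c r x} hc hdec hr hx hy => by
    refine norm_lie_smearRadius_le_of_field hl hq0 H₃ ha₃ (T.continuous_field hA₃) (by positivity) p3.le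
      fun y hy' => (norm_lie_field_cone_le hl hq0 hc hdec hc₀ hC (by positivity) hR hr hr₃
        (hy y hy')).trans ?_
    have hw1 := rpow_nonneg (wt_pos hl y.1).le q
    have hw2 : wt lam x.1 ≤ wt lam d := by
      exact add_le_add_right (div_le_div_of_nonneg_right (hx.trans (le_abs_self d)) hl.le) 1
    have hw3 := (wt_pos hl x.1).le
    gcongr
  set κ₁ := 2 * (‖A₁‖ * c₂ + ‖A₂‖ * c₁) * (r₃ * (k * wt lam d ^ q * (a₃ * totalAngle))) with hκ₁
  have hκ₁0 : 0 ≤ κ₁ := by positivity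
  have h2 := norm_apply_nearComm_le (T := T) (adL (smearRadius T A₃ r₃ h₃)) hl hq0 H₁ H₂ ha₁ ha₂
    (T.continuous_field hA₁) (T.continuous_field hA₂) p1 p2 hd0.le MeasurableSet.empty hκ₁0 le_rfl
    fun z hz n1 n2 => ?_
  · rw [← adL_apply]
    refine (h2.trans ?_).trans_lt g1
    rw [zero_mul, add_zero]
    have h3 := rpow_wt_scale_le hl hq0 hθ hR
    have e1 : (R / lam) ^ (σ * 2 + 1 + -q + σ * q) =
        ((R / lam) ^ σ) ^ 2 * (R / lam) * (R / lam) ^ (-q) * (R / lam) ^ (σ * q) := by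
      rw [rpow_add (by positivity), rpow_add (by positivity), rpow_add (by positivity),
        rpow_one, rpow_mul (by positivity), rpow_two]
    rw [e1, hdw, hκ₁]
    calc _ ≤ a₁ * a₂ * (lam * (R / lam) ^ σ) ^ 2 * (2 * (‖A₁‖ * c₂ + ‖A₂‖ * c₁) * ((C * R) *
          ((θ ^ (-q) * (R / lam) ^ (-q)) * (2 ^ q * (R / lam) ^ (σ * q)) * (a₃ * totalAngle))) * totalAngle) := by
          gcongr
          exact hr₃.2
      _ = _ := by field_simp
  · obtain ⟨m1, m1'⟩ := abs_le_of_truncate_ne_zero n1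
    obtain ⟨m2, m2'⟩ := abs_le_of_truncate_ne_zero n2
    rw [Set.indicator_empty, add_zero, adL_apply, lie_lie_eq]
    have hz' : ‖(z.1.2 : Space3) - z.2.2‖ ≤ α / 2 := by
      have h4 : c₀ * R ≤ sqrt (r₁ * r₂) := by
        refine Real.le_sqrt_of_sq_le ?_
        rw [pow_two]
        exact mul_le_mul hr₁.1 hr₂.1 hcR.le p1.le
      have h5 : c₀ * R * ‖(z.1.2 : Space3) - z.2.2‖ ≤ d :=
        (mul_le_mul_of_nonneg_right h4 (norm_nonneg _)).trans hz
      have h6 : width lam 1 R = R := by rw [width, rpow_one]; field_simp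
      rw [h6, one_div, inv_mul_le_iff₀ (by positivity)] at g2
      have h7 : c₀ * R * ‖(z.1.2 : Space3) - z.2.2‖ ≤ c₀ * R * (α / 2) := h5.trans (g2.trans (le_of_eq (by ring)))
      exact le_of_mul_le_mul_left h7 hcR
    have s2 := single hc₂ hd₂ hr₂ m2 fun y hy => le_trans (by linarith) (hs z.2 y m2' hy)
    have s1 := single hc₁ hd₁ hr₁ m1 fun y hy => by
      have h8 := hs z.2 y m2' hy
      have h9 : (z.2.2 : Space3) - y.2 = (z.1.2 - y.2) - (z.1.2 - z.2.2) := by abel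
      rw [h9] at h8
      linarith [norm_sub_le ((z.1.2 : Space3) - y.2) (z.1.2 - z.2.2)]
    rw [norm_lie_comm] at s1 s2
    refine (norm_add_le _ _).trans ((add_le_add (norm_lie_le _ _) (norm_lie_le _ _)).trans ?_)
    have f1 := T.norm_field_le A₁ (conePoint r₁ z.1)
    have f2 := T.norm_field_le A₂ (conePoint r₂ z.2)
    calc _ ≤ 2 * ((r₃ * (c₁ * k * wt lam d ^ q * (a₃ * totalAngle))) * ‖A₂‖) +
          2 * (‖A₁‖ * (r₃ * (c₂ * k * wt lam d ^ q * (a₃ * totalAngle)))) := by gcongr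
      _ = _ := by rw [hκ₁]; ring

end VacuumTheory

/-! ### Fock structure -/

theorem tendsto_zero_of_eventually_le {E : Type*} [NormedAddCommGroup E] {f : ℝ → E} {K : ℝ} (h : ∀
    δ > 0, ∀ᶠ R in atTop, ‖f R‖ ≤ K * δ) : Tendsto f atTop (𝓝 0) := by
  refine Metric.tendsto_nhds.2 fun δ hδ => ?_
  filter_upwards [h (δ / (|K| + 1)) (by positivity)] with R hR
  rw [dist_zero_right]
  refine hR.trans_lt ?_
  rw [← mul_div_assoc, div_lt_iff₀ (by positivity)]
  nlinarith [le_abs_self K]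

theorem sum_equiv_succ {m n : ℕ} (t : Fin (m + 1) → Fin (n + 1) → ℂ) : ∑ σ : Fin (m + 1) ≃ Fin (n +
    1), ∏ i, t i (σ i) = ∑ j, t 0 j * ∑ σ : Fin m ≃ Fin n, ∏ i, t i.succ (j.succAbove (σ i)) := by
  let Φ : Fin (n + 1) × (Fin m ≃ Fin n) → (Fin (m + 1) ≃ Fin (n + 1)) := fun x =>
    (finSuccEquiv m).trans ((Equiv.optionCongr x.2).trans (finSuccEquiv' x.1).symm)
  have h0 : ∀ x, Φ x 0 = x.1 := fun x => by simp [Φ]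
  have h1 : ∀ x (i : Fin m), Φ x i.succ = x.1.succAbove (x.2 i) := fun x i => by simp [Φ]
  have hΦ : Function.Bijective Φ := by
    refine (Fintype.bijective_iff_injective_and_card Φ).2 ⟨fun x y hxy => ?_, ?_⟩
    · have e0 : x.1 = y.1 := by rw [← h0, ← h0, hxy]
      refine Prod.ext e0 (Equiv.ext fun i => ?_)
      have e1 := h1 x i
      rw [hxy, h1, e0] at e1
      exact (Fin.succAbove_right_injective e1).symm
    · by_cases hmn : m = n
      · subst hmn
        rw [Fintype.card_prod, Fintype.card_equiv (Equiv.refl _), Fintype.card_equiv (Equiv.refl _)]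
        simp [Nat.factorial_succ]
      · have : IsEmpty (Fin m ≃ Fin n) := ⟨fun e => hmn (by simpa using Fintype.card_congr e)⟩
        have : IsEmpty (Fin (m + 1) ≃ Fin (n + 1)) :=
          ⟨fun e => hmn (by simpa using Fintype.card_congr e)⟩
        simp
  rw [← Function.Bijective.sum_comp hΦ, Fintype.sum_prod_type]
  refine sum_congr rfl fun j _ => ?_
  rw [mul_sum]
  refine sum_congr rfl fun σ _ => ?_
  rw [Fin.prod_univ_succ, h0]
  simp_rw [h1]

namespace VacuumTheory

variable {lam κ : ℝ} (T : VacuumTheory H lam κ)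

/-- Families which together with their adjoints have uniform energy bounds. -/
def BiTame (X : ℝ → Op H) : Prop := T.TameFamily X ∧ T.TameFamily fun R => star (X R)

/-- Families which vanish asymptotically between vectors with uniform energy bounds. -/
def WeaklyNull (D : ℝ → Op H) : Prop := ∀ w v, T.TameVector w → T.TameVector v →
  Tendsto (fun R => inner ℂ (w R) (D R (v R))) atTop (𝓝 0)

/-- Products applied to the vacuum. -/
def prodVec {n : ℕ} (Y : Fin n → ℝ → Op H) (R : ℝ) : H := (List.ofFn fun i => Y i R).prod T.Ω

variable {T}

theorem prodVec_succ {n : ℕ} (Y : Fin (n + 1) → ℝ → Op H) (R : ℝ) : T.prodVec Y R = Y 0 R (T.prodVec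
    (fun i => Y i.succ) R) := by
  simp [prodVec, List.ofFn_succ]

theorem prodVec_zero (Y : Fin 0 → ℝ → Op H) (R : ℝ) : T.prodVec Y R = T.Ω := by simp [prodVec]

theorem tameVector_prodVec {n : ℕ} {Y : Fin n → ℝ → Op H} (hY : ∀ i, T.BiTame (Y i)) : T.TameVector
    (T.prodVec Y) := by
  induction n with
  | zero =>
    rw [show T.prodVec Y = fun _ => T.Ω from funext (prodVec_zero Y)]
    exact TranslationRep.tameVector_const T.vacuum_invariant
  | succ n ih =>
    rw [show T.prodVec Y = _ from funext (prodVec_succ Y)]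
    exact (hY 0).1.tameVector (ih fun i => hY i.succ)

theorem inner_apply_star (X : Op H) (φ ψ : H) : inner ℂ φ (X ψ) = inner ℂ (star X φ) ψ := by
  rw [star_eq_adjoint, adjoint_inner_left]

theorem tendsto_inner_of_tendsto_zero {w u : ℝ → H} (hw : T.TameVector w) (hu : Tendsto u atTop (𝓝
    0)) : Tendsto (fun R => inner ℂ (w R) (u R)) atTop (𝓝 0) := by
  obtain ⟨c, hc⟩ := hw.exists_norm_le
  have h1 := hu.norm.const_mul c
  rw [norm_zero, mul_zero] at h1
  refine squeeze_zero_norm' ?_ h1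
  filter_upwards [hc] with R hR
  exact (norm_inner_le_norm _ _).trans (by gcongr)

/-- An operator which nearly commutes with the factors of a product and nearly annihilates the vacuum. -/
theorem tendsto_inner_apply_prodVec {D : ℝ → Op H} (hD : Tendsto (fun R => D R T.Ω) atTop (𝓝 0)) {n
    : ℕ} {Y : Fin n → ℝ → Op H} (hY : ∀ i, T.BiTame (Y i)) (hn : ∀ i, T.WeaklyNull fun R => ⁅Y i R,
    D R⁆) {w : ℝ → H} (hw : T.TameVector w) : Tendsto (fun R => inner ℂ (w R) (D R (T.prodVec Y R)))
    atTop (𝓝 0) := by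
  induction n generalizing w with
  | zero => simpa only [prodVec_zero] using tendsto_inner_of_tendsto_zero hw hD
  | succ n ih =>
    have h1 := (ih (fun i => hY i.succ) (fun i => hn i.succ) ((hY 0).2.tameVector hw)).sub
      (hn 0 w _ hw (tameVector_prodVec fun i => hY i.succ))
    rw [sub_zero] at h1
    refine h1.congr fun R => ?_
    rw [prodVec_succ, ← inner_apply_star, ← inner_sub_right]
    simp [Ring.lie_def]

/-- Replacement of the factors of a product by asymptotically equal ones. -/
theorem tendsto_inner_prodVec_sub {n : ℕ} {X X' : Fin n → ℝ → Op H} (hX : ∀ i, T.BiTame (X i)) (hX'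
    : ∀ i, T.BiTame (X' i)) (hΩ : ∀ i, Tendsto (fun R => (X i R - X' i R) T.Ω) atTop (𝓝 0)) (hn : ∀
    i j, i ≠ j → T.WeaklyNull fun R => ⁅X' j R, X i R - X' i R⁆) {w : ℝ → H} (hw : T.TameVector w) :
    Tendsto (fun R => inner ℂ (w R) (T.prodVec X R - T.prodVec X' R)) atTop (𝓝 0) := by
  induction n generalizing w with
  | zero => simp [prodVec_zero]
  | succ n ih =>
    have h1 := (ih (fun i => hX i.succ) (fun i => hX' i.succ) (fun i => hΩ i.succ)
      (fun i j hij => hn _ _ fun h => hij (Fin.succ_injective _ h)) ((hX 0).2.tameVector hw)).add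
      (tendsto_inner_apply_prodVec (hΩ 0) (fun i => hX' i.succ) (fun i => hn _ _ (Fin.succ_ne_zero i).symm) hw)
    rw [add_zero] at h1
    refine h1.congr fun R => ?_
    rw [prodVec_succ, prodVec_succ, ← inner_apply_star, ← inner_add_right]
    simp [inner_sub_right]

/-- The action of annihilation operators on products. -/
theorem tendsto_inner_annihilator {A : ℝ → Op H} (hA : ∀ R, A R T.Ω = 0) {n : ℕ} {Y : Fin (n + 1) →
    ℝ → Op H} (hY : ∀ i, T.BiTame (Y i)) {t : Fin (n + 1) → ℂ} (hΩ : ∀ i, Tendsto (fun R => ⁅A R, Y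
    i R⁆ T.Ω) atTop (𝓝 (t i • T.Ω))) (hn : ∀ i j, i ≠ j → T.WeaklyNull fun R => ⁅Y j R, ⁅A R, Y i
    R⁆⁆) {w : ℝ → H} (hw : T.TameVector w) : Tendsto (fun R => inner ℂ (w R) (A R (T.prodVec Y R)) -
    ∑ j, t j * inner ℂ (w R) (T.prodVec (fun i => Y (j.succAbove i)) R)) atTop (𝓝 0) := by
  have step : ∀ {n : ℕ} {Y : Fin (n + 1) → ℝ → Op H} {t : Fin (n + 1) → ℂ}, (∀ i, T.BiTame (Y i)) →
      (∀ i, Tendsto (fun R => ⁅A R, Y i R⁆ T.Ω) atTop (𝓝 (t i • T.Ω))) →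
      (∀ i j, i ≠ j → T.WeaklyNull fun R => ⁅Y j R, ⁅A R, Y i R⁆⁆) → ∀ {w : ℝ → H}, T.TameVector w →
      Tendsto (fun R => inner ℂ (w R) (A R (T.prodVec Y R)) - t 0 * inner ℂ (w R) (T.prodVec
        (fun i => Y i.succ) R) - inner ℂ (star (Y 0 R) (w R)) (A R (T.prodVec (fun i => Y i.succ) R)))
        atTop (𝓝 0) := by
    intro n Y t hY hΩ hn w hw
    have h1 := tendsto_inner_apply_prodVec (D := fun R => ⁅A R, Y 0 R⁆ - t 0 • 1)
      (by simpa using (hΩ 0).sub_const (t 0 • T.Ω)) (fun i => hY i.succ) (fun i => ?_) hw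
    · refine h1.congr fun R => ?_
      rw [prodVec_succ, ← inner_apply_star, ← inner_smul_right, ← inner_sub_right, ← inner_sub_right,
        Ring.lie_def]
      congr 1
      simp; abel
    · convert hn 0 i.succ (Fin.succ_ne_zero i).symm using 2 with R
      simp [Ring.lie_def, mul_sub, sub_mul]
  induction n generalizing w with
  | zero =>
    refine (step hY hΩ hn hw).congr fun R => ?_
    simp [prodVec_zero, hA]
  | succ n ih =>
    have h1 := (step hY hΩ hn hw).add (ih (fun i => hY i.succ) (fun i => hΩ i.succ)
      (fun i j hij => hn _ _ fun h => hij (Fin.succ_injective _ h)) ((hY 0).2.tameVector hw))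
    rw [add_zero] at h1
    refine h1.congr fun R => ?_
    rw [Fin.sum_univ_succ (n := n + 1)]
    simp only [Fin.succAbove_zero, ← inner_apply_star]
    have h2 : ∀ j : Fin (n + 1), T.prodVec (fun i => Y (j.succ.succAbove i)) R =
        Y 0 R (T.prodVec (fun i => Y (j.succAbove i).succ) R) := fun j => by
      rw [prodVec_succ]; simp
    simp_rw [h2]
    ring

theorem tendsto_inner_prodVec {m n : ℕ} {X : Fin m → ℝ → Op H} {Y : Fin n → ℝ → Op H} (hX : ∀ i,
    T.BiTame (X i)) (hY : ∀ i, T.BiTame (Y i)) (hXΩ : ∀ i R, star (X i R) T.Ω = 0) (hYΩ : ∀ i R,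
    star (Y i R) T.Ω = 0) {t : Fin m → Fin n → ℂ} (hΩ : ∀ i j, Tendsto (fun R => ⁅star (X i R), Y j
    R⁆ T.Ω) atTop (𝓝 (t i j • T.Ω))) (hn : ∀ i j k, j ≠ k → T.WeaklyNull fun R => ⁅Y k R, ⁅star (X i
    R), Y j R⁆⁆) : Tendsto (fun R => inner ℂ (T.prodVec X R) (T.prodVec Y R)) atTop (𝓝 (∑ σ : Fin m
    ≃ Fin n, ∏ i, t i (σ i))) := by
  induction m generalizing n with
  | zero =>
    cases n with
    | zero => simp [prodVec_zero, inner_self_eq_norm_sq_to_K, T.norm_vacuum]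
    | succ n =>
      have : IsEmpty (Fin 0 ≃ Fin (n + 1)) := ⟨fun e => by simpa using Fintype.card_congr e⟩
      simp [prodVec_zero, prodVec_succ, inner_apply_star, hYΩ]
  | succ m ih =>
    cases n with
    | zero =>
      have : IsEmpty (Fin (m + 1) ≃ Fin 0) := ⟨fun e => by simpa using Fintype.card_congr e⟩
      have h1 : ∀ R, inner ℂ (T.prodVec X R) (T.prodVec Y R) = 0 := fun R => by
        rw [prodVec_zero, prodVec_succ, ← star_star (X 0 R), ← inner_apply_star, hXΩ, inner_zero_right]
      simp [h1]
    | succ n =>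
      have h1 := tendsto_inner_annihilator (hXΩ 0) hY (hΩ 0) (hn 0)
        (tameVector_prodVec fun i => hX (Fin.succ i))
      have h2 : Tendsto (fun R => ∑ j, t 0 j * inner ℂ (T.prodVec (fun i : Fin m => X i.succ) R)
          (T.prodVec (fun i => Y (j.succAbove i)) R)) atTop
          (𝓝 (∑ j, t 0 j * ∑ σ : Fin m ≃ Fin n, ∏ i, t i.succ (j.succAbove (σ i)))) :=
        tendsto_finsetSum _ fun j _ => (ih (fun i => hX _) (fun i => hY _) (fun i => hXΩ _)
          (fun i => hYΩ _) (fun i k => hΩ _ _) fun i k l hkl => hn _ _ _ fun h =>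
            hkl (Fin.succAbove_right_injective h)).const_mul _
      rw [sum_equiv_succ]
      refine (zero_add (∑ j, t 0 j * _) ▸ h1.add h2).congr fun R => ?_
      rw [sub_add_cancel, prodVec_succ X, inner_apply_star, star_star]

end VacuumTheory

/-! ### Asymptotic commutators -/

theorem star_smear_eq (T : TranslationRep H) (B : Op H) (γ : ℝ → ℝ) (h : TestFn) : star (smear T B γ
    h) = smear T (star B) γ fun s l => star (h s l) := by
  simp_rw [star_smear, star_smearRadius]; rfl

theorem exists_separated {lam ε : ℝ} {b b' : TestFn} (hb : IsHomTestFn lam ε 1 b) (hb' : IsHomTestFn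
    lam ε 1 b') (hl : 0 < lam) (hε : 0 < ε) (hd : Disjoint (angularSupport (thirdDeriv b))
    (angularSupport (thirdDeriv b'))) : ∃ α > 0, Separated α (positivePart (thirdDeriv b))
    (positivePart (thirdDeriv b')) := by
  have key : ∀ {b : TestFn}, IsHomTestFn lam ε 1 b → ∀ x : ℝ × S²,
      positivePart (thirdDeriv b) x.1 x.2 ≠ 0 → x.2 ∈ angularSupport (thirdDeriv b) := by
    intro b hb x hx
    refine subset_tsupport _ fun h0 => hx ?_
    obtain ⟨C, hC0, hC⟩ := hb.exists_bound hl hε 3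
    have h1 : ∀ s, thirdDeriv b s x.2 = 0 := fun s => by
      refine norm_le_zero_iff.1 (le_of_le_of_eq (le_ciSup (f := fun s => ‖thirdDeriv b s x.2‖) ⟨C, ?_⟩ s) h0)
      rintro _ ⟨s', rfl⟩
      refine (hC s' x.2 (norm_sphere_mem x.2)).trans (mul_le_of_le_one_right hC0
        (Real.rpow_le_one_of_one_le_of_nonpos (one_le_wt hl s') (by linarith)))
    simp [positivePart, timeFourier, h1]
  obtain ⟨α, hα, h⟩ := Metric.exists_pos_forall_lt_edist (isClosed_tsupport _).isCompact
    (isClosed_tsupport _) hd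
  refine ⟨α, hα, fun x y hx hy => ?_⟩
  have h2 := (h _ (key hb x hx) _ (key hb' y hy)).le
  rw [edist_nndist, ENNReal.coe_le_coe, ← NNReal.coe_le_coe, coe_nndist, Subtype.dist_eq, dist_eq_norm] at h2
  exact h2

namespace VacuumTheory

variable {lam κ : ℝ} (T : VacuumTheory H lam κ)

/-- Fields and amplitudes with the decay needed for commutator estimates. -/
def IsSmearable (p : ℝ) (A : Op H) (h : TestFn) : Prop :=
  A ∈ T.𝓕 ∧ ∃ a : ℝ, 0 ≤ a ∧ IsAmplitude lam (2 + 2 * p) h (ofReal a)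

variable {T} {A₁ A₂ A₃ : Op H} {h₁ h₂ h₃ : TestFn} {p η η₁ η₂ τ₁ τ₂ Γ R δ α σ : ℝ} {γ₁ γ₂ : ℝ → ℝ}
  {g : ℝ → ℝ}

theorem IsSmearable.conj (h : T.IsSmearable p A₁ h₁) : T.IsSmearable p (star A₁) fun s l => star (h₁ s l) :=
  ⟨star_mem h.1, h.2.imp fun _ h => ⟨h.1, h.2.conj⟩⟩

theorem IsSmearable.norm_apply_smear_le (h : T.IsSmearable p A₁ h₁) (hl : 0 < lam) (hp : 0 < p) {F :
    Type*} [NormedAddCommGroup F] [NormedSpace ℂ F] [CompleteSpace F] (Λ : (Op H) →L[ℂ] F) (hγ :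
    IsWeight lam η τ₁ τ₂ Γ R γ₁) (hδ : 0 ≤ δ) (hb : ∀ r ∈ window lam η τ₁ τ₂ R, ‖Λ (smearRadius T A₁
    r h₁)‖ ≤ δ) : ‖Λ (smear T A₁ γ₁ h₁)‖ ≤ δ * Γ := by
  obtain ⟨hA, a, ha, hh⟩ := h
  rw [smear, ← integral_comp_comm _ (integrable_smear hl (by linarith)
    ofReal_ne_top hh (T.continuous_field hA) hγ.continuous hγ.hasCompactSupport)]
  simp_rw [map_smul]
  exact hγ.norm_integral_le hδ hb

theorem IsSmearable.norm_apply_lie_smear_le (H₁ : T.IsSmearable p A₁ h₁) (H₂ : T.IsSmearable p A₂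
    h₂) (hl : 0 < lam) (hp : 0 < p) {F : Type*} [NormedAddCommGroup F] [NormedSpace ℂ F]
    [CompleteSpace F] (Λ : (Op H) →L[ℂ] F) (hγ₁ : IsWeight lam η₁ τ₁ τ₂ Γ R γ₁) (hγ₂ : IsWeight lam
    η₂ τ₁ τ₂ Γ R γ₂) (hΓ : 0 ≤ Γ) (hδ : 0 ≤ δ) (hb : ∀ r₁ ∈ window lam η₁ τ₁ τ₂ R, ∀ r₂ ∈ window lam
    η₂ τ₁ τ₂ R, ‖Λ ⁅smearRadius T A₁ r₁ h₁, smearRadius T A₂ r₂ h₂⁆‖ ≤ δ) : ‖Λ ⁅smear T A₁ γ₁ h₁,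
    smear T A₂ γ₂ h₂⁆‖ ≤ δ * Γ * Γ := by
  have sw : ∀ X Y, ‖Λ ⁅X, Y⁆‖ = ‖(Λ.comp (adL Y)) X‖ := fun X Y => by
    rw [comp_apply, adL_apply, ← norm_neg, ← map_neg, Ring.lie_def, neg_sub]; rfl
  rw [sw]
  refine H₁.norm_apply_smear_le hl hp _ hγ₁ (by positivity) fun r₁ hr₁ => ?_
  rw [← sw]
  exact H₂.norm_apply_smear_le hl hp (Λ.comp (adL _)) hγ₂ hδ (hb r₁ hr₁)

theorem window_subset (hl : 0 < lam) (hη : η ≤ 1) (hR : lam ≤ R) (hτ₁ : 0 < τ₁) (hτ : τ₁ ≤ τ₂) :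
    window lam η τ₁ τ₂ R ⊆ Icc (min 1 τ₁ * R) ((1 + τ₂) * R) := fun _ hr =>
  ⟨le_of_mem_window hl hη hR hr, le_of_mem_window' hl hη hR (by linarith) hr⟩

/-- Fields with disjoint angular supports commute asymptotically. -/
theorem IsSmearable.weaklyNull_lie (H₁ : T.IsSmearable p A₁ h₁) (H₂ : T.IsSmearable p A₂ h₂) (hl : 0
    < lam) (hp : 0 < p) (hpκ : 2 + p ≤ κ) (hα : 0 < α) (hs : Separated α h₁ h₂) (hg :
    IsRadialSmearing g) (hη₁ : η₁ ≤ 1) (hη₂ : η₂ ≤ 1) : T.WeaklyNull fun R => ⁅smear T A₁ (scaled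
    lam η₁ g R) h₁, smear T A₂ (scaled lam η₂ g R) h₂⁆ := by
  obtain ⟨τ₁, τ₂, Γ, hτ₁, hτ, hΓ, hw⟩ := hg.exists_isWeight hl
  obtain ⟨a₁, ha₁, K₁⟩ := H₁.2
  obtain ⟨a₂, ha₂, K₂⟩ := H₂.2
  intro w v hw' hv
  obtain ⟨c, hc⟩ := hv.exists_norm_le
  refine tendsto_inner_of_tendsto_zero hw' (tendsto_zero_of_eventually_le (K := Γ * Γ * c) fun δ hδ => ?_)
  filter_upwards [eventually_norm_lie_separated_lt hl H₁.1 H₂.1 (by linarith : 2 < 2 + p) hpκ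
    (K₁.mono_exponent hl (by linarith)) (K₂.mono_exponent hl (by linarith)) ha₁ ha₂ hα hs
    (lt_min one_pos hτ₁) (by linarith : 0 < 1 + τ₂) hδ, eventually_ge_atTop lam, hc] with R h1 hR h2
  have h3 := H₁.norm_apply_lie_smear_le H₂ hl hp (ContinuousLinearMap.id ℂ (Op H))
    (hw η₁ R (hl.trans_le hR)) (hw η₂ R (hl.trans_le hR)) hΓ hδ.le fun r₁ hr₁ r₂ hr₂ =>
      (h1 r₁ (window_subset hl hη₁ hR hτ₁ hτ hr₁) r₂ (window_subset hl hη₂ hR hτ₁ hτ hr₂)).le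
  refine (le_of_opNorm_le_of_le _ h3 h2).trans (le_of_eq (by ring))

/-- Commutators commute asymptotically with fields with angular support disjoint from one factor. -/
theorem IsSmearable.weaklyNull_lie_lie (H₁ : T.IsSmearable p A₁ h₁) (H₂ : T.IsSmearable p A₂ h₂) (H₃
    : T.IsSmearable p A₃ h₃) (hl : 0 < lam) (hp : 0 < p) (hpκ : 2 + p ≤ κ) (hα : 0 < α) (hs :
    Separated α h₂ h₃) (hσ : 0 < σ) (hσ' : σ ≤ 1 / 5) (hη : 0 < η) (hη1 : η ≤ 1) (hησ : η * (2 + p)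
    < σ * p) (hg : IsRadialSmearing g) (hX : T.BiTame fun R => smear T A₃ (scaled lam η g R) h₃) :
    T.WeaklyNull fun R => ⁅smear T A₃ (scaled lam η g R) h₃, ⁅smear T A₁ (scaled lam η g R) h₁,
    smear T A₂ (scaled lam η g R) h₂⁆⁆ := by
  obtain ⟨τ₁, τ₂, Γ, hτ₁, hτ, hΓ, hw⟩ := hg.exists_isWeight hl
  obtain ⟨a₁, ha₁, K₁⟩ := H₁.2
  obtain ⟨a₂, ha₂, K₂⟩ := H₂.2
  obtain ⟨a₃, ha₃, K₃⟩ := H₃.2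
  intro w v hw' hv
  obtain ⟨c₁, hc₁⟩ := hw'.exists_norm_le
  obtain ⟨c₂, hc₂⟩ := hv.exists_norm_le
  obtain ⟨c₃, hc₃⟩ := (hX.2.tameVector hw').exists_norm_le
  obtain ⟨c₄, hc₄⟩ := (hX.1.tameVector hv).exists_norm_le
  refine tendsto_zero_of_eventually_le (K := (c₁ * (Γ * c₂) + (c₃ * c₂ + c₁ * c₄)) * Γ * Γ) fun δ hδ => ?_
  filter_upwards [eventually_norm_lie_nearComm_lt hl H₁.1 H₂.1 H₃.1 (by linarith : 2 < 2 + p) hpκ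
    (K₁.mono_exponent hl (by linarith)) (K₂.mono_exponent hl (by linarith))
    (K₃.mono_exponent hl (by linarith)) ha₁ ha₂ ha₃ hα hs hσ hσ' (lt_min one_pos hτ₁)
    (by linarith : 0 < 1 + τ₂) hδ, eventually_norm_lie_sub_nearComm_lt hl H₁.1 H₂.1 hp hpκ K₁ K₂ ha₁ ha₂
    hη hη1 hησ hτ₁ hτ hδ, eventually_ge_atTop lam, hc₁, hc₂, hc₃, hc₄] with R g1 g2 hR k1 k2 k3 k4
  have hW := hw η R (hl.trans_le hR)
  set X := smear T A₃ (scaled lam η g R) h₃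
  have p1 := (norm_nonneg _).trans k1
  have p2 := (norm_nonneg _).trans k2
  have p3 := (norm_nonneg _).trans k3
  have p4 := (norm_nonneg _).trans k4
  let Λ : (Op H) →L[ℂ] ℂ := (innerSL ℂ (w R)).comp ((ContinuousLinearMap.apply ℂ H (v R)).comp (adL X))
  have h := H₁.norm_apply_lie_smear_le H₂ hl hp Λ hW hW hΓ
    (δ := (c₁ * (Γ * c₂) + (c₃ * c₂ + c₁ * c₄)) * δ) (by positivity) fun r₁ hr₁ r₂ hr₂ => ?_
  · exact h.trans (le_of_eq (by ring))
  have s := window_subset hl hη1 hR hτ₁ hτ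
  have f1 := (g2 r₁ hr₁ r₂ hr₂).le
  set N := nearComm T A₁ r₁ h₁ A₂ r₂ h₂ (width lam σ R) with hN
  set C := ⁅smearRadius T A₁ r₁ h₁, smearRadius T A₂ r₂ h₂⁆
  have f2 : ‖⁅X, N⁆‖ ≤ δ * Γ := by
    rw [norm_lie_comm]
    refine H₃.norm_apply_smear_le hl hp (adL N) hW hδ.le fun r₃ hr₃ => ?_
    rw [adL_apply, norm_lie_comm]
    exact (g1 r₁ (s hr₁) r₂ (s hr₂) r₃ (s hr₃)).le
  have f3 : Λ C = inner ℂ (w R) (⁅X, N⁆ (v R)) + (inner ℂ (star X (w R)) ((C - N) (v R)) -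
      inner ℂ (w R) ((C - N) (X (v R)))) := by
    rw [← inner_apply_star, ← inner_sub_right, ← inner_add_right]
    change inner ℂ (w R) (⁅X, C⁆ (v R)) = _
    congr 1
    simp only [Ring.lie_def, sub_apply, mul_apply_eq_comp, _root_.map_sub]
    abel
  rw [f3]
  have e : ∀ {x y : H} {Z : Op H} {a b c : ℝ}, ‖x‖ ≤ a → ‖Z‖ ≤ b → ‖y‖ ≤ c → ‖inner ℂ x (Z y)‖ ≤ a * (b * c) :=
    fun hx hZ hy => (norm_inner_le_norm _ _).trans (mul_le_mul hx
      (le_of_opNorm_le_of_le _ hZ hy) (norm_nonneg _) ((norm_nonneg _).trans hx))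
  refine (norm_add_le _ _).trans ((add_le_add (e k1 f2 k2) ((norm_sub_le _ _).trans
    (add_le_add (e k3 f1 k2) (e k1 f1 k4)))).trans (le_of_eq (by ring)))

section Creation

variable {ε : ℝ} {B B' : Op H} {b b' : TestFn}

theorem isSmearable_positivePart (hb : IsHomTestFn lam ε 1 b) (hB : B ∈ T.𝓕) (hl : 0 < lam) (hp : 0
    < p) (hpε : 2 + 2 * p < ε) (hp3 : 2 + 2 * p < 3) : T.IsSmearable p B (positivePart (thirdDeriv
    b)) :=
  ⟨hB, hb.exists_isAmplitude_positivePart hl (by linarith) hp3 hpε⟩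

theorem biTame_creation (hb : IsHomTestFn lam ε 1 b) (hl : 0 < lam) (hκ : 2 < κ) (hε : 2 < ε) (hB :
    B ∈ T.𝓕) (hg : IsRadialSmearing g) (hη : η ≤ 1) : T.BiTame (creation T lam η g B (thirdDeriv b))
    := by
  obtain ⟨τ₁, τ₂, Γ, hτ₁, hτ, hΓ, hw⟩ := hg.exists_isWeight hl
  refine tameFamily_smear hb hl hκ hε hB (Γ := Γ) ?_
  filter_upwards [eventually_ge_atTop lam] with R hR
  have hW := hw η R (hl.trans_le hR)
  exact ⟨hW.1, hW.2, fun r hr => (mul_pos (lt_min one_pos hτ₁) (hl.trans_le hR)).trans_le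
    (le_of_mem_window hl hη hR (hW.3 r hr)), hW.4⟩

theorem star_creation_vacuum (hb : IsHomTestFn lam ε 1 b) (hl : 0 < lam) (hε : 2 < ε) (hB : B ∈ T.𝓕)
    (R : ℝ) : star (creation T lam η g B (thirdDeriv b) R) T.Ω = 0 := by
  rw [creation, star_smear]
  by_cases hi : Integrable fun r => (scaled lam η g R r : ℂ) •
      star (smearRadius T B r (positivePart (thirdDeriv b)))
  · rw [integral_apply hi]
    simp [star_smearRadius_vacuum hb hl hε hB]
  · rw [integral_undef hi, zero_apply]

/-- The commutators of the asymptotic annihilation and creation operators on the vacuum. -/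
theorem ClusterExponent.tendsto_lie_creation_vacuum (hσ : T.ClusterExponent (star B) B' σ) (hb :
    IsHomTestFn lam ε 1 b) (hb' : IsHomTestFn lam ε 1 b') (hl : 0 < lam) (hκ : 2 < κ) (hε : 2 < ε)
    (hp : 0 < p) (hpκ : 2 + p ≤ κ) (hpε : 2 + 2 * p < ε) (hp3 : 2 + 2 * p < 3) (hB : B ∈ T.𝓕) (hB' :
    B' ∈ T.𝓕) (hg : IsRadialSmearing g) (hη : 0 < η) (hη1 : η ≤ 1) (hησ : η * (2 + p) < σ * p) :
    Tendsto (fun R => ⁅star (creation T lam η g B (thirdDeriv b) R), creation T lam η g B'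
    (thirdDeriv b') R⁆ T.Ω) atTop (𝓝 (T.twoPoint B (thirdDeriv b) B' (thirdDeriv b') • T.Ω)) := by
  obtain ⟨τ₁, τ₂, Γ, hτ₁, hτ, hΓ, hw⟩ := hg.exists_isWeight hl
  have H₁ := (isSmearable_positivePart hb hB hl hp hpε hp3).conj
  have H₂ := isSmearable_positivePart hb' hB' hl hp hpε hp3
  obtain ⟨a₁, ha₁, K₁⟩ := H₁.2
  obtain ⟨a₂, ha₂, K₂⟩ := H₂.2
  have h1 : Tendsto (fun R => T.vacuumPerp (⁅star (creation T lam η g B (thirdDeriv b) R),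
      creation T lam η g B' (thirdDeriv b') R⁆ T.Ω)) atTop (𝓝 0) := by
    refine tendsto_zero_of_eventually_le (K := Γ * Γ) fun δ hδ => ?_
    filter_upwards [hσ.eventually_vacuumPerp_lie_lt hl H₁.1 H₂.1 hp hpκ K₁ K₂ ha₁ ha₂ hη hη1 hησ hτ₁ hτ hδ,
      eventually_gt_atTop 0] with R g1 hR
    rw [creation, star_smear_eq]
    exact (H₁.norm_apply_lie_smear_le H₂ hl hp (T.vacuumPerp.comp (ContinuousLinearMap.apply ℂ H T.Ω))
      (hw η R hR) (hw η R hR) hΓ hδ.le fun r₁ hr₁ r₂ hr₂ => (g1 r₁ hr₁ r₂ hr₂).le).trans (le_of_eq (by ring))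
  have h2 := h1.add ((tendsto_inner_creation hb hb' hl hκ hε hB hB' hg hη hη1 hη hη1).smul_const T.Ω)
  rw [zero_add] at h2
  refine h2.congr fun R => ?_
  have h3 : ∀ X Y : Op H, star X T.Ω = 0 → ⁅star X, Y⁆ T.Ω = star X (Y T.Ω) := fun X Y h => by
    simp [Ring.lie_def, h]
  rw [h3 _ _ (star_creation_vacuum hb hl hε hB R), vacuumPerp_apply, inner_apply_star, star_star, sub_add_cancel]

end Creation
end VacuumTheory

namespace VacuumTheory

variable {lam κ ε η η' p : ℝ} {T : VacuumTheory H lam κ} {g : ℝ → ℝ}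

/-- Product states are asymptotically independent of the width of the smearing. -/
theorem tendsto_inner_productState_sub {n : ℕ} {B : Fin n → Op H} {b : Fin n → TestFn} (hl : 0 <
    lam) (hκ : 2 < κ) (hε : 2 < ε) (hp : 0 < p) (hpκ : 2 + p ≤ κ) (hpε : 2 + 2 * p < ε) (hp3 : 2 + 2
    * p < 3) (hB : ∀ i, B i ∈ T.𝓕) (hb : ∀ i, IsHomTestFn lam ε 1 (b i)) (hs : ∀ i j, i ≠ j →
    Disjoint (angularSupport (thirdDeriv (b i))) (angularSupport (thirdDeriv (b j)))) (hg :
    IsRadialSmearing g) (hη : 0 < η) (hη1 : η ≤ 1) (hη' : 0 < η') (hη1' : η' ≤ 1) {w : ℝ → H} (hw :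
    T.TameVector w) : Tendsto (fun R => inner ℂ (w R) (T.productState η g B (fun i => thirdDeriv (b
    i)) R - T.productState η' g B (fun i => thirdDeriv (b i)) R)) atTop (𝓝 0) := by
  refine tendsto_inner_prodVec_sub (fun i => biTame_creation (hb i) hl hκ hε (hB i) hg hη1)
    (fun i => biTame_creation (hb i) hl hκ hε (hB i) hg hη1') (fun i => ?_) (fun i j hij => ?_) hw
  · simpa using (tendsto_creation_vacuum (hb i) hl hκ hε (hB i) hg hη hη1).sub
      (tendsto_creation_vacuum (hb i) hl hκ hε (hB i) hg hη' hη1')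
  · have S := fun i => isSmearable_positivePart (hb i) (hB i) hl hp hpε hp3
    obtain ⟨α, hα, h⟩ := exists_separated (hb j) (hb i) hl (by linarith) (hs j i hij.symm)
    intro w v hw hv
    have := ((S j).weaklyNull_lie (S i) hl hp hpκ hα h hg hη1' hη1 w v hw hv).sub
      ((S j).weaklyNull_lie (S i) hl hp hpκ hα h hg hη1' hη1' w v hw hv)
    rw [sub_zero] at this
    refine this.congr fun R => ?_
    rw [← inner_sub_right, ← sub_apply]
    simp only [Ring.lie_def, creation]
    congr 2
    noncomm_ring

/-- Scalar products of product states. -/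
theorem tendsto_inner_productState (hT : T.Clustering) {m n : ℕ} {B : Fin m → Op H} {B' : Fin n → Op
    H} {b : Fin m → TestFn} {b' : Fin n → TestFn} (hl : 0 < lam) (hκ : 2 < κ) (hε : 2 < ε) (hp : 0 <
    p) (hpκ : 2 + p ≤ κ) (hpε : 2 + 2 * p < ε) (hp3 : 2 + 2 * p < 3) (hB : ∀ i, B i ∈ T.𝓕) (hB' : ∀
    j, B' j ∈ T.𝓕) (hb : ∀ i, IsHomTestFn lam ε 1 (b i)) (hb' : ∀ j, IsHomTestFn lam ε 1 (b' j)) (hs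
    : ∀ i j, i ≠ j → Disjoint (angularSupport (thirdDeriv (b i))) (angularSupport (thirdDeriv (b
    j)))) (hs' : ∀ i j, i ≠ j → Disjoint (angularSupport (thirdDeriv (b' i))) (angularSupport
    (thirdDeriv (b' j)))) (hg : IsRadialSmearing g) (hη : 0 < η) (hη1 : η ≤ 1) : Tendsto (fun R =>
    inner ℂ (T.productState η g B (fun i => thirdDeriv (b i)) R) (T.productState η g B' (fun j =>
    thirdDeriv (b' j)) R)) atTop (𝓝 (T.fockProduct B (fun i => thirdDeriv (b i)) B' (fun j =>
    thirdDeriv (b' j)))) := by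
  choose σ hσ using fun i j => hT.exists_clusterExponent hl (star_mem (hB i)) (hB' j)
  obtain ⟨η', ⟨hη', hη1'⟩, hησ⟩ : ∃ η', (0 < η' ∧ η' < 1) ∧ ∀ i j, η' < σ i j * p / (2 + p) := by
    refine (Filter.Eventually.and (Ioo_mem_nhdsGT one_pos) (eventually_all.2 fun i => eventually_all.2 fun j =>
      (?_ : ∀ᶠ x in 𝓝[>] (0 : ℝ), _))).exists
    have := (hσ i j).1
    exact mem_of_superset (Ioo_mem_nhdsGT (show 0 < σ i j * p / (2 + p) by positivity)) fun x hx => hx.2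
  have hησ' : ∀ i j, η' * (2 + p) < σ i j * p := fun i j => (lt_div_iff₀ (by linarith)).1 (hησ i j)
  have S := fun i => isSmearable_positivePart (hb i) (hB i) hl hp hpε hp3
  have S' := fun i => isSmearable_positivePart (hb' i) (hB' i) hl hp hpε hp3
  have X := fun i {η} => biTame_creation (η := η) (hb i) hl hκ hε (hB i) hg
  have X' := fun i {η} => biTame_creation (η := η) (hb' i) hl hκ hε (hB' i) hg
  have h1 : Tendsto (fun R => inner ℂ (T.productState η' g B (fun i => thirdDeriv (b i)) R)
      (T.productState η' g B' (fun j => thirdDeriv (b' j)) R)) atTop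
      (𝓝 (T.fockProduct B (fun i => thirdDeriv (b i)) B' (fun j => thirdDeriv (b' j)))) := by
    refine tendsto_inner_prodVec (fun i => X i hη1'.le) (fun i => X' i hη1'.le)
      (fun i => star_creation_vacuum (hb i) hl hε (hB i)) (fun i => star_creation_vacuum (hb' i) hl hε (hB' i))
      (t := fun i j => T.twoPoint (B i) (thirdDeriv (b i)) (B' j) (thirdDeriv (b' j)))
      (fun i j => (hσ i j).tendsto_lie_creation_vacuum (hb i) (hb' j) hl hκ hε hp hpκ hpε hp3 (hB i) (hB' j) hg
        hη' hη1'.le (hησ' i j)) fun i j k hjk => ?_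
    obtain ⟨α, hα, h⟩ := exists_separated (hb' j) (hb' k) hl (by linarith) (hs' j k hjk)
    have := (S i).conj.weaklyNull_lie_lie (S' j) (S' k) hl hp hpκ hα h (hσ i j).1 (hσ i j).2.1 hη' hη1'.le
      (hησ' i j) hg (X' k hη1'.le)
    simpa only [creation, star_smear_eq] using this
  have h2 := tendsto_inner_productState_sub hl hκ hε hp hpκ hpε hp3 hB' hb' hs' hg hη hη1 hη' hη1'.le
    (tameVector_prodVec fun i => X i hη1)
  have h3 := (tendsto_inner_productState_sub hl hκ hε hp hpκ hpε hp3 hB hb hs hg hη hη1 hη' hη1'.le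
    (tameVector_prodVec fun i => X' i hη1'.le)).star
  refine (add_zero (T.fockProduct _ _ _ _) ▸ h1.add ((add_zero (0 : ℂ) ▸ star_zero ℂ ▸ h2.add h3 : _))).congr fun R => ?_
  simp [inner_sub_right, prodVec, productState]

end VacuumTheory

end

end NullAsymptotics

theorem mainTheorem10 {H : Type*} [NormedAddCommGroup H] [InnerProductSpace ℂ H]
    [CompleteSpace H] (lam κ ε : ℝ) (hlam : 0 < lam) (hκ : 2 < κ) (hε : 2 < ε)
    (T : VacuumTheory H lam κ) (hT : T.Clustering) :
    -- vanishing of the commutator off the vacuum, uniformly in the window, and two-point formula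
    (∀ B₁ ∈ T.𝓕, ∀ B₂ ∈ T.𝓕, ∃ η₀ : ℝ, 0 < η₀ ∧ η₀ ≤ 1 ∧
      ∀ b₁ b₂ : ℝ → Space3 → ℂ,
        IsHomTestFn lam ε 1 b₁ → IsHomTestFn lam ε 1 b₂ →
        ∀ η : ℝ, 0 < η → η ≤ η₀ →
          (∀ τ₁ τ₂ : ℝ, 0 < τ₁ → τ₁ ≤ τ₂ →
            ∀ δ : ℝ, 0 < δ → ∃ R₀ : ℝ, ∀ R ≥ R₀,
              ∀ r₁ ∈ window lam η τ₁ τ₂ R,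
              ∀ r₂ ∈ window lam η τ₁ τ₂ R,
                ‖T.vacuumPerp
                  (⁅star (smearRadius T.toTranslationRep B₁ r₁
                      (positivePart (thirdDeriv b₁))),
                    smearRadius T.toTranslationRep B₂ r₂
                      (positivePart (thirdDeriv b₂))⁆ T.Ω)‖
                  < δ) ∧
          (∀ g : ℝ → ℝ, IsRadialSmearing g →
            Filter.Tendsto
              (fun R : ℝ =>
                star (creation T.toTranslationRep lam η g B₁
                    (thirdDeriv b₁) R)
                  (creation T.toTranslationRep lam η g B₂
                    (thirdDeriv b₂) R T.Ω))
              Filter.atTop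
              (nhds (T.twoPoint B₁ (thirdDeriv b₁)
                B₂ (thirdDeriv b₂) • T.Ω)))) ∧
    -- Fock structure of the scalar products and of the asymptotic states
    (∀ (m n : ℕ) (B : Fin m → H →L[ℂ] H) (B' : Fin n → H →L[ℂ] H),
      (∀ i, B i ∈ T.𝓕) → (∀ j, B' j ∈ T.𝓕) → ∃ η₀ : ℝ, 0 < η₀ ∧ η₀ ≤ 1 ∧
      ∀ (b : Fin m → ℝ → Space3 → ℂ) (b' : Fin n → ℝ → Space3 → ℂ),
        (∀ i, IsHomTestFn lam ε 1 (b i)) →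
        (∀ j, IsHomTestFn lam ε 1 (b' j)) →
        (∀ i₁ i₂, i₁ ≠ i₂ →
          Disjoint (angularSupport (thirdDeriv (b i₁)))
            (angularSupport (thirdDeriv (b i₂)))) →
        (∀ j₁ j₂, j₁ ≠ j₂ →
          Disjoint (angularSupport (thirdDeriv (b' j₁)))
            (angularSupport (thirdDeriv (b' j₂)))) →
        ∀ g : ℝ → ℝ, IsRadialSmearing g →
          (∀ η : ℝ, 0 < η → η ≤ η₀ →
            Filter.Tendsto
              (fun R : ℝ => inner ℂ
                (T.productState η g B (fun i => thirdDeriv (b i)) R)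
                (T.productState η g B' (fun j => thirdDeriv (b' j)) R))
              Filter.atTop
              (nhds (T.fockProduct B (fun i => thirdDeriv (b i))
                B' (fun j => thirdDeriv (b' j))))) ∧
          (∀ Ψ Ψ' : H,
            Filter.Tendsto
              (T.productState 1 g B fun i => thirdDeriv (b i))
              Filter.atTop (nhds Ψ) →
            Filter.Tendsto
              (T.productState 1 g B' fun j => thirdDeriv (b' j))
              Filter.atTop (nhds Ψ') →
            inner ℂ Ψ Ψ' = T.fockProduct B (fun i => thirdDeriv (b i))
              B' (fun j => thirdDeriv (b' j)))) := by
  obtain ⟨p, hp, hpκ, hpε, hp3⟩ := exists_decay_exponent hκ hε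
  refine ⟨fun B₁ hB₁ B₂ hB₂ => ?_, fun m n B B' hB hB' => ⟨1, one_pos, le_rfl, 
    fun b b' hb hb' hs hs' g hg => ?_⟩⟩
  · obtain ⟨σ, hσ⟩ := hT.exists_clusterExponent hlam (star_mem hB₁) hB₂
    have hσ0 := hσ.1
    have hσ1 := hσ.2.1
    refine ⟨σ * p / (2 * (2 + p)), by positivity, by rw [div_le_one (by positivity)]; nlinarith, 
      fun b₁ b₂ hb₁ hb₂ η hη hηle => ?_⟩
    rw [le_div_iff₀ (by positivity)] at hηle
    have hησ : η * (2 + p) < σ * p := by nlinarith [mul_pos hη hp]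
    have hη1 : η ≤ 1 := by nlinarith [mul_pos hη hp]
    refine ⟨fun τ₁ τ₂ hτ₁ hτ δ hδ => ?_, fun g hg => ?_⟩
    · have H₁ := (VacuumTheory.isSmearable_positivePart hb₁ hB₁ hlam hp hpε hp3).conj
      obtain ⟨a₁, ha₁, K₁⟩ := H₁.2
      obtain ⟨a₂, ha₂, K₂⟩ := hb₂.exists_isAmplitude_positivePart hlam (by linarith) hp3 hpε
      simp_rw [star_smearRadius]
      exact Filter.eventually_atTop.1 (hσ.eventually_vacuumPerp_lie_lt hlam H₁.1 hB₂ hp hpκ K₁ K₂ ha₁ ha₂ 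
        hη hη1 hησ hτ₁ hτ hδ)
    · refine (hσ.tendsto_lie_creation_vacuum hb₁ hb₂ hlam hκ hε hp hpκ hpε hp3 hB₁ hB₂ hg hη hη1 
        hησ).congr fun R => ?_
      simp [Ring.lie_def, VacuumTheory.star_creation_vacuum hb₁ hlam hε hB₁ R]
  · have key : ∀ η : ℝ, 0 < η → η ≤ 1 → Filter.Tendsto (fun R : ℝ => inner ℂ 
        (T.productState η g B (fun i => thirdDeriv (b i)) R) 
        (T.productState η g B' (fun j => thirdDeriv (b' j)) R)) Filter.atTop 
        (nhds (T.fockProduct B (fun i => thirdDeriv (b i)) B' (fun j => thirdDeriv (b' j)))) := 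
      fun η hη hη1 => VacuumTheory.tendsto_inner_productState hT hlam hκ hε hp hpκ hpε hp3 hB hB' hb hb' hs hs' hg hη hη1
    exact ⟨key, fun Ψ Ψ' hΨ hΨ' => tendsto_nhds_unique (hΨ.inner hΨ') (key 1 one_pos le_rfl)⟩
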